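/- **Setting.** Let $\mathbb T^2=\mathbb R^2/\mathbb Z^2$ and $V\in C^\infty(\mathbb T^2;\mathbb R)$. Let $\hbar_n\to0^+$, $\epsilon_n>0$ and $\tau_n$ be sequences with $\epsilon_n\to0$, $\hbar_n/\epsilon_n\to0$, $\tau_n\to+\infty$. Let $u_n\in L^2(\mathbb T^2)$, $\|u_n\|_{L^2}=1$, satisfy $$\lim_{R\to\infty}\limsup_{n}\|\mathbf 1_{[R,\infty)}(-\hbar_n^2\Delta)u_n\|_{L^2}=0,\qquad \lim_{\delta\to0^+}\limsup_{n}\|\mathbf 1_{[0,\delta]}(-\hbar_n^2\Delta)u_n\|_{L^2}=0,$$ and let $v_n\in C(\mathbb R;L^2(\mathbb T^2))$ be the (weak) solution of $i\hbar_n\partial_tv_n=\big(-\tfrac{\hbar_n^2}{2}\Delta+\epsilon_n^2V\big)v_n$, $v_n(0)=u_n$. Let $\Lambda\subset\mathbb Z^2$ be a primitive rank-one lattice (its real span $\langle\Lambda\rangle$ is a line and $\langle\Lambda\rangle\cap\mathbb Z^2=\Lambda$), $\Lambda=\mathbb Z\mathfrak e$, let $L=\|\mathfrak e\|$, let $\mathfrak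 e^\perp$ be $\mathfrak e$ rotated by $+\pi/2$, $\Lambda^\perp=\{\xi\in\mathbb R^2:\langle\xi,\mathfrak e\rangle=0\}$ and $H_\Lambda(\xi)=\langle\xi,\mathfrak e\rangle/L$. Put $\widehat{\mathbb R}=\mathbb R\cup\{\pm\infty\}$, with its smooth structure of a closed interval ($1/\eta$ is a coordinate near $\pm\infty$). For $a\in C_c^\infty(T^*\mathbb T^2\times\widehat{\mathbb R})$ and $w\in L^2(\mathbb T^2)$ set $$W_n[w](a)=\Big\langle w,\operatorname{Op}^w_{\hbar_n}\big(a(x,\xi,H_\Lambda(\xi)/\epsilon_n)\big)w\Big\rangle_{L^2},$$ where the Weyl quantization on the torus is $\operatorname{Op}^w_\hbar(b)e_k=\sum_{q\in\mathbb Z^2}\hat b_{q-k}(\pi\hbar(q+k))\,e_q$, with $e_k(x)=e^{2i\pi k\cdot x}$ and $\hat b_p(\xi)=\int_{\mathbb T^2}b(x,\xi)e^{-2i\pi p\cdot x}dx$. Let $\mathcal B=C_0(\mathbb R^2\times\widehat{\mathbb R};C^3(\mathbb T^2))$. Let $\mu_\Lambda\in L^1(\mathbb R,\mathcal B)'$,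 i.e. $t\mapsto\mu_\Lambda(t)\in\mathcal B'$ is weakly measurable and essentially bounded, be such that for all $a\in C_c^\infty(T^*\mathbb T^2\times\widehat{\mathbb R})$ and $\theta\in L^1(\mathbb R)$ $$\lim_{n\to\infty}\int_{\mathbb R}\theta(t)\,W_n[v_n(t\tau_n)](a)\,dt=\int_{\mathbb R}\theta(t)\,\langle\mu_\Lambda(t),a\rangle\,dt.$$ For $f$ on $\mathbb T^2$ let $\mathcal I_\Lambda(f)(x)=\frac1L\int_0^Lf\big(x+s\tfrac{\mathfrak e^\perp}{L}\big)ds$; for $a$ on $\mathbb T^2\times\Lambda^\perp\times\mathbb R$, $\mathcal I_\Lambda(a)$ is this average in the variable $x$. Let $\varphi^t_{p_\Lambda}$ be the flow on $\mathbb T^2\times\Lambda^\perp\times\mathbb R\ni(x,\xi,\eta)$ of $$\eta\,\tfrac{\mathfrak e}{L}\cdot\partial_x-\big(\tfrac{\mathfrak e}{L}\cdot\partial_x\mathcal I_\Lambda(V)\big)\partial_\eta,$$ the Hamiltonian vector field of $p_\Lambda=\tfrac{\eta^2}{2}+\mathcal I_\Lambda(V)(x)$. **Theorem.** The flow $\varphi^t_{p_\Lambda}$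 is defined for all $t\in\mathbb R$. For a.e. $t$ the compact part of $\mu_\Lambda(t)$, that is its restriction to $T^*\mathbb T^2\times\mathbb R$, is a finite positive measure $\tilde\mu_\Lambda(t)$ carried by $\mathbb T^2\times\Lambda^\perp\times\mathbb R$: $\langle\mu_\Lambda(t),a\rangle=\int a\,d\tilde\mu_\Lambda(t)$ for all $a\in C_c^\infty(T^*\mathbb T^2\times\mathbb R)$. If moreover $W_n[u_n](a)\to\langle\mu^0_\Lambda,a\rangle$ for all $a\in C_c^\infty(T^*\mathbb T^2\times\widehat{\mathbb R})$, with $\mu_\Lambda^0\in\mathcal B'$, then the compact part $\tilde\mu_\Lambda^0$ of $\mu^0_\Lambda$ is likewise a finite positive measure carried by $\mathbb T^2\times\Lambda^\perp\times\mathbb R$. After modification of $\tilde\mu_\Lambda$ on a null set of times $t$, the following hold. 1. If $\tau_n\epsilon_n\to0$ and $\mu_\Lambda^0$ is as above, then $t\mapsto\tilde\mu_\Lambda(t)$ is continuous for the weak topology of finite measures and, for all $t\in\mathbb R$ and $a\in C^0_c(\mathbb T^2\times\Lambda^\perp\times\mathbb R)$, $\ \tilde\mu_\Lambda(t)(a)=\tilde\mu^0_\Lambda(\mathcal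 I_\Lambda(a))$. 2. If $\tau_n\epsilon_n=1$ for all large $n$ and $\mu_\Lambda^0$ is as above, then $t\mapsto\tilde\mu_\Lambda(t)$ is continuous for the weak topology of finite measures and, for all $t\in\mathbb R$ and $a\in C^0_c(\mathbb T^2\times\Lambda^\perp\times\mathbb R)$, $\ \tilde\mu_\Lambda(t)(a)=\tilde\mu^0_\Lambda(\mathcal I_\Lambda(a)\circ\varphi^t_{p_\Lambda})$. 3. If $\tau_n\epsilon_n\to+\infty$, then for a.e. $t\in\mathbb R$, for all $a\in C^0_c(\mathbb T^2\times\Lambda^\perp\times\mathbb R)$ and all $s\in\mathbb R$, $\ \tilde\mu_\Lambda(t)(a)=\tilde\mu_\Lambda(t)(a\circ\varphi^s_{p_\Lambda})$. -/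

import Mathlib

open MeasureTheory Filter Topology
open scoped ContDiff Matrix ComplexConjugate

noncomputable section

namespace TwoMicrolocal

/-! ### The torus and its covering -/

/-- The torus `ℝ² / ℤ²`. -/
abbrev T2 : Type := UnitAddTorus (Fin 2)

/-- The normalised Haar (Lebesgue) measure of the torus. -/
abbrev torusMeasure : Measure T2 := Measure.pi fun _ => AddCircle.haarAddCircle

/-- Complex `L²` of the torus. -/
abbrev L2T : Type := Lp ℂ 2 torusMeasure

/-- The covering map `ℝ² → ℝ² / ℤ²`. -/
def proj (x : Fin 2 → ℝ) : T2 := fun i => (x i : UnitAddCircle)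

/-- An integer vector, seen in `ℝ²`. -/
def toR (k : Fin 2 → ℤ) : Fin 2 → ℝ := fun i => (k i : ℝ)

/-- The square of the Euclidean norm of an integer vector. -/
def normSq (k : Fin 2 → ℤ) : ℝ := toR k ⬝ᵥ toR k

/-- Smoothness of a function on the torus, i.e. of its periodic lift to `ℝ²`. -/
def SmoothOnTorus (V : T2 → ℝ) : Prop :=
  ContDiff ℝ ∞ fun x : Fin 2 → ℝ => V (proj x)

/-! ### Primitive rank-one lattices -/

/-- `Λ ⊂ ℤ²` is primitive of rank one: its real span `⟨Λ⟩` is a line, and `⟨Λ⟩ ∩ ℤ² = Λ`. -/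
def IsPrimitiveRankOne (Λ : AddSubgroup (Fin 2 → ℤ)) : Prop :=
  Module.finrank ℝ (Submodule.span ℝ (toR '' (Λ : Set (Fin 2 → ℤ)))) = 1 ∧
    ∀ k : Fin 2 → ℤ, toR k ∈ Submodule.span ℝ (toR '' (Λ : Set (Fin 2 → ℤ))) → k ∈ Λ

/-- `L_Λ = ‖e‖`, where `e` generates `Λ`. -/
def len (e : Fin 2 → ℤ) : ℝ := Real.sqrt (normSq e)

/-- The unit vector `e / L_Λ`. -/
def unitDir (e : Fin 2 → ℤ) : Fin 2 → ℝ := (len e)⁻¹ • toR e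

/-- The unit vector `e^⊥ / L_Λ`, where `e^⊥` is `e` rotated by `+π/2`. -/
def unitPerp (e : Fin 2 → ℤ) : Fin 2 → ℝ := (len e)⁻¹ • ![-(e 1 : ℝ), (e 0 : ℝ)]

/-- The Hamiltonian `H_Λ(ξ) = ⟨ξ, e⟩ / L_Λ`. -/
def HLam (e : Fin 2 → ℤ) (ξ : Fin 2 → ℝ) : ℝ := ξ ⬝ᵥ unitDir e

/-- The line `Λ^⊥` of covectors orthogonal to `e`. -/
abbrev LamPerp (e : Fin 2 → ℤ) : Type := {ξ : Fin 2 → ℝ // ξ ⬝ᵥ toR e = 0}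

/-- The space `𝕋² × Λ^⊥ × ℝ`, with points `(x, ξ, η)`. -/
abbrev CompactPhase (e : Fin 2 → ℤ) : Type := T2 × LamPerp e × ℝ

/-! ### Averages and the flow of `p_Λ` -/

/-- The average of a function on the torus along `s ↦ x + s e^⊥ / L_Λ`, `0 ≤ s ≤ L_Λ`. -/
def avg {E : Type} [NormedAddCommGroup E] [NormedSpace ℝ E] (e : Fin 2 → ℤ) (f : T2 → E)
    (x : T2) : E :=
  (len e)⁻¹ • ∫ s in (0 : ℝ)..len e, f (x + proj (s • unitPerp e))

/-- The average `I_Λ(a)` of a function on `𝕋² × Λ^⊥ × ℝ`, taken in the variable `x`. -/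
def avgPhase (e : Fin 2 → ℤ) (a : CompactPhase e → ℂ) (z : CompactPhase e) : ℂ :=
  avg e (fun x => a (x, z.2)) z.1

/-- The derivative `(e / L_Λ) · ∂_x I_Λ(V)`, at (the class of) a point of `ℝ²`. -/
def derivAvg (e : Fin 2 → ℤ) (V : T2 → ℝ) (x : Fin 2 → ℝ) : ℝ :=
  fderiv ℝ (fun y : Fin 2 → ℝ => avg e V (proj y)) x (unitDir e)

/-- `φ` is the flow on `𝕋² × Λ^⊥ × ℝ` of the vector field
`η (e / L_Λ) · ∂_x - ((e / L_Λ) · ∂_x I_Λ(V)) ∂_η`, the Hamiltonian vector field of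
`p_Λ = η² / 2 + I_Λ(V)`: every orbit is the projection of a solution, defined for all times, of
`X' = η e / L_Λ`, `η' = - (e / L_Λ) · ∂_x I_Λ(V) (X)`, while `ξ` is constant. Since the field is
smooth, this determines `φ`. -/
def IsFlowOfPLam (e : Fin 2 → ℤ) (V : T2 → ℝ) (φ : ℝ → CompactPhase e → CompactPhase e) : Prop :=
  ∀ (x : Fin 2 → ℝ) (ξ : LamPerp e) (η : ℝ), ∃ (X : ℝ → Fin 2 → ℝ) (Y : ℝ → ℝ),
    X 0 = x ∧ Y 0 = η ∧
    (∀ t, HasDerivAt X (Y t • unitDir e) t) ∧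
    (∀ t, HasDerivAt Y (-derivAvg e V (X t)) t) ∧
    ∀ t, φ t (proj x, ξ, η) = (proj (X t), ξ, Y t)

/-! ### The semiclassical Schrödinger equation and its data -/

/-- `t ↦ v t ∈ L²(𝕋²)` is the solution of `i ħ ∂_t v = (- ħ² Δ / 2 + ε² V) v` with initial datum
`u`: a continuous curve in `L²` that satisfies the equation in the weak sense, tested on each
exponential `e^{2iπ k·x}` (for which `- Δ` has the eigenvalue `4 π² |k|²`). -/
def IsSchrodingerSolution (V : T2 → ℝ) (ħ ε : ℝ) (u : L2T) (v : ℝ → L2T) : Prop :=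
  Continuous v ∧ v 0 = u ∧
    ∀ (k : Fin 2 → ℤ) (t : ℝ),
      HasDerivAt (fun s => UnitAddTorus.mFourierCoeff (v s) k)
        (-(Complex.I / (ħ : ℂ)) *
          (((ħ ^ 2 / 2 * (4 * Real.pi ^ 2 * normSq k) : ℝ) : ℂ) *
              UnitAddTorus.mFourierCoeff (v t) k +
            ((ε ^ 2 : ℝ) : ℂ) *
              UnitAddTorus.mFourierCoeff (fun x => (V x : ℂ) * v t x) k)) t

open Classical in
/-- The norm `‖1_S(- ħ² Δ) u‖` in `L²(𝕋²)`, computed in the orthonormal basis of exponentials. -/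
def spectralNorm (S : Set ℝ) (ħ : ℝ) (u : L2T) : ℝ :=
  Real.sqrt (∑' k : Fin 2 → ℤ,
    if ħ ^ 2 * (4 * Real.pi ^ 2 * normSq k) ∈ S then
      ‖UnitAddTorus.mFourierCoeff u k‖ ^ 2 else 0)

/-- No mass of `u_n` escapes to frequencies much higher than `1 / ħ_n`. -/
def IsOscillating (ħ : ℕ → ℝ) (u : ℕ → L2T) : Prop :=
  Tendsto (fun R : ℝ => limsup (fun n => spectralNorm (Set.Ici R) (ħ n) (u n)) atTop)
    atTop (𝓝 0)

/-- No mass of `u_n` stays at frequencies much lower than `1 / ħ_n`. -/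
def IsStrictlyOscillating (ħ : ℕ → ℝ) (u : ℕ → L2T) : Prop :=
  Tendsto (fun δ : ℝ => limsup (fun n => spectralNorm (Set.Icc 0 δ) (ħ n) (u n)) atTop)
    (𝓝[>] 0) (𝓝 0)

/-! ### Weyl quantization on the torus -/

/-- The Fourier coefficient of index `q` of `Op_ħ^w(b) u`, for a symbol `b` on `T*𝕋²`; the operator
acts on exponentials `e_k(x) = e^{2iπ k·x}` by `Op_ħ^w(b) e_k = ∑_q b̂_{q-k}(π ħ (q + k)) e_q`, with
`b̂_p(ξ) = ∫ b(x, ξ) e^{-2iπ p·x} dx`. -/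
def weylCoeff (ħ : ℝ) (b : T2 → (Fin 2 → ℝ) → ℂ) (u : L2T) (q : Fin 2 → ℤ) : ℂ :=
  ∑' k : Fin 2 → ℤ,
    UnitAddTorus.mFourierCoeff (fun x => b x ((Real.pi * ħ) • toR (q + k))) (q - k) *
      UnitAddTorus.mFourierCoeff u k

/-- The pairing `⟨u, Op_ħ^w(b) u⟩` in `L²(𝕋²)` (linear in the second argument). -/
def weylForm (ħ : ℝ) (b : T2 → (Fin 2 → ℝ) → ℂ) (u : L2T) : ℂ :=
  ∑' q : Fin 2 → ℤ, conj (UnitAddTorus.mFourierCoeff u q) * weylCoeff ħ b u q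

/-! ### Two-microlocal symbols and distributions -/

/-- The lift to `ℝ² × ℝ² × ℝ` of a function on `𝕋² × ℝ² × ℝ`. -/
def liftPhase (A : T2 × (Fin 2 → ℝ) × ℝ → ℂ) : (Fin 2 → ℝ) × (Fin 2 → ℝ) × ℝ → ℂ :=
  fun p => A (proj p.1, p.2)

/-- The space `C_c^∞(T*𝕋² × ℝ̂)`, where `ℝ̂ = [-∞, +∞]` carries the smooth structure of
`[-π/2, π/2]` through `arctan` (equivalently, `1 / η` is a coordinate near `±∞`). An element is
recorded by its restriction to the dense subset `T*𝕋² × ℝ`. -/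
def Symbols : Submodule ℂ (T2 × (Fin 2 → ℝ) × ℝ → ℂ) where
  carrier := {a | ∃ A : T2 × (Fin 2 → ℝ) × ℝ → ℂ,
    ContDiff ℝ ∞ (liftPhase A) ∧
    (∃ R : ℝ, ∀ x ξ θ, R ≤ ‖ξ‖ → A (x, ξ, θ) = 0) ∧
    ∀ x ξ η, a (x, ξ, η) = A (x, ξ, Real.arctan η)}
  zero_mem' := ⟨0, contDiff_const, ⟨0, fun _ _ _ _ => rfl⟩, fun _ _ _ => rfl⟩
  add_mem' := by
    rintro a b ⟨A, hA, ⟨R, hR⟩, ha⟩ ⟨B, hB, ⟨S, hS⟩, hb⟩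
    refine ⟨A + B, hA.add hB, ⟨max R S, fun x ξ θ h => ?_⟩, fun x ξ η => ?_⟩
    · simp [hR x ξ θ (le_trans (le_max_left _ _) h), hS x ξ θ (le_trans (le_max_right _ _) h)]
    · simp [ha, hb]
  smul_mem' := by
    rintro c a ⟨A, hA, ⟨R, hR⟩, ha⟩
    refine ⟨c • A, contDiff_const.smul hA, ⟨R, fun x ξ θ h => ?_⟩, fun x ξ η => ?_⟩
    · simp [hR x ξ θ h]
    · simp [ha]

/-- `‖a‖_𝓑 ≤ K`, for the norm of `𝓑 = C_0(ℝ² × ℝ̂, C³(𝕋²))`. -/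
def BNormLE (a : Symbols) (K : ℝ) : Prop :=
  ∀ (ξ : Fin 2 → ℝ) (η : ℝ) (x : Fin 2 → ℝ), ∀ j ≤ 3,
    ‖iteratedFDeriv ℝ j (fun y : Fin 2 → ℝ => a.1 (proj y, ξ, η)) x‖ ≤ K

/-- The linear form `L` on symbols satisfies `|L(a)| ≤ C ‖a‖_𝓑`. For some `C`, this says that `L`
is (the restriction to the dense subspace of symbols of) an element of the dual `𝓑'`. -/
def BDualBound (L : Symbols →ₗ[ℂ] ℂ) (C : ℝ) : Prop :=
  ∀ (a : Symbols) (K : ℝ), BNormLE a K → ‖L a‖ ≤ C * K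

/-- The two-microlocal Wigner distribution of `u`,
`a ↦ ⟨u, Op_ħ^w(a(x, ξ, H_Λ(ξ) / ε)) u⟩`. -/
def wigner (e : Fin 2 → ℤ) (ħ ε : ℝ) (u : L2T) (a : Symbols) : ℂ :=
  weylForm ħ (fun x ξ => a.1 (x, ξ, HLam e ξ / ε)) u

/-- `t ↦ μ t ∈ 𝓑'`, an element of `L¹(ℝ, 𝓑)'`, is the limit of the two-microlocal Wigner
distributions of `v_n(t τ_n)`, in the weak sense in `t`. -/
structure IsTimeLimit (e : Fin 2 → ℤ) (ħ ε τ : ℕ → ℝ) (v : ℕ → ℝ → L2T)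
    (μ : ℝ → Symbols →ₗ[ℂ] ℂ) : Prop where
  measurable : ∀ a : Symbols, AEStronglyMeasurable (fun t => μ t a) volume
  bounded : ∃ C : ℝ, ∀ᵐ t : ℝ, BDualBound (μ t) C
  tendsto : ∀ (a : Symbols) (θ : ℝ → ℂ), Integrable θ volume →
    Tendsto (fun n => ∫ t : ℝ, θ t * wigner e (ħ n) (ε n) (v n (t * τ n)) a) atTop
      (𝓝 (∫ t : ℝ, θ t * μ t a))

/-- `μ₀ ∈ 𝓑'` is the limit of the two-microlocal Wigner distributions of the initial data. -/
structure IsInitialLimit (e : Fin 2 → ℤ) (ħ ε : ℕ → ℝ) (u : ℕ → L2T)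
    (μ₀ : Symbols →ₗ[ℂ] ℂ) : Prop where
  bounded : ∃ C : ℝ, BDualBound μ₀ C
  tendsto : ∀ a : Symbols, Tendsto (fun n => wigner e (ħ n) (ε n) (u n) a) atTop (𝓝 (μ₀ a))

/-- The compact part of `L ∈ 𝓑'`, i.e. its restriction to `T*𝕋² × ℝ`, is the finite positive
measure `m`, carried by `𝕋² × Λ^⊥ × ℝ`: one has `L(a) = ∫ a dm` for all `a ∈ C_c^∞(T*𝕋² × ℝ)`. -/
def IsCompactPart (e : Fin 2 → ℤ) (L : Symbols →ₗ[ℂ] ℂ) (m : FiniteMeasure (CompactPhase e)) :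
    Prop :=
  ∀ a : Symbols, HasCompactSupport a.1 →
    L a = ∫ z, a.1 (z.1, z.2.1.1, z.2.2) ∂(m : Measure (CompactPhase e))

end TwoMicrolocal

end

/-! Tested on a single mode e^{2iπp·x} c(ξ, η), the Wigner distribution is a correlation `corr` of
the Fourier coefficients with their shift by p, weighted by c at the midpoint of the two frequencies
(`wigner_eq_corr`). All limits are taken on these correlations. Modes with coefficients in a
countable dense family determine a finite measure (`measure_ext_of_modes`), so countably many
statements valid for almost every t suffice.

Nature of the limits. Between sampling points at bounded distance in ℤ² the pair (ξ, H_Λ(ξ)/ε) moves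
by O(ħ/ε), so the distribution of the square of a trigonometric polynomial is a sum of squares up to
o(1) (`exists_nonneg_corr_sum`); a positive bounded form is then a finite measure
(`PosOnSquares.exists_measure`). At the sampling points H_Λ(ξ) = εη, hence the measure lives on H_Λ
= 0. It does not charge ξ = 0: the norm of the resolvent of the full Hamiltonian applied to the
solution is exactly conserved, and this resolvent differs from the free one by O(ε²) at a fixed
spectral parameter, so strict oscillation of the data persists for all times
(`lowMass_almost_conserved`).

Dynamics. In rescaled time the derivative of the correlation of index p is τ times the correlation
with weight 2iπ(p·ξ)c, minus τε times a sum over the frequencies j of V that involves ∂_η c, up to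
O(τ(ε² + ħ)) (`norm_corr_increment_le`). Since correlations are bounded and τ → ∞, the time
integrals of the correlations with weight (p·ξ)c tend to 0 (`Evolution.tendsto_fast`). If p is not
parallel to e, then p·ξ ≠ 0 on Λ^⊥ minus the origin; dividing by it shows that the p-th Fourier
coefficient of the limit vanishes. This is invariance along e^⊥ (`PerpInvariant`), and it holds
whatever the size of τε.

If p is parallel to e, then p·ξ = ε(p·e/L)η at the sampling points, so the whole derivative has size
τε. In the limit it is τε times the integral of X applied to the mode, where X is the field of p_Λ:
the frequencies of V that are not parallel to e act through coefficients that vanish by invariance,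
which is how V becomes I_Λ(V) (`LimitFamily.tendsto_slowField`). The three regimes follow. If τε →
0, the slow coefficients keep their initial values and the others vanish, which gives the average of
the initial measure. If τε = 1, the limit solves the transport equation of X with this average as
datum. If τε → ∞, division by τε shows that X annihilates the limit.

From the equation to the flow. The equation is tested on a∘φ^s, which is only known to be Lipschitz
and differentiable along the flow. A Friedrichs mollification yields test functions that approximate
it together with its derivative along X (`IsPLamField.exists_test_approx`). Then t ↦ ∫ a∘φ^{T-t}
dN_t has quadratic increments, hence is constant (`Transports.integral_eq`); for τε → ∞ this is
applied to a constant family. -/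

noncomputable section

namespace TwoMicrolocal

/-! ### Wigner distributions as correlations of Fourier coefficients. -/

section

/-! ### Correlations of square-summable sequences -/

/-- The dual lattice of the torus. -/
abbrev Z2 : Type := Fin 2 → ℤ

/-- The cotangent variables `(ξ, η)`. -/
abbrev Cot : Type := (Fin 2 → ℝ) × ℝ

/-- The correlation of a sequence with its shift by `p`, weighted by `f` at the (doubled)
midpoint. -/
def corr (x : Z2 → ℂ) (p : Z2) (f : Z2 → ℂ) : ℂ :=
  ∑' k, conj (x (k + p)) * x k * f (k + k + p)

lemma summable_sq_shift {x : Z2 → ℂ} (hx : Summable fun k => ‖x k‖ ^ 2) (p : Z2) :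
    Summable fun k => ‖x (k + p)‖ ^ 2 :=
  (Equiv.addRight p).summable_iff.mpr hx

lemma tsum_sq_shift (x : Z2 → ℂ) (p : Z2) :
    ∑' k, ‖x (k + p)‖ ^ 2 = ∑' k, ‖x k‖ ^ 2 :=
  (Equiv.addRight p).tsum_eq fun k => ‖x k‖ ^ 2

lemma norm_corr_term_le (x : Z2 → ℂ) (p k : Z2) {z : ℂ} {B : ℝ} (hz : ‖z‖ ≤ B) :
    ‖conj (x (k + p)) * x k * z‖ ≤ B / 2 * (‖x (k + p)‖ ^ 2 + ‖x k‖ ^ 2) := by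
  have hB : 0 ≤ B := (norm_nonneg _).trans hz
  rw [norm_mul, norm_mul, RCLike.norm_conj]
  have h1 : ‖x (k + p)‖ * ‖x k‖ ≤ (‖x (k + p)‖ ^ 2 + ‖x k‖ ^ 2) / 2 := by
    nlinarith [sq_nonneg (‖x (k + p)‖ - ‖x k‖)]
  calc _ ≤ (‖x (k + p)‖ ^ 2 + ‖x k‖ ^ 2) / 2 * B := by gcongr
    _ = _ := by ring

lemma summable_corr_term {x : Z2 → ℂ} (hx : Summable fun k => ‖x k‖ ^ 2) (p : Z2)
    {f : Z2 → ℂ} {B : ℝ} (hf : ∀ k, ‖f k‖ ≤ B) :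
    Summable fun k => ‖conj (x (k + p)) * x k * f k‖ :=
  .of_nonneg_of_le (fun _ => norm_nonneg _) (fun k => norm_corr_term_le x p k (hf k))
    (((summable_sq_shift hx p).add hx).mul_left _)

lemma summable_corr {x : Z2 → ℂ} (hx : Summable fun k => ‖x k‖ ^ 2) (p : Z2)
    {f : Z2 → ℂ} {B : ℝ} (hf : ∀ m, ‖f m‖ ≤ B) :
    Summable fun k => conj (x (k + p)) * x k * f (k + k + p) :=
  (summable_corr_term hx p (f := fun k => f (k + k + p)) fun _ => hf _).of_norm

lemma norm_tsum_corr_le {x : Z2 → ℂ} (hx : Summable fun k => ‖x k‖ ^ 2) (p : Z2)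
    {f : Z2 → ℂ} {B : ℝ} (hf : ∀ k, ‖f k‖ ≤ B) :
    ‖∑' k, conj (x (k + p)) * x k * f k‖ ≤ B * ∑' k, ‖x k‖ ^ 2 := by
  have h := norm_tsum_le_tsum_norm (summable_corr_term hx p hf)
  refine h.trans (((summable_corr_term hx p hf).tsum_le_tsum
    (fun k => norm_corr_term_le x p k (hf k))
    (((summable_sq_shift hx p).add hx).mul_left _)).trans (le_of_eq ?_))
  rw [tsum_mul_left, (summable_sq_shift hx p).tsum_add hx, tsum_sq_shift]
  ring

lemma norm_corr_le {x : Z2 → ℂ} (hx : Summable fun k => ‖x k‖ ^ 2) (p : Z2)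
    {f : Z2 → ℂ} {B : ℝ} (hf : ∀ m, ‖f m‖ ≤ B) :
    ‖corr x p f‖ ≤ B * ∑' k, ‖x k‖ ^ 2 :=
  norm_tsum_corr_le hx p (f := fun k => f (k + k + p)) fun _ => hf _

lemma corr_const_mul (x : Z2 → ℂ) (p : Z2) (f : Z2 → ℂ) (c : ℂ) :
    corr x p (fun m => c * f m) = c * corr x p f := by
  rw [corr, corr, ← tsum_mul_left]
  exact tsum_congr fun k => by ring

lemma corr_add {x : Z2 → ℂ} (hx : Summable fun k => ‖x k‖ ^ 2) (p : Z2)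
    {f g : Z2 → ℂ} {B C : ℝ} (hf : ∀ m, ‖f m‖ ≤ B) (hg : ∀ m, ‖g m‖ ≤ C) :
    corr x p (fun m => f m + g m) = corr x p f + corr x p g := by
  rw [corr, corr, corr, ← (summable_corr hx p hf).tsum_add (summable_corr hx p hg)]
  exact tsum_congr fun k => by ring

lemma corr_sub {x : Z2 → ℂ} (hx : Summable fun k => ‖x k‖ ^ 2) (p : Z2)
    {f g : Z2 → ℂ} {B C : ℝ} (hf : ∀ m, ‖f m‖ ≤ B) (hg : ∀ m, ‖g m‖ ≤ C) :
    corr x p (fun m => f m - g m) = corr x p f - corr x p g := by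
  rw [corr, corr, corr, ← (summable_corr hx p hf).tsum_sub (summable_corr hx p hg)]
  exact tsum_congr fun k => by ring

/-- Almost positivity of a quadratic family of correlations with slowly varying weights. -/
lemma exists_nonneg_corr_sum {x : Z2 → ℂ} (hx : Summable fun k => ‖x k‖ ^ 2) (F : Finset Z2)
    (g : Z2 → Z2 → ℂ) {B κ : ℝ} (hB : ∀ p ∈ F, ∀ m, ‖g p m‖ ≤ B)
    (hκ : ∀ p ∈ F, ∀ p' ∈ F, ∀ m,
      ‖g p m * conj (g p' m) - g p (m + (p + p')) * conj (g p' (m + (p + p')))‖ ≤ κ) :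
    ∃ r : ℝ, 0 ≤ r ∧
      ‖∑ p ∈ F, ∑ p' ∈ F, corr x (p - p') (fun m => g p m * conj (g p' m)) - (r : ℂ)‖ ≤
        (F.card : ℝ) ^ 2 * (κ * ∑' k, ‖x k‖ ^ 2) := by
  set h : Z2 → Z2 → Z2 → ℂ := fun p p' m => g p m * conj (g p' m) with hh
  have hb : ∀ p ∈ F, ∀ p' ∈ F, ∀ m, ‖h p p' m‖ ≤ B * B := fun p hp p' hp' m => by
    rw [hh, norm_mul, RCLike.norm_conj]
    exact mul_le_mul (hB p hp m) (hB p' hp' m) (norm_nonneg _)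
      ((norm_nonneg _).trans (hB p hp m))
  -- The weights are displaced by p + p', at the cost κ: with k = q - p the sampling index becomes
  -- 2q for every pair (p, p'), and the double sum factorises into squared moduli.
  set A : Z2 → Z2 → ℂ := fun p p' =>
    ∑' k, conj (x (k + (p - p'))) * x k * h p p' (k + k + (p - p') + (p + p')) with hA
  have hsum : ∀ p ∈ F, ∀ p' ∈ F, Summable fun k =>
      conj (x (k + (p - p'))) * x k * h p p' (k + k + (p - p') + (p + p')) := fun p hp p' hp' =>
    (summable_corr_term hx (p - p')
      (f := fun k => h p p' (k + k + (p - p') + (p + p'))) fun _ => hb p hp p' hp' _).of_norm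
  have hdiff : ∀ p ∈ F, ∀ p' ∈ F, ‖corr x (p - p') (h p p') - A p p'‖ ≤
      κ * ∑' k, ‖x k‖ ^ 2 := fun p hp p' hp' => by
    rw [corr, hA, ← (summable_corr hx _ (hb p hp p' hp')).tsum_sub (hsum p hp p' hp')]
    simp_rw [← mul_sub]
    exact norm_tsum_corr_le hx (p - p') fun k => hκ p hp p' hp' _
  have hterm : ∀ p p' q : Z2, conj (x (q - p + (p - p'))) * x (q - p) *
      h p p' (q - p + (q - p) + (p - p') + (p + p')) =
      (g p (q + q) * x (q - p)) * conj (g p' (q + q) * x (q - p')) := fun p p' q => by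
    have e1 : q - p + (p - p') = q - p' := by abel
    have e2 : q - p + (q - p) + (p - p') + (p + p') = q + q := by abel
    rw [e1, e2, hh, map_mul]; ring
  have hAq : ∀ p p', A p p' = ∑' q, (g p (q + q) * x (q - p)) *
      conj (g p' (q + q) * x (q - p')) := fun p p' => by
    rw [hA]
    exact ((Equiv.subRight p).tsum_eq _).symm.trans (tsum_congr fun q => hterm p p' q)
  have hsq : ∀ p ∈ F, ∀ p' ∈ F, Summable fun q => (g p (q + q) * x (q - p)) *
      conj (g p' (q + q) * x (q - p')) := fun p hp p' hp' =>
    ((Equiv.subRight p).summable_iff.mpr (hsum p hp p' hp')).congr fun q => hterm p p' q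
  have hpos : ∑ p ∈ F, ∑ p' ∈ F, A p p' =
      ((∑' q, ‖∑ p ∈ F, g p (q + q) * x (q - p)‖ ^ 2 : ℝ) : ℂ) := by
    simp_rw [hAq]
    have : ∀ p ∈ F, ∑ p' ∈ F, ∑' q, (g p (q + q) * x (q - p)) *
        conj (g p' (q + q) * x (q - p')) = ∑' q, ∑ p' ∈ F, (g p (q + q) * x (q - p)) *
        conj (g p' (q + q) * x (q - p')) := fun p hp =>
      (Summable.tsum_finsetSum fun p' hp' => hsq p hp p' hp').symm
    rw [Finset.sum_congr rfl this, ← Summable.tsum_finsetSum fun p hp =>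
      summable_sum fun p' hp' => hsq p hp p' hp', Complex.ofReal_tsum]
    refine tsum_congr fun q => ?_
    rw [← Complex.normSq_eq_norm_sq, ← Complex.mul_conj, map_sum, Finset.sum_mul_sum]
  refine ⟨∑' q, ‖∑ p ∈ F, g p (q + q) * x (q - p)‖ ^ 2,
    tsum_nonneg fun q => sq_nonneg _, ?_⟩
  · rw [← hpos, ← Finset.sum_sub_distrib]
    simp_rw [← Finset.sum_sub_distrib]
    refine (norm_sum_le_of_le F fun p hp => norm_sum_le_of_le F fun p' hp' =>
      hdiff p hp p' hp').trans (le_of_eq ?_)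
    simp only [Finset.sum_const, nsmul_eq_mul]
    ring

/-! ### Fourier coefficients and single-mode symbols -/

/-- The sequence of Fourier coefficients. -/
def coef (u : L2T) (k : Z2) : ℂ := UnitAddTorus.mFourierCoeff u k

/-- The Hilbert basis of exponentials. -/
def expBasis : HilbertBasis Z2 ℂ L2T := UnitAddTorus.mFourierBasis

lemma expBasis_repr (u : L2T) (k : Z2) : expBasis.repr u k = coef u k :=
  UnitAddTorus.mFourierBasis_repr u k

lemma inner_expBasis (u : L2T) (k : Z2) : inner ℂ (expBasis k) u = coef u k := by
  rw [← expBasis_repr, HilbertBasis.repr_apply_apply]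

lemma hasSum_sq_coef (u : L2T) : HasSum (fun k => ‖coef u k‖ ^ 2) (‖u‖ ^ 2) := by
  have h := expBasis.hasSum_inner_mul_inner u u
  have h2 := (RCLike.hasSum_re ℂ h)
  rw [inner_self_eq_norm_sq] at h2
  refine h2.congr_fun fun k => ?_
  rw [inner_expBasis, ← inner_conj_symm, inner_expBasis, RCLike.conj_mul]
  norm_cast

lemma summable_sq_coef (u : L2T) : Summable fun k => ‖coef u k‖ ^ 2 := (hasSum_sq_coef u).summable

lemma tsum_sq_coef (u : L2T) : ∑' k, ‖coef u k‖ ^ 2 = ‖u‖ ^ 2 := (hasSum_sq_coef u).tsum_eq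

/-- The single-mode function `e^{2iπ p·x} c(ξ, η)`. -/
def modeFn (p : Z2) (c : Cot → ℂ) : T2 × Cot → ℂ := fun z => UnitAddTorus.mFourier p z.1 * c z.2

/-- Values of a symbol `c(ξ, H_Λ(ξ)/ε)` at the points `ξ = π ħ m`. -/
def sample (e : Z2) (ħ ε : ℝ) (c : Cot → ℂ) (m : Z2) : ℂ :=
  c ((Real.pi * ħ) • toR m, HLam e ((Real.pi * ħ) • toR m) / ε)

lemma integral_mFourier (n : Z2) :
    ∫ t, UnitAddTorus.mFourier n t ∂torusMeasure = if n = 0 then 1 else 0 := by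
  have h := orthonormal_iff_ite.mp (UnitAddTorus.orthonormal_mFourier (d := Fin 2)) 0 n
  rw [ContinuousMap.inner_toLp] at h
  simp only [UnitAddTorus.mFourier_zero, ContinuousMap.one_apply, map_one, mul_one] at h
  simpa only [eq_comm] using! h

lemma mFourierCoeff_const_mul_mFourier (p n : Z2) (c : ℂ) :
    UnitAddTorus.mFourierCoeff (fun x : T2 => UnitAddTorus.mFourier p x * c) n =
      if n = p then c else 0 := by
  have : UnitAddTorus.mFourierCoeff (fun x : T2 => UnitAddTorus.mFourier p x * c) n =
      ∫ t, UnitAddTorus.mFourier (-n + p) t * c ∂torusMeasure := by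
    refine integral_congr_ae (.of_forall fun t => ?_)
    simp only [UnitAddTorus.mFourier_add, smul_eq_mul]; ring
  rw [this, integral_mul_const, integral_mFourier]
  by_cases h : n = p
  · simp [h]
  · have : -n + p ≠ 0 := fun h' => h (by rw [neg_add_eq_zero] at h'; exact h')
    simp [h, this]

/-- A single mode has one Fourier coefficient in x, of index p, so the Weyl matrix is carried by the
diagonal q = k + p, where the symbol is read at πħ(2k + p). -/
lemma wigner_eq_corr (e : Z2) (ħ ε : ℝ) (u : L2T) (a : Symbols) (p : Z2) (c : Cot → ℂ)
    (ha : a.1 = modeFn p c) :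
    wigner e ħ ε u a = corr (coef u) p (sample e ħ ε c) := by
  rw [wigner, weylForm, corr, ← (Equiv.addRight p).tsum_eq]
  refine tsum_congr fun k => ?_
  have : weylCoeff ħ (fun x ξ => a.1 (x, ξ, HLam e ξ / ε)) u (k + p) =
      coef u k * sample e ħ ε c (k + k + p) := by
    rw [weylCoeff, tsum_eq_single k]
    · simp only [ha, modeFn]
      rw [mFourierCoeff_const_mul_mFourier, if_pos (by abel), coef, mul_comm, sample]
      congr 4 <;> (try congr 1) <;> abel_nf
    · intro k' hk'
      simp only [ha, modeFn]
      rw [mFourierCoeff_const_mul_mFourier, if_neg, zero_mul]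
      intro h
      apply hk'
      have : k' = k + p - (k + p - k') := by abel
      rw [this, h, add_sub_cancel_right]
  simp only [Equiv.coe_addRight, this, coef]
  ring

end

/-! ### Conservation laws for equations that hold coefficient by coefficient. -/

section

/-! ### Approximate conservation laws through the resolvent -/

section Resolvent

variable {ι H : Type*} [NormedAddCommGroup H] [InnerProductSpace ℂ H] [CompleteSpace H]

/-- A diagonal operator in a Hilbert basis. -/
lemma exists_diagonal (b : HilbertBasis ι ℂ H) (d : ι → ℝ) {C : ℝ} (hC : 0 ≤ C)
    (hd : ∀ k, |d k| ≤ C) :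
    ∃ T : H →L[ℂ] H, IsSelfAdjoint T ∧ ‖T‖ ≤ C ∧
      ∀ x k, b.repr (T x) k = d k * b.repr x k := by
  have hmem : ∀ f : lp (fun _ : ι => ℂ) 2, Memℓp (fun k => (d k : ℂ) * f k) 2 := fun f => by
    refine memℓp_gen (.of_nonneg_of_le (fun k => by positivity) (fun k => ?_)
      ((f.2.summable (by norm_num)).mul_left (C ^ 2)))
    simp only [norm_mul, Complex.norm_real, Real.norm_eq_abs, ENNReal.toReal_ofNat,
      Real.rpow_ofNat, mul_pow]
    gcongr
    exact hd k
  let D : lp (fun _ : ι => ℂ) 2 →ₗ[ℂ] lp (fun _ : ι => ℂ) 2 :=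
    { toFun := fun f => ⟨fun k => (d k : ℂ) * f k, hmem f⟩
      map_add' := fun f g => by
        ext k
        change (d k : ℂ) * (f k + g k) = d k * f k + d k * g k
        rw [mul_add]
      map_smul' := fun c f => by ext k; simp; ring }
  have hD : ∀ f, ‖D f‖ ≤ C * ‖f‖ := fun f => by
    have h1 : ‖D f‖ ≤ ‖(C : ℂ) • f‖ := by
      refine lp.norm_mono (by norm_num) fun k => ?_
      simp only [D, LinearMap.coe_mk, AddHom.coe_mk, lp.coeFn_smul, Pi.smul_apply, smul_eq_mul,
        norm_mul, Complex.norm_real, Real.norm_eq_abs]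
      exact mul_le_mul_of_nonneg_right ((hd k).trans (le_abs_self C)) (norm_nonneg _)
    rwa [norm_smul, Complex.norm_real, Real.norm_of_nonneg hC] at h1
  let T : H →L[ℂ] H := (b.repr.symm : lp (fun _ : ι => ℂ) 2 →L[ℂ] H) ∘L
    (D.mkContinuous C hD) ∘L (b.repr : H →L[ℂ] lp (fun _ : ι => ℂ) 2)
  have hT : ∀ x k, b.repr (T x) k = d k * b.repr x k := fun x k => by
    simp [T, D]
  refine ⟨T, ?_, ?_, hT⟩
  · rw [ContinuousLinearMap.isSelfAdjoint_iff_isSymmetric]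
    intro x y
    change inner ℂ (T x) y = inner ℂ x (T y)
    rw [← b.repr.inner_map_map, ← b.repr.inner_map_map x, lp.inner_eq_tsum, lp.inner_eq_tsum]
    refine tsum_congr fun k => ?_
    rw [hT, hT]
    simp only [RCLike.inner_apply, map_mul, Complex.conj_ofReal]
    ring
  · refine T.opNorm_le_bound hC fun x => ?_
    change ‖b.repr.symm (D (b.repr x))‖ ≤ _
    rw [LinearIsometryEquiv.norm_map]
    simpa using hD (b.repr x)

/-- The regularised mass of `x` on the low part `lam ≲ δ` of the spectrum. -/
def lowMass (b : HilbertBasis ι ℂ H) (lam : ι → ℝ) (δ : ℝ) (x : H) : ℝ :=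
  Real.sqrt (∑' k, (δ / (lam k + δ)) ^ 2 * ‖b.repr x k‖ ^ 2)

omit [CompleteSpace H] in
lemma hasSum_norm_repr_sq (b : HilbertBasis ι ℂ H) (x : H) :
    HasSum (fun k => ‖b.repr x k‖ ^ 2) (‖x‖ ^ 2) := by
  have h := lp.hasSum_norm (p := 2) (by norm_num) (b.repr x)
  simpa using h

/-- Let D be the diagonal operator with eigenvalues `lam`; the regularised mass of x is δ‖(D +
δ)⁻¹x‖. The resolvent (D + A + δ)⁻¹ commutes with the evolution, so its value on `v t` has constant
norm, and the resolvent identity bounds its distance to (D + δ)⁻¹ by 2‖A‖/δ². Only bounded operators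
appear, so no domain has to be discussed although the equation is weak. -/
lemma lowMass_almost_conserved (b : HilbertBasis ι ℂ H) (lam : ι → ℝ) (hlam : ∀ k, 0 ≤ lam k)
    (A : H →L[ℂ] H) (hA : IsSelfAdjoint A) {δ : ℝ} (hδ : 0 < δ) (hAδ : ‖A‖ ≤ δ / 2)
    (ħ : ℝ) (v : ℝ → H) (hv : Continuous v)
    (hdv : ∀ k t, HasDerivAt (fun s => b.repr (v s) k)
      (-(Complex.I / (ħ : ℂ)) * (lam k * b.repr (v t) k + b.repr (A (v t)) k)) t) (t : ℝ) :
    |lowMass b lam δ (v t) - lowMass b lam δ (v 0)| ≤ 2 * ‖A‖ / δ * (‖v t‖ + ‖v 0‖) := by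
  have hpos : ∀ k, 0 < lam k + δ := fun k => add_pos_of_nonneg_of_pos (hlam k) hδ
  obtain ⟨T, hTsa, hTn, hT⟩ := exists_diagonal b (fun k => (lam k + δ)⁻¹) (C := δ⁻¹)
    (by positivity) fun k => by
      rw [abs_of_pos (inv_pos.mpr (hpos k))]
      exact inv_anti₀ hδ (by linarith [hlam k])
  have hTA : ‖T * A‖ ≤ 1 / 2 := by
    calc ‖T * A‖ ≤ ‖T‖ * ‖A‖ := norm_mul_le _ _
      _ ≤ δ⁻¹ * (δ / 2) := by gcongr
      _ = 1 / 2 := by field_simp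
  have hlt : ‖-(T * A)‖ < 1 := by rw [norm_neg]; linarith
  -- `m = 1 + T A` is inverted by a Neumann series, and `R = m⁻¹ T` is the resolvent (D + A + δ)⁻¹.
  set m : (H →L[ℂ] H)ˣ := Units.oneSub (-(T * A)) hlt with hm
  have hmv : (m : H →L[ℂ] H) = 1 + T * A := by simp [hm]
  set R : H →L[ℂ] H := ((m⁻¹ : (H →L[ℂ] H)ˣ) : H →L[ℂ] H) * T with hR
  have hmR : (m : H →L[ℂ] H) * R = T := by rw [hR, Units.mul_inv_cancel_left]
  -- One has m T = T + T A T = T m*. With m R = T this gives m R m* = m R* m*, and m, m* are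
  -- cancelled.
  have hRsa : IsSelfAdjoint R := by
    have h1 : (m : H →L[ℂ] H) * T = T * star (m : H →L[ℂ] H) := by
      rw [hmv, star_add, star_one, star_mul, hTsa.star_eq, hA.star_eq, mul_add, add_mul, one_mul,
        mul_one, mul_assoc]
    have h2 : (m : H →L[ℂ] H) * R * star (m : H →L[ℂ] H) =
        (m : H →L[ℂ] H) * star R * star (m : H →L[ℂ] H) := by
      rw [hmR, ← h1, mul_assoc, ← star_mul, hmR, hTsa.star_eq]
    have h3 := (IsUnit.star m.isUnit).mul_right_cancel h2
    exact (m.isUnit.mul_left_cancel h3).symm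
  -- the derivative of `T v`
  have hTv : ∀ t, HasDerivAt (fun s => T (v s))
      (-(Complex.I / (ħ : ℂ)) • ((m : H →L[ℂ] H) (v t) - (δ : ℂ) • T (v t))) t := by
    set w : ℝ → H := fun t => -(Complex.I / (ħ : ℂ)) •
      ((m : H →L[ℂ] H) (v t) - (δ : ℂ) • T (v t)) with hw
    have hwc : Continuous w := by fun_prop
    have hint : ∀ t, HasDerivAt (fun s => T (v 0) + ∫ r in (0 : ℝ)..s, w r) (w t) t := fun t =>
      (intervalIntegral.integral_hasDerivAt_right (hwc.intervalIntegrable _ _)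
        (hwc.stronglyMeasurableAtFilter _ _) hwc.continuousAt).const_add _
    -- The equation is known only on coefficients. Applying `T` turns its right-hand side into a
    -- continuous curve in `H`, whose primitive has the same coefficients as `T v`.
    have heq : (fun s => T (v s)) = fun s => T (v 0) + ∫ r in (0 : ℝ)..s, w r := by
      funext s
      apply b.repr.injective
      ext k
      let ev : H →L[ℂ] ℂ := innerSL ℂ (b k)
      have hev : ∀ x, b.repr x k = ev x := fun x => by
        rw [HilbertBasis.repr_apply_apply]; rfl
      have hd1 : ∀ t, HasDerivAt (fun s => b.repr (T (v s)) k) (ev (w t)) t := fun t => by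
        have h := (hdv k t).const_mul ((((lam k + δ)⁻¹ : ℝ)) : ℂ)
        simp only [hT]
        refine h.congr_deriv ?_
        have hne : ((lam k : ℂ) + δ) ≠ 0 := by exact_mod_cast (hpos k).ne'
        rw [← hev, hw, map_smul, map_sub, map_smul, hmv]
        simp only [add_apply, one_apply_eq_self,
          mul_apply_eq_comp, map_add, lp.coeFn_smul, lp.coeFn_sub, lp.coeFn_add,
          Pi.smul_apply, Pi.sub_apply, Pi.add_apply, smul_eq_mul, hT]
        push_cast
        field_simp
        ring
      have hd2 : ∀ t, HasDerivAt (fun s => b.repr (T (v 0) + ∫ r in (0 : ℝ)..s, w r) k)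
          (ev (w t)) t := fun t => by
        simp only [hev]
        exact (ev.hasFDerivAt.restrictScalars ℝ).comp_hasDerivAt t (hint t)
      have hd3 : ∀ t, HasDerivAt (fun s => b.repr (T (v s)) k -
          b.repr (T (v 0) + ∫ r in (0 : ℝ)..s, w r) k) 0 t := fun t => by
        exact ((hd1 t).sub (hd2 t)).congr_deriv (sub_self _)
      have hc := is_const_of_deriv_eq_zero (fun t => (hd3 t).differentiableAt)
        (fun t => (hd3 t).deriv) s 0
      simp only [intervalIntegral.integral_same, add_zero, sub_self] at hc
      exact sub_eq_zero.mp hc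
    intro t
    rw [heq]
    exact hint t
  have hRv : ∀ t, HasDerivAt (fun s => R (v s))
      (-(Complex.I / (ħ : ℂ)) • (v t - (δ : ℂ) • R (v t))) t := fun t => by
    have h := ((m⁻¹ : (H →L[ℂ] H)ˣ) : H →L[ℂ] H).hasFDerivAt.restrictScalars ℝ
      |>.comp_hasDerivAt t (hTv t)
    refine h.congr_deriv ?_
    have h1 : ((m⁻¹ : (H →L[ℂ] H)ˣ) : H →L[ℂ] H) ((m : H →L[ℂ] H) (v t)) = v t := by
      rw [← mul_apply_eq_comp, Units.inv_mul]; rfl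
    simp only [ContinuousLinearMap.coe_restrictScalars', map_smul, map_sub, h1]
    rfl
  have hconst : ‖R (v t)‖ = ‖R (v 0)‖ := by
    let _ : InnerProductSpace ℝ H := InnerProductSpace.rclikeToReal ℂ H
    have hd : ∀ t, HasDerivAt (fun s => ‖R (v s)‖ ^ 2) 0 t := fun t => by
      have h := (hRv t).norm_sq
      refine h.congr_deriv ?_
      -- Self-adjointness makes ⟨Rv, v⟩ real, so the derivative of ‖Rv‖² is the real part of a
      -- purely imaginary number.
      have hre : inner ℂ (R (v t)) (v t) = (((inner ℂ (R (v t)) (v t)).re : ℝ) : ℂ) := by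
        apply Complex.ext
        · simp
        · have h1 := hRsa.isSymmetric (v t) (v t)
          change inner ℂ (R (v t)) (v t) = inner ℂ (v t) (R (v t)) at h1
          rw [← inner_conj_symm] at h1
          have h2 := congrArg Complex.im h1
          rw [Complex.conj_im] at h2
          have h3 := congrArg Complex.im (inner_conj_symm (𝕜 := ℂ) (v t) (R (v t)))
          rw [Complex.conj_im] at h3
          simp only [Complex.ofReal_im]
          linarith
      rw [real_inner_eq_re_inner ℂ, inner_smul_right, inner_sub_right, inner_smul_right,
        inner_self_eq_norm_sq_to_K, hre]
      have : -(Complex.I / (ħ : ℂ)) * ((((inner ℂ (R (v t)) (v t)).re : ℝ) : ℂ) -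
          (δ : ℂ) * ((‖R (v t)‖ : ℝ) : ℂ) ^ 2) = (((-(1 / ħ) * ((inner ℂ (R (v t)) (v t)).re -
          δ * ‖R (v t)‖ ^ 2) : ℝ)) : ℂ) * Complex.I := by
        push_cast; ring
      simp only [Complex.coe_algebraMap]
      rw [this, RCLike.re_to_complex, Complex.re_ofReal_mul, Complex.I_re, mul_zero, mul_zero]
    have h := is_const_of_deriv_eq_zero (fun t => (hd t).differentiableAt)
      (fun t => (hd t).deriv) t 0
    exact (sq_eq_sq₀ (norm_nonneg _) (norm_nonneg _)).mp h
  have hlow : ∀ x, lowMass b lam δ x = δ * ‖T x‖ := fun x => by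
    have h := (hasSum_norm_repr_sq b (T x)).mul_left (δ ^ 2)
    rw [lowMass, ← Real.sqrt_sq (mul_nonneg hδ.le (norm_nonneg (T x))), mul_pow, ← h.tsum_eq]
    congr 1
    refine tsum_congr fun k => ?_
    rw [hT, norm_mul, Complex.norm_real, Real.norm_eq_abs, abs_of_pos (inv_pos.mpr (hpos k))]
    ring
  have hdiff : ∀ x, ‖R x - T x‖ ≤ 2 * ‖A‖ / δ ^ 2 * ‖x‖ := fun x => by
    have h1 : R x - T x = -(T (A (R x))) := by
      have : T x = R x + T (A (R x)) := by
        conv_lhs => rw [← hmR, hmv]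
        rfl
      rw [this]; abel
    have hTle : ∀ y, ‖T y‖ ≤ δ⁻¹ * ‖y‖ := fun y => T.le_of_opNorm_le hTn y
    have hTAle : ∀ y, ‖T (A y)‖ ≤ δ⁻¹ * (‖A‖ * ‖y‖) := fun y =>
      (hTle _).trans (by gcongr; exact A.le_opNorm y)
    -- From R = T - T A R, the term T A R is absorbed because ‖T A‖ ≤ 1/2.
    have h2 : ‖R x‖ ≤ 2 * (δ⁻¹ * ‖x‖) := by
      have h3 : ‖T (A (R x))‖ ≤ 1 / 2 * ‖R x‖ := (T * A).le_of_opNorm_le hTA (R x)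
      have h4 : ‖R x‖ ≤ ‖T x‖ + ‖T (A (R x))‖ := by
        have h5 : R x = T x - T (A (R x)) := by rw [sub_eq_add_neg, ← sub_eq_iff_eq_add', h1]
        exact (congrArg norm h5).le.trans (norm_sub_le _ _)
      linarith [hTle x]
    rw [h1, norm_neg]
    calc _ ≤ δ⁻¹ * (‖A‖ * (2 * (δ⁻¹ * ‖x‖))) := (hTAle _).trans (by gcongr)
      _ = _ := by field_simp
  have hab : ∀ x, |δ * ‖T x‖ - δ * ‖R x‖| ≤ 2 * ‖A‖ / δ * ‖x‖ := fun x => by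
    rw [← mul_sub, abs_mul, abs_of_pos hδ, abs_sub_comm]
    calc _ ≤ δ * (2 * ‖A‖ / δ ^ 2 * ‖x‖) := by
          gcongr; exact (abs_norm_sub_norm_le _ _).trans (hdiff x)
      _ = _ := by field_simp
  rw [hlow, hlow]
  have h1 := abs_le.mp (hab (v t))
  have h2 := abs_le.mp (hab (v 0))
  rw [hconst] at h1
  rw [abs_le, mul_add]
  constructor <;> linarith [h1.1, h1.2, h2.1, h2.2]

omit [CompleteSpace H] in
lemma tendsto_lowMass_atTop (b : HilbertBasis ι ℂ H) (lam : ι → ℝ) (hlam : ∀ k, 0 ≤ lam k)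
    (x : H) : Tendsto (fun δ => lowMass b lam δ x) atTop (𝓝 ‖x‖) := by
  have h : Tendsto (fun δ : ℝ => ∑' k, (δ / (lam k + δ)) ^ 2 * ‖b.repr x k‖ ^ 2) atTop
      (𝓝 (∑' k, ‖b.repr x k‖ ^ 2)) := by
    refine tendsto_tsum_of_dominated_convergence (hasSum_norm_repr_sq b x).summable
      (fun k => ?_) ?_
    · have h1 : Tendsto (fun δ : ℝ => δ / (lam k + δ)) atTop (𝓝 1) := by
        have h2 : Tendsto (fun δ : ℝ => 1 - lam k / (lam k + δ)) atTop (𝓝 (1 - 0)) :=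
          tendsto_const_nhds.sub (tendsto_const_nhds.div_atTop
            (tendsto_atTop_add_const_left _ _ tendsto_id))
        rw [sub_zero] at h2
        refine h2.congr' ?_
        filter_upwards [eventually_gt_atTop 0] with δ hδ
        have : lam k + δ ≠ 0 := by linarith [hlam k]
        field_simp; ring
      simpa using (h1.pow 2).mul_const (‖b.repr x k‖ ^ 2)
    · filter_upwards [eventually_gt_atTop 0] with δ hδ k
      rw [Real.norm_of_nonneg (by positivity)]
      have : δ / (lam k + δ) ≤ 1 := div_le_one_of_le₀ (by linarith [hlam k]) (by linarith [hlam k])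
      have h0 : 0 ≤ δ / (lam k + δ) := div_nonneg hδ.le (by linarith [hlam k])
      exact mul_le_of_le_one_left (sq_nonneg _) (pow_le_one₀ h0 this)
  rw [(hasSum_norm_repr_sq b x).tsum_eq] at h
  have h3 := (Real.continuous_sqrt.tendsto _).comp h
  rw [Real.sqrt_sq (norm_nonneg _)] at h3
  exact h3

/-- As δ → ∞ the regularised low mass exhausts the norm, while the defect of its conservation is
O(1/δ). -/
lemma norm_conserved (b : HilbertBasis ι ℂ H) (lam : ι → ℝ) (hlam : ∀ k, 0 ≤ lam k)
    (A : H →L[ℂ] H) (hA : IsSelfAdjoint A) (ħ : ℝ) (v : ℝ → H) (hv : Continuous v)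
    (hdv : ∀ k t, HasDerivAt (fun s => b.repr (v s) k)
      (-(Complex.I / (ħ : ℂ)) * (lam k * b.repr (v t) k + b.repr (A (v t)) k)) t) (t : ℝ) :
    ‖v t‖ = ‖v 0‖ := by
  have h1 : Tendsto (fun δ => |lowMass b lam δ (v t) - lowMass b lam δ (v 0)|) atTop
      (𝓝 |‖v t‖ - ‖v 0‖|) :=
    ((tendsto_lowMass_atTop b lam hlam _).sub (tendsto_lowMass_atTop b lam hlam _)).abs
  have h2 : Tendsto (fun δ : ℝ => 2 * ‖A‖ / δ * (‖v t‖ + ‖v 0‖)) atTop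
      (𝓝 (0 * (‖v t‖ + ‖v 0‖))) :=
    (tendsto_const_nhds.div_atTop tendsto_id).mul_const _
  rw [zero_mul] at h2
  have h3 := le_of_tendsto_of_tendsto h1 h2 (by
    filter_upwards [eventually_ge_atTop (2 * ‖A‖), eventually_gt_atTop 0] with δ h1 h2
    exact lowMass_almost_conserved b lam hlam A hA h2 (by linarith) ħ v hv hdv t)
  exact sub_eq_zero.mp (abs_nonpos_iff.mp h3)

end Resolvent

end

/-! ### Analysis on the torus: integrals with parameters, decay of Fourier coefficients. -/

section

/-! ### Smooth integrals with parameters -/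

section Parametric

variable {Y W : Type} [NormedAddCommGroup Y] [NormedSpace ℝ Y] [FiniteDimensional ℝ Y]
  [MeasurableSpace Y] [BorelSpace Y] [NormedAddCommGroup W] [NormedSpace ℝ W]
  [FiniteDimensional ℝ W]

omit [FiniteDimensional ℝ Y] [MeasurableSpace Y] [BorelSpace Y] [FiniteDimensional ℝ W] in
lemma contDiff_fderiv_right {G : Type} [NormedAddCommGroup G] [NormedSpace ℝ G] {f : Y × W → G}
    (hf : ContDiff ℝ ∞ f) :
    ContDiff ℝ ∞ fun z : Y × W => fderiv ℝ (fun w => f (z.1, w)) z.2 := by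
  refine ContDiff.fderiv (f := fun (z : Y × W) w => f (z.1, w)) (m := ∞) (n := ∞) ?_
    contDiff_snd (by simp)
  exact hf.comp ((contDiff_fst.comp contDiff_fst).prodMk contDiff_snd)

lemma hasFDerivAt_integral_param {G : Type} [NormedAddCommGroup G] [NormedSpace ℝ G]
    (ν : Measure Y) [IsFiniteMeasure ν] {K : Set Y} (hK : IsCompact K) (hKν : ∀ᵐ y ∂ν, y ∈ K)
    {f : Y × W → G} (hf : ContDiff ℝ ∞ f) (w : W) :
    HasFDerivAt (fun w => ∫ y, f (y, w) ∂ν) (∫ y, fderiv ℝ (fun w => f (y, w)) w ∂ν) w := by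
  have : ProperSpace W := FiniteDimensional.proper ℝ W
  have : ProperSpace Y := FiniteDimensional.proper ℝ Y
  have hd := (contDiff_fderiv_right hf).continuous
  obtain ⟨C, hC⟩ := (hK.prod (isCompact_closedBall w 1)).exists_bound_of_continuousOn
    hd.continuousOn
  obtain ⟨C', hC'⟩ := (hK.prod (isCompact_singleton (x := w))).exists_bound_of_continuousOn
    hf.continuous.continuousOn
  have hmeas : ∀ w, AEStronglyMeasurable (fun y => f (y, w)) ν := fun w =>
    (hf.continuous.comp (by fun_prop : Continuous fun y => (y, w))).aestronglyMeasurable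
  refine hasFDerivAt_integral_of_dominated_of_fderiv_le (Metric.closedBall_mem_nhds w one_pos)
    (F := fun w y => f (y, w)) (F' := fun w y => fderiv ℝ (fun w => f (y, w)) w)
    (.of_forall hmeas) ?_ ?_ (bound := fun _ => C) ?_ (integrable_const _) ?_
  · refine Integrable.of_bound (hmeas w) C' ?_
    filter_upwards [hKν] with y hy
    exact hC' (y, w) ⟨hy, rfl⟩
  · exact (hd.comp (by fun_prop : Continuous fun y => (y, w))).aestronglyMeasurable
  · filter_upwards [hKν] with y hy x hx
    exact hC (y, x) ⟨hy, hx⟩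
  · refine .of_forall fun y x _ => DifferentiableAt.hasFDerivAt ?_
    exact ((hf.comp (contDiff_prodMk_right y)).differentiable (by simp)) x

lemma contDiff_integral_param {G : Type} [NormedAddCommGroup G] [NormedSpace ℝ G]
    (ν : Measure Y) [IsFiniteMeasure ν] {K : Set Y} (hK : IsCompact K) (hKν : ∀ᵐ y ∂ν, y ∈ K)
    {f : Y × W → G} (hf : ContDiff ℝ ∞ f) :
    ContDiff ℝ ∞ fun w => ∫ y, f (y, w) ∂ν := by
  rw [contDiff_infty]
  intro n
  -- Each derivative changes the target space from `G` to `W →L[ℝ] G`.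
  induction n generalizing G with
  | zero =>
    exact contDiff_zero.mpr (continuous_iff_continuousAt.mpr fun w =>
      (hasFDerivAt_integral_param ν hK hKν hf w).continuousAt)
  | succ n ih =>
    push_cast
    rw [contDiff_succ_iff_fderiv]
    refine ⟨fun w => (hasFDerivAt_integral_param ν hK hKν hf w).differentiableAt, by simp, ?_⟩
    have : fderiv ℝ (fun w => ∫ y, f (y, w) ∂ν) =
        fun w => ∫ y, fderiv ℝ (fun w => f (y, w)) w ∂ν :=
      funext fun w => (hasFDerivAt_integral_param ν hK hKν hf w).fderiv
    rw [this]
    exact ih (contDiff_fderiv_right hf)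

lemma norm_iteratedFDeriv_integral_le {G : Type} [NormedAddCommGroup G] [NormedSpace ℝ G]
    (ν : Measure Y) [IsFiniteMeasure ν] {K : Set Y} (hK : IsCompact K) (hKν : ∀ᵐ y ∂ν, y ∈ K)
    {f : Y × W → G} (hf : ContDiff ℝ ∞ f) {B : Y → ℝ} (hB : Integrable B ν) (j : ℕ)
    (h : ∀ᵐ y ∂ν, ∀ w, ‖iteratedFDeriv ℝ j (fun w => f (y, w)) w‖ ≤ B y) (w : W) :
    ‖iteratedFDeriv ℝ j (fun w => ∫ y, f (y, w) ∂ν) w‖ ≤ ∫ y, B y ∂ν := by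
  induction j generalizing G with
  | zero =>
    rw [norm_iteratedFDeriv_zero]
    refine norm_integral_le_of_norm_le hB ?_
    filter_upwards [h] with y hy
    have := hy w
    rwa [norm_iteratedFDeriv_zero] at this
  | succ n ih =>
    rw [← norm_iteratedFDeriv_fderiv]
    have : fderiv ℝ (fun w => ∫ y, f (y, w) ∂ν) =
        fun w => ∫ y, fderiv ℝ (fun w => f (y, w)) w ∂ν :=
      funext fun w => (hasFDerivAt_integral_param ν hK hKν hf w).fderiv
    rw [this]
    refine ih (G := W →L[ℝ] G) (f := fun z : Y × W => fderiv ℝ (fun w => f (z.1, w)) z.2)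
      (contDiff_fderiv_right hf) ?_
    filter_upwards [h] with y hy w
    have h1 := hy w
    rw [← norm_iteratedFDeriv_fderiv] at h1
    exact h1

end Parametric

/-! ### The covering map and exponentials -/

lemma isOpenQuotientMap_proj : IsOpenQuotientMap proj :=
  IsOpenQuotientMap.piMap fun _ => QuotientAddGroup.isOpenQuotientMap_mk

lemma continuous_proj : Continuous proj := isOpenQuotientMap_proj.continuous

lemma proj_surjective : Function.Surjective proj := isOpenQuotientMap_proj.surjective

lemma proj_add (x y : Fin 2 → ℝ) : proj (x + y) = proj x + proj y := by
  ext i; simp [proj]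

lemma proj_zero : proj 0 = 0 := by
  ext i; simp [proj]

lemma proj_toR (k : Z2) : proj (toR k) = 0 := by
  ext i
  simp only [proj, toR, Pi.zero_apply]
  rw [AddCircle.coe_eq_zero_iff]
  exact ⟨k i, by simp⟩

lemma exists_toR_of_proj_eq {x y : Fin 2 → ℝ} (h : proj x = proj y) : ∃ k : Z2, x = y + toR k := by
  have h1 : ∀ i, ∃ n : ℤ, x i = y i + n := fun i => by
    have h2 : ((x i - y i : ℝ) : UnitAddCircle) = 0 := by
      rw [AddCircle.coe_sub, sub_eq_zero]
      exact congrFun h i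
    obtain ⟨n, hn⟩ := AddCircle.coe_eq_zero_iff 1 |>.mp h2
    exact ⟨n, by simp at hn; linarith⟩
  choose k hk using h1
  exact ⟨k, funext hk⟩

lemma continuous_of_comp_proj {F : Type*} [TopologicalSpace F] {f : T2 → F}
    (hf : Continuous fun x => f (proj x)) : Continuous f :=
  isOpenQuotientMap_proj.isQuotientMap.continuous_iff.mpr hf

lemma mFourier_proj (p : Z2) (x : Fin 2 → ℝ) :
    UnitAddTorus.mFourier p (proj x) =
      Complex.exp (2 * Real.pi * Complex.I * ((toR p ⬝ᵥ x : ℝ) : ℂ)) := by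
  simp only [UnitAddTorus.mFourier, proj, ContinuousMap.coe_mk, fourier_coe_apply, Fin.prod_univ_two,
    ← Complex.exp_add, dotProduct, Fin.sum_univ_two, toR]
  congr 1
  push_cast
  ring

lemma norm_mFourier_apply (p : Z2) (x : T2) : ‖UnitAddTorus.mFourier p x‖ = 1 := by
  obtain ⟨y, rfl⟩ := proj_surjective x
  rw [mFourier_proj, Complex.norm_exp]
  simp

lemma mFourier_apply_add (p : Z2) (x y : T2) :
    UnitAddTorus.mFourier p (x + y) = UnitAddTorus.mFourier p x * UnitAddTorus.mFourier p y := by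
  obtain ⟨x, rfl⟩ := proj_surjective x
  obtain ⟨y, rfl⟩ := proj_surjective y
  rw [← proj_add, mFourier_proj, mFourier_proj, mFourier_proj, ← Complex.exp_add, dotProduct_add]
  congr 1
  push_cast
  ring

lemma hasDerivAt_mFourier_line (p : Z2) (x w : Fin 2 → ℝ) (s : ℝ) :
    HasDerivAt (fun s : ℝ => UnitAddTorus.mFourier p (proj (x + s • w)))
      (2 * Real.pi * Complex.I * ((toR p ⬝ᵥ w : ℝ) : ℂ) *
        UnitAddTorus.mFourier p (proj (x + s • w))) s := by
  simp only [mFourier_proj]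
  have h1 : HasDerivAt (fun s : ℝ => (toR p ⬝ᵥ (x + s • w) : ℝ)) (toR p ⬝ᵥ w) s := by
    simp only [dotProduct_add, dotProduct_smul, smul_eq_mul]
    simpa using ((hasDerivAt_id s).mul_const (toR p ⬝ᵥ w)).const_add (toR p ⬝ᵥ x)
  have h2 := ((h1.ofReal_comp).const_mul (2 * Real.pi * Complex.I)).cexp
  refine h2.congr_deriv ?_
  ring

lemma contDiff_mFourier_proj (p : Z2) :
    ContDiff ℝ ∞ fun x : Fin 2 → ℝ => UnitAddTorus.mFourier p (proj x) := by
  simp only [mFourier_proj, dotProduct, Fin.sum_univ_two]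
  refine Complex.contDiff_exp.comp (contDiff_const.mul (Complex.ofRealCLM.contDiff.comp ?_))
  exact (contDiff_const.mul (contDiff_apply ℝ ℝ 0)).add (contDiff_const.mul (contDiff_apply ℝ ℝ 1))

/-! ### Decay of Fourier coefficients of smooth functions -/

/-- Smoothness of a complex function on the torus. -/
def SmoothC (f : T2 → ℂ) : Prop := ContDiff ℝ ∞ fun x : Fin 2 → ℝ => f (proj x)

lemma SmoothC.continuous {f : T2 → ℂ} (hf : SmoothC f) : Continuous f :=
  continuous_of_comp_proj (ContDiff.continuous hf)

/-- The derivative of a function on the torus in the direction `w`. -/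
def dirDeriv (w : Fin 2 → ℝ) (f : T2 → ℂ) (x : T2) : ℂ :=
  deriv (fun s : ℝ => f (x + proj (s • w))) 0

lemma SmoothC.hasDerivAt {f : T2 → ℂ} (hf : SmoothC f) (w : Fin 2 → ℝ) (x : T2) (s : ℝ) :
    HasDerivAt (fun s : ℝ => f (x + proj (s • w))) (dirDeriv w f (x + proj (s • w))) s := by
  obtain ⟨y, rfl⟩ := proj_surjective x
  have h : ∀ y s, HasDerivAt (fun s : ℝ => f (proj (y + s • w)))
      (fderiv ℝ (fun x => f (proj x)) (y + s • w) w) s := fun y s => by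
    have h1 : HasDerivAt (fun s : ℝ => y + s • w) w s := by
      simpa using ((hasDerivAt_id s).smul_const w).const_add y
    exact ((ContDiff.differentiable hf (by simp)) (y + s • w)).hasFDerivAt.comp_hasDerivAt s h1
  have h2 : dirDeriv w f (proj y + proj (s • w)) =
      fderiv ℝ (fun x => f (proj x)) (y + s • w) w := by
    have := (h (y + s • w) 0).deriv
    simpa only [dirDeriv, ← proj_add, zero_smul, add_zero] using this
  rw [h2]
  simpa only [proj_add] using h y s

lemma dirDeriv_proj {f : T2 → ℂ} (hf : SmoothC f) (w y : Fin 2 → ℝ) :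
    dirDeriv w f (proj y) = fderiv ℝ (fun x => f (proj x)) y w := by
  have h1 : HasDerivAt (fun s : ℝ => y + s • w) w 0 := by
    simpa using ((hasDerivAt_id (0 : ℝ)).smul_const w).const_add y
  have h2 : HasFDerivAt (fun x => f (proj x)) (fderiv ℝ (fun x => f (proj x)) y)
      (y + (0 : ℝ) • w) := by
    simpa using ((ContDiff.differentiable hf (by simp)) y).hasFDerivAt
  simp only [dirDeriv, ← proj_add]
  exact (h2.comp_hasDerivAt (0 : ℝ) h1).deriv

lemma SmoothC.dirDeriv {f : T2 → ℂ} (hf : SmoothC f) (w : Fin 2 → ℝ) :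
    SmoothC (dirDeriv w f) := by
  have : (fun y => TwoMicrolocal.dirDeriv w f (proj y)) =
      fun y => fderiv ℝ (fun x => f (proj x)) y w := funext fun y => dirDeriv_proj hf w y
  rw [SmoothC, this]
  exact (ContDiff.fderiv_right (m := ∞) hf (by simp)).clm_apply contDiff_const

lemma exists_bound_of_continuous {f : T2 → ℂ} (hf : Continuous f) : ∃ C, ∀ x, ‖f x‖ ≤ C := by
  obtain ⟨C, hC⟩ := isCompact_univ.exists_bound_of_continuousOn hf.continuousOn
  exact ⟨C, fun x => hC x trivial⟩

lemma mFourierCoeff_eq (f : T2 → ℂ) (p : Z2) :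
    UnitAddTorus.mFourierCoeff f p = ∫ t, UnitAddTorus.mFourier (-p) t * f t ∂torusMeasure := rfl

/-- Translation of f by s w multiplies the coefficient of index p by e^{2iπ s p·w}. Differentiating
at s = 0 under the integral replaces an integration by parts. -/
lemma mFourierCoeff_dirDeriv {f : T2 → ℂ} (hf : SmoothC f) (w : Fin 2 → ℝ) (p : Z2) :
    UnitAddTorus.mFourierCoeff (dirDeriv w f) p =
      2 * Real.pi * Complex.I * ((toR p ⬝ᵥ w : ℝ) : ℂ) * UnitAddTorus.mFourierCoeff f p := by
  obtain ⟨C, hC⟩ := exists_bound_of_continuous (hf.dirDeriv w).continuous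
  have hm : Continuous fun t : T2 => UnitAddTorus.mFourier (-p) t := ContinuousMap.continuous _
  have hcont : ∀ (g : T2 → ℂ) (s : ℝ), Continuous g → Continuous
      fun t => UnitAddTorus.mFourier (-p) t * g (t + proj (s • w)) := fun g s hg =>
    hm.mul (hg.comp (continuous_id.add continuous_const))
  have h1 : HasDerivAt (fun s : ℝ => ∫ t, UnitAddTorus.mFourier (-p) t * f (t + proj (s • w))
      ∂torusMeasure) (∫ t, UnitAddTorus.mFourier (-p) t * dirDeriv w f (t + proj ((0 : ℝ) • w))
      ∂torusMeasure) 0 := by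
    refine (hasDerivAt_integral_of_dominated_loc_of_deriv_le (s := Set.univ)
      (F' := fun s t => UnitAddTorus.mFourier (-p) t * dirDeriv w f (t + proj (s • w)))
      (bound := fun _ => C) univ_mem (.of_forall fun s => ?_) ?_ ?_ ?_
      (integrable_const _) ?_).2
    · exact (hcont f s hf.continuous).aestronglyMeasurable
    · exact (hcont f 0 hf.continuous).integrable_of_hasCompactSupport
        (HasCompactSupport.of_compactSpace _)
    · exact (hcont _ 0 (hf.dirDeriv w).continuous).aestronglyMeasurable
    · refine .of_forall fun t s _ => ?_
      rw [norm_mul, norm_mFourier_apply, one_mul]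
      exact hC _
    · exact .of_forall fun t s _ => (hf.hasDerivAt w t s).const_mul _
  have h2 : ∀ s : ℝ, ∫ t, UnitAddTorus.mFourier (-p) t * f (t + proj (s • w)) ∂torusMeasure =
      UnitAddTorus.mFourier p (proj (0 + s • w)) * UnitAddTorus.mFourierCoeff f p := fun s => by
    rw [mFourierCoeff_eq, ← integral_const_mul,
      ← integral_add_right_eq_self (fun t => UnitAddTorus.mFourier p (proj (0 + s • w)) *
        (UnitAddTorus.mFourier (-p) t * f t)) (proj (s • w))]
    refine integral_congr_ae (.of_forall fun t => ?_)
    simp only [mFourier_apply_add, zero_add]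
    have : UnitAddTorus.mFourier p (proj (s • w)) * UnitAddTorus.mFourier (-p) (proj (s • w)) = 1 := by
      rw [← UnitAddTorus.mFourier_add, add_neg_cancel, UnitAddTorus.mFourier_zero]; rfl
    linear_combination (-(UnitAddTorus.mFourier (-p) t * f (t + proj (s • w)))) * this
  simp only [h2] at h1
  have h3 := (hasDerivAt_mFourier_line p 0 w 0).mul_const (UnitAddTorus.mFourierCoeff f p)
  have h4 := h1.unique h3
  simp only [zero_smul, proj_zero, add_zero] at h4
  rw [mFourierCoeff_eq, h4]
  have : UnitAddTorus.mFourier p (0 : T2) = 1 := by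
    simp [UnitAddTorus.mFourier]
  rw [this, mul_one]

lemma norm_mFourierCoeff_le {f : T2 → ℂ} {C : ℝ} (hC : ∀ x, ‖f x‖ ≤ C) (p : Z2) :
    ‖UnitAddTorus.mFourierCoeff f p‖ ≤ C := by
  rw [mFourierCoeff_eq]
  refine (norm_integral_le_of_norm_le_const (C := C) (.of_forall fun t => ?_)).trans ?_
  · rw [norm_mul, norm_mFourier_apply, one_mul]
    exact hC t
  · simp

/-- The function is (1 - ∂_i²)f. -/
lemma exists_smooth_weighted (i : Fin 2) {f : T2 → ℂ} (hf : SmoothC f) :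
    ∃ g, SmoothC g ∧ ∀ p : Z2, UnitAddTorus.mFourierCoeff g p =
      ((1 + 4 * Real.pi ^ 2 * (p i : ℝ) ^ 2 : ℝ) : ℂ) * UnitAddTorus.mFourierCoeff f p := by
  set w : Fin 2 → ℝ := Pi.single i 1
  have h2 := (hf.dirDeriv w).dirDeriv w
  refine ⟨fun x => f x - dirDeriv w (dirDeriv w f) x, ContDiff.sub hf h2, fun p => ?_⟩
  have hint : ∀ g : T2 → ℂ, Continuous g →
      Integrable (fun t => UnitAddTorus.mFourier (-p) t * g t) torusMeasure := fun g hg =>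
    ((ContinuousMap.continuous _).mul hg).integrable_of_hasCompactSupport
      (HasCompactSupport.of_compactSpace _)
  have h3 : UnitAddTorus.mFourierCoeff (fun x => f x - dirDeriv w (dirDeriv w f) x) p =
      UnitAddTorus.mFourierCoeff f p - UnitAddTorus.mFourierCoeff (dirDeriv w (dirDeriv w f)) p := by
    simp only [mFourierCoeff_eq, mul_sub]
    exact integral_sub (hint _ hf.continuous) (hint _ h2.continuous)
  have hw : toR p ⬝ᵥ w = p i := by simp [w, toR]
  rw [h3, mFourierCoeff_dirDeriv (hf.dirDeriv w), mFourierCoeff_dirDeriv hf, hw]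
  push_cast
  linear_combination (-4 * (Real.pi : ℂ) ^ 2 * (p i : ℂ) ^ 2 *
    UnitAddTorus.mFourierCoeff f p) * Complex.I_sq

lemma summable_int_weight : Summable fun n : ℤ => (1 + (n : ℝ) ^ 2)⁻¹ := by
  have h1 : Summable fun n : ℤ => 1 / (n : ℝ) ^ 2 := Real.summable_one_div_int_pow.mpr one_lt_two
  have h2 : Summable fun n : ℤ => if n = 0 then (1 : ℝ) else 0 :=
    (hasSum_ite_eq (0 : ℤ) (1 : ℝ)).summable
  refine .of_nonneg_of_le (fun n => by positivity) (fun n => ?_) (h1.add h2)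
  by_cases hn : n = 0
  · simp [hn]
  · have : (0 : ℝ) < (n : ℝ) ^ 2 := by positivity
    simp only [hn, if_false, add_zero, one_div]
    exact inv_anti₀ this (by linarith)

lemma summable_lattice_weight :
    Summable fun p : Z2 => (1 + (p 0 : ℝ) ^ 2)⁻¹ * (1 + (p 1 : ℝ) ^ 2)⁻¹ := by
  have h := summable_int_weight.mul_of_nonneg summable_int_weight (fun n => by positivity)
    (fun n => by positivity)
  exact (finTwoArrowEquiv ℤ).summable_iff.mpr h

lemma norm_toR_sq_le (p : Z2) :
    (1 + ‖toR p‖) ^ 2 ≤ 2 * ((1 + (p 0 : ℝ) ^ 2) * (1 + (p 1 : ℝ) ^ 2)) := by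
  have h : ‖toR p‖ ^ 2 ≤ (p 0 : ℝ) ^ 2 + (p 1 : ℝ) ^ 2 := by
    obtain ⟨i, hi⟩ : ∃ i, ‖toR p‖ = ‖toR p i‖ := by
      obtain ⟨i, -, hi⟩ := Finset.exists_mem_eq_sup' Finset.univ_nonempty fun i => ‖toR p i‖₊
      refine ⟨i, ?_⟩
      rw [Pi.norm_def, ← Finset.sup'_eq_sup Finset.univ_nonempty, hi, coe_nnnorm]
    rw [hi, toR, Real.norm_eq_abs, sq_abs]
    fin_cases i <;> simp <;> positivity
  nlinarith [sq_nonneg (1 - ‖toR p‖), mul_nonneg (sq_nonneg (p 0 : ℝ)) (sq_nonneg (p 1 : ℝ))]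

/-- The function (1 - ∂_0²)²(1 - ∂_1²)²f is bounded, which gives decay by the square of the product
weight: one factor dominates (1 + ‖p‖)², the other is summable. The quadratic weight is what the
second-order Taylor remainder in the evolution of correlations consumes. -/
lemma SmoothC.summable_weighted {f : T2 → ℂ} (hf : SmoothC f) :
    Summable fun p : Z2 => (1 + ‖toR p‖) ^ 2 * ‖UnitAddTorus.mFourierCoeff f p‖ := by
  obtain ⟨g₁, hg₁, h₁⟩ := exists_smooth_weighted 0 hf
  obtain ⟨g₂, hg₂, h₂⟩ := exists_smooth_weighted 0 hg₁
  obtain ⟨g₃, hg₃, h₃⟩ := exists_smooth_weighted 1 hg₂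
  obtain ⟨g₄, hg₄, h₄⟩ := exists_smooth_weighted 1 hg₃
  obtain ⟨C, hC⟩ := exists_bound_of_continuous hg₄.continuous
  refine .of_nonneg_of_le (fun p => by positivity) (fun p => ?_)
    (summable_lattice_weight.mul_left (2 * C))
  have h := norm_mFourierCoeff_le hC p
  rw [h₄, h₃, h₂, h₁] at h
  simp only [norm_mul, Complex.norm_real, Real.norm_eq_abs] at h
  rw [abs_of_pos (by positivity), abs_of_pos (by positivity)] at h
  set c := ‖UnitAddTorus.mFourierCoeff f p‖ with hc
  have hc0 : 0 ≤ c := norm_nonneg _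
  have hpi : 1 ≤ 4 * Real.pi ^ 2 := by nlinarith [Real.pi_gt_three]
  have hw : ∀ i, 1 + (p i : ℝ) ^ 2 ≤ 1 + 4 * Real.pi ^ 2 * (p i : ℝ) ^ 2 := fun i => by
    nlinarith [sq_nonneg (p i : ℝ)]
  set a := 1 + (p 0 : ℝ) ^ 2 with ha
  set b := 1 + (p 1 : ℝ) ^ 2 with hb
  have ha0 : 0 < a := by positivity
  have hb0 : 0 < b := by positivity
  have h5 : b * (b * (a * (a * c))) ≤ C := by
    refine le_trans ?_ h
    gcongr <;> exact hw _
  have h6 : (1 + ‖toR p‖) ^ 2 * c ≤ 2 * (a * b) * c := by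
    gcongr; exact norm_toR_sq_le p
  refine h6.trans ?_
  rw [mul_assoc 2 C]
  have h7 : a * b * c ≤ C * (a⁻¹ * b⁻¹) := by
    rw [← mul_inv, ← div_eq_mul_inv, le_div_iff₀ (by positivity)]
    linarith
  linarith

lemma SmoothC.summable {f : T2 → ℂ} (hf : SmoothC f) :
    Summable (UnitAddTorus.mFourierCoeff f) := by
  refine .of_norm (.of_nonneg_of_le (fun _ => norm_nonneg _) (fun p => ?_) hf.summable_weighted)
  refine le_mul_of_one_le_left (norm_nonneg _) (one_le_pow₀ ?_)
  linarith [norm_nonneg (toR p)]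

end

/-! ### The Schrödinger equation read on Fourier coefficients and on correlations. -/

section

/-! ### Multiplication operators -/

lemma SmoothOnTorus.smoothC {V : T2 → ℝ} (hV : SmoothOnTorus V) : SmoothC fun x => (V x : ℂ) :=
  Complex.ofRealCLM.contDiff.comp hV

/-- The Fourier coefficients of the potential. -/
def vhat (V : T2 → ℝ) (j : Z2) : ℂ := UnitAddTorus.mFourierCoeff (fun x => (V x : ℂ)) j

lemma conj_vhat (V : T2 → ℝ) (j : Z2) : conj (vhat V j) = vhat V (-j) := by
  rw [vhat, vhat, mFourierCoeff_eq, mFourierCoeff_eq, ← integral_conj]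
  refine integral_congr_ae (.of_forall fun t => ?_)
  simp only [map_mul, Complex.conj_ofReal, ← UnitAddTorus.mFourier_neg]

/-- Multiplication by a continuous function, as an operator on `L²`. -/
def mulOp : C(T2, ℂ) →L[ℂ] L2T →L[ℂ] L2T :=
  ((ContinuousLinearMap.mul ℂ ℂ).holderL torusMeasure ⊤ 2 2) ∘L
    (ContinuousMap.toLp ⊤ torusMeasure ℂ)

lemma coeFn_mulOp (f : C(T2, ℂ)) (u : L2T) :
    mulOp f u =ᵐ[torusMeasure] fun x => f x * u x := by
  have h1 := (ContinuousLinearMap.mul ℂ ℂ).coeFn_holder (r := 2)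
    (ContinuousMap.toLp ⊤ torusMeasure ℂ f) u
  have h2 := ContinuousMap.coeFn_toLp (p := ⊤) (𝕜 := ℂ) torusMeasure f
  have h3 : mulOp f u = (ContinuousLinearMap.mul ℂ ℂ).holder 2
    (ContinuousMap.toLp ⊤ torusMeasure ℂ f) u := rfl
  rw [h3]
  filter_upwards [h1, h2] with x hx1 hx2
  rw [hx1, hx2]
  rfl

lemma coef_mulOp (f : C(T2, ℂ)) (u : L2T) (k : Z2) :
    coef (mulOp f u) k = UnitAddTorus.mFourierCoeff (fun x => f x * u x) k := by
  rw [coef, mFourierCoeff_eq, mFourierCoeff_eq]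
  refine integral_congr_ae ?_
  filter_upwards [coeFn_mulOp f u] with x hx
  rw [hx]

lemma coef_mulOp_mFourier (j : Z2) (u : L2T) (k : Z2) :
    coef (mulOp (UnitAddTorus.mFourier j) u) k = coef u (k - j) := by
  rw [coef_mulOp, coef, mFourierCoeff_eq, mFourierCoeff_eq]
  refine integral_congr_ae (.of_forall fun t => ?_)
  simp only
  rw [neg_sub, sub_eq_neg_add, UnitAddTorus.mFourier_add, mul_assoc]

/-- The potential as a continuous complex function. -/
def potC (V : T2 → ℝ) (hV : SmoothOnTorus V) : C(T2, ℂ) := ⟨fun x => (V x : ℂ), hV.smoothC.continuous⟩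

lemma isSelfAdjoint_mulOp (V : T2 → ℝ) (hV : SmoothOnTorus V) :
    IsSelfAdjoint (mulOp (potC V hV)) := by
  rw [ContinuousLinearMap.isSelfAdjoint_iff_isSymmetric]
  intro x y
  change inner ℂ (mulOp (potC V hV) x) y = inner ℂ x (mulOp (potC V hV) y)
  rw [L2.inner_def, L2.inner_def]
  refine integral_congr_ae ?_
  filter_upwards [coeFn_mulOp (potC V hV) x, coeFn_mulOp (potC V hV) y] with t h1 h2
  rw [h1, h2]
  simp only [RCLike.inner_apply, map_mul, potC, ContinuousMap.coe_mk, Complex.conj_ofReal]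
  ring

/-- The Fourier series of V converges uniformly, each exponential acts by a shift of the
coefficients, and a coefficient of f u depends continuously on f in the uniform norm. -/
lemma hasSum_coef_mulOp (V : T2 → ℝ) (hV : SmoothOnTorus V) (u : L2T) (k : Z2) :
    HasSum (fun j => vhat V j * coef u (k - j)) (coef (mulOp (potC V hV) u) k) := by
  have h1 : HasSum (fun j => vhat V j • UnitAddTorus.mFourier j) (potC V hV) :=
    UnitAddTorus.hasSum_mFourier_series_of_summable (f := potC V hV) hV.smoothC.summable
  let Φ : C(T2, ℂ) →L[ℂ] ℂ :=
    (innerSL ℂ (expBasis k)) ∘L ((ContinuousLinearMap.apply ℂ L2T u) ∘L mulOp)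
  have hΦ : ∀ f, Φ f = coef (mulOp f u) k := fun f => inner_expBasis _ _
  have h2 := h1.mapL Φ
  rw [hΦ] at h2
  refine h2.congr_fun fun j => ?_
  rw [map_smul, hΦ, coef_mulOp_mFourier, smul_eq_mul]

/-! ### Conservation laws for the Schrödinger equation -/

/-- The eigenvalues of `- ħ² Δ / 2`. -/
def freeEig (ħ : ℝ) (k : Z2) : ℝ := ħ ^ 2 / 2 * (4 * Real.pi ^ 2 * normSq k)

lemma normSq_nonneg (k : Z2) : 0 ≤ normSq k := by
  simp only [normSq, dotProduct, Fin.sum_univ_two]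
  nlinarith [mul_self_nonneg (toR k 0), mul_self_nonneg (toR k 1)]

lemma freeEig_nonneg (ħ : ℝ) (k : Z2) : 0 ≤ freeEig ħ k := by
  have := normSq_nonneg k
  unfold freeEig
  positivity

section Schrodinger

variable {V : T2 → ℝ} (hV : SmoothOnTorus V) {ħ ε : ℝ} {u : L2T} {v : ℝ → L2T}
  (hv : IsSchrodingerSolution V ħ ε u v)

include hv

lemma IsSchrodingerSolution.hasDerivAt_coef (k : Z2) (t : ℝ) :
    HasDerivAt (fun s => coef (v s) k)
      (-(Complex.I / (ħ : ℂ)) * (freeEig ħ k * coef (v t) k +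
        ((ε ^ 2 : ℝ) : ℂ) * coef (mulOp (potC V hV) (v t)) k)) t := by
  rw [coef_mulOp]
  exact hv.2.2 k t

lemma IsSchrodingerSolution.hasDerivAt_repr (k : Z2) (t : ℝ) :
    HasDerivAt (fun s => expBasis.repr (v s) k)
      (-(Complex.I / (ħ : ℂ)) * (freeEig ħ k * expBasis.repr (v t) k +
        expBasis.repr ((((ε ^ 2 : ℝ) : ℂ) • mulOp (potC V hV)) (v t)) k)) t := by
  have h := hv.hasDerivAt_coef hV k t
  simp only [expBasis_repr, _root_.smul_apply, map_smul, lp.coeFn_smul, Pi.smul_apply,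
    smul_eq_mul]
  exact h

omit hv in
lemma isSelfAdjoint_smul_mulOp (ε : ℝ) :
    IsSelfAdjoint ((((ε ^ 2 : ℝ) : ℂ) • mulOp (potC V hV))) :=
  IsSelfAdjoint.smul (by simp [IsSelfAdjoint]) (isSelfAdjoint_mulOp V hV)

include hV in
lemma IsSchrodingerSolution.norm_eq (t : ℝ) : ‖v t‖ = ‖u‖ := by
  rw [norm_conserved expBasis (freeEig ħ) (freeEig_nonneg ħ) _ (isSelfAdjoint_smul_mulOp hV ε) ħ v
    hv.1 (hv.hasDerivAt_repr hV) t, hv.2.1]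

lemma IsSchrodingerSolution.lowMass_le {δ : ℝ} (hδ : 0 < δ)
    (hε : ε ^ 2 * ‖mulOp (potC V hV)‖ ≤ δ / 2) (t : ℝ) :
    lowMass expBasis (freeEig ħ) δ (v t) ≤ lowMass expBasis (freeEig ħ) δ u +
      4 * (ε ^ 2 * ‖mulOp (potC V hV)‖) / δ * ‖u‖ := by
  have hn : ‖(((ε ^ 2 : ℝ) : ℂ) • mulOp (potC V hV))‖ = ε ^ 2 * ‖mulOp (potC V hV)‖ := by
    rw [norm_smul, Complex.norm_real, Real.norm_of_nonneg (sq_nonneg _)]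
  have h := lowMass_almost_conserved expBasis (freeEig ħ) (freeEig_nonneg ħ) _
    (isSelfAdjoint_smul_mulOp hV ε) hδ (by rw [hn]; exact hε) ħ v hv.1 (hv.hasDerivAt_repr hV) t
  rw [hn, hv.norm_eq hV, hv.2.1] at h
  have h1 := (abs_le.mp h).2
  have h2 : 2 * (ε ^ 2 * ‖mulOp (potC V hV)‖) / δ * (‖u‖ + ‖u‖) =
    4 * (ε ^ 2 * ‖mulOp (potC V hV)‖) / δ * ‖u‖ := by ring
  linarith

end Schrodinger

/-! ### Sampled symbols -/

/-- The sampling point of index `m`. -/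
def samplePt (e : Z2) (ħ ε : ℝ) (m : Z2) : Cot :=
  ((Real.pi * ħ) • toR m, HLam e ((Real.pi * ħ) • toR m) / ε)

lemma sample_eq (e : Z2) (ħ ε : ℝ) (c : Cot → ℂ) (m : Z2) :
    sample e ħ ε c m = c (samplePt e ħ ε m) := rfl

lemma toR_add (k l : Z2) : toR (k + l) = toR k + toR l := by ext i; simp [toR]

lemma HLam_add (e : Z2) (x y : Fin 2 → ℝ) : HLam e (x + y) = HLam e x + HLam e y := by
  simp [HLam, add_dotProduct]

lemma HLam_smul (e : Z2) (r : ℝ) (x : Fin 2 → ℝ) : HLam e (r • x) = r * HLam e x := by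
  simp [HLam, smul_dotProduct]

lemma samplePt_add (e : Z2) (ħ ε : ℝ) (k l : Z2) :
    samplePt e ħ ε (k + l) = samplePt e ħ ε k + samplePt e ħ ε l := by
  simp only [samplePt, toR_add, smul_add, HLam_add, Prod.mk_add_mk, add_div]

lemma samplePt_sub (e : Z2) (ħ ε : ℝ) (k l : Z2) :
    samplePt e ħ ε (k - l) = samplePt e ħ ε k - samplePt e ħ ε l := by
  rw [eq_sub_iff_add_eq, ← samplePt_add, sub_add_cancel]

lemma norm_unitDir_le (e : Z2) : ‖unitDir e‖ ≤ 1 := by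
  have h0 : 0 ≤ len e := Real.sqrt_nonneg _
  rw [pi_norm_le_iff_of_nonneg zero_le_one]
  intro i
  rw [unitDir, Pi.smul_apply, smul_eq_mul, norm_mul, Real.norm_eq_abs, Real.norm_eq_abs,
    abs_of_nonneg (inv_nonneg.mpr h0)]
  have h1 : |toR e i| ≤ len e := by
    rw [len]
    refine Real.abs_le_sqrt ?_
    simp only [normSq, dotProduct, Fin.sum_univ_two]
    fin_cases i <;> simp <;> nlinarith [sq_nonneg (toR e 0), sq_nonneg (toR e 1)]
  rw [inv_mul_eq_div]
  exact div_le_one_of_le₀ h1 h0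

lemma abs_HLam_le (e : Z2) (x : Fin 2 → ℝ) : |HLam e x| ≤ 2 * ‖x‖ := by
  have h := (pi_norm_le_iff_of_nonneg zero_le_one).mp (norm_unitDir_le e)
  simp only [HLam, dotProduct, Fin.sum_univ_two]
  have h1 : ∀ i, |x i * unitDir e i| ≤ ‖x‖ := fun i => by
    rw [abs_mul]
    calc |x i| * |unitDir e i| ≤ ‖x‖ * 1 :=
          mul_le_mul (norm_le_pi_norm x i) (h i) (abs_nonneg _) (norm_nonneg _)
      _ = _ := mul_one _
  linarith [abs_add_le (x 0 * unitDir e 0) (x 1 * unitDir e 1), h1 0, h1 1]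

/-- The component η = H_Λ(ξ)/ε dominates: ξ moves by O(ħ) and η by O(ħ/ε), with ε ≤ 1. -/
lemma norm_samplePt_le (e : Z2) {ħ ε : ℝ} (hħ : 0 < ħ) (hε : 0 < ε) (hε1 : ε ≤ 1) (m : Z2) :
    ‖samplePt e ħ ε m‖ ≤ 2 * Real.pi * (ħ / ε) * ‖toR m‖ := by
  have hp := Real.pi_pos
  have h0 : ‖(Real.pi * ħ) • toR m‖ = Real.pi * ħ * ‖toR m‖ := by
    rw [norm_smul, Real.norm_of_nonneg (by positivity)]
  rw [samplePt, Prod.norm_def, max_le_iff]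
  constructor
  · rw [h0]
    have : ħ ≤ ħ / ε := by rw [le_div_iff₀ hε]; nlinarith
    nlinarith [mul_le_mul_of_nonneg_right this (norm_nonneg (toR m)),
      mul_nonneg hħ.le (norm_nonneg (toR m)),
      mul_nonneg hp.le (mul_nonneg (sub_nonneg.mpr this) (norm_nonneg (toR m))),
      mul_nonneg hp.le (mul_nonneg hħ.le (norm_nonneg (toR m)))]
  · rw [norm_div, Real.norm_eq_abs, Real.norm_of_nonneg hε.le, div_le_iff₀ hε]
    refine (abs_HLam_le e _).trans (le_of_eq ?_)
    rw [h0]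
    field_simp

/-- For fixed ħ > 0 compact support in ξ bounds the frequency. Correlations with compactly supported
weights are thus finite sums, which can be differentiated term by term. -/
lemma finite_sample_support (e : Z2) {ħ ε : ℝ} (hħ : 0 < ħ) {c : Cot → ℂ}
    (hc : HasCompactSupport c) (p : Z2) :
    {k : Z2 | sample e ħ ε c (k + k + p) ≠ 0}.Finite := by
  obtain ⟨R, hR⟩ := hc.isBounded.exists_norm_le
  have hp := Real.pi_pos
  have hsub : {k : Z2 | sample e ħ ε c (k + k + p) ≠ 0} ⊆
      (fun k : Z2 => fun i => k i) ⁻¹' (Set.univ.pi fun i => Set.Icc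
        (-(⌈R / (Real.pi * ħ)⌉ + |p i|)) (⌈R / (Real.pi * ħ)⌉ + |p i|)) := by
    intro k hk
    have h1 : ‖samplePt e ħ ε (k + k + p)‖ ≤ R := hR _ (subset_closure hk)
    have h2 : ‖(Real.pi * ħ) • toR (k + k + p)‖ ≤ R := (le_max_left _ _).trans h1
    intro i _
    have h3 : |(Real.pi * ħ) * ((k i + k i + p i : ℤ) : ℝ)| ≤ R := by
      have := (norm_le_pi_norm ((Real.pi * ħ) • toR (k + k + p)) i).trans h2
      simpa [toR] using this
    rw [abs_mul, abs_of_pos (by positivity : 0 < Real.pi * ħ), mul_comm,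
      ← le_div_iff₀ (by positivity)] at h3
    have h4 : |k i + k i + p i| ≤ ⌈R / (Real.pi * ħ)⌉ := by
      have := h3.trans (Int.le_ceil _)
      exact_mod_cast this
    have h5 := abs_le.mp h4
    have h6 := neg_abs_le (p i)
    have h7 := le_abs_self (p i)
    have h8 : 0 ≤ ⌈R / (Real.pi * ħ)⌉ := (abs_nonneg _).trans h4
    constructor <;> simp only <;> linarith [h5.1, h5.2]
  exact (Set.Finite.pi fun i => Set.finite_Icc _ _).subset hsub

/-! ### Time derivatives of correlations -/

/-- The kinetic part is exact, because |k + p|² - |k|² = p·(2k + p) is linear in the midpoint: this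
is the benefit of the Weyl quantization. The potential acts by convolution on either factor of the
correlation; after reindexing, both contributions are correlations of index p + j, with weights
shifted by -j and by +j. -/
lemma hasDerivAt_corr {V : T2 → ℝ} (hV : SmoothOnTorus V) {ħ ε : ℝ} (hħ : 0 < ħ) {u : L2T}
    {v : ℝ → L2T} (hv : IsSchrodingerSolution V ħ ε u v) (p : Z2) {f : Z2 → ℂ} {B : ℝ}
    (hB : ∀ m, ‖f m‖ ≤ B) (hf : {k : Z2 | f (k + k + p) ≠ 0}.Finite) (t : ℝ) :
    HasDerivAt (fun s => corr (coef (v s)) p f)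
      (corr (coef (v t)) p
        (fun m => 2 * Real.pi * Complex.I * ((toR p ⬝ᵥ ((Real.pi * ħ) • toR m) : ℝ) : ℂ) * f m) +
        Complex.I * ((ε ^ 2 / ħ : ℝ) : ℂ) *
          ∑' j, vhat V j * corr (coef (v t)) (p + j) fun m => f (m - j) - f (m + j)) t := by
  set x := coef (v t) with hx
  set y := coef (mulOp (potC V hV) (v t)) with hy
  have hx2 : Summable fun k => ‖x k‖ ^ 2 := summable_sq_coef _
  set S := hf.toFinset with hS
  have hfS : ∀ k ∉ S, f (k + k + p) = 0 := fun k hk => by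
    simpa [hS] using hk
  have hsum : ∀ (z : Z2 → ℂ) (g : Z2 → ℂ), corr z p (fun m => g m * f m) =
      ∑ k ∈ S, conj (z (k + p)) * z k * (g (k + k + p) * f (k + k + p)) := fun z g =>
    tsum_eq_sum fun k hk => by simp only [hfS k hk, mul_zero]
  have hsum1 : ∀ z : Z2 → ℂ, corr z p f = ∑ k ∈ S, conj (z (k + p)) * z k * f (k + k + p) :=
    fun z => tsum_eq_sum fun k hk => by rw [hfS k hk]; ring
  simp only [hsum1]
  have hd := HasDerivAt.fun_sum (u := S) (x := t) fun k _ =>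
    (((hv.hasDerivAt_coef hV (k + p) t).star).mul (hv.hasDerivAt_coef hV k t)).mul_const
      (f (k + k + p))
  refine hd.congr_deriv ?_
  have hħ0 : (ħ : ℂ) ≠ 0 := by exact_mod_cast hħ.ne'
  -- the potential part
  have hpot : ∑' j, vhat V j * corr x (p + j) (fun m => f (m - j) - f (m + j)) =
      ∑ k ∈ S, (conj (y (k + p)) * x k - conj (x (k + p)) * y k) * f (k + k + p) := by
    have hc1 : ∀ j, corr x (p + j) (fun m => f (m - j)) =
        ∑ k ∈ S, conj (x (k + (p + j))) * x k * f (k + k + p) := fun j => by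
      have e1 : ∀ k, k + k + (p + j) - j = k + k + p := fun k => by abel
      simp only [corr, e1]
      exact tsum_eq_sum fun k hk => by rw [hfS k hk]; ring
    have hc2 : ∀ j, corr x (p + j) (fun m => f (m + j)) =
        ∑ k ∈ S, conj (x (k + p)) * x (k - j) * f (k + k + p) := fun j => by
      have e1 : ∀ k, k - j + (k - j) + (p + j) + j = k + k + p := fun k => by abel
      have e2 : ∀ k, k - j + (p + j) = k + p := fun k => by abel
      rw [corr, ← (Equiv.subRight j).tsum_eq]
      simp only [Equiv.subRight_apply, e1, e2]
      exact tsum_eq_sum fun k hk => by rw [hfS k hk]; ring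
    have hb1 : ∀ j m, ‖(fun m => f (m - j)) m‖ ≤ B := fun j m => hB _
    have hb2 : ∀ j m, ‖(fun m => f (m + j)) m‖ ≤ B := fun j m => hB _
    have hy1 : ∀ k, HasSum (fun j => vhat V j * x (k - j)) (y k) := fun k =>
      hasSum_coef_mulOp V hV (v t) k
    -- V is real, so conjugation exchanges the coefficients of index j and -j.
    have hy2 : ∀ k, HasSum (fun j => vhat V j * conj (x (k + j))) (conj (y k)) := fun k => by
      have h2 := (Equiv.neg Z2).hasSum_iff.mpr (hy1 k).star
      refine h2.congr_fun fun j => ?_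
      simp [conj_vhat]
    have h3 : HasSum (fun j => ∑ k ∈ S, ((vhat V j * conj (x (k + p + j))) * x k -
        conj (x (k + p)) * (vhat V j * x (k - j))) * f (k + k + p))
        (∑ k ∈ S, (conj (y (k + p)) * x k - conj (x (k + p)) * y k) * f (k + k + p)) :=
      hasSum_sum fun k _ => (((hy2 (k + p)).mul_right (x k)).sub
        ((hy1 k).mul_left (conj (x (k + p))))).mul_right _
    rw [← h3.tsum_eq]
    refine tsum_congr fun j => ?_
    rw [corr_sub hx2 (p + j) (hb1 j) (hb2 j), hc1, hc2, ← Finset.sum_sub_distrib, Finset.mul_sum]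
    refine Finset.sum_congr rfl fun k _ => ?_
    rw [← add_assoc]
    ring
  rw [hpot, hsum, Finset.mul_sum, ← Finset.sum_add_distrib]
  refine Finset.sum_congr rfl fun k _ => ?_
  have hlam : (freeEig ħ (k + p) : ℂ) = freeEig ħ k +
      2 * Real.pi * ħ * ((toR p ⬝ᵥ ((Real.pi * ħ) • toR (k + k + p)) : ℝ) : ℂ) := by
    rw [freeEig, freeEig, normSq, normSq]
    simp only [toR_add, dotProduct, Fin.sum_univ_two, Pi.add_apply, Pi.smul_apply, smul_eq_mul]
    push_cast
    ring
  simp only [star_mul', star_add, star_neg, Complex.star_def, map_div₀, Complex.conj_I,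
    Complex.conj_ofReal, ← hx, ← hy]
  rw [hlam]
  push_cast
  field_simp
  ring

end

/-! ### First-order expansion of the evolution of correlations. -/

section

/-! ### Increments of correlations along the Schrödinger flow -/

/-- The derivative of a symbol in `η`. -/
def dEta (c : Cot → ℂ) (w : Cot) : ℂ := fderiv ℝ c w (0, 1)

/-- The symbol `2iπ (p·ξ) c`. -/
def mulXi (p : Z2) (c : Cot → ℂ) (w : Cot) : ℂ :=
  2 * Real.pi * Complex.I * ((toR p ⬝ᵥ w.1 : ℝ) : ℂ) * c w

lemma contDiff_dEta {c : Cot → ℂ} (hc : ContDiff ℝ ∞ c) : ContDiff ℝ ∞ (dEta c) :=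
  (hc.fderiv_right (m := ∞) (by simp)).clm_apply contDiff_const

lemma hasCompactSupport_dEta {c : Cot → ℂ} (hs : HasCompactSupport c) :
    HasCompactSupport (dEta c) :=
  (hs.fderiv (𝕜 := ℝ)).mono' (fun w hw => subset_closure fun h => hw (by
    simp only [dEta] at *
    rw [h]; rfl))

lemma contDiff_toR_dot (p : Z2) : ContDiff ℝ ∞ fun w : Cot => (toR p ⬝ᵥ w.1 : ℝ) := by
  simp only [dotProduct, Fin.sum_univ_two]
  fun_prop

lemma contDiff_mulXi (p : Z2) {c : Cot → ℂ} (hc : ContDiff ℝ ∞ c) :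
    ContDiff ℝ ∞ (mulXi p c) :=
  (contDiff_const.mul (Complex.ofRealCLM.contDiff.comp (contDiff_toR_dot p))).mul hc

lemma hasCompactSupport_mulXi (p : Z2) {c : Cot → ℂ} (hs : HasCompactSupport c) :
    HasCompactSupport (mulXi p c) := hs.mul_left

lemma exists_bound_of_compactSupport {X : Type*} [TopologicalSpace X] {F : Type*}
    [NormedAddCommGroup F] {c : X → F} (hc : Continuous c)
    (hs : HasCompactSupport c) : ∃ B, 0 ≤ B ∧ ∀ w, ‖c w‖ ≤ B := by
  obtain ⟨B, hB⟩ := hs.exists_bound_of_continuous hc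
  exact ⟨max B 0, le_max_right _ _, fun w => (hB w).trans (le_max_left _ _)⟩

/-- Two first-order expansions at z, in the directions h and -h, with remainders controlled by the
Lipschitz constant of the derivative. -/
lemma exists_taylor_bound {c : Cot → ℂ} (hc : ContDiff ℝ ∞ c) (hs : HasCompactSupport c) :
    ∃ C, 0 ≤ C ∧ ∀ z h : Cot, ‖c (z - h) - c (z + h) + 2 * fderiv ℝ c z h‖ ≤ C * ‖h‖ ^ 2 := by
  obtain ⟨K, hK⟩ := ContDiff.lipschitzWith_of_hasCompactSupport (hs.fderiv (𝕜 := ℝ))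
    (hc.fderiv_right (m := 1) (by norm_cast)) one_ne_zero
  have key : ∀ z h : Cot, ‖c (z + h) - c z - fderiv ℝ c z h‖ ≤ K * ‖h‖ * ‖h‖ := fun z h => by
    have hh := Convex.norm_image_sub_le_of_norm_fderiv_le' (𝕜 := ℝ) (f := c) (φ := fderiv ℝ c z)
      (C := K * ‖h‖) (s := Metric.closedBall z ‖h‖) (x := z) (y := z + h)
      (fun x _ => (hc.differentiable (by simp)) x) (fun x hx => by
        refine (hK.norm_sub_le x z).trans ?_
        gcongr
        rwa [← dist_eq_norm]) (convex_closedBall z ‖h‖)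
      (Metric.mem_closedBall_self (norm_nonneg _)) (by simp [dist_eq_norm])
    simpa using hh
  refine ⟨2 * K, by positivity, fun z h => ?_⟩
  have h1 := key z h
  have h2 := key z (-h)
  rw [norm_neg, map_neg, ← sub_eq_add_neg] at h2
  have : c (z - h) - c (z + h) + 2 * fderiv ℝ c z h =
      (c (z - h) - c z - -(fderiv ℝ c z) h) - (c (z + h) - c z - fderiv ℝ c z h) := by ring
  rw [this]
  refine (norm_sub_le _ _).trans ?_
  linarith

/-- The leading part of the time derivative of a correlation. -/
def corrField (e : Z2) (V : T2 → ℝ) (ħ ε : ℝ) (p : Z2) (c : Cot → ℂ) (x : Z2 → ℂ) : ℂ :=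
  corr x p (sample e ħ ε (mulXi p c)) - (ε : ℂ) *
    ∑' j, vhat V j * (2 * Real.pi * Complex.I * ((toR j ⬝ᵥ unitDir e : ℝ) : ℂ)) *
      corr x (p + j) (sample e ħ ε (dEta c))

lemma abs_dot_unitDir_le (e j : Z2) : |toR j ⬝ᵥ unitDir e| ≤ 2 * ‖toR j‖ := abs_HLam_le e (toR j)

lemma norm_vhat_mul_le (e : Z2) (V : T2 → ℝ) (j : Z2) {z : ℂ} {B : ℝ} (hz : ‖z‖ ≤ B) :
    ‖vhat V j * (2 * Real.pi * Complex.I * ((toR j ⬝ᵥ unitDir e : ℝ) : ℂ)) * z‖ ≤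
      (4 * Real.pi * B) * ((1 + ‖toR j‖) ^ 2 * ‖vhat V j‖) := by
  have hB : 0 ≤ B := (norm_nonneg _).trans hz
  have hp := Real.pi_pos
  have h1 := abs_dot_unitDir_le e j
  have h2 : ‖toR j‖ ≤ (1 + ‖toR j‖) ^ 2 := by nlinarith [norm_nonneg (toR j)]
  rw [norm_mul, norm_mul, norm_mul, norm_mul, norm_mul, Complex.norm_real, Complex.norm_real,
    Complex.norm_I, Complex.norm_ofNat, Real.norm_of_nonneg hp.le, Real.norm_eq_abs]
  calc _ ≤ ‖vhat V j‖ * (2 * Real.pi * 1 * (2 * (1 + ‖toR j‖) ^ 2)) * B := by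
        gcongr; linarith
    _ = _ := by ring

/-- A frequency j of V displaces the sampling point by h = (πħ j, πħ(j·e/L)/ε). In -2(ε²/ħ) Dc·h the
η-component gives the term of size ε retained in `corrField`, and the ξ-component has size ε². The
Taylor remainder has size (ε²/ħ)(ħ/ε)² = ħ. -/
lemma norm_derivative_sub_corrField_le (e : Z2) {V : T2 → ℝ} (hV : SmoothOnTorus V) (p : Z2)
    {c : Cot → ℂ} (hc : ContDiff ℝ ∞ c) (hs : HasCompactSupport c) :
    ∃ C, 0 ≤ C ∧ ∀ (ħ ε : ℝ), 0 < ħ → 0 < ε → ε ≤ 1 → ∀ x : Z2 → ℂ,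
      (Summable fun k => ‖x k‖ ^ 2) → ∑' k, ‖x k‖ ^ 2 = 1 →
      ‖(corr x p (fun m => 2 * Real.pi * Complex.I *
          ((toR p ⬝ᵥ ((Real.pi * ħ) • toR m) : ℝ) : ℂ) * sample e ħ ε c m) +
        Complex.I * ((ε ^ 2 / ħ : ℝ) : ℂ) * ∑' j, vhat V j * corr x (p + j)
          fun m => sample e ħ ε c (m - j) - sample e ħ ε c (m + j)) -
        corrField e V ħ ε p c x‖ ≤ C * (ε ^ 2 + ħ) := by
  obtain ⟨C₂, hC₂0, hC₂⟩ := exists_taylor_bound hc hs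
  obtain ⟨B, hB0, hB⟩ := exists_bound_of_compactSupport hc.continuous hs
  obtain ⟨B₁, hB₁0, hB₁⟩ := exists_bound_of_compactSupport
    (hc.continuous_fderiv (by simp)) (hs.fderiv (𝕜 := ℝ))
  obtain ⟨B₂, hB₂0, hB₂⟩ := exists_bound_of_compactSupport (contDiff_dEta hc).continuous
    (hasCompactSupport_dEta hs)
  have hw := hV.smoothC.summable_weighted
  set σw := ∑' j, (1 + ‖toR j‖) ^ 2 * ‖vhat V j‖ with hσ
  have hσ0 : 0 ≤ σw := tsum_nonneg fun j => by positivity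
  have hp := Real.pi_pos
  -- The first term comes from the Taylor remainder, through ‖h‖ ≤ 2π(ħ/ε)‖j‖; the second comes from
  -- the ξ-component of the differential.
  set A := 4 * Real.pi ^ 2 * C₂ + 2 * Real.pi * B₁ with hA
  have hA0 : 0 ≤ A := by positivity
  refine ⟨A * σw, by positivity, fun ħ ε hħ hε hε1 x hx hx1 => ?_⟩
  have hħ0 : (ħ : ℂ) ≠ 0 := by exact_mod_cast hħ.ne'
  have hε0 : (ε : ℂ) ≠ 0 := by exact_mod_cast hε.ne'
  have hterm : ∀ j m, ‖Complex.I * ((ε ^ 2 / ħ : ℝ) : ℂ) *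
      (sample e ħ ε c (m - j) - sample e ħ ε c (m + j)) + (ε : ℂ) *
      (2 * Real.pi * Complex.I * ((toR j ⬝ᵥ unitDir e : ℝ) : ℂ)) * sample e ħ ε (dEta c) m‖ ≤
      A * (ε ^ 2 + ħ) * (1 + ‖toR j‖) ^ 2 := fun j m => by
    set z := samplePt e ħ ε m
    set h := samplePt e ħ ε j with hh
    have h1 := hC₂ z h
    have hsplit : fderiv ℝ c z h = fderiv ℝ c z ((Real.pi * ħ) • toR j, 0) +
        ((Real.pi * ħ / ε * (toR j ⬝ᵥ unitDir e) : ℝ) : ℂ) * dEta c z := by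
      have e1 : h = ((Real.pi * ħ) • toR j, (0 : ℝ)) +
          (Real.pi * ħ / ε * (toR j ⬝ᵥ unitDir e)) • ((0 : Fin 2 → ℝ), (1 : ℝ)) := by
        rw [hh, samplePt, HLam_smul, HLam]
        ext <;> simp; ring
      conv_lhs => rw [e1]
      rw [map_add, map_smul, Complex.real_smul, dEta]
    have h2 : Complex.I * ((ε ^ 2 / ħ : ℝ) : ℂ) *
        (sample e ħ ε c (m - j) - sample e ħ ε c (m + j)) + (ε : ℂ) *
        (2 * Real.pi * Complex.I * ((toR j ⬝ᵥ unitDir e : ℝ) : ℂ)) * sample e ħ ε (dEta c) m =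
        Complex.I * ((ε ^ 2 / ħ : ℝ) : ℂ) * (c (z - h) - c (z + h) + 2 * fderiv ℝ c z h) -
        2 * Complex.I * ((ε ^ 2 / ħ : ℝ) : ℂ) * fderiv ℝ c z ((Real.pi * ħ) • toR j, 0) := by
      rw [hsplit, sample_eq, sample_eq, sample_eq, samplePt_sub, samplePt_add]
      push_cast
      field_simp
      ring
    have h3 : ‖fderiv ℝ c z ((Real.pi * ħ) • toR j, 0)‖ ≤ B₁ * (Real.pi * ħ * ‖toR j‖) := by
      refine ((fderiv ℝ c z).le_of_opNorm_le (hB₁ z) _).trans (le_of_eq ?_)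
      rw [Prod.norm_def, norm_zero, max_eq_left (norm_nonneg _), norm_smul,
        Real.norm_of_nonneg (by positivity)]
    have h4 : ‖h‖ ^ 2 ≤ (2 * Real.pi * (ħ / ε) * ‖toR j‖) ^ 2 := by
      gcongr
      exact norm_samplePt_le e hħ hε hε1 j
    rw [h2]
    refine (norm_sub_le _ _).trans ?_
    simp only [norm_mul, Complex.norm_I, Complex.norm_real, Complex.norm_ofNat]
    rw [Real.norm_of_nonneg (by positivity)]
    calc _ ≤ 1 * (ε ^ 2 / ħ) * (C₂ * (2 * Real.pi * (ħ / ε) * ‖toR j‖) ^ 2) +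
          2 * 1 * (ε ^ 2 / ħ) * (B₁ * (Real.pi * ħ * ‖toR j‖)) := by
          gcongr
          exact h1.trans (by gcongr)
      _ = 4 * Real.pi ^ 2 * C₂ * ħ * ‖toR j‖ ^ 2 + 2 * Real.pi * B₁ * ε ^ 2 * ‖toR j‖ := by
          field_simp; ring
      _ ≤ 4 * Real.pi ^ 2 * C₂ * (ε ^ 2 + ħ) * (1 + ‖toR j‖) ^ 2 +
          2 * Real.pi * B₁ * (ε ^ 2 + ħ) * (1 + ‖toR j‖) ^ 2 := by
          gcongr
          · nlinarith [sq_nonneg ε]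
          · linarith
          · linarith
          · nlinarith [norm_nonneg (toR j)]
      _ = _ := by rw [hA]; ring
  have hb1 : ∀ j m, ‖sample e ħ ε c (m - j) - sample e ħ ε c (m + j)‖ ≤ B + B := fun j m =>
    (norm_sub_le _ _).trans (add_le_add (hB _) (hB _))
  have hs1 : Summable fun j => vhat V j * corr x (p + j)
      fun m => sample e ħ ε c (m - j) - sample e ħ ε c (m + j) := by
    refine .of_norm (.of_nonneg_of_le (fun _ => norm_nonneg _) (fun j => ?_)
      (hw.mul_left (B + B)))
    have h := norm_corr_le hx (p + j) (hb1 j)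
    rw [hx1, mul_one] at h
    rw [norm_mul]
    calc _ ≤ ‖vhat V j‖ * (B + B) := by gcongr
      _ ≤ ‖vhat V j‖ * (B + B) * (1 + ‖toR j‖) ^ 2 :=
        le_mul_of_one_le_right (by positivity) (one_le_pow₀ (by linarith [norm_nonneg (toR j)]))
      _ = (B + B) * ((1 + ‖toR j‖) ^ 2 * ‖vhat V j‖) := by ring
  have hs2 : Summable fun j => vhat V j *
      (2 * Real.pi * Complex.I * ((toR j ⬝ᵥ unitDir e : ℝ) : ℂ)) *
      corr x (p + j) (sample e ħ ε (dEta c)) := by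
    refine .of_norm (.of_nonneg_of_le (fun _ => norm_nonneg _) (fun j => ?_)
      (hw.mul_left (4 * Real.pi * B₂)))
    have h := norm_corr_le hx (p + j) (f := sample e ħ ε (dEta c)) fun m => hB₂ _
    rw [hx1, mul_one] at h
    exact norm_vhat_mul_le e V j h
  have heq1 : corr x p (fun m => 2 * Real.pi * Complex.I *
      ((toR p ⬝ᵥ ((Real.pi * ħ) • toR m) : ℝ) : ℂ) * sample e ħ ε c m) =
      corr x p (sample e ħ ε (mulXi p c)) := rfl
  rw [heq1, corrField, add_sub_sub_cancel, ← tsum_mul_left, ← tsum_mul_left,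
    ← (hs1.mul_left _).tsum_add (hs2.mul_left _)]
  have hj : ∀ j, Complex.I * ((ε ^ 2 / ħ : ℝ) : ℂ) * (vhat V j * corr x (p + j)
      fun m => sample e ħ ε c (m - j) - sample e ħ ε c (m + j)) + (ε : ℂ) * (vhat V j *
      (2 * Real.pi * Complex.I * ((toR j ⬝ᵥ unitDir e : ℝ) : ℂ)) *
      corr x (p + j) (sample e ħ ε (dEta c))) = vhat V j * corr x (p + j) (fun m =>
      Complex.I * ((ε ^ 2 / ħ : ℝ) : ℂ) *
      (sample e ħ ε c (m - j) - sample e ħ ε c (m + j)) + (ε : ℂ) *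
      (2 * Real.pi * Complex.I * ((toR j ⬝ᵥ unitDir e : ℝ) : ℂ)) * sample e ħ ε (dEta c) m) :=
    fun j => by
    rw [corr_add hx (p + j) (B := ‖Complex.I * ((ε ^ 2 / ħ : ℝ) : ℂ)‖ * (B + B))
      (C := ‖(ε : ℂ) * (2 * Real.pi * Complex.I * ((toR j ⬝ᵥ unitDir e : ℝ) : ℂ))‖ * B₂)
      (fun m => by rw [norm_mul]; gcongr; exact hb1 j m)
      (fun m => by rw [norm_mul]; gcongr; exact hB₂ _), corr_const_mul, corr_const_mul]
    ring
  refine tsum_of_norm_bounded (g := fun j => A * (ε ^ 2 + ħ) * ((1 + ‖toR j‖) ^ 2 * ‖vhat V j‖))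
    (a := A * σw * (ε ^ 2 + ħ)) ?_ fun j => ?_
  · have := hw.hasSum.mul_left (A * (ε ^ 2 + ħ))
    rwa [show A * σw * (ε ^ 2 + ħ) = A * (ε ^ 2 + ħ) * σw by ring]
  · rw [hj, norm_mul]
    have h := norm_corr_le hx (p + j) (hterm j)
    rw [hx1, mul_one] at h
    calc _ ≤ ‖vhat V j‖ * (A * (ε ^ 2 + ħ) * (1 + ‖toR j‖) ^ 2) := by gcongr
      _ = _ := by ring

lemma continuous_corr_sample (e : Z2) {ħ ε : ℝ} (hħ : 0 < ħ) {v : ℝ → L2T} (hv : Continuous v)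
    (p : Z2) {c : Cot → ℂ} (hs : HasCompactSupport c) :
    Continuous fun t => corr (coef (v t)) p (sample e ħ ε c) := by
  have hf := finite_sample_support e (ε := ε) hħ hs p
  have h1 : (fun t => corr (coef (v t)) p (sample e ħ ε c)) = fun t => ∑ k ∈ hf.toFinset,
      conj (coef (v t) (k + p)) * coef (v t) k * sample e ħ ε c (k + k + p) := funext fun t =>
    tsum_eq_sum fun k hk => by
      have : sample e ħ ε c (k + k + p) = 0 := by simpa using hk
      rw [this, mul_zero]
  have h2 : ∀ k, Continuous fun t => coef (v t) k := fun k => by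
    simp only [← inner_expBasis]
    exact continuous_const.inner hv
  rw [h1]
  exact continuous_finsetSum _ fun k _ =>
    ((Complex.continuous_conj.comp (h2 _)).mul (h2 k)).mul continuous_const

lemma continuous_corrField (e : Z2) {V : T2 → ℝ} (hV : SmoothOnTorus V) {ħ ε : ℝ} (hħ : 0 < ħ)
    {v : ℝ → L2T} (hv : Continuous v) (hn : ∀ t, ‖v t‖ = 1) (p : Z2) {c : Cot → ℂ}
    (hc : ContDiff ℝ ∞ c) (hs : HasCompactSupport c) :
    Continuous fun t => corrField e V ħ ε p c (coef (v t)) := by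
  obtain ⟨B₂, hB₂0, hB₂⟩ := exists_bound_of_compactSupport (contDiff_dEta hc).continuous
    (hasCompactSupport_dEta hs)
  refine (continuous_corr_sample e hħ hv p (hasCompactSupport_mulXi p hs)).sub
    (continuous_const.mul (continuous_tsum (fun j => continuous_const.mul
      (continuous_corr_sample e hħ hv (p + j) (hasCompactSupport_dEta hs)))
      (hV.smoothC.summable_weighted.mul_left (4 * Real.pi * B₂)) fun j t => ?_))
  refine norm_vhat_mul_le e V j ?_
  have h := norm_corr_le (summable_sq_coef (v t)) (p + j) (f := sample e ħ ε (dEta c))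
    fun m => hB₂ _
  rwa [tsum_sq_coef, hn, one_pow, mul_one] at h

/-- The increments of a correlation along the rescaled Schrödinger flow. -/
lemma norm_corr_increment_le (e : Z2) {V : T2 → ℝ} (hV : SmoothOnTorus V) (p : Z2)
    {c : Cot → ℂ} (hc : ContDiff ℝ ∞ c) (hs : HasCompactSupport c) :
    ∃ C, 0 ≤ C ∧ ∀ (ħ ε : ℝ), 0 < ħ → 0 < ε → ε ≤ 1 → ∀ (u : L2T) (v : ℝ → L2T), ‖u‖ = 1 →
      IsSchrodingerSolution V ħ ε u v → ∀ τ s t : ℝ,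
      ‖corr (coef (v (t * τ))) p (sample e ħ ε c) - corr (coef (v (s * τ))) p (sample e ħ ε c) -
        τ * ∫ r in s..t, corrField e V ħ ε p c (coef (v (r * τ)))‖ ≤
        C * (ε ^ 2 + ħ) * |τ| * |t - s| := by
  obtain ⟨C, hC0, hC⟩ := norm_derivative_sub_corrField_le e hV p hc hs
  obtain ⟨B, hB0, hB⟩ := exists_bound_of_compactSupport hc.continuous hs
  refine ⟨C, hC0, fun ħ ε hħ hε hε1 u v hu hv τ s t => ?_⟩
  have hn : ∀ t, ‖v t‖ = 1 := fun t => (hv.norm_eq hV t).trans hu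
  have hcont : Continuous fun r => corrField e V ħ ε p c (coef (v (r * τ))) :=
    continuous_corrField e hV hħ (hv.1.comp (continuous_id.mul continuous_const))
      (fun t => hn _) p hc hs
  have hd : ∀ r, ∃ D : ℂ, HasDerivAt (fun r => corr (coef (v (r * τ))) p (sample e ħ ε c) -
      τ * ∫ r in s..r, corrField e V ħ ε p c (coef (v (r * τ)))) D r ∧
      ‖D‖ ≤ C * (ε ^ 2 + ħ) * |τ| := fun r => by
    have h1 := hasDerivAt_corr hV hħ hv p (f := sample e ħ ε c) (fun m => hB _)
      (finite_sample_support e hħ hs p) (r * τ)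
    have h2 := h1.scomp r ((hasDerivAt_id r).mul_const τ)
    have h3 := (intervalIntegral.integral_hasDerivAt_right (hcont.intervalIntegrable s r)
      (hcont.stronglyMeasurableAtFilter _ _) hcont.continuousAt).const_mul (τ : ℂ)
    refine ⟨_, h2.sub h3, ?_⟩
    rw [one_mul, Complex.real_smul, ← mul_sub, norm_mul, Complex.norm_real, Real.norm_eq_abs,
      mul_comm]
    gcongr
    exact hC ħ ε hħ hε hε1 _ (summable_sq_coef _) (by rw [tsum_sq_coef, hn, one_pow])
  choose D hD hDb using hd
  have h := Convex.norm_image_sub_le_of_norm_hasDerivWithin_le (s := Set.univ)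
    (fun r _ => (hD r).hasDerivWithinAt) (fun r _ => hDb r) convex_univ (Set.mem_univ s)
    (Set.mem_univ t)
  rw [intervalIntegral.integral_same, mul_zero, sub_zero, Real.norm_eq_abs] at h
  refine le_trans (le_of_eq ?_) h
  congr 1
  ring

end

/-! ### Test functions and their approximation by trigonometric polynomials. -/

section

/-! ### Test functions -/

/-- The phase space `𝕋² × ℝ² × ℝ`. -/
abbrev Om : Type := T2 × Cot

/-- The covering space of `Om`. -/
abbrev Cover : Type := (Fin 2 → ℝ) × Cot

lemma hasCompactSupport_of_bound {a : Om → ℂ} {R : ℝ} (h : ∀ z, R < ‖z.2‖ → a z = 0) :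
    HasCompactSupport a := by
  refine HasCompactSupport.intro (K := Set.univ ×ˢ Metric.closedBall 0 R)
    (isCompact_univ.prod (isCompact_closedBall 0 R)) fun z hz => h z ?_
  by_contra h'
  exact hz ⟨trivial, by simpa using h'⟩

lemma exists_support_bound {a : Om → ℂ} (h : HasCompactSupport a) :
    ∃ R : ℝ, ∀ z, R < ‖z.2‖ → a z = 0 := by
  obtain ⟨R, hR⟩ := (h.image continuous_snd).isBounded.exists_norm_le
  refine ⟨R, fun z hz => ?_⟩
  by_contra h'
  exact absurd (hR z.2 ⟨z, subset_closure h', rfl⟩) (not_le.mpr hz)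

lemma exists_support_bound_cot {c : Cot → ℂ} (h : HasCompactSupport c) :
    ∃ R : ℝ, ∀ w, R < ‖w‖ → c w = 0 := by
  obtain ⟨R, hR⟩ := h.isBounded.exists_norm_le
  refine ⟨R, fun z hz => ?_⟩
  by_contra h'
  exact absurd (hR z (subset_closure h')) (not_le.mpr hz)

lemma hasCompactSupport_cot_of_bound {c : Cot → ℂ} {R : ℝ} (h : ∀ w, R < ‖w‖ → c w = 0) :
    HasCompactSupport c :=
  HasCompactSupport.intro (isCompact_closedBall 0 R) fun w hw => h w (by simpa using hw)

/-- The smooth compactly supported functions on `𝕋² × ℝ² × ℝ`. -/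
def Test : Submodule ℂ (Om → ℂ) where
  carrier := {a | ContDiff ℝ ∞ (liftPhase a) ∧ HasCompactSupport a}
  zero_mem' := ⟨contDiff_const, HasCompactSupport.zero⟩
  add_mem' := fun ha hb => ⟨ha.1.add hb.1, ha.2.add hb.2⟩
  smul_mem' := fun c _ ha => ⟨contDiff_const.smul ha.1, ha.2.smul_left (f := fun _ => c)⟩

lemma Test.mul {a b : Om → ℂ} (ha : a ∈ Test) (hb : b ∈ Test) : a * b ∈ Test :=
  ⟨ha.1.mul hb.1, ha.2.mul_right⟩

lemma Test.conj {a : Om → ℂ} (ha : a ∈ Test) : (fun z => conj (a z)) ∈ Test :=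
  ⟨Complex.conjCLE.contDiff.comp ha.1, ha.2.comp_left (map_zero _)⟩

lemma continuous_of_lift {F : Type*} [TopologicalSpace F] {a : Om → F}
    (h : Continuous fun z : Cover => a (proj z.1, z.2)) : Continuous a :=
  (isOpenQuotientMap_proj.prodMap (IsOpenQuotientMap.id (X := Cot))).isQuotientMap.continuous_iff.mpr h

lemma Test.continuous {a : Om → ℂ} (ha : a ∈ Test) : Continuous a :=
  continuous_of_lift ha.1.continuous

lemma modeFn_mem_test (p : Z2) {c : Cot → ℂ} (hc : ContDiff ℝ ∞ c) (hs : HasCompactSupport c) :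
    modeFn p c ∈ Test := by
  constructor
  · exact ((contDiff_mFourier_proj p).comp contDiff_fst).mul (hc.comp contDiff_snd)
  · obtain ⟨R, hR⟩ := exists_support_bound_cot hs
    exact hasCompactSupport_of_bound (R := R) fun z hz => by rw [modeFn, hR _ hz, mul_zero]

/-- In the coordinate θ = arctan η the function is a(x, ξ, tan θ). It vanishes as soon as |θ| passes
the arctangent of a bound for the support, so its extension by 0 is smooth across ±π/2. -/
lemma test_le_symbols {a : Om → ℂ} (ha : a ∈ Test) : a ∈ Symbols := by
  obtain ⟨R, hR⟩ := exists_support_bound ha.2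
  set R' := max R 0 + 1 with hR'
  have hRR' : R < R' := by rw [hR']; linarith [le_max_left R 0]
  have hR0 : 0 < R' := by rw [hR']; linarith [le_max_right R 0]
  let A : T2 × (Fin 2 → ℝ) × ℝ → ℂ := fun z =>
    if |z.2.2| < Real.pi / 2 then a (z.1, z.2.1, Real.tan z.2.2) else 0
  refine ⟨A, ?_, ⟨R', fun x ξ θ h => ?_⟩, fun x ξ η => ?_⟩
  · rw [contDiff_iff_contDiffAt]
    rintro ⟨x, ξ, θ⟩
    by_cases hθ : |θ| < Real.pi / 2
    · have h1 : ContDiffAt ℝ ∞ (fun p : Cover => (p.1, p.2.1, Real.tan p.2.2)) (x, ξ, θ) := by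
        have hcos : Real.cos θ ≠ 0 := (Real.cos_pos_of_mem_Ioo (abs_lt.mp hθ)).ne'
        have h2 : ContDiffAt ℝ ∞ (fun p : Cover => Real.tan p.2.2) (x, ξ, θ) :=
          (Real.contDiffAt_tan.mpr hcos).comp (x, ξ, θ)
            (f := fun p : Cover => p.2.2) (by fun_prop)
        fun_prop
      have h3 := (ha.1.contDiffAt (x := (x, ξ, Real.tan θ))).comp (x, ξ, θ) h1
      refine h3.congr_of_eventuallyEq ?_
      have : ∀ᶠ p : Cover in 𝓝 (x, ξ, θ), |p.2.2| < Real.pi / 2 :=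
        (by fun_prop : Continuous fun p : Cover => |p.2.2|).continuousAt.eventually_lt_const hθ
      filter_upwards [this] with p hp
      simp [liftPhase, A, hp]
    · refine (contDiffAt_const (c := (0 : ℂ))).congr_of_eventuallyEq ?_
      have h1 : Real.arctan R' < |θ| := (Real.arctan_lt_pi_div_two R').trans_le (not_lt.mp hθ)
      have : ∀ᶠ p : Cover in 𝓝 (x, ξ, θ), Real.arctan R' < |p.2.2| :=
        (by fun_prop : Continuous fun p : Cover => |p.2.2|).continuousAt.eventually_const_lt h1
      filter_upwards [this] with p hp
      simp only [liftPhase, A]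
      split_ifs with hlt
      · apply hR
        refine lt_of_lt_of_le ?_ (le_max_right _ _)
        rw [Real.norm_eq_abs]
        refine hRR'.trans ?_
        rcases le_or_gt 0 p.2.2 with h0 | h0
        · rw [abs_of_nonneg h0] at hp hlt
          have := Real.tan_lt_tan_of_lt_of_lt_pi_div_two (Real.neg_pi_div_two_lt_arctan R') hlt hp
          rw [Real.tan_arctan] at this
          exact this.trans_le (le_abs_self _)
        · rw [abs_of_neg h0] at hp hlt
          have := Real.tan_lt_tan_of_lt_of_lt_pi_div_two (Real.neg_pi_div_two_lt_arctan R') hlt hp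
          rw [Real.tan_arctan, Real.tan_neg] at this
          exact this.trans_le (neg_le_abs _)
      · rfl
  · simp only [A]
    split_ifs
    · exact hR _ (hRR'.trans_le (h.trans (le_max_left _ _)))
    · rfl
  · have h1 : |Real.arctan η| < Real.pi / 2 :=
      abs_lt.mpr ⟨Real.neg_pi_div_two_lt_arctan η, Real.arctan_lt_pi_div_two η⟩
    simp [A, h1, Real.tan_arctan]

lemma symbols_mem_test {a : Om → ℂ} (ha : a ∈ Symbols) (hs : HasCompactSupport a) : a ∈ Test := by
  obtain ⟨A, hA, -, h⟩ := ha
  refine ⟨?_, hs⟩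
  have : liftPhase a = fun p : Cover => liftPhase A (p.1, p.2.1, Real.arctan p.2.2) := by
    funext p
    exact h _ _ _
  rw [this]
  have h2 : ContDiff ℝ ∞ fun p : Cover => Real.arctan p.2.2 :=
    Real.contDiff_arctan.comp (by fun_prop)
  exact hA.comp (contDiff_fst.prodMk ((contDiff_fst.comp contDiff_snd).prodMk h2))

/-- A test function, seen as a symbol. -/
def toSym : Test →ₗ[ℂ] Symbols := Submodule.inclusion fun _ ha => test_le_symbols ha

/-- A single-mode symbol. -/
def modeSym (p : Z2) (c : Cot → ℂ) (hc : ContDiff ℝ ∞ c) (hs : HasCompactSupport c) : Symbols :=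
  toSym ⟨modeFn p c, modeFn_mem_test p hc hs⟩

/-! ### Norms of derivatives up to order three -/

/-- All derivatives of order at most three are bounded by `K`. -/
def C3LE {E : Type} [NormedAddCommGroup E] [NormedSpace ℝ E] (f : E → ℂ) (K : ℝ) : Prop :=
  ∀ j ≤ 3, ∀ z, ‖iteratedFDeriv ℝ j f z‖ ≤ K

lemma iteratedFDeriv_partial_le {f : Cover → ℂ} (hf : ContDiff ℝ ∞ f) (j : ℕ)
    (w : Cot) (x : Fin 2 → ℝ) :
    ‖iteratedFDeriv ℝ j (fun y => f (y, w)) x‖ ≤ ‖iteratedFDeriv ℝ j f (x, w)‖ := by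
  set g : Cover → ℂ := fun z => f (z + (0, w)) with hg
  have hgs : ContDiff ℝ ∞ g := hf.comp (contDiff_id.add contDiff_const)
  have h1 : (fun y => f (y, w)) = g ∘ (ContinuousLinearMap.inl ℝ (Fin 2 → ℝ) Cot) := by
    funext y; simp [hg]
  rw [h1, ContinuousLinearMap.iteratedFDeriv_comp_right _ hgs x (by norm_cast; exact le_top)]
  refine (ContinuousMultilinearMap.norm_compContinuousLinearMap_le _ _).trans ?_
  rw [Finset.prod_const, hg, iteratedFDeriv_comp_add_right]
  simp only [ContinuousLinearMap.inl_apply, Prod.mk_add_mk, add_zero, zero_add]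
  refine mul_le_of_le_one_right (norm_nonneg _) (pow_le_one₀ (norm_nonneg _) ?_)
  exact ContinuousLinearMap.norm_inl_le_one ℝ _ _

lemma C3LE.add {E : Type} [NormedAddCommGroup E] [NormedSpace ℝ E] {f g : E → ℂ} (hf : ContDiff ℝ ∞ f) (hg : ContDiff ℝ ∞ g) {K L : ℝ}
    (h : C3LE f K) (h' : C3LE g L) : C3LE (f + g) (K + L) := fun j hj z => by
  rw [iteratedFDeriv_add_apply (hf.contDiffAt.of_le (by norm_cast; exact le_top))
    (hg.contDiffAt.of_le (by norm_cast; exact le_top))]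
  exact (norm_add_le _ _).trans (add_le_add (h j hj z) (h' j hj z))

/-- Leibniz formula: the binomial coefficients of an order j ≤ 3 add up to 2^j ≤ 8. -/
lemma C3LE.mul {E : Type} [NormedAddCommGroup E] [NormedSpace ℝ E] {f g : E → ℂ} (hf : ContDiff ℝ ∞ f) (hg : ContDiff ℝ ∞ g) {K L : ℝ}
    (h : C3LE f K) (h' : C3LE g L) : C3LE (f * g) (8 * (K * L)) := fun j hj z => by
  have hK : 0 ≤ K := (norm_nonneg _).trans (h 0 (by simp) z)
  have hL : 0 ≤ L := (norm_nonneg _).trans (h' 0 (by simp) z)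
  refine (norm_iteratedFDeriv_mul_le hf hg z
    (by norm_cast; exact le_top)).trans ?_
  calc _ ≤ ∑ i ∈ Finset.range (j + 1), (j.choose i : ℝ) * (K * L) := by
        refine Finset.sum_le_sum fun i hi => ?_
        rw [mul_assoc]
        have hi' : i ≤ j := Nat.lt_succ_iff.mp (Finset.mem_range.mp hi)
        have h1 := h i (hi'.trans hj) z
        have h2 := h' (j - i) ((Nat.sub_le _ _).trans hj) z
        gcongr
    _ = (2 : ℝ) ^ j * (K * L) := by
        rw [← Finset.sum_mul]
        congr 1
        exact_mod_cast Nat.sum_range_choose j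
    _ ≤ 2 ^ 3 * (K * L) := by
        gcongr
        norm_num
    _ = _ := by norm_num

lemma C3LE.conj {E : Type} [NormedAddCommGroup E] [NormedSpace ℝ E] {f : E → ℂ} {K : ℝ} (h : C3LE f K) : C3LE (fun z => conj (f z)) K :=
  fun j hj z => by
  have : (fun z => (starRingEnd ℂ) (f z)) = Complex.conjLIE ∘ f := rfl
  rw [this, LinearIsometryEquiv.norm_iteratedFDeriv_comp_left]
  exact h j hj z

lemma C3LE.mono {E : Type} [NormedAddCommGroup E] [NormedSpace ℝ E] {f : E → ℂ} {K L : ℝ} (h : C3LE f K) (hKL : K ≤ L) : C3LE f L :=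
  fun j hj z => (h j hj z).trans hKL

lemma liftPhase_periodic (a : Om → ℂ) (z : Cover) (k : Z2) :
    liftPhase a (z + (toR k, 0)) = liftPhase a z := by
  simp [liftPhase, proj_add, proj_toR]

lemma exists_cube_rep (x : Fin 2 → ℝ) : ∃ k : Z2, x + toR k ∈ Set.Icc (0 : Fin 2 → ℝ) 1 := by
  refine ⟨fun i => -⌊x i⌋, fun i => ?_, fun i => ?_⟩
  · simp only [Pi.zero_apply, Pi.add_apply, toR]
    push_cast
    linarith [Int.floor_le (x i)]
  · simp only [Pi.one_apply, Pi.add_apply, toR]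
    push_cast
    linarith [Int.lt_floor_add_one (x i)]

/-- The derivatives are periodic in x, so only the unit cube times a ball of the cotangent variables
matters, and this is compact. -/
lemma Test.exists_iteratedFDeriv_bound {a : Om → ℂ} (ha : a ∈ Test) (j : ℕ) :
    ∃ M, 0 ≤ M ∧ ∀ z, ‖iteratedFDeriv ℝ j (liftPhase a) z‖ ≤ M := by
  obtain ⟨R, hR⟩ := exists_support_bound ha.2
  have hcont : Continuous (iteratedFDeriv ℝ j (liftPhase a)) :=
    ha.1.continuous_iteratedFDeriv (by norm_cast; exact le_top)
  obtain ⟨M, hM⟩ := ((isCompact_Icc (a := (0 : Fin 2 → ℝ)) (b := 1)).prod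
    (isCompact_closedBall (0 : Cot) R)).exists_bound_of_continuousOn hcont.continuousOn
  refine ⟨max M 0, le_max_right _ _, fun z => ?_⟩
  obtain ⟨k, hk⟩ := exists_cube_rep z.1
  have hper : iteratedFDeriv ℝ j (liftPhase a) z =
      iteratedFDeriv ℝ j (liftPhase a) (z + (toR k, 0)) := by
    rw [← iteratedFDeriv_comp_add_right]
    congr 1
    funext z
    exact (liftPhase_periodic a z k).symm
  rw [hper]
  by_cases hz : ‖z.2‖ ≤ R
  · exact (hM _ ⟨hk, by simpa using hz⟩).trans (le_max_left _ _)
  · have h0 : iteratedFDeriv ℝ j (liftPhase a) (z + (toR k, 0)) = 0 := by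
      by_contra hne
      have h1 := (support_iteratedFDeriv_subset (𝕜 := ℝ) (f := liftPhase a) j)
        (Function.mem_support.mpr hne)
      have h2 : tsupport (liftPhase a) ⊆ {z | ‖z.2‖ ≤ R} :=
        closure_minimal (fun y hy => by
          by_contra h'
          exact hy (hR (proj y.1, y.2) (not_le.mp h')))
          (isClosed_le (continuous_snd.norm) continuous_const)
      have := h2 h1
      simp at this
      exact hz this
    rw [h0, norm_zero]
    exact le_max_right _ _

lemma Test.exists_c3LE {a : Om → ℂ} (ha : a ∈ Test) : ∃ M, 0 ≤ M ∧ C3LE (liftPhase a) M := by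
  choose M hM0 hM using fun j => Test.exists_iteratedFDeriv_bound ha j
  refine ⟨∑ j ∈ Finset.range 4, M j, Finset.sum_nonneg fun j _ => hM0 j, fun j hj z => ?_⟩
  exact (hM j z).trans (Finset.single_le_sum (f := M) (fun i _ => hM0 i)
    (Finset.mem_range.mpr (by omega)))

/-! ### A countable dense family of coefficients -/

lemma fderiv_eq_zero_of_bound {c : Cot → ℂ} {R : ℝ} (h : ∀ w, R < ‖w‖ → c w = 0) {w : Cot}
    (hw : R < ‖w‖) : fderiv ℝ c w = 0 := by
  have h1 : c =ᶠ[𝓝 w] fun _ => 0 := by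
    filter_upwards [(continuous_norm (E := Cot)).continuousAt.eventually_const_lt hw] with y hy
    exact h y hy
  rw [h1.fderiv_eq, fderiv_fun_const]
  rfl

/-- Restricted to the closed ball, the pairs (c, Dc) form a subset of a separable metric space, the
continuous functions on a compact set; such a subset is separable. The derivative is recorded
because the field of p_Λ, which differentiates in η, must be approximated too. -/
lemma exists_countable_dense_coeff : ∃ s : ℕ × ℕ → Cot → ℂ,
    (∀ n, ContDiff ℝ ∞ (s n)) ∧ (∀ n w, (n.1 : ℝ) < ‖w‖ → s n w = 0) ∧
    ∀ (R : ℕ) (c : Cot → ℂ), ContDiff ℝ ∞ c → (∀ w, (R : ℝ) < ‖w‖ → c w = 0) → ∀ δ > 0,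
      ∃ n, ∀ w, ‖c w - s (R, n) w‖ ≤ δ ∧ ‖fderiv ℝ c w - fderiv ℝ (s (R, n)) w‖ ≤ δ := by
  have key : ∀ R : ℕ, ∃ s : ℕ → Cot → ℂ, (∀ n, ContDiff ℝ ∞ (s n)) ∧
      (∀ n w, (R : ℝ) < ‖w‖ → s n w = 0) ∧ ∀ (c : Cot → ℂ), ContDiff ℝ ∞ c →
      (∀ w, (R : ℝ) < ‖w‖ → c w = 0) → ∀ δ > 0,
      ∃ n, ∀ w, ‖c w - s n w‖ ≤ δ ∧ ‖fderiv ℝ c w - fderiv ℝ (s n) w‖ ≤ δ := fun R => by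
    let 𝒮 : Type := {c : Cot → ℂ // ContDiff ℝ ∞ c ∧ ∀ w, (R : ℝ) < ‖w‖ → c w = 0}
    let K : Type := Metric.closedBall (0 : Cot) R
    have : CompactSpace K := isCompact_iff_compactSpace.mp (isCompact_closedBall _ _)
    let J : 𝒮 → C(K, ℂ × (Cot →L[ℝ] ℂ)) := fun c =>
      ⟨fun w => (c.1 w.1, fderiv ℝ c.1 w.1),
        (c.2.1.continuous.comp continuous_subtype_val).prodMk
          ((c.2.1.continuous_fderiv (by simp)).comp continuous_subtype_val)⟩
    let z : 𝒮 := ⟨0, contDiff_const, fun _ _ => rfl⟩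
    have hne : Nonempty (Set.range J) := ⟨⟨J z, z, rfl⟩⟩
    choose s hs using fun n => (TopologicalSpace.denseSeq (Set.range J) n).2
    refine ⟨fun n => (s n).1, fun n => (s n).2.1, fun n => (s n).2.2, fun c hc hcR δ hδ => ?_⟩
    let y : Set.range J := ⟨J ⟨c, hc, hcR⟩, _, rfl⟩
    obtain ⟨n, hn⟩ : ∃ n, dist y (TopologicalSpace.denseSeq (Set.range J) n) < δ :=
      DenseRange.exists_dist_lt (TopologicalSpace.denseRange_denseSeq (Set.range J)) y hδ
    rw [Subtype.dist_eq, ← hs n] at hn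
    refine ⟨n, fun w => ?_⟩
    by_cases hw : ‖w‖ ≤ R
    · have h1 := (ContinuousMap.dist_apply_le_dist (f := J ⟨c, hc, hcR⟩) (g := J (s n))
        ⟨w, by simpa using hw⟩).trans hn.le
      rw [Prod.dist_eq, max_le_iff] at h1
      exact ⟨by rw [← dist_eq_norm]; exact h1.1, by rw [← dist_eq_norm]; exact h1.2⟩
    · rw [not_le] at hw
      beta_reduce
      rw [hcR w hw, (s n).2.2 w hw, fderiv_eq_zero_of_bound hcR hw,
        fderiv_eq_zero_of_bound (s n).2.2 hw, sub_zero, sub_zero, norm_zero, norm_zero]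
      exact ⟨hδ.le, hδ.le⟩
  choose s h1 h2 h3 using key
  exact ⟨fun n => s n.1 n.2, fun n => h1 _ _, fun n => h2 _ _, fun R => h3 R⟩

end

section

/-! ### Approximation by trigonometric polynomials with smooth coefficients -/

/-- The centred unit cell. -/
def cell : Set (Fin 2 → ℝ) := {x | ∀ i, x i ∈ Set.Ioc (-1 / 2 : ℝ) (-1 / 2 + 1)}

/-- Lebesgue measure on the centred unit cell. -/
def cellMeasure : Measure (Fin 2 → ℝ) := volume.restrict cell

lemma measurableSet_cell : MeasurableSet cell :=
  MeasurableSet.univ_pi' fun _ => measurableSet_Ioc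

lemma integral_torus_eq (f : T2 → ℂ) : ∫ x, f x ∂torusMeasure = ∫ y, f (proj y) ∂cellMeasure :=
  UnitAddTorus.integral_preimage f fun _ => -1 / 2

lemma lintegral_torus_eq (f : T2 → ENNReal) :
    ∫⁻ x, f x ∂torusMeasure = ∫⁻ y, f (proj y) ∂cellMeasure :=
  UnitAddTorus.lintegral_preimage f fun _ => -1 / 2

instance : IsProbabilityMeasure cellMeasure := ⟨by
  have := lintegral_torus_eq fun _ => 1
  simpa using this.symm⟩

lemma abs_le_of_mem_cell {x : Fin 2 → ℝ} (hx : x ∈ cell) (i : Fin 2) : |x i| ≤ 1 / 2 := by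
  have := hx i
  rw [abs_le]
  constructor <;> linarith [this.1, this.2]

/-- This is the reason for centring the cell: for |x_i| ≤ 1/2 the quotient norm is attained at the
representative itself, which allows the first moment of a kernel to be computed on either side. -/
lemma norm_proj_of_mem_cell {x : Fin 2 → ℝ} (hx : x ∈ cell) : ‖proj x‖ = ‖x‖ := by
  have h : ∀ i, ‖proj x i‖ = ‖x i‖ := fun i =>
    (AddCircle.norm_coe_eq_abs_iff (p := (1 : ℝ)) one_ne_zero).mpr
      (by simpa using abs_le_of_mem_cell hx i)
  simp only [Pi.norm_def, nnnorm]
  congr 2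
  funext i
  exact Subtype.ext (h i)

lemma ae_mem_cell : ∀ᵐ y ∂cellMeasure, y ∈ cell := ae_restrict_mem measurableSet_cell

lemma ae_mem_closedBall : ∀ᵐ y ∂cellMeasure, y ∈ Metric.closedBall (0 : Fin 2 → ℝ) 1 := by
  filter_upwards [ae_mem_cell] with y hy
  rw [mem_closedBall_zero_iff, pi_norm_le_iff_of_nonneg zero_le_one]
  intro i
  rw [Real.norm_eq_abs]
  linarith [abs_le_of_mem_cell hy i]

lemma integrable_torus {E : Type} [NormedAddCommGroup E] {f : T2 → E} (hf : Continuous f) :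
    Integrable f torusMeasure :=
  hf.integrable_of_hasCompactSupport (HasCompactSupport.of_compactSpace _)

lemma norm_torus_le (x : T2) : ‖x‖ ≤ 1 := by
  refine (pi_norm_le_iff_of_nonneg zero_le_one).mpr fun i => ?_
  have := AddCircle.norm_le_half_period (p := (1 : ℝ)) (x := x i) one_ne_zero
  rw [abs_one] at this
  linarith

/-- Trigonometric polynomials of integral one that are concentrated at the origin. -/
lemma exists_trig_kernel {δ : ℝ} (hδ : 0 < δ) : ∃ (F : Finset Z2) (κ : Z2 → ℂ),
    ∫ x, ∑ p ∈ F, κ p * UnitAddTorus.mFourier p x ∂torusMeasure = 1 ∧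
    ∫ x, ‖∑ p ∈ F, κ p * UnitAddTorus.mFourier p x‖ * ‖x‖ ∂torusMeasure ≤ δ := by
  -- `r` is both the radius of a normalised tent function and the accuracy of its uniform
  -- approximation. The first moment of the approximation is at most 2r. Since r ≤ 1/8, its integral
  -- `J` has modulus at least 1/2, so dividing by `J` leaves at most 4r ≤ δ.
  set r := min δ 1 / 8 with hr
  have hr0 : 0 < r := by positivity
  have hrδ : r ≤ δ / 8 := by rw [hr]; gcongr; exact min_le_left _ _
  have hr1 : r ≤ 1 / 8 := by rw [hr]; gcongr; exact min_le_right _ _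
  have hc0 : Continuous fun x : T2 => max 0 (r - ‖x‖) := by fun_prop
  obtain ⟨I, hI⟩ : ∃ I, I = ∫ x, max 0 (r - ‖x‖) ∂torusMeasure := ⟨_, rfl⟩
  have hI0 : 0 < I := by
    rw [hI]
    refine hc0.integral_pos_of_hasCompactSupport_nonneg_nonzero
      (HasCompactSupport.of_compactSpace _) (fun x => le_max_left _ _) (x := 0) ?_
    simp [hr0.ne', hr0.le]
  let Φ : C(T2, ℂ) := ⟨fun x => ((I⁻¹ * max 0 (r - ‖x‖) : ℝ) : ℂ), by fun_prop⟩
  have hΦn : ∀ x, ‖Φ x‖ = I⁻¹ * max 0 (r - ‖x‖) := fun x => by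
    simp only [Φ, ContinuousMap.coe_mk, Complex.norm_real, Real.norm_eq_abs]
    exact abs_of_nonneg (by positivity)
  have hΦ1 : ∫ x, Φ x ∂torusMeasure = 1 := by
    simp only [Φ, ContinuousMap.coe_mk]
    rw [integral_complex_ofReal, integral_const_mul, ← hI, inv_mul_cancel₀ hI0.ne']
    simp
  have hΦ2 : ∫ x, ‖Φ x‖ * ‖x‖ ∂torusMeasure ≤ r := by
    calc ∫ x, ‖Φ x‖ * ‖x‖ ∂torusMeasure ≤ ∫ x, r * (I⁻¹ * max 0 (r - ‖x‖)) ∂torusMeasure := by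
          refine integral_mono (integrable_torus (by fun_prop)) (integrable_torus (by fun_prop))
            fun x => ?_
          simp only [hΦn]
          rw [mul_comm]
          rcases le_total ‖x‖ r with h | h
          · exact mul_le_mul_of_nonneg_right h (by positivity)
          · rw [max_eq_left (by linarith), mul_zero, mul_zero, mul_zero]
      _ = r := by
          rw [integral_const_mul, integral_const_mul, ← hI, inv_mul_cancel₀ hI0.ne', mul_one]
  have hmem : Φ ∈ closure ((Submodule.span ℂ (Set.range <| UnitAddTorus.mFourier (d := Fin 2)) :
      Submodule ℂ C(T2, ℂ)) : Set C(T2, ℂ)) := by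
    have h := UnitAddTorus.span_mFourier_closure_eq_top (d := Fin 2)
    have h2 : Φ ∈ (Submodule.span ℂ (Set.range <| UnitAddTorus.mFourier (d := Fin 2))).topologicalClosure := by
      rw [h]; trivial
    exact h2
  obtain ⟨K, hK, hKΦ⟩ := Metric.mem_closure_iff.mp hmem r hr0
  have hKx : ∀ x, ‖K x - Φ x‖ ≤ r := fun x => by
    rw [← dist_eq_norm, dist_comm]
    exact (ContinuousMap.dist_apply_le_dist x).trans hKΦ.le
  obtain ⟨c, hc⟩ := (Finsupp.mem_span_range_iff_exists_finsupp).mp hK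
  have hKsum : ∀ x, K x = ∑ p ∈ c.support, c p * UnitAddTorus.mFourier p x := fun x => by
    rw [← hc, Finsupp.sum, ContinuousMap.sum_apply]
    rfl
  set J := ∫ x, K x ∂torusMeasure with hJ
  have hJ1 : ‖J - 1‖ ≤ r := by
    rw [hJ, ← hΦ1, ← integral_sub (integrable_torus K.continuous) (integrable_torus Φ.continuous)]
    refine (norm_integral_le_of_norm_le_const (C := r) (.of_forall hKx)).trans ?_
    simp
  have hJ2 : 1 / 2 ≤ ‖J‖ := by
    have : ‖(1 : ℂ)‖ ≤ ‖J‖ + ‖J - 1‖ := by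
      calc ‖(1 : ℂ)‖ = ‖J - (J - 1)‖ := by ring_nf
        _ ≤ _ := norm_sub_le _ _
    rw [norm_one] at this
    linarith
  have hJ0 : J ≠ 0 := fun h => by rw [h, norm_zero] at hJ2; linarith
  have hsum : ∀ x, ∑ p ∈ c.support, J⁻¹ * c p * UnitAddTorus.mFourier p x = J⁻¹ * K x := fun x => by
    rw [hKsum, Finset.mul_sum]
    exact Finset.sum_congr rfl fun p _ => by ring
  refine ⟨c.support, fun p => J⁻¹ * c p, ?_, ?_⟩
  · simp only [hsum]
    rw [integral_const_mul, ← hJ, inv_mul_cancel₀ hJ0]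
  · simp only [hsum]
    simp only [norm_mul, norm_inv, mul_assoc]
    rw [integral_const_mul]
    have h3 : ∫ x, ‖K x‖ * ‖x‖ ∂torusMeasure ≤ 2 * r := by
      calc ∫ x, ‖K x‖ * ‖x‖ ∂torusMeasure ≤ ∫ x, (‖Φ x‖ * ‖x‖ + r) ∂torusMeasure := by
            refine integral_mono (integrable_torus (by fun_prop)) (integrable_torus (by fun_prop))
              fun x => ?_
            have h4 : ‖K x‖ ≤ ‖Φ x‖ + r := by
              calc ‖K x‖ = ‖Φ x + (K x - Φ x)‖ := by congr 1; ring
                _ ≤ ‖Φ x‖ + ‖K x - Φ x‖ := norm_add_le _ _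
                _ ≤ _ := by gcongr; exact hKx x
            calc ‖K x‖ * ‖x‖ ≤ (‖Φ x‖ + r) * ‖x‖ := by gcongr
              _ = ‖Φ x‖ * ‖x‖ + r * ‖x‖ := by ring
              _ ≤ ‖Φ x‖ * ‖x‖ + r * 1 := by gcongr; exact norm_torus_le x
              _ = _ := by ring
        _ ≤ 2 * r := by
            rw [integral_add (integrable_torus (by fun_prop)) (integrable_const _)]
            simp only [integral_const, probReal_univ, one_smul]
            linarith
    have h5 : ‖J‖⁻¹ ≤ 2 := by
      rw [inv_le_comm₀ (by linarith) two_pos]; linarith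
    calc ‖J‖⁻¹ * ∫ x, ‖K x‖ * ‖x‖ ∂torusMeasure ≤ 2 * (2 * r) := by gcongr
      _ ≤ δ := by linarith

/-- The Fourier coefficient in `x` of a function on the phase space. -/
def phaseCoeff (a : Om → ℂ) (p : Z2) (w : Cot) : ℂ :=
  ∫ x, UnitAddTorus.mFourier (-p) x * a (x, w) ∂torusMeasure

lemma contDiff_phaseCoeff {a : Om → ℂ} (ha : a ∈ Test) (p : Z2) : ContDiff ℝ ∞ (phaseCoeff a p) := by
  have : phaseCoeff a p = fun w => ∫ y, UnitAddTorus.mFourier (-p) (proj y) * liftPhase a (y, w)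
      ∂cellMeasure := funext fun w => integral_torus_eq _
  rw [this]
  exact contDiff_integral_param cellMeasure (isCompact_closedBall _ _) ae_mem_closedBall
    (((contDiff_mFourier_proj (-p)).comp contDiff_fst).mul ha.1)

lemma phaseCoeff_eq_zero {a : Om → ℂ} {R : ℝ} (h : ∀ z, R < ‖z.2‖ → a z = 0) (p : Z2) {w : Cot}
    (hw : R < ‖w‖) : phaseCoeff a p w = 0 := by
  simp [phaseCoeff, h (_, w) hw]

lemma iteratedFDeriv_sub_translate_le {f : Cover → ℂ} (hf : ContDiff ℝ ∞ f) (j : ℕ) {M : ℝ}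
    (hM : ∀ z, ‖iteratedFDeriv ℝ (j + 1) f z‖ ≤ M) (z h : Cover) :
    ‖iteratedFDeriv ℝ j (fun z => f z - f (z - h)) z‖ ≤ M * ‖h‖ := by
  have h1 : (fun z => f z - f (z - h)) = f - fun z => f (z + (-h)) := by
    funext z; simp [sub_eq_add_neg]
  have hs : ContDiff ℝ j f := hf.of_le (by norm_cast; exact le_top)
  have hs' : ContDiff ℝ j fun z => f (z + (-h)) := hs.comp (contDiff_id.add contDiff_const)
  rw [h1, iteratedFDeriv_sub_apply hs.contDiffAt hs'.contDiffAt, iteratedFDeriv_comp_add_right]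
  have := Convex.norm_image_sub_le_of_norm_fderiv_le (𝕜 := ℝ) (f := iteratedFDeriv ℝ j f)
    (s := Set.univ) (C := M) (x := z + -h) (y := z)
    (fun x _ => (hf.differentiable_iteratedFDeriv (m := j)
      (by norm_cast; exact WithTop.coe_lt_top _)) x)
    (fun x _ => by rw [norm_fderiv_iteratedFDeriv]; exact hM x) convex_univ trivial trivial
  simpa using this

/-- The approximation is the convolution of a, in x, with a trigonometric kernel K of integral 1.
The error is the integral of K(y)(a - a(· - y)), whose derivatives are O(‖y‖), and the first
absolute moment of K is small. K need not be positive. -/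
lemma exists_trig_approx {a : Om → ℂ} (ha : a ∈ Test) {R : ℝ} (hR : ∀ z, R < ‖z.2‖ → a z = 0)
    {δ : ℝ} (hδ : 0 < δ) : ∃ (F : Finset Z2) (c : Z2 → Cot → ℂ),
      (∀ p, ContDiff ℝ ∞ (c p)) ∧ (∀ p w, R < ‖w‖ → c p w = 0) ∧
      C3LE (liftPhase (a - ∑ p ∈ F, modeFn p (c p))) δ := by
  choose M hM0 hM using fun j => Test.exists_iteratedFDeriv_bound ha j
  -- Orders 0 to 4: the mean value bound costs one derivative beyond the third.
  set M' := ∑ j ∈ Finset.range 5, M j with hM'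
  have hM'0 : 0 ≤ M' := Finset.sum_nonneg fun j _ => hM0 j
  obtain ⟨F, κ, h1, h2⟩ := exists_trig_kernel (δ := δ / (M' + 1)) (by positivity)
  refine ⟨F, fun p w => κ p * phaseCoeff a p w, fun p => contDiff_const.mul
    (contDiff_phaseCoeff ha p), fun p w hw => by
      beta_reduce; rw [phaseCoeff_eq_zero hR p hw, mul_zero], ?_⟩
  set K : T2 → ℂ := fun x => ∑ p ∈ F, κ p * UnitAddTorus.mFourier p x with hK
  have hKc : Continuous K := by fun_prop
  have hKs : ContDiff ℝ ∞ fun y => K (proj y) :=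
    ContDiff.sum fun p _ => contDiff_const.mul (contDiff_mFourier_proj p)
  have hac := Test.continuous ha
  have : torusMeasure.IsNegInvariant := Measure.pi.isNegInvariant _
  have key : liftPhase (a - ∑ p ∈ F, modeFn p (fun w => κ p * phaseCoeff a p w)) =
      fun z => ∫ y, K (proj y) * (liftPhase a z - liftPhase a (z - (y, 0))) ∂cellMeasure := by
    funext z
    have e1 : ∀ p, modeFn p (fun w => κ p * phaseCoeff a p w) (proj z.1, z.2) =
        ∫ x, κ p * UnitAddTorus.mFourier p x * a (proj z.1 - x, z.2) ∂torusMeasure := fun p => by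
      simp only [modeFn, phaseCoeff]
      rw [← mul_assoc, ← integral_const_mul,
        ← integral_sub_left_eq_self (fun x => UnitAddTorus.mFourier p (proj z.1) * κ p *
          (UnitAddTorus.mFourier (-p) x * a (x, z.2))) torusMeasure (proj z.1)]
      refine integral_congr_ae (.of_forall fun x => ?_)
      have e2 : UnitAddTorus.mFourier p (proj z.1) * UnitAddTorus.mFourier (-p) (proj z.1 - x) =
          UnitAddTorus.mFourier p x := by
        have e3 : proj z.1 = x + (proj z.1 - x) := by abel
        conv_lhs => rw [e3, mFourier_apply_add, add_sub_cancel_left]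
        rw [mul_assoc, ← UnitAddTorus.mFourier_add, add_neg_cancel, UnitAddTorus.mFourier_zero]
        exact mul_one _
      beta_reduce
      rw [← e2]
      ring
    have e4 : ∀ x : T2, Continuous fun y : T2 => a (x - y, z.2) := fun x => by fun_prop
    have e5 : ∑ p ∈ F, modeFn p (fun w => κ p * phaseCoeff a p w) (proj z.1, z.2) =
        ∫ x, K x * a (proj z.1 - x, z.2) ∂torusMeasure := by
      simp only [e1, hK, Finset.sum_mul]
      rw [integral_finsetSum]
      intro p _
      exact integrable_torus ((continuous_const.mul (ContinuousMap.continuous _)).mul (e4 _))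
    have e6 : a (proj z.1, z.2) = ∫ x, K x * a (proj z.1, z.2) ∂torusMeasure := by
      rw [integral_mul_const, h1, one_mul]
    have e7 : ∀ y, liftPhase a (z - (y, 0)) = a (proj z.1 - proj y, z.2) := fun y => by
      simp only [liftPhase, Prod.fst_sub, Prod.snd_sub, sub_zero]
      rw [show proj z.1 - proj y = proj (z.1 - y) from rfl]
    calc liftPhase (a - ∑ p ∈ F, modeFn p (fun w => κ p * phaseCoeff a p w)) z
        = a (proj z.1, z.2) - ∑ p ∈ F, modeFn p (fun w => κ p * phaseCoeff a p w)
            (proj z.1, z.2) := by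
          simp [liftPhase, Finset.sum_apply]
      _ = ∫ x, K x * (a (proj z.1, z.2) - a (proj z.1 - x, z.2)) ∂torusMeasure := by
          rw [e5]
          conv_lhs => rw [e6]
          have e8 := integral_sub (integrable_torus (hKc.mul (continuous_const (y := a (proj z.1, z.2)))))
            (integrable_torus (hKc.mul (e4 (proj z.1))))
          simp only [mul_sub]
          exact e8.symm
      _ = _ := by
          rw [integral_torus_eq]
          simp only [e7]
          rfl
  rw [key]
  have hf : ContDiff ℝ ∞ fun q : (Fin 2 → ℝ) × Cover =>
      K (proj q.1) * (liftPhase a q.2 - liftPhase a (q.2 - (q.1, 0))) := by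
    refine (hKs.comp contDiff_fst).mul ((ha.1.comp contDiff_snd).sub (ha.1.comp ?_))
    exact contDiff_snd.sub (contDiff_fst.prodMk contDiff_const)
  have hBc : Continuous fun y : Fin 2 → ℝ => ‖K (proj y)‖ * (M' * ‖y‖) :=
    hKs.continuous.norm.mul (continuous_const.mul continuous_norm)
  have hB : Integrable (fun y : Fin 2 → ℝ => ‖K (proj y)‖ * (M' * ‖y‖)) cellMeasure := by
    obtain ⟨C, hC⟩ := (isCompact_closedBall (0 : Fin 2 → ℝ) 1).exists_bound_of_continuousOn
      hBc.continuousOn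
    refine Integrable.of_bound hBc.aestronglyMeasurable C ?_
    filter_upwards [ae_mem_closedBall] with y hy using hC y hy
  intro j hj z
  refine (norm_iteratedFDeriv_integral_le cellMeasure (isCompact_closedBall _ _) ae_mem_closedBall
    hf hB j (.of_forall fun y w => ?_) z).trans ?_
  · have h3 : ContDiff ℝ j fun z => liftPhase a z - liftPhase a (z - (y, 0)) :=
      (ha.1.sub (ha.1.comp (contDiff_id.sub contDiff_const))).of_le (by norm_cast; exact le_top)
    have h4 := iteratedFDeriv_const_smul_apply' (a := K (proj y)) (x := w) h3.contDiffAt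
    simp only [smul_eq_mul] at h4
    rw [h4, norm_smul]
    gcongr
    refine (iteratedFDeriv_sub_translate_le ha.1 j (M := M') (fun z => (hM _ z).trans
      (Finset.single_le_sum (f := M) (fun i _ => hM0 i) (Finset.mem_range.mpr (by omega))))
      w (y, 0)).trans ?_
    simp [Prod.norm_def]
  · have h5 : ∫ y, ‖K (proj y)‖ * (M' * ‖y‖) ∂cellMeasure =
        M' * ∫ x, ‖K x‖ * ‖x‖ ∂torusMeasure := by
      have h6 := UnitAddTorus.integral_preimage (fun x : T2 => ‖K x‖ * ‖x‖) fun _ => -1 / 2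
      have h7 : ∫ x, ‖K x‖ * ‖x‖ ∂torusMeasure = ∫ y, ‖K (proj y)‖ * ‖proj y‖ ∂cellMeasure := h6
      rw [h7, ← integral_const_mul]
      refine integral_congr_ae ?_
      filter_upwards [ae_mem_cell] with y hy
      rw [norm_proj_of_mem_cell hy]
      ring
    rw [h5]
    calc M' * ∫ x, ‖K x‖ * ‖x‖ ∂torusMeasure ≤ M' * (δ / (M' + 1)) := by gcongr
      _ ≤ δ := by
        rw [mul_div_assoc', div_le_iff₀ (by positivity)]
        nlinarith

end

section

/-! ### Cutoffs -/

/-- A smooth function on `ℝ² × ℝ`, equal to `1` for `‖w‖ ≤ R + 1` and to `0` for `‖w‖ ≥ R + 2`. -/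
def cut (R : ℕ) : ContDiffBump (0 : Cot) :=
  ⟨R + 1, R + 2, by positivity, by linarith⟩

lemma cut_eq_one {R : ℕ} {w : Cot} (h : ‖w‖ ≤ R + 1) : cut R w = 1 :=
  (cut R).one_of_mem_closedBall (by simpa [cut] using h)

lemma cut_eq_zero {R : ℕ} {w : Cot} (h : (R : ℝ) + 2 < ‖w‖) : cut R w = 0 :=
  (cut R).zero_of_le_dist (by simpa [cut] using h.le)

lemma contDiff_cut (R : ℕ) : ContDiff ℝ ∞ fun w => cut R w := (cut R).contDiff

lemma contDiff_proj_slice {a : Om → ℂ} (ha : a ∈ Test) (w : Cot) :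
    ContDiff ℝ ∞ fun y => a (proj y, w) :=
  ha.1.comp (contDiff_id.prodMk contDiff_const)

/-! ### The norm of `𝓑` -/

/-- `‖a‖_𝓑 ≤ K`, for a function on the phase space. -/
def B3LE (a : Om → ℂ) (K : ℝ) : Prop := ∀ w, C3LE (fun y => a (proj y, w)) K

lemma B3LE.bNormLE {a : Om → ℂ} (ha : a ∈ Test) {K : ℝ} (h : B3LE a K) :
    BNormLE (toSym ⟨a, ha⟩) K := fun ξ η x j hj => h (ξ, η) j hj x

lemma B3LE.of_lift {a : Om → ℂ} (ha : a ∈ Test) {K : ℝ} (h : C3LE (liftPhase a) K) : B3LE a K :=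
  fun w j hj x => (iteratedFDeriv_partial_le ha.1 j w x).trans (h j hj _)

lemma B3LE.add {a b : Om → ℂ} (ha : a ∈ Test) (hb : b ∈ Test) {K L : ℝ} (h : B3LE a K)
    (h' : B3LE b L) : B3LE (a + b) (K + L) := fun w =>
  (h w).add (contDiff_proj_slice ha w) (contDiff_proj_slice hb w) (h' w)

lemma B3LE.mul {a b : Om → ℂ} (ha : a ∈ Test) (hb : b ∈ Test) {K L : ℝ} (h : B3LE a K)
    (h' : B3LE b L) : B3LE (a * b) (8 * (K * L)) := fun w =>
  (h w).mul (contDiff_proj_slice ha w) (contDiff_proj_slice hb w) (h' w)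

lemma B3LE.conj {a : Om → ℂ} {K : ℝ} (h : B3LE a K) : B3LE (fun z => conj (a z)) K := fun w =>
  (h w).conj

lemma B3LE.norm_le {a : Om → ℂ} {K : ℝ} (h : B3LE a K) (z : Om) : ‖a z‖ ≤ K := by
  obtain ⟨y, hy⟩ := proj_surjective z.1
  have := h z.2 0 (by norm_num) y
  rw [norm_iteratedFDeriv_zero, hy] at this
  exact this

/-- Multiplied by a cut-off in the cotangent variables, f becomes a test function, and the slice
where the cut-off equals 1 gives f back. -/
lemma SmoothC.exists_c3LE {f : T2 → ℂ} (hf : SmoothC f) :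
    ∃ N, 0 ≤ N ∧ C3LE (fun y => f (proj y)) N := by
  have ht : (fun z : Om => f z.1 * ((cut 0 z.2 : ℝ) : ℂ)) ∈ Test :=
    ⟨ContDiff.mul (ContDiff.comp (g := fun y => f (proj y)) hf contDiff_fst)
      (Complex.ofRealCLM.contDiff.comp ((contDiff_cut 0).comp contDiff_snd)),
      hasCompactSupport_of_bound (R := (0 : ℕ) + 2) fun z hz => by rw [cut_eq_zero hz]; simp⟩
  obtain ⟨N, hN, h⟩ := Test.exists_c3LE ht
  refine ⟨N, hN, ?_⟩
  have h2 := B3LE.of_lift ht h 0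
  have h3 : cut 0 (0 : Cot) = 1 := cut_eq_one (by simp)
  simpa [h3] using h2

lemma exists_c3LE_mFourier (p : Z2) : ∃ N, 0 ≤ N ∧
    C3LE (fun y => UnitAddTorus.mFourier p (proj y)) N :=
  SmoothC.exists_c3LE (contDiff_mFourier_proj p)

/-- The norm of 𝓑 differentiates in x only, so a bound on the values of c is enough. -/
lemma b3LE_modeFn {p : Z2} {N : ℝ} (hN : C3LE (fun y => UnitAddTorus.mFourier p (proj y)) N)
    {c : Cot → ℂ} {δ : ℝ} (hc : ∀ w, ‖c w‖ ≤ δ) : B3LE (modeFn p c) (N * δ) := fun w j hj x => by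
  have h1 : (fun y => modeFn p c (proj y, w)) =
      fun y => c w • UnitAddTorus.mFourier p (proj y) := funext fun y => mul_comm _ _
  have hN0 : 0 ≤ N := (norm_nonneg _).trans (hN 0 (by norm_num) 0)
  rw [h1, iteratedFDeriv_const_smul_apply'
    ((contDiff_mFourier_proj p).of_le (by norm_cast; exact le_top)).contDiffAt, norm_smul, mul_comm]
  exact mul_le_mul (hN j hj x) (hc w) (norm_nonneg _) hN0

lemma norm_fderiv_modeFn_le {p : Z2} {N : ℝ}
    (hN : C3LE (fun y => UnitAddTorus.mFourier p (proj y)) N)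
    {c : Cot → ℂ} (hcs : ContDiff ℝ ∞ c) {δ : ℝ} (hc : ∀ w, ‖c w‖ ≤ δ)
    (hc' : ∀ w, ‖fderiv ℝ c w‖ ≤ δ) (z : Cover) :
    ‖fderiv ℝ (liftPhase (modeFn p c)) z‖ ≤ N * δ + δ := by
  have hN0 : 0 ≤ N := (norm_nonneg _).trans (hN 0 (by norm_num) 0)
  have h1 : HasFDerivAt (fun y => UnitAddTorus.mFourier p (proj y))
      (fderiv ℝ (fun y => UnitAddTorus.mFourier p (proj y)) z.1) z.1 :=
    ((contDiff_mFourier_proj p).differentiable (by simp)).differentiableAt.hasFDerivAt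
  have h2 : HasFDerivAt c (fderiv ℝ c z.2) z.2 :=
    (hcs.differentiable (by simp)).differentiableAt.hasFDerivAt
  have h3 := (h1.comp z hasFDerivAt_fst).mul (h2.comp z hasFDerivAt_snd)
  have h4 : ‖fderiv ℝ (fun y => UnitAddTorus.mFourier p (proj y)) z.1‖ ≤ N := by
    have := hN 1 (by norm_num) z.1
    rwa [norm_iteratedFDeriv_one] at this
  have h5 : HasFDerivAt (liftPhase (modeFn p c)) _ z := h3
  rw [h5.fderiv]
  refine (norm_add_le _ _).trans ?_
  rw [norm_smul, norm_smul, add_comm]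
  refine add_le_add ?_ ?_
  · rw [mul_comm]
    refine mul_le_mul ?_ (hc _) (norm_nonneg _) hN0
    exact (ContinuousLinearMap.opNorm_comp_le _ _).trans ((mul_le_of_le_one_right (norm_nonneg _)
      (ContinuousLinearMap.norm_fst_le ..)).trans h4)
  · simp only [Function.comp_apply, norm_mFourier_apply, one_mul]
    exact (ContinuousLinearMap.opNorm_comp_le _ _).trans ((mul_le_of_le_one_right (norm_nonneg _)
      (ContinuousLinearMap.norm_snd_le ..)).trans (hc' _))

/-! ### A countable dense family of trigonometric polynomials -/

/-- A dense sequence of coefficients with support in the ball of radius `n.1`. -/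
def denseCoeff : ℕ × ℕ → Cot → ℂ := exists_countable_dense_coeff.choose

lemma contDiff_denseCoeff (n : ℕ × ℕ) : ContDiff ℝ ∞ (denseCoeff n) :=
  exists_countable_dense_coeff.choose_spec.1 n

lemma denseCoeff_eq_zero {n : ℕ × ℕ} {w : Cot} (h : (n.1 : ℝ) < ‖w‖) : denseCoeff n w = 0 :=
  exists_countable_dense_coeff.choose_spec.2.1 n w h

lemma hasCompactSupport_denseCoeff (n : ℕ × ℕ) : HasCompactSupport (denseCoeff n) :=
  hasCompactSupport_cot_of_bound fun _ => denseCoeff_eq_zero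

/-- Finite sums of modes with coefficients in the dense sequence. -/
def trigSum (R : ℕ) (f : Finset (Z2 × ℕ)) : Om → ℂ :=
  ∑ q ∈ f, modeFn q.1 (denseCoeff (R, q.2))

lemma trigSum_mem_test (R : ℕ) (f : Finset (Z2 × ℕ)) : trigSum R f ∈ Test :=
  Submodule.sum_mem _ fun q _ =>
    modeFn_mem_test q.1 (contDiff_denseCoeff _) (hasCompactSupport_denseCoeff _)

lemma trigSum_eq_zero {R : ℕ} {f : Finset (Z2 × ℕ)} {z : Om} (h : (R : ℝ) < ‖z.2‖) :
    trigSum R f z = 0 := by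
  rw [trigSum, Finset.sum_apply]
  refine Finset.sum_eq_zero fun q _ => ?_
  rw [modeFn, denseCoeff_eq_zero h, mul_zero]

/-- Two successive approximations: by finitely many modes with smooth coefficients, then of these
coefficients by members of the dense sequence. The full first derivative is controlled besides the
norm of 𝓑, because the field of p_Λ also acts in η. -/
lemma exists_trigSum_approx {a : Om → ℂ} (ha : a ∈ Test) {R : ℕ}
    (hR : ∀ z : Om, (R : ℝ) < ‖z.2‖ → a z = 0) {δ : ℝ} (hδ : 0 < δ) :
    ∃ f, B3LE (a - trigSum R f) δ ∧ ∀ z, ‖fderiv ℝ (liftPhase (a - trigSum R f)) z‖ ≤ δ := by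
  obtain ⟨F, c, hc, hcR, hF⟩ := exists_trig_approx ha hR (half_pos hδ)
  choose N hN0 hN using exists_c3LE_mFourier
  set S := ∑ p ∈ F, (N p + 1) with hS
  have hS0 : 0 ≤ S := Finset.sum_nonneg fun p _ => by linarith [hN0 p]
  -- A coefficient that is κ-small with its derivative costs at most (N p + 1)κ on the mode p, so
  -- all the replacements cost at most Sκ ≤ δ/2.
  set κ := δ / 2 / (S + 1) with hκ
  have hκ0 : 0 < κ := by positivity
  have hκS : S * κ ≤ δ / 2 := by
    rw [hκ, mul_div_assoc', div_le_iff₀ (by positivity)]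
    nlinarith
  choose i hi using fun p => exists_countable_dense_coeff.choose_spec.2.2 R (c p) (hc p) (hcR p) κ hκ0
  have hinj : Set.InjOn (fun p => (p, i p)) (F : Set Z2) := fun p _ q _ h => congrArg Prod.fst h
  have hsum : trigSum R (F.image fun p => (p, i p)) =
      ∑ p ∈ F, modeFn p (denseCoeff (R, i p)) := Finset.sum_image hinj
  have hcs : ∀ p, HasCompactSupport (c p) := fun p => hasCompactSupport_cot_of_bound (hcR p)
  let d : Z2 → Cot → ℂ := fun p w => c p w - denseCoeff (R, i p) w
  have hd : ∀ p, ContDiff ℝ ∞ (d p) := fun p => (hc p).sub (contDiff_denseCoeff _)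
  have hdR : ∀ p w, (R : ℝ) < ‖w‖ → d p w = 0 := fun p w hw => by
    simp [d, hcR p w hw, denseCoeff_eq_zero (n := (R, i p)) hw]
  have hdn : ∀ p w, ‖d p w‖ ≤ κ := fun p w => (hi p w).1
  have hdn' : ∀ p w, ‖fderiv ℝ (d p) w‖ ≤ κ := fun p w => by
    have : fderiv ℝ (d p) w = fderiv ℝ (c p) w - fderiv ℝ (denseCoeff (R, i p)) w :=
      fderiv_fun_sub ((hc p).differentiable (by simp)).differentiableAt
        ((contDiff_denseCoeff _).differentiable (by simp)).differentiableAt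
    rw [this]
    exact (hi p w).2
  have hdT : ∀ p, modeFn p (d p) ∈ Test := fun p =>
    modeFn_mem_test p (hd p) (hasCompactSupport_cot_of_bound (hdR p))
  set b := a - ∑ p ∈ F, modeFn p (c p) with hb
  have hbT : b ∈ Test := Submodule.sub_mem _ ha (Submodule.sum_mem _ fun p _ =>
    modeFn_mem_test p (hc p) (hcs p))
  have hsplit : a - trigSum R (F.image fun p => (p, i p)) = b + ∑ p ∈ F, modeFn p (d p) := by
    rw [hsum, hb]
    have : ∑ p ∈ F, modeFn p (d p) =
        ∑ p ∈ F, modeFn p (c p) - ∑ p ∈ F, modeFn p (denseCoeff (R, i p)) := by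
      rw [← Finset.sum_sub_distrib]
      refine Finset.sum_congr rfl fun p _ => ?_
      funext z
      simp [modeFn, d, mul_sub]
    rw [this]
    abel
  have hsumT : ∀ G : Finset Z2, ∑ p ∈ G, modeFn p (d p) ∈ Test := fun G =>
    Submodule.sum_mem _ fun p _ => hdT p
  have h1 : ∀ G : Finset Z2, B3LE (∑ p ∈ G, modeFn p (d p)) (∑ p ∈ G, (N p + 1) * κ) ∧
      ∀ z, ‖fderiv ℝ (liftPhase (∑ p ∈ G, modeFn p (d p))) z‖ ≤ ∑ p ∈ G, (N p + 1) * κ := by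
    classical
    intro G
    induction G using Finset.induction_on with
    | empty =>
      simp only [Finset.sum_empty]
      refine ⟨fun w j _ x => ?_, fun z => ?_⟩
      · have : (fun y : Fin 2 → ℝ => (0 : Om → ℂ) (proj y, w)) = fun _ => 0 := rfl
        rw [this, iteratedFDeriv_fun_zero]
        simp
      · have : liftPhase (0 : Om → ℂ) = fun _ => 0 := rfl
        rw [this, fderiv_fun_const]
        simp
    | insert p G hp ih =>
      rw [Finset.sum_insert hp, Finset.sum_insert hp]
      refine ⟨B3LE.add (hdT p) (hsumT G) (fun w => (b3LE_modeFn (hN p) (hdn p) w).mono ?_) ih.1,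
        fun z => ?_⟩
      · nlinarith
      · have h2 : liftPhase (modeFn p (d p) + ∑ p ∈ G, modeFn p (d p)) =
            liftPhase (modeFn p (d p)) + liftPhase (∑ p ∈ G, modeFn p (d p)) := rfl
        rw [h2, fderiv_add ((hdT p).1.differentiable (by simp)).differentiableAt
          ((hsumT G).1.differentiable (by simp)).differentiableAt]
        refine (norm_add_le _ _).trans (add_le_add ?_ (ih.2 z))
        have := norm_fderiv_modeFn_le (hN p) (hd p) (hdn p) (hdn' p) z
        linarith
  have h3 : ∑ p ∈ F, (N p + 1) * κ ≤ δ / 2 := by rw [← Finset.sum_mul]; exact hκS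
  refine ⟨F.image fun p => (p, i p), ?_, fun z => ?_⟩
  · rw [hsplit]
    intro w
    refine (B3LE.add hbT (hsumT F) (B3LE.of_lift hbT hF) (h1 F).1 w).mono ?_
    linarith
  · rw [hsplit]
    have h2 : liftPhase (b + ∑ p ∈ F, modeFn p (d p)) =
        liftPhase b + liftPhase (∑ p ∈ F, modeFn p (d p)) := rfl
    rw [h2, fderiv_add (hbT.1.differentiable (by simp)).differentiableAt
      ((hsumT F).1.differentiable (by simp)).differentiableAt]
    refine (norm_add_le _ _).trans ?_
    have h4 := hF 1 (by norm_num) z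
    rw [norm_iteratedFDeriv_one] at h4
    linarith [(h1 F).2 z]

end

/-! ### Positive functionals on test functions are finite measures. -/

section

/-! ### Representation of positive functionals by measures -/

/-- The nonnegative reals, inside the complex numbers. -/
def nonnegC : Set ℂ := {z | 0 ≤ z.re ∧ z.im = 0}

lemma isClosed_nonnegC : IsClosed nonnegC :=
  (isClosed_le continuous_const Complex.continuous_re).inter
    (isClosed_eq Complex.continuous_im continuous_const)

/-- The functional is nonnegative on the squares of a dense family of trigonometric polynomials. -/
def PosOnSquares (L : Symbols →ₗ[ℂ] ℂ) : Prop :=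
  ∀ (R : ℕ) (f : Finset (Z2 × ℕ)),
    L (toSym ⟨trigSum R f * fun z => conj (trigSum R f z),
      Test.mul (trigSum_mem_test R f) (Test.conj (trigSum_mem_test R f))⟩) ∈ nonnegC

lemma exists_nat_support {a : Om → ℂ} (ha : a ∈ Test) :
    ∃ R : ℕ, ∀ z : Om, (R : ℝ) < ‖z.2‖ → a z = 0 := by
  obtain ⟨R, hR⟩ := exists_support_bound ha.2
  obtain ⟨n, hn⟩ := exists_nat_ge R
  exact ⟨n, fun z hz => hR z (hn.trans_lt hz)⟩

variable {L : Symbols →ₗ[ℂ] ℂ} {C : ℝ}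

lemma BDualBound.norm_le (hL : BDualBound L C) {a : Om → ℂ} (ha : a ∈ Test) {K : ℝ}
    (h : B3LE a K) : ‖L (toSym ⟨a, ha⟩)‖ ≤ C * K :=
  hL _ K (h.bNormLE ha)

/-- Positivity is given on a countable family of squares; boundedness on 𝓑 and density of the
trigonometric sums carry it to all squares. -/
lemma PosOnSquares.mul_conj_mem (hL : BDualBound L C) (hpos : PosOnSquares L) {b : Om → ℂ}
    (hb : b ∈ Test) : L (toSym ⟨b * fun z => conj (b z), Test.mul hb (Test.conj hb)⟩) ∈ nonnegC := by
  obtain ⟨R, hR⟩ := exists_nat_support hb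
  obtain ⟨M, hM0, hM⟩ := Test.exists_c3LE hb
  have hMb := B3LE.of_lift hb hM
  have hC : 0 ≤ |C| := abs_nonneg C
  refine isClosed_nonnegC.mem_of_frequently_of_tendsto (b := atTop) (f := fun n : ℕ =>
    L (toSym ⟨trigSum R (exists_trigSum_approx hb hR (Nat.one_div_pos_of_nat (n := n))).choose *
      fun z => conj (trigSum R (exists_trigSum_approx hb hR
        (Nat.one_div_pos_of_nat (α := ℝ) (n := n))).choose z),
      Test.mul (trigSum_mem_test R _) (Test.conj (trigSum_mem_test R _))⟩))
    (Frequently.of_forall fun n => hpos R _) ?_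
  rw [tendsto_iff_norm_sub_tendsto_zero]
  -- The identity t t̄ - b b̄ = -((b - t) b̄ + t conj(b - t)) and the product rule for the norm
  -- bound the error by |C|(8δM + 8(M + δ)δ), which is at most |C|·16(M + 1)δ as δ ≤ 1.
  refine squeeze_zero (fun _ => norm_nonneg _)
    (g := fun n : ℕ => |C| * (16 * (M + 1) * (1 / ((n : ℝ) + 1)))) (fun n => ?_) ?_
  · have h1 := (exists_trigSum_approx hb hR (Nat.one_div_pos_of_nat (α := ℝ) (n := n))).choose_spec.1
    set f := (exists_trigSum_approx hb hR (Nat.one_div_pos_of_nat (α := ℝ) (n := n))).choose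
    set δ : ℝ := 1 / ((n : ℝ) + 1) with hδ
    have hδ0 : 0 < δ := by positivity
    have hδ1 : δ ≤ 1 := by
      rw [hδ, div_le_one (by positivity)]
      linarith [(Nat.cast_nonneg n : (0 : ℝ) ≤ n)]
    set t := trigSum R f with ht
    have htT : t ∈ Test := trigSum_mem_test R f
    have hdT : b - t ∈ Test := Submodule.sub_mem _ hb htT
    have htM : B3LE t (M + δ) := by
      have h2 : B3LE (-(b - t)) δ := fun w j hj x => by
        have h3 : (fun y => (-(b - t)) (proj y, w)) = -fun y => (b - t) (proj y, w) := rfl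
        rw [h3, iteratedFDeriv_neg, Pi.neg_apply, norm_neg]
        exact h1 w j hj x
      have h3 := B3LE.add hb (Submodule.neg_mem _ hdT) hMb h2
      simpa using h3
    have e1 : (⟨t * fun z => conj (t z), Test.mul htT (Test.conj htT)⟩ : Test) -
        ⟨b * fun z => conj (b z), Test.mul hb (Test.conj hb)⟩ =
        -(⟨(b - t) * (fun z => conj (b z)) + t * fun z => conj ((b - t) z),
          Submodule.add_mem _ (Test.mul hdT (Test.conj hb)) (Test.mul htT (Test.conj hdT))⟩ : Test) := by
      apply Subtype.ext
      funext z
      simp only [Submodule.coe_sub, Submodule.coe_neg, Pi.sub_apply, Pi.neg_apply, Pi.add_apply,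
        Pi.mul_apply, map_sub]
      ring
    rw [← map_sub, ← map_sub, e1, map_neg, map_neg, norm_neg]
    refine (hL.norm_le _ (B3LE.add (Test.mul hdT (Test.conj hb)) (Test.mul htT (Test.conj hdT))
      (B3LE.mul hdT (Test.conj hb) h1 hMb.conj) (B3LE.mul htT (Test.conj hdT) htM h1.conj))).trans ?_
    refine (mul_le_mul_of_nonneg_right (le_abs_self C) (by positivity)).trans ?_
    gcongr
    nlinarith [mul_le_mul_of_nonneg_left hδ1 hδ0.le]
  · have := ((tendsto_one_div_add_atTop_nhds_zero_nat (𝕜 := ℝ)).const_mul (16 * (M + 1))).const_mul |C|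
    simpa using this

lemma ofReal_cut_mem_test (R : ℕ) : (fun z : Om => ((cut R z.2 : ℝ) : ℂ)) ∈ Test := by
  refine ⟨Complex.ofRealCLM.contDiff.comp ((contDiff_cut R).comp contDiff_snd),
    hasCompactSupport_of_bound (R := R + 2) fun z hz => ?_⟩
  rw [cut_eq_zero hz]
  rfl

lemma b3LE_cut (R : ℕ) : B3LE (fun z => ((cut R z.2 : ℝ) : ℂ)) 1 := fun w j hj x => by
  rcases Nat.eq_zero_or_pos j with rfl | h
  · rw [norm_iteratedFDeriv_zero, Complex.norm_real, Real.norm_eq_abs, abs_of_nonneg (cut R).nonneg]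
    exact (cut R).le_one
  · have h2 : (fun y : Fin 2 → ℝ => (fun z : Om => ((cut R z.2 : ℝ) : ℂ)) (proj y, w)) =
      fun _ => ((cut R w : ℝ) : ℂ) := rfl
    rw [h2, iteratedFDeriv_const_of_ne h.ne', Pi.zero_apply, norm_zero]
    exact zero_le_one

/-- The square root of r need not be smooth. With a cut-off χ equal to 1 where r ≠ 0, the function r
+ δχ² = (χ√(r + δ))² is the square of a test function; then δ → 0. -/
lemma PosOnSquares.of_nonneg (hL : BDualBound L C) (hpos : PosOnSquares L) {r : Om → ℝ}
    (hr : (fun z => (r z : ℂ)) ∈ Test) (hr0 : ∀ z, 0 ≤ r z) :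
    L (toSym ⟨fun z => (r z : ℂ), hr⟩) ∈ nonnegC := by
  obtain ⟨R, hR⟩ := exists_nat_support hr
  have hlift : ContDiff ℝ ∞ fun z : Cover => r (proj z.1, z.2) :=
    Complex.reCLM.contDiff.comp hr.1
  let χ : Test := ⟨_, ofReal_cut_mem_test R⟩
  let χ2 : Test := ⟨χ.1 * fun z => conj (χ.1 z), Test.mul χ.2 (Test.conj χ.2)⟩
  let r' : Test := ⟨fun z => (r z : ℂ), hr⟩
  have hδ : ∀ δ : ℝ, 0 < δ → L (toSym r') + (δ : ℂ) * L (toSym χ2) ∈ nonnegC := fun δ hδ => by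
    let b : Om → ℂ := fun z => ((cut R z.2 * Real.sqrt (r z + δ) : ℝ) : ℂ)
    have hb : b ∈ Test := by
      refine ⟨Complex.ofRealCLM.contDiff.comp (((contDiff_cut R).comp contDiff_snd).mul
        ((hlift.add contDiff_const).sqrt fun z => ?_)),
        hasCompactSupport_of_bound (R := R + 2) fun z hz => ?_⟩
      · have := hr0 (proj z.1, z.2)
        positivity
      · simp only [b]
        rw [cut_eq_zero hz, zero_mul, Complex.ofReal_zero]
    have h1 := hpos.mul_conj_mem hL hb
    have h2 : (⟨b * fun z => conj (b z), Test.mul hb (Test.conj hb)⟩ : Test) = r' + (δ : ℂ) • χ2 := by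
      apply Subtype.ext
      funext z
      have h3 := Real.mul_self_sqrt (add_nonneg (hr0 z) hδ.le)
      simp only [b, r', χ2, χ, Submodule.coe_add, Submodule.coe_smul, Pi.mul_apply, Pi.add_apply,
        Pi.smul_apply, Complex.conj_ofReal, smul_eq_mul]
      norm_cast
      by_cases hz : (R : ℝ) < ‖z.2‖
      · have h4 : r z = 0 := by have := hR z hz; exact_mod_cast this
        rw [h4] at h3 ⊢
        linear_combination (cut R z.2) ^ 2 * h3
      · rw [cut_eq_one (by linarith)]
        linear_combination h3
    rw [h2, map_add, map_add, map_smul, map_smul] at h1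
    exact h1
  refine isClosed_nonnegC.mem_of_frequently_of_tendsto (b := 𝓝[>] (0 : ℝ))
    (f := fun δ : ℝ => L (toSym r') + (δ : ℂ) * L (toSym χ2))
    (Eventually.frequently (eventually_mem_nhdsWithin.mono hδ)) ?_
  have h5 : Continuous fun δ : ℝ => L (toSym r') + (δ : ℂ) * L (toSym χ2) := by fun_prop
  have h6 := (h5.tendsto 0).mono_left (nhdsWithin_le_nhds (s := Set.Ioi 0))
  simpa using h6

open scoped CompactlySupported in
-- No continuity in the uniform norm is known in advance. The extension theorem of M. Riesz needs
-- only positivity and the fact that multiples of the cut-offs dominate compactly supported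
-- functions; the Riesz–Markov–Kakutani theorem then gives the measure. Its mass is read on the
-- cut-offs, of norm at most 1 in 𝓑 whatever their radius, since they do not depend on x.
lemma PosOnSquares.exists_measure_re (hL : BDualBound L C) (hpos : PosOnSquares L) :
    ∃ M : Measure Om, M Set.univ ≤ ENNReal.ofReal |C| ∧
      ∀ (r : Om → ℝ) (hr : (fun z => (r z : ℂ)) ∈ Test),
      (L (toSym ⟨_, hr⟩)).re = ∫ z, r z ∂M := by
  let P : Submodule ℝ C_c(Om, ℝ) :=
    { carrier := {f | (fun z => (f z : ℂ)) ∈ Test}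
      zero_mem' := by
        have : (fun z => (((0 : C_c(Om, ℝ)) z : ℝ) : ℂ)) = 0 := by funext z; simp
        rw [Set.mem_ofPred_eq, this]
        exact Submodule.zero_mem _
      add_mem' := fun {f g} hf hg => by
        have : (fun z => (((f + g : C_c(Om, ℝ)) z : ℝ) : ℂ)) =
          (fun z => (f z : ℂ)) + fun z => (g z : ℂ) := by funext z; simp
        rw [Set.mem_ofPred_eq, this]
        exact Submodule.add_mem _ hf hg
      smul_mem' := fun c f hf => by
        have : (fun z => (((c • f : C_c(Om, ℝ)) z : ℝ) : ℂ)) = (c : ℂ) • fun z => (f z : ℂ) := by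
          funext z; simp
        rw [Set.mem_ofPred_eq, this]
        exact Submodule.smul_mem _ _ hf }
  let ℓ : P →ₗ[ℝ] ℝ :=
    { toFun := fun f => (L (toSym ⟨_, f.2⟩)).re
      map_add' := fun f g => by
        rw [← Complex.add_re, ← map_add, ← map_add]
        congr 3
        apply Subtype.ext
        funext z
        simp
      map_smul' := fun c f => by
        have : (⟨_, (c • f).2⟩ : Test) = (c : ℂ) • (⟨_, f.2⟩ : Test) := by
          apply Subtype.ext
          funext z
          simp
        rw [this, map_smul, map_smul, smul_eq_mul, Complex.re_ofReal_mul]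
        rfl }
  have hχP : ∀ R, (⟨⟨fun z : Om => cut R z.2, (contDiff_cut R).continuous.comp continuous_snd⟩,
      by
        refine HasCompactSupport.intro (K := Set.univ ×ˢ Metric.closedBall 0 (R + 2))
          (isCompact_univ.prod (isCompact_closedBall 0 _)) fun z hz => cut_eq_zero ?_
        by_contra h'
        exact hz ⟨trivial, by simpa using h'⟩⟩ : C_c(Om, ℝ)) ∈ P := fun R => ofReal_cut_mem_test R
  set χ : ℕ → P := fun R => ⟨_, hχP R⟩ with hχ
  have hχv : ∀ R z, (χ R : C_c(Om, ℝ)) z = cut R z.2 := fun _ _ => rfl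
  obtain ⟨g, hg, hg0⟩ := riesz_extension (E := C_c(Om, ℝ))
    { carrier := {f | ∀ z, 0 ≤ f z}
      zero_mem' := fun z => le_rfl
      add_mem' := fun hf hg z => add_nonneg (hf z) (hg z)
      smul_mem' := fun c f hf z => mul_nonneg c.2 (hf z) } ⟨P, ℓ⟩
    (fun f hf => (hpos.of_nonneg hL f.2 hf).1) (fun y => by
      have hyc : HasCompactSupport fun z => (y z : ℂ) := y.hasCompactSupport.comp_left Complex.ofReal_zero
      obtain ⟨R, hR⟩ := exists_support_bound hyc
      obtain ⟨n, hn⟩ := exists_nat_ge R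
      obtain ⟨K, hK⟩ := y.hasCompactSupport.exists_bound_of_continuous y.continuous
      refine ⟨(|K|) • χ n, fun z => ?_⟩
      have h1 : ((((|K|) • χ n : P) : C_c(Om, ℝ)) + y) z = |K| * cut n z.2 + y z := rfl
      rw [h1]
      by_cases hz : (n : ℝ) < ‖z.2‖
      · have : y z = 0 := by exact_mod_cast hR z (hn.trans_lt hz)
        rw [this, add_zero]
        exact mul_nonneg (abs_nonneg _) (cut n).nonneg
      · rw [cut_eq_one (by linarith)]
        have := (hK z).trans (le_abs_self K)
        rw [Real.norm_eq_abs] at this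
        linarith [neg_abs_le (y z)])
  let Λ : C_c(Om, ℝ) →ₚ[ℝ] ℝ := PositiveLinearMap.mk₀ g fun f hf => hg0 f hf
  have hΛ : ∀ f : P, Λ f = (L (toSym ⟨_, f.2⟩)).re := fun f => hg f
  set M := RealRMK.rieszMeasure Λ with hM
  have hfin : M Set.univ ≤ ENNReal.ofReal |C| := by
    have h1 : (Set.univ : Set Om) = ⋃ R : ℕ, Set.univ ×ˢ Metric.closedBall (0 : Cot) R := by
      ext z
      obtain ⟨n, hn⟩ := exists_nat_ge ‖z.2‖
      simp only [Set.mem_univ, Set.mem_iUnion, true_iff]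
      exact ⟨n, trivial, by simpa using hn⟩
    rw [h1, Monotone.measure_iUnion]
    · refine iSup_le fun R => (RealRMK.rieszMeasure_le_of_eq_one Λ (f := χ R)
        (fun z => (cut R).nonneg) (isCompact_univ.prod (isCompact_closedBall _ _))
        fun z hz => cut_eq_one ?_).trans ?_
      · have := hz.2
        rw [mem_closedBall_zero_iff] at this
        linarith
      · refine ENNReal.ofReal_le_ofReal ?_
        rw [hΛ]
        refine (Complex.re_le_norm _).trans ((hL.norm_le _ (b3LE_cut R)).trans ?_)
        rw [mul_one]
        exact le_abs_self C
    · intro m n hmn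
      exact Set.prod_mono le_rfl (Metric.closedBall_subset_closedBall (by exact_mod_cast hmn))
  have hfinM : IsFiniteMeasure M := ⟨hfin.trans_lt ENNReal.ofReal_lt_top⟩
  refine ⟨M, hfin, fun r hr => ?_⟩
  have hc : Continuous r := Complex.continuous_re.comp (Test.continuous hr)
  have hs : HasCompactSupport r := hr.2.comp_left (g := Complex.re) Complex.zero_re
  let f : P := ⟨⟨⟨r, hc⟩, hs⟩, hr⟩
  exact (hΛ f).symm.trans (RealRMK.integral_rieszMeasure Λ (f : C_c(Om, ℝ))).symm

lemma PosOnSquares.exists_measure (hL : BDualBound L C) (hpos : PosOnSquares L) :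
    ∃ M : Measure Om, IsFiniteMeasure M ∧ M.real Set.univ ≤ |C| ∧
      ∀ a (ha : a ∈ Test), L (toSym ⟨a, ha⟩) = ∫ z, a z ∂M := by
  obtain ⟨M, hfin, hM⟩ := hpos.exists_measure_re hL
  have hfinM : IsFiniteMeasure M := ⟨hfin.trans_lt ENNReal.ofReal_lt_top⟩
  have hreal : ∀ (r : Om → ℝ) (hr : (fun z => (r z : ℂ)) ∈ Test),
      L (toSym ⟨_, hr⟩) = ((∫ z, r z ∂M : ℝ) : ℂ) := fun r hr => by
    have hc : Continuous r := Complex.continuous_re.comp (Test.continuous hr)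
    have hs : HasCompactSupport r := hr.2.comp_left (g := Complex.re) Complex.zero_re
    -- A real test function is a difference of two nonnegative ones, r + |K|χ and |K|χ, on which L
    -- takes real values.
    have him : (L (toSym ⟨_, hr⟩)).im = 0 := by
      obtain ⟨n, hn⟩ := exists_nat_support hr
      obtain ⟨K, hK⟩ := hs.exists_bound_of_continuous hc
      have hχT : (fun z : Om => ((|K| * cut n z.2 : ℝ) : ℂ)) ∈ Test := by
        have := Submodule.smul_mem Test ((|K| : ℝ) : ℂ) (ofReal_cut_mem_test n)
        convert this using 1
        funext z
        simp
      have hsT : (fun z : Om => ((r z + |K| * cut n z.2 : ℝ) : ℂ)) ∈ Test := by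
        have := Submodule.add_mem Test hr hχT
        convert this using 1
        funext z
        simp
      have e1 := (hpos.of_nonneg hL hχT fun z => mul_nonneg (abs_nonneg _) (cut n).nonneg).2
      have e2 := (hpos.of_nonneg hL hsT fun z => by
        by_cases hz : (n : ℝ) < ‖z.2‖
        · have : r z = 0 := by exact_mod_cast hn z hz
          rw [this, zero_add]
          exact mul_nonneg (abs_nonneg _) (cut n).nonneg
        · rw [cut_eq_one (by linarith)]
          have := (hK z).trans (le_abs_self K)
          rw [Real.norm_eq_abs] at this
          linarith [neg_abs_le (r z)]).2
      have e3 : (⟨_, hsT⟩ : Test) = ⟨_, hr⟩ + ⟨_, hχT⟩ := by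
        apply Subtype.ext
        funext z
        simp
      rw [e3, map_add, map_add, Complex.add_im, e1, add_zero] at e2
      exact e2
    exact Complex.ext (by rw [hM, Complex.ofReal_re]) (by rw [him, Complex.ofReal_im])
  refine ⟨M, hfinM, ENNReal.toReal_le_of_le_ofReal (abs_nonneg _) hfin, fun a ha => ?_⟩
  have hre : (fun z => ((a z).re : ℂ)) ∈ Test :=
    ⟨(Complex.ofRealCLM.comp Complex.reCLM).contDiff.comp ha.1,
      HasCompactSupport.comp_left (g := fun z : ℂ => (z.re : ℂ)) ha.2 (by simp)⟩
  have him : (fun z => ((a z).im : ℂ)) ∈ Test :=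
    ⟨(Complex.ofRealCLM.comp Complex.imCLM).contDiff.comp ha.1,
      HasCompactSupport.comp_left (g := fun z : ℂ => (z.im : ℂ)) ha.2 (by simp)⟩
  have e : (⟨a, ha⟩ : Test) = ⟨_, hre⟩ + Complex.I • ⟨_, him⟩ := by
    apply Subtype.ext
    funext z
    simp only [Submodule.coe_add, Submodule.coe_smul, Pi.add_apply, Pi.smul_apply, smul_eq_mul]
    rw [mul_comm, Complex.re_add_im]
  have hint : Integrable a M := (Test.continuous ha).integrable_of_hasCompactSupport ha.2
  rw [e, map_add, map_add, map_smul, map_smul, hreal _ hre, hreal _ him]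
  have := integral_re_add_im hint
  rw [← this, smul_eq_mul, mul_comm]
  rfl

end

/-! ### The averaged potential, the flow of p_Λ and regularisation along it. -/

section

/-! ### The averaged potential -/

lemma len_pos {e : Z2} (he : e ≠ 0) : 0 < len e := by
  refine Real.sqrt_pos.mpr ((normSq_nonneg e).lt_of_ne fun h => he ?_)
  have h0 : toR e 0 * toR e 0 + toR e 1 * toR e 1 = 0 := by
    have := h.symm
    rwa [normSq, dotProduct, Fin.sum_univ_two] at this
  have h1 : toR e 0 = 0 := by nlinarith [mul_self_nonneg (toR e 0), mul_self_nonneg (toR e 1)]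
  have h2 : toR e 1 = 0 := by nlinarith [mul_self_nonneg (toR e 0), mul_self_nonneg (toR e 1)]
  funext i
  fin_cases i
  · exact Int.cast_eq_zero.mp h1
  · exact Int.cast_eq_zero.mp h2

/-- The integer vector `e^⊥`. -/
def perp (e : Z2) : Z2 := ![-e 1, e 0]

lemma len_smul_unitPerp {e : Z2} (he : e ≠ 0) : len e • unitPerp e = toR (perp e) := by
  rw [unitPerp, smul_smul, mul_inv_cancel₀ (len_pos he).ne', one_smul]
  funext i
  fin_cases i <;> simp [toR, perp]

lemma periodic_perp {e : Z2} (he : e ≠ 0) {E : Type} (f : T2 → E) (x : T2) :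
    Function.Periodic (fun s : ℝ => f (x + proj (s • unitPerp e))) (len e) := fun s => by
  beta_reduce
  rw [add_smul, len_smul_unitPerp he, proj_add, proj_toR, add_zero]

/-- The integrand has period L in s, since L times the unit vector is e^⊥ ∈ ℤ²; the integral over a
period does not depend on its origin. -/
lemma avg_add_perp {e : Z2} (he : e ≠ 0) {E : Type} [NormedAddCommGroup E] [NormedSpace ℝ E]
    (f : T2 → E) (x : T2) (s : ℝ) : avg e f (x + proj (s • unitPerp e)) = avg e f x := by
  have h1 : ∀ r : ℝ, f (x + proj (s • unitPerp e) + proj (r • unitPerp e)) =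
      f (x + proj ((r + s) • unitPerp e)) := fun r => by
    rw [add_assoc, ← proj_add, ← add_smul, add_comm s r]
  simp only [avg, h1]
  rw [intervalIntegral.integral_comp_add_right fun r => f (x + proj (r • unitPerp e)), zero_add,
    add_comm (len e), (periodic_perp he f x).intervalIntegral_add_eq s 0, zero_add]

lemma contDiff_avg {e : Z2} (he : e ≠ 0) {V : T2 → ℝ} (hV : SmoothOnTorus V) :
    SmoothOnTorus (avg e V) := by
  have h1 : (fun y => avg e V (proj y)) = fun y => (len e)⁻¹ •
      ∫ s, V (proj (y + s • unitPerp e)) ∂(volume.restrict (Set.Icc 0 (len e))) := by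
    funext y
    rw [avg, intervalIntegral.integral_of_le (len_pos he).le, integral_Icc_eq_integral_Ioc]
    rfl
  have h2 : IsFiniteMeasure (volume.restrict (Set.Icc 0 (len e))) :=
    ⟨by rw [Measure.restrict_apply_univ]; exact measure_Icc_lt_top⟩
  rw [SmoothOnTorus, h1]
  have h3 : ContDiff ℝ ∞ fun y => ∫ s, V (proj (y + s • unitPerp e))
      ∂(volume.restrict (Set.Icc 0 (len e))) := by
    refine contDiff_integral_param (Y := ℝ)
      (volume.restrict (Set.Icc 0 (len e))) isCompact_Icc
      (ae_restrict_mem measurableSet_Icc) (f := fun q : ℝ × (Fin 2 → ℝ) =>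
        V (proj (q.2 + q.1 • unitPerp e))) ?_
    exact ContDiff.comp (g := fun y => V (proj y)) hV
      (contDiff_snd.add (contDiff_fst.smul contDiff_const))
  exact h3.const_smul (len e)⁻¹

/-- The derivative `(e / L_Λ) · ∂_x I_Λ(V)`, as a function on the torus. -/
def dAvg (e : Z2) (V : T2 → ℝ) : T2 → ℂ := dirDeriv (unitDir e) fun x => ((avg e V x : ℝ) : ℂ)

lemma smoothC_dAvg {e : Z2} (he : e ≠ 0) {V : T2 → ℝ} (hV : SmoothOnTorus V) :
    SmoothC (dAvg e V) := (contDiff_avg he hV).smoothC.dirDeriv _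

lemma dAvg_proj {e : Z2} (he : e ≠ 0) {V : T2 → ℝ} (hV : SmoothOnTorus V) (y : Fin 2 → ℝ) :
    dAvg e V (proj y) = (derivAvg e V y : ℂ) := by
  rw [dAvg, dirDeriv_proj (contDiff_avg he hV).smoothC]
  have h1 : HasFDerivAt (fun y => avg e V (proj y)) (fderiv ℝ (fun y => avg e V (proj y)) y) y :=
    (ContDiff.differentiable (contDiff_avg he hV) (by simp)).differentiableAt.hasFDerivAt
  have h2 : HasFDerivAt (fun y => ((avg e V (proj y) : ℝ) : ℂ)) _ y :=
    Complex.ofRealCLM.hasFDerivAt.comp y h1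
  rw [h2.fderiv]
  rfl

lemma derivAvg_add_of_invariant {e : Z2} {V : T2 → ℝ} {w : Fin 2 → ℝ}
    (h : ∀ x, avg e V (x + proj w) = avg e V x) (y : Fin 2 → ℝ) :
    derivAvg e V (y + w) = derivAvg e V y := by
  have h1 : (fun y => avg e V (proj y)) = fun y => avg e V (proj (y + w)) :=
    funext fun y => by rw [proj_add, h]
  unfold derivAvg
  conv_rhs => rw [h1]
  rw [fderiv_comp_add_right (f := fun y => avg e V (proj y))]

lemma derivAvg_add_toR (e : Z2) (V : T2 → ℝ) (y : Fin 2 → ℝ) (k : Z2) :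
    derivAvg e V (y + toR k) = derivAvg e V y :=
  derivAvg_add_of_invariant (fun x => by rw [proj_toR, add_zero]) y

lemma derivAvg_add_perp {e : Z2} (he : e ≠ 0) (V : T2 → ℝ) (y : Fin 2 → ℝ) (s : ℝ) :
    derivAvg e V (y + s • unitPerp e) = derivAvg e V y :=
  derivAvg_add_of_invariant (fun x => avg_add_perp he V x s) y

/-! ### The flow -/

/-- The Hamiltonian vector field of `p_Λ`, on the covering space. -/
def field (e : Z2) (V : T2 → ℝ) (z : Cover) : Cover := (z.2.2 • unitDir e, 0, -derivAvg e V z.1)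

lemma contDiff_derivAvg {e : Z2} (he : e ≠ 0) {V : T2 → ℝ} (hV : SmoothOnTorus V) :
    ContDiff ℝ ∞ (derivAvg e V) := by
  have : derivAvg e V = fun y => (dAvg e V (proj y)).re := funext fun y => by
    rw [dAvg_proj he hV, Complex.ofReal_re]
  rw [this]
  exact Complex.reCLM.contDiff.comp (smoothC_dAvg he hV)

lemma contDiff_field {e : Z2} (he : e ≠ 0) {V : T2 → ℝ} (hV : SmoothOnTorus V) :
    ContDiff ℝ ∞ (field e V) :=
  ((contDiff_snd.comp contDiff_snd).smul contDiff_const).prodMk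
    (contDiff_const.prodMk ((contDiff_derivAvg he hV).comp contDiff_fst).neg)

lemma exists_derivAvg_bounds {e : Z2} (he : e ≠ 0) {V : T2 → ℝ} (hV : SmoothOnTorus V) :
    ∃ K : NNReal, 1 ≤ K ∧ (∀ y, |derivAvg e V y| ≤ K) ∧ LipschitzWith K (field e V) := by
  obtain ⟨N, hN, h⟩ := (smoothC_dAvg he hV).exists_c3LE
  have h0 : ∀ y, |derivAvg e V y| ≤ N := fun y => by
    have := h 0 (by norm_num) y
    rwa [norm_iteratedFDeriv_zero, dAvg_proj he hV, Complex.norm_real] at this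
  have h1 : ∀ y z, |derivAvg e V y - derivAvg e V z| ≤ N * ‖y - z‖ := fun y z => by
    have := Convex.norm_image_sub_le_of_norm_fderiv_le (𝕜 := ℝ) (f := fun y => dAvg e V (proj y))
      (s := Set.univ) (C := N) (x := z) (y := y)
      (fun x _ => (ContDiff.differentiable (smoothC_dAvg he hV) (by simp)).differentiableAt)
      (fun x _ => by have := h 1 (by norm_num) x; rwa [norm_iteratedFDeriv_one] at this)
      convex_univ trivial trivial
    rwa [dAvg_proj he hV, dAvg_proj he hV, ← Complex.ofReal_sub, Complex.norm_real] at this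
  have hN' : N ≤ N.toNNReal + 1 := by rw [Real.coe_toNNReal N hN]; linarith
  -- The 1 accounts for the component η e/L of the field; `N` bounds the force and its derivative.
  refine ⟨N.toNNReal + 1, le_add_self, fun y => (h0 y).trans (by push_cast; exact hN'),
    LipschitzWith.of_dist_le_mul fun y z => ?_⟩
  rw [dist_eq_norm, dist_eq_norm]
  push_cast
  have hyz1 : ‖y.1 - z.1‖ ≤ ‖y - z‖ := norm_fst_le (y - z)
  have hyz2 : ‖y.2.2 - z.2.2‖ ≤ ‖y - z‖ := (norm_snd_le (y - z).2).trans (norm_snd_le (y - z))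
  refine max_le ?_ (max_le ?_ ?_)
  · have : (field e V y - field e V z).1 = (y.2.2 - z.2.2) • unitDir e := (sub_smul _ _ _).symm
    rw [this, norm_smul]
    calc ‖y.2.2 - z.2.2‖ * ‖unitDir e‖ ≤ ‖y - z‖ * 1 := by gcongr; exact norm_unitDir_le e
      _ ≤ _ := by nlinarith [norm_nonneg (y - z), NNReal.coe_nonneg N.toNNReal]
  · have : (field e V y - field e V z).2.1 = 0 := sub_zero _
    rw [this, norm_zero]
    positivity
  · have : (field e V y - field e V z).2.2 = -(derivAvg e V y.1 - derivAvg e V z.1) := by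
      simp only [field, Prod.snd_sub]
      ring
    rw [this, norm_neg]
    calc _ ≤ N * ‖y.1 - z.1‖ := h1 _ _
      _ ≤ (N.toNNReal + 1) * ‖y - z‖ := by gcongr

open scoped Manifold in
-- On the ball of radius ‖F x‖/K about x the field is at most 2‖F x‖, so a solution started at x
-- lives for the time 1/(2K). This time does not depend on x, hence solutions extend to all times.
lemma exists_global_curve {E : Type} [NormedAddCommGroup E] [NormedSpace ℝ E] [CompleteSpace E]
    {F : E → E} (hF : ContDiff ℝ 1 F) {K : NNReal} (hK1 : 1 ≤ K) (hK : LipschitzWith K F) (x : E) :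
    ∃ γ : ℝ → E, γ 0 = x ∧ ∀ t, HasDerivAt γ (F (γ t)) t := by
  have hK0 : (0 : ℝ) < K := by exact_mod_cast one_pos.trans_le hK1
  have hloc : ∀ x, ∃ γ : ℝ → E, γ 0 = x ∧
      IsMIntegralCurveOn (I := 𝓘(ℝ, E)) γ (fun x => (F x : E))
        (Set.Ioo (-(1 / (2 * (K : ℝ)))) (1 / (2 * K))) := fun x => by
    set T : ℝ := 1 / (2 * K) with hT
    have hT0 : 0 < T := by positivity
    let a : NNReal := ‖F x‖₊ / K
    have hp : IsPicardLindelof (fun _ => F) (tmin := -T) (tmax := T)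
        ⟨0, by constructor <;> linarith⟩ x a 0 (2 * ‖F x‖₊) K := by
      refine ⟨fun _ _ => hK.lipschitzOnWith, fun _ _ => continuousOn_const, fun _ _ y hy => ?_, ?_⟩
      · have h1 := hK.dist_le_mul y x
        rw [Metric.mem_closedBall] at hy
        have h2 : (K : ℝ) * dist y x ≤ ‖F x‖ := by
          calc (K : ℝ) * dist y x ≤ K * a := by gcongr
            _ = ‖F x‖ := by
              simp only [a, NNReal.coe_div, coe_nnnorm]
              field_simp
        rw [dist_eq_norm] at h1
        rw [NNReal.coe_mul, NNReal.coe_ofNat, coe_nnnorm]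
        have h3 : ‖F y‖ ≤ ‖F x‖ + ‖F y - F x‖ := by
          calc ‖F y‖ = ‖F x + (F y - F x)‖ := by congr 1; abel
            _ ≤ _ := norm_add_le _ _
        linarith
      · simp only [sub_zero, zero_sub, neg_neg, max_self, NNReal.coe_zero, a, NNReal.coe_div,
          coe_nnnorm, NNReal.coe_mul, NNReal.coe_ofNat, hT]
        apply le_of_eq
        field_simp
    obtain ⟨α, h0, hα⟩ := hp.exists_eq_forall_mem_Icc_hasDerivWithinAt₀
    refine ⟨α, h0, fun t ht => ?_⟩
    have h1 := (hα t (Set.Ioo_subset_Icc_self ht)).mono (Set.Ioo_subset_Icc_self)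
    exact h1.hasFDerivWithinAt.hasMFDerivWithinAt
  obtain ⟨γ, h0, hγ⟩ := exists_isMIntegralCurve_of_isMIntegralCurveOn (I := 𝓘(ℝ, E)) (M := E)
    (v := fun x => (F x : E)) (contMDiff_vectorSpace_iff_contDiff.mpr hF)
    (ε := 1 / (2 * K)) (by positivity) hloc x
  exact ⟨γ, h0, fun t => (hasMFDerivAt_iff_hasFDerivAt.mp (hγ t))⟩

end

section

/-! ### The flow on the covering space -/

/-- A globally Lipschitz vector field on the covering space, with the properties of the field of
`p_Λ` that govern its flow. -/
structure IsPLamField (e : Z2) (V : T2 → ℝ) (K : NNReal) : Prop where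
  one_le : 1 ≤ K
  contDiff : ContDiff ℝ ∞ (field e V)
  lipschitz : LipschitzWith K (field e V)
  derivAvg_le : ∀ y, |derivAvg e V y| ≤ K

lemma exists_isPLamField {e : Z2} (he : e ≠ 0) {V : T2 → ℝ} (hV : SmoothOnTorus V) :
    ∃ K, IsPLamField e V K := by
  obtain ⟨K, h1, h2, h3⟩ := exists_derivAvg_bounds he hV
  exact ⟨K, h1, contDiff_field he hV, h3, h2⟩

open Classical in
/-- The flow of the field of `p_Λ` on the covering space. -/
def flowCover (e : Z2) (V : T2 → ℝ) (t : ℝ) (z : Cover) : Cover :=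
  if h : ∃ γ : ℝ → Cover, γ 0 = z ∧ ∀ t, HasDerivAt γ (field e V (γ t)) t then h.choose t else z

variable {e : Z2} {V : T2 → ℝ} {K : NNReal} (h : IsPLamField e V K)
include h

lemma IsPLamField.flowCover_spec (z : Cover) : flowCover e V 0 z = z ∧
    ∀ t, HasDerivAt (fun t => flowCover e V t z) (field e V (flowCover e V t z)) t := by
  have hex := exists_global_curve (h.contDiff.of_le (by norm_cast)) h.one_le
    h.lipschitz z
  have : (fun t => flowCover e V t z) = hex.choose := by
    funext t
    rw [flowCover, dif_pos hex]
  have h0 : ∀ t, flowCover e V t z = hex.choose t := fun t => congrFun this t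
  rw [this, h0]
  simp only [h0]
  exact hex.choose_spec

lemma IsPLamField.flowCover_zero (z : Cover) : flowCover e V 0 z = z := (h.flowCover_spec z).1

lemma IsPLamField.hasDerivAt_flowCover (z : Cover) (t : ℝ) :
    HasDerivAt (fun t => flowCover e V t z) (field e V (flowCover e V t z)) t :=
  (h.flowCover_spec z).2 t

lemma IsPLamField.eq_flowCover {γ : ℝ → Cover} (hγ : ∀ t, HasDerivAt γ (field e V (γ t)) t)
    (t : ℝ) : γ t = flowCover e V t (γ 0) := by
  have := ODE_solution_unique_univ (v := fun _ => field e V) (s := fun _ => Set.univ) (K := K)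
    (f := γ) (g := fun t => flowCover e V t (γ 0)) (t₀ := 0)
    (fun t => h.lipschitz.lipschitzOnWith) (fun t => ⟨hγ t, trivial⟩)
    (fun t => ⟨h.hasDerivAt_flowCover _ t, trivial⟩) (h.flowCover_zero _).symm
  exact congrFun this t

lemma IsPLamField.flowCover_add (s t : ℝ) (z : Cover) :
    flowCover e V (s + t) z = flowCover e V t (flowCover e V s z) := by
  have := h.eq_flowCover (γ := fun t => flowCover e V (s + t) z)
    (fun t => (h.hasDerivAt_flowCover z (s + t)).comp_const_add s t) t
  simpa using this

/-- Serves twice: integer translations make the flow descend to the torus, and translations along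
e^⊥ make it commute with the average. -/
lemma IsPLamField.flowCover_translate {w : Fin 2 → ℝ}
    (hw : ∀ y, derivAvg e V (y + w) = derivAvg e V y) (t : ℝ) (z : Cover) :
    flowCover e V t (z + (w, 0)) = flowCover e V t z + (w, 0) := by
  have := h.eq_flowCover (γ := fun t => flowCover e V t z + (w, 0)) (fun t => by
    have h1 : field e V (flowCover e V t z + (w, 0)) = field e V (flowCover e V t z) := by
      simp [field, hw]
    rw [h1]
    exact (h.hasDerivAt_flowCover z t).add_const _) t
  rw [h.flowCover_zero] at this
  exact this.symm

lemma IsPLamField.flowCover_xi (t : ℝ) (z : Cover) : (flowCover e V t z).2.1 = z.2.1 := by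
  have h1 : ∀ t, HasDerivAt (fun t => (flowCover e V t z).2.1) 0 t := fun t =>
    (hasFDerivAt_fst.comp_hasDerivAt t (hasFDerivAt_snd.comp_hasDerivAt t
      (h.hasDerivAt_flowCover z t)) :)
  have := is_const_of_deriv_eq_zero (fun t => (h1 t).differentiableAt) (fun t => (h1 t).deriv) t 0
  rw [this, h.flowCover_zero]

lemma IsPLamField.hasDerivAt_fst (t : ℝ) (z : Cover) :
    HasDerivAt (fun t => (flowCover e V t z).1) ((flowCover e V t z).2.2 • unitDir e) t :=
  (hasFDerivAt_fst.comp_hasDerivAt t (h.hasDerivAt_flowCover z t) :)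

lemma IsPLamField.hasDerivAt_eta (t : ℝ) (z : Cover) :
    HasDerivAt (fun t => (flowCover e V t z).2.2) (-derivAvg e V (flowCover e V t z).1) t :=
  (hasFDerivAt_snd.comp_hasDerivAt t (hasFDerivAt_snd.comp_hasDerivAt t
      (h.hasDerivAt_flowCover z t)) :)

lemma IsPLamField.abs_eta_sub_le (s t : ℝ) (z : Cover) :
    |(flowCover e V t z).2.2 - (flowCover e V s z).2.2| ≤ K * |t - s| := by
  have := Convex.norm_image_sub_le_of_norm_hasDerivWithin_le (𝕜 := ℝ) (s := Set.univ)
    (f := fun t => (flowCover e V t z).2.2) (C := K) (x := s) (y := t)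
    (fun x _ => (h.hasDerivAt_eta x z).hasDerivWithinAt)
    (fun x _ => by rw [norm_neg]; exact h.derivAvg_le _) convex_univ trivial trivial
  exact this

lemma IsPLamField.norm_snd_sub_le (t : ℝ) (z : Cover) :
    ‖(flowCover e V t z).2 - z.2‖ ≤ K * |t| := by
  refine max_le ?_ ?_
  · rw [Prod.fst_sub, h.flowCover_xi, sub_self, norm_zero]
    positivity
  · have := h.abs_eta_sub_le 0 t z
    rw [h.flowCover_zero, sub_zero] at this
    exact this

lemma IsPLamField.dist_flowCover_le (t : ℝ) (y z : Cover) :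
    dist (flowCover e V t y) (flowCover e V t z) ≤ dist y z * Real.exp (K * |t|) := by
  rcases le_total 0 t with ht | ht
  · rw [abs_of_nonneg ht]
    have := dist_le_of_trajectories_ODE (v := fun _ => field e V) (K := K)
      (f := fun t => flowCover e V t y) (g := fun t => flowCover e V t z) (a := 0) (b := t)
      (δ := dist y z) (fun _ => h.lipschitz)
      (fun s _ => (h.hasDerivAt_flowCover y s).continuousAt.continuousWithinAt)
      (fun s _ => (h.hasDerivAt_flowCover y s).hasDerivWithinAt)
      (fun s _ => (h.hasDerivAt_flowCover z s).continuousAt.continuousWithinAt)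
      (fun s _ => (h.hasDerivAt_flowCover z s).hasDerivWithinAt)
      (by rw [h.flowCover_zero, h.flowCover_zero]) t ⟨ht, le_rfl⟩
    rwa [sub_zero] at this
  · rw [abs_of_nonpos ht]
    have hd : ∀ z s, HasDerivAt (fun s => flowCover e V (-s) z)
        (-field e V (flowCover e V (-s) z)) s := fun z s => by
      have := (h.hasDerivAt_flowCover z (-s)).scomp s (hasDerivAt_neg s)
      rw [neg_one_smul] at this
      exact this
    have := dist_le_of_trajectories_ODE (v := fun _ => -field e V) (K := K)
      (f := fun t => flowCover e V (-t) y) (g := fun t => flowCover e V (-t) z) (a := 0) (b := -t)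
      (δ := dist y z) (fun _ => h.lipschitz.neg)
      (fun s _ => (hd y s).continuousAt.continuousWithinAt)
      (fun s _ => (hd y s).hasDerivWithinAt)
      (fun s _ => (hd z s).continuousAt.continuousWithinAt)
      (fun s _ => (hd z s).hasDerivWithinAt)
      (by rw [neg_zero, h.flowCover_zero, h.flowCover_zero]) (-t) ⟨by linarith, le_rfl⟩
    rwa [sub_zero, neg_neg] at this

lemma IsPLamField.continuous_flowCover (t : ℝ) : Continuous (flowCover e V t) :=
  (LipschitzWith.of_dist_le_mul (K := (Real.exp (K * |t|)).toNNReal) fun y z => by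
    rw [Real.coe_toNNReal _ (Real.exp_pos _).le, mul_comm]
    exact h.dist_flowCover_le t y z).continuous

end

section

/-! ### Descent to the phase space -/

/-- The function on the phase space with a given periodic lift. -/
def descend {E : Type} (f : Cover → E) (z : Om) : E :=
  f (Function.surjInv proj_surjective z.1, z.2)

lemma descend_proj {E : Type} {f : Cover → E} (hf : ∀ z (k : Z2), f (z + (toR k, 0)) = f z)
    (z : Cover) : descend f (proj z.1, z.2) = f z := by
  obtain ⟨k, hk⟩ := exists_toR_of_proj_eq (Function.surjInv_eq proj_surjective (proj z.1))
  rw [descend, hk, ← hf z k]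
  congr 1
  exact Prod.ext rfl (add_zero _).symm

lemma liftPhase_descend {f : Cover → ℂ} (hf : ∀ z (k : Z2), f (z + (toR k, 0)) = f z) :
    liftPhase (descend f) = f := funext fun z => descend_proj hf z

lemma exists_lift (z : Om) : ∃ y : Cover, (proj y.1, y.2) = z := by
  obtain ⟨y, hy⟩ := proj_surjective z.1
  exact ⟨(y, z.2), Prod.ext hy rfl⟩

/-- The action of the vector field of `p_Λ` on functions. -/
def Xop (e : Z2) (V : T2 → ℝ) (a : Om → ℂ) : Om → ℂ :=
  descend fun z => fderiv ℝ (liftPhase a) z (field e V z)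

/-- The flow of `p_Λ` on the phase space. -/
def flowOm (e : Z2) (V : T2 → ℝ) (t : ℝ) : Om → Om :=
  descend fun z => (proj (flowCover e V t z).1, (flowCover e V t z).2)

lemma field_periodic (e : Z2) (V : T2 → ℝ) (z : Cover) (k : Z2) :
    field e V (z + (toR k, 0)) = field e V z := by
  simp [field, derivAvg_add_toR]

lemma liftPhase_Xop (e : Z2) (V : T2 → ℝ) (a : Om → ℂ) :
    liftPhase (Xop e V a) = fun z => fderiv ℝ (liftPhase a) z (field e V z) := by
  refine liftPhase_descend fun z k => ?_
  rw [field_periodic]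
  congr 1
  have : liftPhase a = fun z => liftPhase a (z + (toR k, 0)) :=
    funext fun z => (liftPhase_periodic a z k).symm
  conv_rhs => rw [this]
  rw [fderiv_comp_add_right]

variable {e : Z2} {V : T2 → ℝ} {K : NNReal} (h : IsPLamField e V K)
include h

lemma IsPLamField.flowOm_proj (t : ℝ) (z : Cover) :
    flowOm e V t (proj z.1, z.2) = (proj (flowCover e V t z).1, (flowCover e V t z).2) :=
  descend_proj (f := fun z => (proj (flowCover e V t z).1, (flowCover e V t z).2))
    (fun z k => by
      rw [h.flowCover_translate (fun y => derivAvg_add_toR e V y k)]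
      simp [proj_add, proj_toR]) z

lemma IsPLamField.liftPhase_comp_flowOm (t : ℝ) (a : Om → ℂ) :
    liftPhase (a ∘ flowOm e V t) = liftPhase a ∘ flowCover e V t :=
  funext fun z => congrArg a (h.flowOm_proj t z)

lemma IsPLamField.flowOm_zero (z : Om) : flowOm e V 0 z = z := by
  obtain ⟨y, rfl⟩ := exists_lift z
  rw [h.flowOm_proj, h.flowCover_zero]

lemma IsPLamField.continuous_flowOm (t : ℝ) : Continuous (flowOm e V t) := by
  refine continuous_of_lift (a := flowOm e V t) ?_
  have : (fun z : Cover => flowOm e V t (proj z.1, z.2)) =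
      fun z => (proj (flowCover e V t z).1, (flowCover e V t z).2) := funext (h.flowOm_proj t)
  rw [this]
  have h1 := h.continuous_flowCover t
  exact (continuous_proj.comp (continuous_fst.comp h1)).prodMk (continuous_snd.comp h1)

lemma IsPLamField.Xop_mem_test {a : Om → ℂ} (ha : a ∈ Test) : Xop e V a ∈ Test := by
  refine ⟨?_, ?_⟩
  · rw [liftPhase_Xop]
    exact (ha.1.fderiv_right (m := ∞) (by simp)).clm_apply h.contDiff
  · obtain ⟨R, hR⟩ := exists_support_bound ha.2
    refine hasCompactSupport_of_bound (R := R) fun z hz => ?_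
    obtain ⟨y, rfl⟩ := exists_lift z
    have h1 : liftPhase (Xop e V a) y = 0 := by
      rw [liftPhase_Xop]
      have h2 : liftPhase a =ᶠ[𝓝 y] fun _ => 0 := by
        have : Continuous fun z : Cover => ‖z.2‖ := by fun_prop
        filter_upwards [this.continuousAt.eventually_const_lt hz] with x hx
        exact hR _ hx
      simp only [h2.fderiv_eq, fderiv_fun_const]
      rfl
    exact h1

lemma IsPLamField.hasDerivAt_comp_flowCover {a : Om → ℂ} (ha : a ∈ Test) (z : Cover) (t : ℝ) :
    HasDerivAt (fun t => liftPhase a (flowCover e V t z))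
      (liftPhase (Xop e V a) (flowCover e V t z)) t := by
  rw [liftPhase_Xop]
  exact ((ha.1.differentiable (by simp)).differentiableAt.hasFDerivAt).comp_hasDerivAt t
    (h.hasDerivAt_flowCover z t)

omit h in
lemma Test.exists_lipschitz {a : Om → ℂ} (ha : a ∈ Test) :
    ∃ A, 0 ≤ A ∧ (∀ z, ‖a z‖ ≤ A) ∧ ∀ y z, ‖liftPhase a y - liftPhase a z‖ ≤ A * dist y z := by
  obtain ⟨A, hA, hC⟩ := Test.exists_c3LE ha
  refine ⟨A, hA, (B3LE.of_lift ha hC).norm_le, fun y z => ?_⟩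
  have := Convex.norm_image_sub_le_of_norm_fderiv_le (𝕜 := ℝ) (f := liftPhase a)
      (s := Set.univ) (C := A) (x := z) (y := y)
      (fun x _ => (ha.1.differentiable (by simp)).differentiableAt)
      (fun x _ => by have := hC 1 (by norm_num) x; rwa [norm_iteratedFDeriv_one] at this)
      convex_univ trivial trivial
  rwa [← dist_eq_norm y z] at this

/-- The velocities along two orbits differ by a multiple of the initial distance; integrating from 0
gains the factor |t| that Gronwall's bound on positions lacks. -/
lemma IsPLamField.norm_displacement_sub_le (x z : Cover) {t : ℝ} (ht : |t| ≤ 1) :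
    ‖(flowCover e V t z - z) - (flowCover e V t x - x)‖ ≤ K * Real.exp K * dist x z * |t| := by
  have h1 := Convex.norm_image_sub_le_of_norm_hasDerivWithin_le (𝕜 := ℝ) (s := Set.Icc (-1) 1)
    (f := fun t => flowCover e V t z - flowCover e V t x) (C := K * Real.exp K * dist x z)
    (x := 0) (y := t)
    (fun s _ => ((h.hasDerivAt_flowCover z s).sub (h.hasDerivAt_flowCover x s)).hasDerivWithinAt)
    (fun s hs => by
      rw [← dist_eq_norm]
      refine (h.lipschitz.dist_le_mul _ _).trans ?_
      rw [mul_assoc]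
      gcongr
      refine (h.dist_flowCover_le s z x).trans ?_
      rw [mul_comm, dist_comm]
      gcongr
      exact mul_le_of_le_one_right K.2 (abs_le.mpr hs))
    (convex_Icc _ _) (by simp) (abs_le.mp ht)
  rw [sub_zero, h.flowCover_zero, h.flowCover_zero] at h1
  have h2 : (flowCover e V t z - z) - (flowCover e V t x - x) =
      flowCover e V t z - flowCover e V t x - (z - x) := by abel
  rw [h2]
  exact h1

/-- This is the commutator estimate behind the mollification. Translating x by the displacement of z
misses the orbit of x by O(|t| dist x z), which the Lipschitz bound on f absorbs; along the true
orbits the difference of the values of f varies at the rate of the difference of the values of g. -/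
lemma IsPLamField.norm_increment_le {f g : Cover → ℂ} {A B : ℝ} (hB0 : 0 ≤ B)
    (hf : ∀ y z, ‖f y - f z‖ ≤ A * dist y z) (hg : ∀ y z, ‖g y - g z‖ ≤ B * dist y z)
    (hfg : ∀ z t, HasDerivAt (fun t => f (flowCover e V t z)) (g (flowCover e V t z)) t)
    (hA0 : 0 ≤ A) (x z : Cover) {t : ℝ} (ht : |t| ≤ 1) :
    ‖(f (flowCover e V t z - z + x) - f x) - (f (flowCover e V t z) - f z)‖ ≤
      (A * K + B) * Real.exp K * dist x z * |t| := by
  have h1 : ‖f (flowCover e V t z - z + x) - f (flowCover e V t x)‖ ≤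
      A * (K * Real.exp K * dist x z * |t|) := by
    refine (hf _ _).trans ?_
    gcongr
    rw [dist_eq_norm]
    have h3 : flowCover e V t z - z + x - flowCover e V t x =
      (flowCover e V t z - z) - (flowCover e V t x - x) := by abel
    rw [h3]
    exact h.norm_displacement_sub_le x z ht
  have h2 := Convex.norm_image_sub_le_of_norm_hasDerivWithin_le (𝕜 := ℝ) (s := Set.Icc (-1) 1)
    (f := fun t => f (flowCover e V t x) - f (flowCover e V t z)) (C := B * (Real.exp K * dist x z))
    (x := 0) (y := t)
    (fun s _ => ((hfg x s).sub (hfg z s)).hasDerivWithinAt)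
    (fun s hs => by
      refine (hg _ _).trans ?_
      gcongr
      refine (h.dist_flowCover_le s x z).trans ?_
      rw [mul_comm]
      gcongr
      exact mul_le_of_le_one_right K.2 (abs_le.mpr hs))
    (convex_Icc _ _) (by simp) (abs_le.mp ht)
  rw [sub_zero, h.flowCover_zero, h.flowCover_zero, Real.norm_eq_abs] at h2
  calc ‖(f (flowCover e V t z - z + x) - f x) - (f (flowCover e V t z) - f z)‖
      = ‖(f (flowCover e V t z - z + x) - f (flowCover e V t x)) +
          ((f (flowCover e V t x) - f (flowCover e V t z)) - (f x - f z))‖ := by congr 1; ring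
    _ ≤ _ := norm_add_le _ _
    _ ≤ A * (K * Real.exp K * dist x z * |t|) + B * (Real.exp K * dist x z) * |t| :=
        add_le_add h1 h2
    _ = _ := by ring

/-! ### Regularisation along the flow -/

open scoped Convolution in
/-- A Lipschitz function that is differentiable along the flow can be approximated by test functions,
together with its derivative along the flow. -/
lemma IsPLamField.exists_test_approx {f g : Om → ℂ} {A B R : ℝ} (hA0 : 0 ≤ A) (hB0 : 0 ≤ B)
    (hf : ∀ y z, ‖liftPhase f y - liftPhase f z‖ ≤ A * dist y z)
    (hg : ∀ y z, ‖liftPhase g y - liftPhase g z‖ ≤ B * dist y z)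
    (hfg : ∀ z t, HasDerivAt (fun t => liftPhase f (flowCover e V t z))
      (liftPhase g (flowCover e V t z)) t)
    (hR : ∀ z, R < ‖z.2‖ → f z = 0) {δ : ℝ} (hδ : 0 < δ) :
    ∃ a ∈ Test, (∀ z, ‖f z - a z‖ ≤ δ) ∧ ∀ z, ‖g z - Xop e V a z‖ ≤ δ := by
  -- At the mollification radius r the value of f is off by at most A r and its derivative along the
  -- flow by (A K + B)e^K r; both are at most C r ≤ δ.
  set C := A + (A * K + B) * Real.exp K with hC
  have hC0 : 0 ≤ C := by positivity
  set r := δ / (C + 1) with hr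
  have hr0 : 0 < r := by positivity
  have hCr : C * r ≤ δ := by
    rw [hr, mul_div_assoc', div_le_iff₀ (by positivity)]
    nlinarith
  let ρ : ContDiffBump (0 : Cover) := ⟨r / 2, r, by positivity, by linarith⟩
  have hfc : Continuous (liftPhase f) :=
    (LipschitzWith.of_dist_le_mul (K := A.toNNReal) fun y z => by
      rw [Real.coe_toNNReal A hA0, dist_eq_norm]; exact hf y z).continuous
  set b : Cover → ℂ := ρ.normed Measure.addHaar ⋆[ContinuousLinearMap.lsmul ℝ ℝ, Measure.addHaar] liftPhase f with hb
  have hbs : ContDiff ℝ ∞ b :=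
    ρ.hasCompactSupport_normed.contDiff_convolution_left _ ρ.contDiff_normed
      hfc.locallyIntegrable
  have hbper : ∀ z (k : Z2), b (z + (toR k, 0)) = b z := fun z k => by
    simp only [hb, convolution_def]
    congr 1
    funext t
    rw [add_sub_right_comm, liftPhase_periodic]
  have hexist : ∀ z, Integrable (fun t => ρ.normed Measure.addHaar t • liftPhase f (z - t)) Measure.addHaar :=
    fun z => ((ρ.continuous_normed).smul (hfc.comp (continuous_const.sub continuous_id)))
      |>.integrable_of_hasCompactSupport ρ.hasCompactSupport_normed.smul_right
  have hbv : ∀ z, b z = ∫ t, ρ.normed Measure.addHaar t • liftPhase f (z - t) ∂Measure.addHaar := fun z => rfl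
  have happrox : ∀ (q : Cover → ℂ) (z : Cover) (η : ℝ), Continuous q →
      (∀ x, dist x z ≤ r → ‖q x - q z‖ ≤ η) →
      ‖(∫ t, ρ.normed Measure.addHaar t • q (z - t) ∂Measure.addHaar) - q z‖ ≤ η := fun q z η hq hη => by
    have := ρ.dist_normed_convolution_le (μ := Measure.addHaar) (g := q) (x₀ := z) (ε := η)
      hq.aestronglyMeasurable fun x hx => by
        rw [dist_eq_norm]
        exact hη x (Metric.mem_ball.mp hx).le
    rw [dist_eq_norm] at this
    exact this
  have hlift : liftPhase (descend b) = b := liftPhase_descend hbper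
  have hT : descend b ∈ Test := by
    refine ⟨by rw [hlift]; exact hbs, hasCompactSupport_of_bound (R := R + r) fun z hz => ?_⟩
    obtain ⟨y, rfl⟩ := exists_lift z
    rw [descend_proj hbper, hbv]
    refine integral_eq_zero_of_ae (.of_forall fun t => ?_)
    by_cases ht : ‖t‖ < r
    · have : liftPhase f (y - t) = 0 := by
        refine hR _ ?_
        have h1 : ‖y.2‖ ≤ ‖y.2 - t.2‖ + ‖t.2‖ := by
          calc ‖y.2‖ = ‖(y.2 - t.2) + t.2‖ := by congr 1; abel
            _ ≤ _ := norm_add_le _ _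
        have h2 : ‖t.2‖ ≤ ‖t‖ := norm_snd_le t
        change R < ‖y.2 - t.2‖
        change R + r < ‖y.2‖ at hz
        linarith
      simp [this]
    · have : ρ.normed Measure.addHaar t = 0 := by
        have h3 : ρ t = 0 := ρ.zero_of_le_dist (by simpa [ρ] using ht)
        simp [ContDiffBump.normed, h3]
      simp [this]
  refine ⟨descend b, hT, fun z => ?_, fun z => ?_⟩
  · obtain ⟨y, rfl⟩ := exists_lift z
    rw [descend_proj hbper, norm_sub_rev, hbv]
    refine (happrox (liftPhase f) y (A * r) hfc fun x hx => (hf x y).trans (by gcongr)).trans ?_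
    refine le_trans ?_ hCr
    gcongr
    rw [hC]
    have : 0 ≤ (A * K + B) * Real.exp K := by positivity
    linarith
  · obtain ⟨y, rfl⟩ := exists_lift z
    change ‖liftPhase g y - liftPhase (Xop e V (descend b)) y‖ ≤ δ
    rw [liftPhase_Xop, hlift, norm_sub_rev]
    have hd1 : HasDerivAt (fun t => b (flowCover e V t y)) (fderiv ℝ b y (field e V y)) 0 := by
      have h1 := h.hasDerivAt_flowCover y 0
      rw [h.flowCover_zero] at h1
      have h2 : HasFDerivAt b (fderiv ℝ b y) (flowCover e V 0 y) := by
        rw [h.flowCover_zero]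
        exact (hbs.differentiable (by simp)).differentiableAt.hasFDerivAt
      exact h2.comp_hasDerivAt 0 h1
    have hd2 := hfg y 0
    rw [h.flowCover_zero] at hd2
    -- The derivatives are compared at t = 0 only: it suffices that the increments of b and of f
    -- along the orbit differ by at most δ|t| for small t.
    refine (hd1.sub hd2).le_of_lip' (C := δ) hδ.le ?_
    have hnear : ∀ᶠ t : ℝ in 𝓝 0, |t| ≤ 1 := by
      have : ∀ᶠ t : ℝ in 𝓝 0, |t| < 1 :=
        continuous_abs.continuousAt.eventually_lt_const (by simp)
      exact this.mono fun t ht => ht.le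
    filter_upwards [hnear] with t ht
    -- The vector Φ_t y - y is held fixed while x varies. Mollification commutes with this
    -- translation, so mollifying `q` at y gives the increment of b along the orbit of y, and q(y)
    -- is the increment of f. Their difference is a mollification error of `q`, which carries the
    -- factor |t|.
    set q : Cover → ℂ := fun x => liftPhase f (flowCover e V t y - y + x) - liftPhase f x with hq
    have hqc : Continuous q := (hfc.comp (continuous_const.add continuous_id)).sub hfc
    have e1 : (∫ s, ρ.normed Measure.addHaar s • q (y - s) ∂Measure.addHaar) = b (flowCover e V t y) - b y := by
      rw [hbv, hbv, ← integral_sub (hexist _) (hexist _)]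
      congr 1
      funext s
      simp only [hq, smul_sub]
      congr 3
      abel
    have e2 := happrox q y ((A * K + B) * Real.exp K * r * |t|) hqc fun x hx => by
      have := h.norm_increment_le hB0 hf hg hfg hA0 x y ht
      have e3 : flowCover e V t y - y + y = flowCover e V t y := by abel
      simp only [hq, e3]
      refine this.trans ?_
      gcongr
    rw [e1] at e2
    have e3 : flowCover e V t y - y + y = flowCover e V t y := by abel
    simp only [hq, e3] at e2
    simp only [Pi.sub_apply, h.flowCover_zero, sub_zero]
    calc ‖b (flowCover e V t y) - liftPhase f (flowCover e V t y) - (b y - liftPhase f y)‖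
        = ‖b (flowCover e V t y) - b y - (liftPhase f (flowCover e V t y) - liftPhase f y)‖ := by
          congr 1; ring
      _ ≤ _ := e2
      _ ≤ C * r * |t| := by
          gcongr
          rw [hC]
          linarith
      _ ≤ δ * ‖t‖ := by
          rw [Real.norm_eq_abs]
          gcongr

end

/-! ### Families of measures transported by the field of p_Λ. -/

section

/-! ### Uniqueness of finite measures -/

/-- Bounded functions with smooth lift form a star subalgebra that separates points, by exponentials
in x and arctangents of linear forms in (ξ, η). Cut-offs and dominated convergence reduce them to
test functions. -/
lemma measure_ext_of_test {M N : Measure Om} [IsFiniteMeasure M] [IsFiniteMeasure N]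
    (hMN : ∀ a ∈ Test, ∫ z, a z ∂M = ∫ z, a z ∂N) : M = N := by
  let A : StarSubalgebra ℂ (BoundedContinuousFunction Om ℂ) :=
    { carrier := {g | ContDiff ℝ ∞ (liftPhase g)}
      mul_mem' := fun {f g} hf hg => by
        have h1 : ContDiff ℝ ∞ (liftPhase f) := hf
        have h2 : ContDiff ℝ ∞ (liftPhase g) := hg
        exact h1.mul h2
      add_mem' := fun {f g} hf hg => by
        have h1 : ContDiff ℝ ∞ (liftPhase f) := hf
        have h2 : ContDiff ℝ ∞ (liftPhase g) := hg
        exact h1.add h2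
      algebraMap_mem' := fun r => by
        have : ContDiff ℝ ∞ fun _ : Cover => r := contDiff_const
        exact this
      star_mem' := fun {f} hf => by
        have h1 : ContDiff ℝ ∞ (liftPhase f) := hf
        exact Complex.conjCLE.contDiff.comp h1 }
  refine ext_of_forall_mem_subalgebra_integral_eq_of_polish (A := A) ?_ fun g hg => ?_
  · intro z z' hzz'
    by_cases h1 : z.1 = z'.1
    · have h2 : z.2 ≠ z'.2 := fun h2 => hzz' (Prod.ext h1 h2)
      obtain ⟨ℓ, hℓ⟩ : ∃ ℓ : Cot →L[ℝ] ℝ, ℓ z.2 ≠ ℓ z'.2 := by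
        by_contra hcon
        push Not at hcon
        refine h2 (Prod.ext (funext fun i => ?_) ?_)
        · exact hcon ((ContinuousLinearMap.proj i).comp (ContinuousLinearMap.fst ℝ _ _))
        · exact hcon (ContinuousLinearMap.snd ℝ _ _)
      let g : BoundedContinuousFunction Om ℂ := BoundedContinuousFunction.ofNormedAddCommGroup
        (fun z => ((Real.arctan (ℓ z.2) : ℝ) : ℂ)) (by
          have := Real.continuous_arctan
          fun_prop) (Real.pi / 2) fun z => by
          rw [Complex.norm_real, Real.norm_eq_abs, abs_le]
          exact ⟨(Real.neg_pi_div_two_lt_arctan _).le, (Real.arctan_lt_pi_div_two _).le⟩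
      refine ⟨g, ⟨BoundedContinuousFunction.toContinuousMapStarₐ ℂ g, ⟨g, ?_, rfl⟩, rfl⟩, ?_⟩
      · have : ContDiff ℝ ∞ fun z : Cover => ((Real.arctan (ℓ z.2) : ℝ) : ℂ) :=
          Complex.ofRealCLM.contDiff.comp (Real.contDiff_arctan.comp
            (ℓ.contDiff.comp contDiff_snd))
        exact this
      · intro heq
        exact hℓ (Real.arctan_injective (Complex.ofReal_injective heq))
    · have h2 : ∃ p : Z2, UnitAddTorus.mFourier p z.1 ≠ UnitAddTorus.mFourier p z'.1 := by
        by_contra hcon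
        push Not at hcon
        obtain ⟨_, ⟨f, hf, rfl⟩, hne⟩ :=
          UnitAddTorus.mFourierSubalgebra_separatesPoints (d := Fin 2) h1
        have hspan : ∀ f ∈ Submodule.span ℂ (Set.range <| UnitAddTorus.mFourier (d := Fin 2)),
            f z.1 = f z'.1 := fun f hf => by
          induction hf using Submodule.span_induction with
          | mem x hx =>
            obtain ⟨p, rfl⟩ := hx
            exact hcon p
          | zero => rfl
          | add x y _ _ hx hy => rw [ContinuousMap.add_apply, ContinuousMap.add_apply, hx, hy]
          | smul c x _ hx => rw [ContinuousMap.smul_apply, ContinuousMap.smul_apply, hx]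
        refine hne (hspan f ?_)
        rw [← UnitAddTorus.mFourierSubalgebra_coe]
        exact hf
      obtain ⟨p, hp⟩ := h2
      let g : BoundedContinuousFunction Om ℂ := BoundedContinuousFunction.ofNormedAddCommGroup
        (fun z => UnitAddTorus.mFourier p z.1) (by fun_prop) 1 fun z =>
          (norm_mFourier_apply p z.1).le
      refine ⟨g, ⟨BoundedContinuousFunction.toContinuousMapStarₐ ℂ g, ⟨g, ?_, rfl⟩, rfl⟩, hp⟩
      have : ContDiff ℝ ∞ fun z : Cover => UnitAddTorus.mFourier p (proj z.1) :=
        (contDiff_mFourier_proj p).comp contDiff_fst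
      exact this
  · have key : ∀ (P : Measure Om) [IsFiniteMeasure P],
        Tendsto (fun n : ℕ => ∫ z, g z * ((cut n z.2 : ℝ) : ℂ) ∂P) atTop (𝓝 (∫ z, g z ∂P)) := by
      intro P _
      refine tendsto_integral_of_dominated_convergence (fun _ => ‖g‖) (fun n => ?_)
        (integrable_const _) (fun n => .of_forall fun z => ?_) (.of_forall fun z => ?_)
      · have : Continuous fun z : Om => g z * ((cut n z.2 : ℝ) : ℂ) :=
          g.continuous.mul (Complex.continuous_ofReal.comp
            ((contDiff_cut n).continuous.comp continuous_snd))
        exact this.aestronglyMeasurable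
      · rw [norm_mul, Complex.norm_real, Real.norm_eq_abs, abs_of_nonneg (cut n).nonneg]
        exact (mul_le_of_le_one_right (norm_nonneg _) (cut n).le_one).trans (g.norm_coe_le_norm z)
      · refine tendsto_const_nhds.congr' ?_
        obtain ⟨N, hN⟩ := exists_nat_ge ‖z.2‖
        filter_upwards [eventually_ge_atTop N] with n hn
        have : (N : ℝ) ≤ n := by exact_mod_cast hn
        rw [cut_eq_one (by linarith), Complex.ofReal_one, mul_one]
    refine tendsto_nhds_unique (key M) ((key N).congr fun n => ?_)
    refine (hMN _ ⟨?_, ?_⟩).symm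
    · exact ContDiff.mul hg (ofReal_cut_mem_test n).1
    · exact (ofReal_cut_mem_test n).2.mul_left

/-! ### Families of measures transported by a vector field -/

/-- The family of measures `N` satisfies `d/dt ∫ f dN = ∫ g dN`, in integrated form, between times
of `G`. -/
def Transports (N : ℝ → Measure Om) (G : Set ℝ) (f g : Om → ℂ) : Prop :=
  AEStronglyMeasurable (fun r => ∫ z, g z ∂(N r)) volume ∧
    ∀ s ∈ G, ∀ t ∈ G, ∫ z, f z ∂(N t) - ∫ z, f z ∂(N s) = ∫ r in s..t, ∫ z, g z ∂(N r)

/-- A continuous bounded function. -/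
def BddCont (f : Om → ℂ) : Prop := Continuous f ∧ ∃ B, ∀ z, ‖f z‖ ≤ B

lemma BddCont.integrable {f : Om → ℂ} (hf : BddCont f) (P : Measure Om) [IsFiniteMeasure P] :
    Integrable f P := by
  obtain ⟨hc, B, hB⟩ := hf
  exact Integrable.of_bound hc.aestronglyMeasurable B (.of_forall hB)

lemma BddCont.of_test {a : Om → ℂ} (ha : a ∈ Test) : BddCont a := by
  obtain ⟨A, -, h, -⟩ := Test.exists_lipschitz ha
  exact ⟨Test.continuous ha, A, h⟩

variable {N : ℝ → Measure Om} [hN : ∀ t, IsFiniteMeasure (N t)] {C : ℝ}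
  (hC : ∀ t, (N t).real Set.univ ≤ C)

lemma norm_integral_sub_le {P : Measure Om} [IsFiniteMeasure P] {C : ℝ} (hC : P.real Set.univ ≤ C)
    {f g : Om → ℂ} (hf : BddCont f) (hg : BddCont g) {δ : ℝ} (h0 : 0 ≤ δ)
    (h : ∀ z, ‖f z - g z‖ ≤ δ) : ‖∫ z, f z ∂P - ∫ z, g z ∂P‖ ≤ C * δ := by
  rw [← integral_sub (hf.integrable P) (hg.integrable P)]
  refine (norm_integral_le_of_norm_le_const (.of_forall h)).trans ?_
  rw [mul_comm]
  gcongr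

include hN hC in
lemma Transports.of_approx {G : Set ℝ} {f g : Om → ℂ} (hf : BddCont f) (hg : BddCont g)
    (happ : ∀ δ > 0, ∃ f' g', BddCont f' ∧ BddCont g' ∧ Transports N G f' g' ∧
      (∀ z, ‖f z - f' z‖ ≤ δ) ∧ ∀ z, ‖g z - g' z‖ ≤ δ) : Transports N G f g := by
  have hC0 : 0 ≤ C := measureReal_nonneg.trans (hC 0)
  choose f' g' hf' hg' hT h1 h2 using fun n : ℕ =>
    happ (1 / ((n : ℝ) + 1)) Nat.one_div_pos_of_nat
  have hlim : ∀ (φ : Om → ℂ) (φ' : ℕ → Om → ℂ), BddCont φ → (∀ n, BddCont (φ' n)) →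
      (∀ n z, ‖φ z - φ' n z‖ ≤ 1 / ((n : ℝ) + 1)) → ∀ t,
      Tendsto (fun n => ∫ z, φ' n z ∂(N t)) atTop (𝓝 (∫ z, φ z ∂(N t))) := by
    intro φ φ' hφ hφ' hφφ t
    rw [tendsto_iff_norm_sub_tendsto_zero]
    refine squeeze_zero (fun _ => norm_nonneg _) (fun n => ?_)
      (g := fun n : ℕ => C * (1 / ((n : ℝ) + 1)))
      (by simpa using (tendsto_one_div_add_atTop_nhds_zero_nat (𝕜 := ℝ)).const_mul C)
    rw [norm_sub_rev]
    exact norm_integral_sub_le (hC t) hφ (hφ' n) (by positivity) (hφφ n)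
  have hgt := hlim g g' hg hg' h2
  refine ⟨aestronglyMeasurable_of_tendsto_ae atTop (fun n => (hT n).1) (.of_forall hgt),
    fun s hs t ht => ?_⟩
  have hl := ((hlim f f' hf hf' h1 t).sub (hlim f f' hf hf' h1 s))
  obtain ⟨hgc, B, hB⟩ := hg
  refine tendsto_nhds_unique hl (Tendsto.congr (fun n => ((hT n).2 s hs t ht).symm) ?_)
  refine intervalIntegral.tendsto_integral_filter_of_dominated_convergence
    (fun _ => (B + 1) * C) (.of_forall fun n => (hT n).1.restrict)
    (.of_forall fun n => .of_forall fun r _ => ?_) intervalIntegrable_const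
    (.of_forall fun r _ => hgt r)
  refine (norm_integral_le_of_norm_le_const (C := B + 1) (.of_forall fun z => ?_)).trans ?_
  · have h3 : ‖g' n z‖ ≤ ‖g z‖ + ‖g z - g' n z‖ := by
      calc ‖g' n z‖ = ‖g z - (g z - g' n z)‖ := by congr 1; ring
        _ ≤ _ := norm_sub_le _ _
    have h4 : 1 / ((n : ℝ) + 1) ≤ 1 := by
      rw [div_le_one (by positivity)]
      linarith [(Nat.cast_nonneg n : (0 : ℝ) ≤ n)]
    linarith [hB z, h2 n z]
  · have : 0 ≤ B := (norm_nonneg _).trans (hB default)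
    gcongr
    exact hC r

variable {e : Z2} {V : T2 → ℝ} {K : NNReal}

lemma IsPLamField.comp_flow_data (h : IsPLamField e V K) {a : Om → ℂ} (ha : a ∈ Test) (s : ℝ) :
    ∃ A R : ℝ, 0 ≤ A ∧ (∀ z, ‖a (flowOm e V s z)‖ ≤ A) ∧
      (∀ y z, ‖liftPhase (a ∘ flowOm e V s) y - liftPhase (a ∘ flowOm e V s) z‖ ≤ A * dist y z) ∧
      ∀ z, R < ‖z.2‖ → a (flowOm e V s z) = 0 := by
  obtain ⟨A, hA, hA1, hA2⟩ := Test.exists_lipschitz ha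
  obtain ⟨R, hR⟩ := exists_support_bound ha.2
  have h1 : (1 : ℝ) ≤ Real.exp (K * |s|) := Real.one_le_exp (by positivity)
  refine ⟨A * Real.exp (K * |s|), R + K * |s|, by positivity, fun z => (hA1 _).trans
    (le_mul_of_one_le_right hA h1), fun y z => ?_, fun z hz => ?_⟩
  · rw [h.liftPhase_comp_flowOm]
    refine (hA2 _ _).trans ?_
    rw [mul_assoc, mul_comm (Real.exp _)]
    gcongr
    exact h.dist_flowCover_le s y z
  · obtain ⟨y, rfl⟩ := exists_lift z
    rw [h.flowOm_proj]
    refine hR _ ?_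
    have h2 := h.norm_snd_sub_le s y
    change R + K * |s| < ‖y.2‖ at hz
    change R < ‖(flowCover e V s y).2‖
    have h3 : ‖y.2‖ ≤ ‖(flowCover e V s y).2‖ + ‖(flowCover e V s y).2 - y.2‖ := by
      calc ‖y.2‖ = ‖(flowCover e V s y).2 - ((flowCover e V s y).2 - y.2)‖ := by congr 1; abel
        _ ≤ _ := norm_sub_le _ _
    linarith

lemma IsPLamField.bddCont_comp (h : IsPLamField e V K) {a : Om → ℂ} (ha : a ∈ Test) (s : ℝ) :
    BddCont (a ∘ flowOm e V s) := by
  obtain ⟨A, R, -, h1, -, -⟩ := h.comp_flow_data ha s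
  exact ⟨(Test.continuous ha).comp (h.continuous_flowOm s), A, h1⟩

include hN hC in
-- The function a∘φ^s is used only as a Lipschitz function: smooth dependence on initial data is
-- never invoked. Its derivative along the flow is (Xa)∘φ^s, and `IsPLamField.exists_test_approx`
-- approximates both functions at once.
lemma Transports.comp_flow (h : IsPLamField e V K) {G : Set ℝ}
    (hT : ∀ a ∈ Test, Transports N G a (Xop e V a)) {a : Om → ℂ} (ha : a ∈ Test) (s : ℝ) :
    Transports N G (a ∘ flowOm e V s) (Xop e V a ∘ flowOm e V s) := by
  have hX := h.Xop_mem_test ha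
  obtain ⟨A, R, hA0, -, hA, hR⟩ := h.comp_flow_data ha s
  obtain ⟨B, -, hB0, -, hB, -⟩ := h.comp_flow_data hX s
  refine Transports.of_approx hC (h.bddCont_comp ha s) (h.bddCont_comp hX s) fun δ hδ => ?_
  have hd : ∀ z t, HasDerivAt (fun t => liftPhase (a ∘ flowOm e V s) (flowCover e V t z))
      (liftPhase (Xop e V a ∘ flowOm e V s) (flowCover e V t z)) t := fun z t => by
    rw [h.liftPhase_comp_flowOm, h.liftPhase_comp_flowOm]
    simp only [Function.comp_apply, ← h.flowCover_add]
    exact (h.hasDerivAt_comp_flowCover ha z (t + s)).comp_add_const t s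
  obtain ⟨b, hb, h1, h2⟩ := h.exists_test_approx hA0 hB0 hA hB hd hR hδ
  exact ⟨b, Xop e V b, .of_test hb, .of_test (h.Xop_mem_test hb), hT b hb, h1, h2⟩

lemma IsPLamField.hasDerivAt_comp_flowOm (h : IsPLamField e V K) {a : Om → ℂ} (ha : a ∈ Test)
    (z : Om) (t : ℝ) :
    HasDerivAt (fun t => a (flowOm e V t z)) (Xop e V a (flowOm e V t z)) t := by
  obtain ⟨y, rfl⟩ := exists_lift z
  simp only [h.flowOm_proj]
  exact h.hasDerivAt_comp_flowCover ha y t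

lemma norm_taylor_le {p p' p'' : ℝ → ℂ} {D : ℝ} (h1 : ∀ t, HasDerivAt p (p' t) t)
    (h2 : ∀ t, HasDerivAt p' (p'' t) t) (hD : ∀ t, ‖p'' t‖ ≤ D) (s t : ℝ) :
    ‖p t - p s - (t - s : ℝ) * p' s‖ ≤ D * |t - s| ^ 2 := by
  have e1 : ∀ r, ‖p' r - p' s‖ ≤ D * |r - s| := fun r =>
    Convex.norm_image_sub_le_of_norm_hasDerivWithin_le (𝕜 := ℝ) (s := Set.univ) (f := p') (C := D)
      (fun x _ => (h2 x).hasDerivWithinAt) (fun x _ => hD x) convex_univ trivial trivial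
  have hD0 : 0 ≤ D := (norm_nonneg _).trans (hD 0)
  have h3 : ∀ r, HasDerivAt (fun r : ℝ => p r - (r : ℂ) * p' s) (p' r - p' s) r := fun r => by
    have := (h1 r).sub ((Complex.ofRealCLM.hasDerivAt (x := r)).mul_const (p' s))
    rw [Complex.ofRealCLM_apply, Complex.ofReal_one, one_mul] at this
    exact this
  have := Convex.norm_image_sub_le_of_norm_hasDerivWithin_le (𝕜 := ℝ) (s := Set.uIcc s t)
    (f := fun r : ℝ => p r - (r : ℂ) * p' s) (C := D * |t - s|) (x := s) (y := t)
    (fun x _ => (h3 x).hasDerivWithinAt) (fun x hx => (e1 x).trans (by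
      exact mul_le_mul_of_nonneg_left (Set.abs_sub_left_of_mem_uIcc hx) hD0)) (convex_uIcc _ _) Set.left_mem_uIcc Set.right_mem_uIcc
  rw [Real.norm_eq_abs, mul_assoc, ← sq] at this
  have e2 : p t - p s - (t - s : ℝ) * p' s = p t - t * p' s - (p s - s * p' s) := by
    push_cast
    ring
  rw [e2]
  exact this

/-- A subdivision into n steps leaves n errors of order n⁻². The nodes must lie in G, so equidistant
points are moved by at most |t - s|/(2n); the steps then have length at most 2|t - s|/n, which gives
the bound 4C|t - s|²/n. -/
lemma eq_of_norm_sub_le_sq {F : ℝ → ℂ} {G : Set ℝ} (hG : Dense G) {C : ℝ}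
    (hF : ∀ s ∈ G, ∀ t ∈ G, ‖F t - F s‖ ≤ C * |t - s| ^ 2) {s t : ℝ} (hs : s ∈ G) (ht : t ∈ G) :
    F t = F s := by
  rcases eq_or_ne s t with rfl | hst
  · rfl
  have hd : 0 < |t - s| := abs_pos.mpr (sub_ne_zero.mpr hst.symm)
  have hC0 : 0 ≤ C := by
    have := (norm_nonneg _).trans (hF s hs t ht)
    by_contra hcon
    have : C * |t - s| ^ 2 < 0 := mul_neg_of_neg_of_pos (not_le.mp hcon) (by positivity)
    linarith
  have key : ∀ n : ℕ, 0 < n → ‖F t - F s‖ ≤ 4 * C * |t - s| ^ 2 * (1 / (n : ℝ)) := by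
    intro n hn
    have hn0 : (0 : ℝ) < n := by exact_mod_cast hn
    have hex : ∀ i : ℕ, ∃ g ∈ G, |g - (s + i * ((t - s) / n))| ≤ |t - s| / (2 * n) := fun i => by
      obtain ⟨g, hg, hd⟩ := hG.exists_dist_lt (s + i * ((t - s) / n))
        (show 0 < |t - s| / (2 * n) by positivity)
      exact ⟨g, hg, by rw [abs_sub_comm]; exact hd.le⟩
    choose g hg hgd using hex
    let q : ℕ → ℝ := fun i => if i = 0 then s else if i = n then t else g i
    have hq : ∀ i, q i ∈ G := fun i => by
      simp only [q]
      split_ifs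
      exacts [hs, ht, hg i]
    have hqd : ∀ i, |q i - (s + i * ((t - s) / n))| ≤ |t - s| / (2 * n) := fun i => by
      simp only [q]
      split_ifs with h1 h2
      · rw [h1]
        simp only [Nat.cast_zero, zero_mul, add_zero, sub_self, abs_zero]
        positivity
      · rw [h2, mul_div_cancel₀ _ hn0.ne']
        simp only [add_sub_cancel, sub_self, abs_zero]
        positivity
      · exact hgd i
    have hstep : ∀ i, |q (i + 1) - q i| ≤ 2 * |t - s| / n := fun i => by
      have e1 : q (i + 1) - q i = (q (i + 1) - (s + (i + 1 : ℕ) * ((t - s) / n))) -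
          (q i - (s + i * ((t - s) / n))) + (t - s) / n := by push_cast; ring
      rw [e1]
      refine (abs_add_le _ _).trans ((add_le_add_left (abs_sub _ _) _).trans ?_)
      rw [abs_div, abs_of_pos hn0]
      have e2 : 2 * |t - s| / n = |t - s| / (2 * n) + |t - s| / (2 * n) + |t - s| / n := by
        field_simp; ring
      rw [e2]
      have := hqd (i + 1)
      have := hqd i
      gcongr
    have hsum : F t - F s = ∑ i ∈ Finset.range n, (F (q (i + 1)) - F (q i)) := by
      rw [Finset.sum_range_sub (fun i => F (q i))]
      simp [q, hn.ne']
    rw [hsum]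
    calc ‖∑ i ∈ Finset.range n, (F (q (i + 1)) - F (q i))‖
        ≤ ∑ i ∈ Finset.range n, C * (2 * |t - s| / n) ^ 2 := norm_sum_le_of_le _ fun i _ =>
          (hF _ (hq i) _ (hq (i + 1))).trans (by gcongr; exact hstep i)
      _ = _ := by
        rw [Finset.sum_const, Finset.card_range, nsmul_eq_mul]
        field_simp
        ring
  have hlim : Tendsto (fun n : ℕ => 4 * C * |t - s| ^ 2 * (1 / (n : ℝ))) atTop (𝓝 0) := by
    have := (tendsto_const_div_atTop_nhds_zero_nat (1 : ℝ)).const_mul (4 * C * |t - s| ^ 2)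
    rwa [mul_zero] at this
  have := ge_of_tendsto hlim (eventually_atTop.mpr ⟨1, fun n hn => key n hn⟩)
  exact sub_eq_zero.mp (norm_le_zero_iff.mp this)

include hN hC in
/-- A family of measures transported by the field of `p_Λ` is transported by its flow. -/
lemma Transports.integral_eq (h : IsPLamField e V K) {G : Set ℝ} (hG : ∀ᵐ t, t ∈ G)
    (hT : ∀ a ∈ Test, Transports N G a (Xop e V a)) {a : Om → ℂ} (ha : a ∈ Test) {s t : ℝ}
    (hs : s ∈ G) (ht : t ∈ G) (T : ℝ) :
    ∫ z, a (flowOm e V (T - t) z) ∂(N t) = ∫ z, a (flowOm e V (T - s) z) ∂(N s) := by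
  have hC0 : 0 ≤ C := measureReal_nonneg.trans (hC 0)
  have hGd : Dense G := Measure.dense_of_ae hG
  have hX := h.Xop_mem_test ha
  have hXX := h.Xop_mem_test hX
  obtain ⟨D, hD0, hD, -⟩ := Test.exists_lipschitz hXX
  -- With b = (Xa)∘φ^{T-t}, the change of measure contributes (t - s)∫ b dN_s and the change of flow
  -- its opposite. Each expansion leaves an error at most C D|t - s|², where D bounds X(Xa).
  refine eq_of_norm_sub_le_sq (F := fun t => ∫ z, a (flowOm e V (T - t) z) ∂(N t)) hGd
    (C := 2 * (C * D)) (fun s hs t ht => ?_) hs ht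
  have i1 : ∀ r : ℝ, BddCont fun z => a (flowOm e V r z) := h.bddCont_comp ha
  have i2 : ∀ r : ℝ, BddCont fun z => Xop e V a (flowOm e V r z) := h.bddCont_comp hX
  have e1 := (Transports.comp_flow hC h hT ha (T - t)).2 s hs t ht
  have tX := Transports.comp_flow hC h hT hX (T - t)
  have mX := (Transports.comp_flow hC h hT ha (T - t)).1
  simp only [Function.comp_apply] at e1 tX mX
  set b : Om → ℂ := fun z => Xop e V a (flowOm e V (T - t) z) with hb
  have e2 : ‖∫ z, (a (flowOm e V (T - s) z) - a (flowOm e V (T - t) z) -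
      ((T - s) - (T - t) : ℝ) * b z) ∂(N s)‖ ≤ C * D * |t - s| ^ 2 := by
    refine (norm_integral_le_of_norm_le_const (C := D * |t - s| ^ 2) (.of_forall fun z => ?_)).trans ?_
    · have := norm_taylor_le (h.hasDerivAt_comp_flowOm ha z) (h.hasDerivAt_comp_flowOm hX z)
        (fun r => hD _) (T - t) (T - s)
      refine this.trans_eq ?_
      congr 3
      ring
    · rw [mul_comm, mul_assoc]
      gcongr
      exact hC s
  have e6 : ∫ z, (a (flowOm e V (T - s) z) - a (flowOm e V (T - t) z) -
      ((T - s) - (T - t) : ℝ) * b z) ∂(N s) = (∫ z, a (flowOm e V (T - s) z) ∂(N s)) -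
      (∫ z, a (flowOm e V (T - t) z) ∂(N s)) - ((T - s - (T - t) : ℝ) : ℂ) * ∫ z, b z ∂(N s) := by
    rw [← integral_const_mul, ← integral_sub ((i1 _).integrable _) ((i1 _).integrable _)]
    exact integral_sub (((i1 _).integrable _).sub ((i1 _).integrable _))
      (((i2 _).integrable _).const_mul _)
  rw [e6] at e2
  -- The integrand is compared with its value at s by the transport equation applied to Xa.
  have e3 : ‖(∫ r in s..t, ∫ z, b z ∂(N r)) - ((t - s : ℝ) : ℂ) * ∫ z, b z ∂(N s)‖ ≤
      C * D * |t - s| ^ 2 := by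
    have e4 : ((t - s : ℝ) : ℂ) * ∫ z, b z ∂(N s) = ∫ r in s..t, ∫ z, b z ∂(N s) := by
      rw [intervalIntegral.integral_const, Complex.real_smul]
    have hint : IntervalIntegrable (fun r => ∫ z, b z ∂(N r)) volume s t := by
      obtain ⟨-, B, hB⟩ := i2 (T - t)
      have hB0 : 0 ≤ B := (norm_nonneg _).trans (hB default)
      refine (intervalIntegrable_const (c := B * C)).mono_fun mX.restrict
        (.of_forall fun r => ?_)
      refine (norm_integral_le_of_norm_le_const (.of_forall hB)).trans ?_
      rw [Real.norm_of_nonneg (by positivity)]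
      exact mul_le_mul_of_nonneg_left (hC r) hB0
    rw [e4, ← intervalIntegral.integral_sub hint intervalIntegrable_const, sq, ← mul_assoc]
    refine intervalIntegral.norm_integral_le_of_norm_le_const_ae ?_
    filter_upwards [hG] with r hr hrst
    have e7 : ∫ z, b z ∂(N r) - ∫ z, b z ∂(N s) =
        ∫ r' in s..r, ∫ z, Xop e V (Xop e V a) (flowOm e V (T - t) z) ∂(N r') := tX.2 s hs r hr
    rw [e7]
    refine (intervalIntegral.norm_integral_le_of_norm_le_const (C := C * D) fun r' _ => ?_).trans ?_
    · refine (norm_integral_le_of_norm_le_const (C := D) (.of_forall fun z => hD _)).trans ?_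
      rw [mul_comm]
      gcongr
      exact hC r'
    · exact mul_le_mul_of_nonneg_left
        (Set.abs_sub_left_of_mem_uIcc (Set.uIoc_subset_uIcc hrst)) (by positivity)
  have e5 : (∫ z, a (flowOm e V (T - t) z) ∂(N t)) - ∫ z, a (flowOm e V (T - s) z) ∂(N s) =
      ((∫ r in s..t, ∫ z, b z ∂(N r)) - ((t - s : ℝ) : ℂ) * ∫ z, b z ∂(N s)) -
      ((∫ z, a (flowOm e V (T - s) z) ∂(N s)) - (∫ z, a (flowOm e V (T - t) z) ∂(N s)) -
        ((T - s - (T - t) : ℝ) : ℂ) * ∫ z, b z ∂(N s)) := by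
    rw [← e1]
    push_cast
    ring
  rw [e5]
  refine (norm_sub_le _ _).trans ((add_le_add e3 e2).trans_eq ?_)
  ring

end

/-! ### Averages along e^⊥ and the action of the field on modes. -/

section

/-! ### Averages of exponentials and of measures -/

lemma avg_mul_left {e : Z2} (g : T2 → ℂ) (b : ℂ) (x : T2) :
    avg e (fun x => b * g x) x = b * avg e g x := by
  simp only [avg, intervalIntegral.integral_const_mul, mul_smul_comm]

/-- If p·e^⊥ ≠ 0, some translation along e^⊥ changes the sign of the exponential while its average
is unchanged; the average is therefore 0. -/
lemma avg_mFourier {e : Z2} (he : e ≠ 0) (p : Z2) (x : T2) :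
    avg e (fun x => UnitAddTorus.mFourier p x) x =
      if toR p ⬝ᵥ unitPerp e = 0 then UnitAddTorus.mFourier p x else 0 := by
  have hL := len_pos he
  split_ifs with h
  · have h1 : ∀ s : ℝ, UnitAddTorus.mFourier p (x + proj (s • unitPerp e)) =
        UnitAddTorus.mFourier p x := fun s => by
      rw [mFourier_apply_add, mFourier_proj, dotProduct_smul, h]
      simp
    simp only [avg, h1, intervalIntegral.integral_const, sub_zero, smul_smul,
      inv_mul_cancel₀ hL.ne', one_smul]
  · set s : ℝ := (2 * (toR p ⬝ᵥ unitPerp e))⁻¹ with hs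
    have h1 : UnitAddTorus.mFourier p (proj (s • unitPerp e)) = -1 := by
      rw [mFourier_proj, dotProduct_smul, smul_eq_mul, hs, ← Complex.exp_pi_mul_I]
      congr 1
      have : ((toR p ⬝ᵥ unitPerp e : ℝ) : ℂ) ≠ 0 := by exact_mod_cast h
      push_cast
      field_simp
    have h2 := avg_add_perp he (fun x => UnitAddTorus.mFourier p x) x s
    have h3 : avg e (fun x => UnitAddTorus.mFourier p x) (x + proj (s • unitPerp e)) =
        -avg e (fun x => UnitAddTorus.mFourier p x) x := by
      have h4 := avg_mul_left (e := e) (fun x => UnitAddTorus.mFourier p x) (-1) x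
      rw [neg_one_mul] at h4
      rw [← h4, avg, avg]
      congr 2
      funext r
      rw [add_right_comm, mFourier_apply_add _ _ (proj (s • unitPerp e)), h1]
      ring
    rw [h3] at h2
    exact self_eq_neg.mp h2.symm

lemma avg_ofReal (e : Z2) (V : T2 → ℝ) (x : T2) :
    ((avg e V x : ℝ) : ℂ) = avg e (fun x => (V x : ℂ)) x := by
  rw [avg, avg, smul_eq_mul, Complex.ofReal_mul, intervalIntegral.integral_ofReal,
    Complex.real_smul]

lemma continuous_shift (e : Z2) :
    Continuous fun q : T2 × ℝ => q.1 + proj (q.2 • unitPerp e) :=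
  continuous_fst.add (continuous_proj.comp (continuous_snd.smul continuous_const))

/-- By Fubini and translation invariance, averaging multiplies the coefficient of index p by the
average of the p-th exponential at the origin. -/
lemma mFourierCoeff_avg {e : Z2} (he : e ≠ 0) {f : T2 → ℂ} (hf : Continuous f) (p : Z2) :
    UnitAddTorus.mFourierCoeff (avg e f) p =
      if toR p ⬝ᵥ unitPerp e = 0 then UnitAddTorus.mFourierCoeff f p else 0 := by
  have hL := len_pos he
  obtain ⟨C, hC⟩ := exists_bound_of_continuous hf
  have hm : Continuous fun t : T2 => UnitAddTorus.mFourier (-p) t := ContinuousMap.continuous _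
  have h0 : ∀ s : ℝ, ∫ x, UnitAddTorus.mFourier (-p) x * f (x + proj (s • unitPerp e)) ∂torusMeasure =
      UnitAddTorus.mFourier p (0 + proj (s • unitPerp e)) * UnitAddTorus.mFourierCoeff f p := fun s => by
    rw [mFourierCoeff_eq, ← integral_const_mul,
      ← integral_add_right_eq_self (μ := torusMeasure) (fun x => UnitAddTorus.mFourier p
        (0 + proj (s • unitPerp e)) * (UnitAddTorus.mFourier (-p) x * f x)) (proj (s • unitPerp e))]
    refine integral_congr_ae (.of_forall fun x => ?_)
    have h1 : UnitAddTorus.mFourier p (0 + proj (s • unitPerp e)) *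
        UnitAddTorus.mFourier (-p) (proj (s • unitPerp e)) = 1 := by
      rw [zero_add, ← UnitAddTorus.mFourier_add, add_neg_cancel, UnitAddTorus.mFourier_zero,
        ContinuousMap.one_apply]
    beta_reduce
    rw [mFourier_apply_add (-p)]
    linear_combination (-UnitAddTorus.mFourier (-p) x * f (x + proj (s • unitPerp e))) * h1
  have h1 : UnitAddTorus.mFourierCoeff (avg e f) p = avg e (fun x => UnitAddTorus.mFourier p x) 0 *
      UnitAddTorus.mFourierCoeff f p := by
    rw [avg, smul_mul_assoc, ← intervalIntegral.integral_mul_const]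
    simp only [← h0]
    rw [mFourierCoeff_eq, intervalIntegral.integral_of_le hL.le, integral_integral_swap,
      ← integral_smul]
    · refine integral_congr_ae (.of_forall fun x => ?_)
      beta_reduce
      rw [integral_const_mul, avg, mul_smul_comm, intervalIntegral.integral_of_le hL.le]
    · have hcont : Continuous (Function.uncurry fun (s : ℝ) (x : T2) =>
          UnitAddTorus.mFourier (-p) x * f (x + proj (s • unitPerp e))) :=
        (hm.comp continuous_snd).mul (hf.comp ((continuous_shift e).comp continuous_swap))
      refine Integrable.of_bound hcont.aestronglyMeasurable C (.of_forall fun q => ?_)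
      rw [Function.uncurry, norm_mul, norm_mFourier_apply, one_mul]
      exact hC _
  rw [h1, avg_mFourier he]
  split_ifs
  · rw [← proj_zero, mFourier_proj]
    simp
  · rw [zero_mul]

/-- The Fourier coefficients of `(e / L_Λ) · ∂_x I_Λ(V)`. -/
def dAvgCoeff (e : Z2) (V : T2 → ℝ) (j : Z2) : ℂ :=
  if toR j ⬝ᵥ unitPerp e = 0 then
    vhat V j * (2 * Real.pi * Complex.I * ((toR j ⬝ᵥ unitDir e : ℝ) : ℂ)) else 0

lemma mFourierCoeff_dAvg {e : Z2} (he : e ≠ 0) {V : T2 → ℝ} (hV : SmoothOnTorus V) (j : Z2) :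
    UnitAddTorus.mFourierCoeff (dAvg e V) j = dAvgCoeff e V j := by
  rw [dAvg, mFourierCoeff_dirDeriv (contDiff_avg he hV).smoothC]
  simp only [avg_ofReal]
  rw [mFourierCoeff_avg he hV.smoothC.continuous, dAvgCoeff]
  split_ifs
  · rw [mul_comm]; rfl
  · rw [mul_zero]

lemma summable_dAvgCoeff {e : Z2} (he : e ≠ 0) {V : T2 → ℝ} (hV : SmoothOnTorus V) :
    Summable (dAvgCoeff e V) := by
  have := (smoothC_dAvg he hV).summable
  rwa [show UnitAddTorus.mFourierCoeff (dAvg e V) = dAvgCoeff e V from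
    funext (mFourierCoeff_dAvg he hV)] at this

lemma hasSum_dAvg {e : Z2} (he : e ≠ 0) {V : T2 → ℝ} (hV : SmoothOnTorus V) (x : T2) :
    HasSum (fun j => dAvgCoeff e V j * UnitAddTorus.mFourier j x) (dAvg e V x) := by
  have := UnitAddTorus.hasSum_mFourier_series_apply_of_summable
    (f := ⟨dAvg e V, (smoothC_dAvg he hV).continuous⟩) (smoothC_dAvg he hV).summable x
  simpa only [ContinuousMap.coe_mk, mFourierCoeff_dAvg he hV, smul_eq_mul] using this

/-- The average of a measure along `s ↦ x + s e^⊥ / L_Λ`, `0 ≤ s ≤ L_Λ`. -/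
def avgMeasure {X : Type} [MeasurableSpace X] (e : Z2) (M : Measure (T2 × X)) : Measure (T2 × X) :=
  (M.prod (ENNReal.ofReal (len e)⁻¹ • volume.restrict (Set.Ioc 0 (len e)))).map
    fun q => (q.1.1 + proj (q.2 • unitPerp e), q.1.2)

section

variable {X : Type} [MeasurableSpace X]

lemma measurable_shift (e : Z2) : Measurable fun q : (T2 × X) × ℝ =>
    (q.1.1 + proj (q.2 • unitPerp e), q.1.2) :=
  ((continuous_shift e).measurable.comp
    ((measurable_fst.comp measurable_fst).prodMk measurable_snd)).prodMk
    (measurable_snd.comp measurable_fst)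

instance (e : Z2) : IsFiniteMeasure
    (ENNReal.ofReal (len e)⁻¹ • volume.restrict (Set.Ioc 0 (len e)) : Measure ℝ) :=
  Measure.smul_finite _ ENNReal.ofReal_ne_top

instance (e : Z2) (M : Measure (T2 × X)) [IsFiniteMeasure M] : IsFiniteMeasure (avgMeasure e M) := by
  unfold avgMeasure
  infer_instance

lemma integral_avgMeasure [TopologicalSpace X] [OpensMeasurableSpace X] [SecondCountableTopology X]
    {e : Z2} (he : e ≠ 0) (M : Measure (T2 × X)) [IsFiniteMeasure M] {f : T2 × X → ℂ}
    (hf : Continuous f) {B : ℝ} (hB : ∀ z, ‖f z‖ ≤ B) :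
    ∫ z, f z ∂(avgMeasure e M) = ∫ z, avg e (fun x => f (x, z.2)) z.1 ∂M := by
  have hL := len_pos he
  rw [avgMeasure, integral_map (measurable_shift e).aemeasurable hf.aestronglyMeasurable,
    integral_prod]
  · refine integral_congr_ae (.of_forall fun z => ?_)
    beta_reduce
    rw [integral_smul_measure, ENNReal.toReal_ofReal (inv_nonneg.mpr hL.le), avg,
      intervalIntegral.integral_of_le hL.le]
  · exact Integrable.of_bound (hf.stronglyMeasurable.comp_measurable
      (measurable_shift e)).aestronglyMeasurable B (.of_forall fun q => hB _)

end

lemma avg_modeFn {e : Z2} (he : e ≠ 0) (p : Z2) (c : Cot → ℂ) (z : Om) :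
    avg e (fun x => modeFn p c (x, z.2)) z.1 =
      if toR p ⬝ᵥ unitPerp e = 0 then modeFn p c z else 0 := by
  have : (fun x => modeFn p c (x, z.2)) = fun x => c z.2 * UnitAddTorus.mFourier p x :=
    funext fun x => mul_comm _ _
  rw [this, avg_mul_left, avg_mFourier he]
  split_ifs
  · exact mul_comm _ _
  · rw [mul_zero]

/-! ### The vector field on modes -/

/-- The symbol `2iπ (p·e / L_Λ) η c`. -/
def mulEta (e p : Z2) (c : Cot → ℂ) (w : Cot) : ℂ :=
  2 * Real.pi * Complex.I * ((toR p ⬝ᵥ unitDir e : ℝ) : ℂ) * (w.2 : ℂ) * c w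

lemma contDiff_mulEta (e p : Z2) {c : Cot → ℂ} (hc : ContDiff ℝ ∞ c) :
    ContDiff ℝ ∞ (mulEta e p c) :=
  (contDiff_const.mul (Complex.ofRealCLM.contDiff.comp contDiff_snd)).mul hc

lemma hasCompactSupport_mulEta (e p : Z2) {c : Cot → ℂ} (hs : HasCompactSupport c) :
    HasCompactSupport (mulEta e p c) := hs.mul_left

lemma Xop_modeFn {e : Z2} (he : e ≠ 0) {V : T2 → ℝ} (hV : SmoothOnTorus V) (p : Z2)
    {c : Cot → ℂ} (hc : ContDiff ℝ ∞ c) (z : Om) :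
    Xop e V (modeFn p c) z = modeFn p (mulEta e p c) z - dAvg e V z.1 * modeFn p (dEta c) z := by
  obtain ⟨y, rfl⟩ := exists_lift z
  have h0 := congrFun (liftPhase_Xop e V (modeFn p c)) y
  rw [show liftPhase (Xop e V (modeFn p c)) y = Xop e V (modeFn p c) (proj y.1, y.2) from rfl] at h0
  rw [h0]
  have hl : HasDerivAt (fun s : ℝ => y + s • field e V y) (field e V y) 0 := by
    simpa using ((hasDerivAt_id (0 : ℝ)).smul_const (field e V y)).const_add y
  have hd : Differentiable ℝ (liftPhase (modeFn p c)) :=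
    (((contDiff_mFourier_proj p).comp contDiff_fst).mul (hc.comp contDiff_snd)).differentiable
      (by simp)
  have h1 : HasDerivAt (fun s : ℝ => liftPhase (modeFn p c) (y + s • field e V y))
      (fderiv ℝ (liftPhase (modeFn p c)) y (field e V y)) 0 := by
    have h2 : HasFDerivAt (liftPhase (modeFn p c)) (fderiv ℝ (liftPhase (modeFn p c)) y)
        (y + (0 : ℝ) • field e V y) := by
      rw [zero_smul, add_zero]
      exact (hd y).hasFDerivAt
    exact h2.comp_hasDerivAt 0 hl
  have h3 := hasDerivAt_mFourier_line p y.1 (y.2.2 • unitDir e) 0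
  have h4 : HasDerivAt (fun s : ℝ => c (y.2 + s • (field e V y).2))
      (fderiv ℝ c y.2 (field e V y).2) 0 := by
    have h2 : HasFDerivAt c (fderiv ℝ c y.2) (y.2 + (0 : ℝ) • (field e V y).2) := by
      rw [zero_smul, add_zero]
      exact ((hc.differentiable (by simp)) y.2).hasFDerivAt
    have h5 : HasDerivAt (fun s : ℝ => y.2 + s • (field e V y).2) (field e V y).2 0 := by
      simpa using ((hasDerivAt_id (0 : ℝ)).smul_const (field e V y).2).const_add y.2
    exact h2.comp_hasDerivAt 0 h5
  rw [h1.unique (h3.mul h4 :)]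
  have h6 : (field e V y).2 = (-derivAvg e V y.1) • ((0, 1) : Cot) := by
    simp [field]
  rw [h6, map_smul, dAvg_proj he hV, zero_smul, zero_smul, add_zero, add_zero, dotProduct_smul]
  simp only [modeFn, mulEta, dEta, Complex.real_smul, smul_eq_mul]
  push_cast
  ring

lemma exists_bound_coeff {c : Cot → ℂ} (hc : ContDiff ℝ ∞ c) (hs : HasCompactSupport c) :
    ∃ B, 0 ≤ B ∧ ∀ w, ‖c w‖ ≤ B := exists_bound_of_compactSupport hc.continuous hs

lemma norm_modeFn (p : Z2) (c : Cot → ℂ) (z : Om) : ‖modeFn p c z‖ = ‖c z.2‖ := by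
  rw [modeFn, norm_mul, norm_mFourier_apply, one_mul]

/-- The integral of the derivative of a mode along the field of `p_Λ`. -/
lemma hasSum_integral_Xop_modeFn {e : Z2} (he : e ≠ 0) {V : T2 → ℝ} (hV : SmoothOnTorus V) (p : Z2)
    {c : Cot → ℂ} (hc : ContDiff ℝ ∞ c) (hs : HasCompactSupport c) (M : Measure Om)
    [IsFiniteMeasure M] :
    HasSum (fun j => dAvgCoeff e V j * ∫ z, modeFn (p + j) (dEta c) z ∂M)
      ((∫ z, modeFn p (mulEta e p c) z ∂M) - ∫ z, Xop e V (modeFn p c) z ∂M) := by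
  have hd := contDiff_dEta hc
  have hds := hasCompactSupport_dEta hs
  obtain ⟨B, hB0, hB⟩ := exists_bound_coeff hd hds
  have hm : ∀ (q : Z2) {c : Cot → ℂ}, ContDiff ℝ ∞ c → HasCompactSupport c →
      Integrable (modeFn q c) M := fun q c hc hs =>
    (BddCont.of_test (modeFn_mem_test q hc hs)).integrable M
  have h1 : HasSum (fun j => ∫ z, dAvgCoeff e V j * modeFn (p + j) (dEta c) z ∂M)
      (∫ z, ∑' j, dAvgCoeff e V j * modeFn (p + j) (dEta c) z ∂M) := by
    refine hasSum_integral_of_summable_integral_norm (fun j => (hm _ hd hds).const_mul _) ?_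
    refine .of_nonneg_of_le (fun j => integral_nonneg fun z => norm_nonneg _) (fun j => ?_)
      ((summable_dAvgCoeff he hV).norm.mul_right (B * M.real Set.univ))
    calc ∫ z, ‖dAvgCoeff e V j * modeFn (p + j) (dEta c) z‖ ∂M
        ≤ ∫ z, ‖dAvgCoeff e V j‖ * B ∂M := by
          refine integral_mono ((hm _ hd hds).const_mul _).norm (integrable_const _) fun z => ?_
          beta_reduce
          rw [norm_mul, norm_modeFn]
          gcongr
          exact hB _
      _ = _ := by
          rw [integral_const, smul_eq_mul]
          ring
  have h2 : ∀ z, ∑' j, dAvgCoeff e V j * modeFn (p + j) (dEta c) z =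
      dAvg e V z.1 * modeFn p (dEta c) z := fun z => by
    rw [← ((hasSum_dAvg he hV z.1).mul_right (modeFn p (dEta c) z)).tsum_eq]
    refine tsum_congr fun j => ?_
    rw [modeFn, modeFn, UnitAddTorus.mFourier_add]
    ring
  simp only [h2, integral_const_mul] at h1
  convert h1 using 1
  have hX : (fun z => dAvg e V z.1 * modeFn p (dEta c) z) =
      fun z => modeFn p (mulEta e p c) z - Xop e V (modeFn p c) z := funext fun z => by
    rw [Xop_modeFn he hV p hc]
    ring
  obtain ⟨K, hK⟩ := exists_isPLamField he hV
  rw [hX, integral_sub (hm _ (contDiff_mulEta e p hc) (hasCompactSupport_mulEta e p hs))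
    ((BddCont.of_test (hK.Xop_mem_test (modeFn_mem_test p hc hs))).integrable M)]

end

section

/-! ### Reduction to modes -/

lemma Xop_apply (e : Z2) (V : T2 → ℝ) (a : Om → ℂ) (y : Cover) :
    Xop e V a (proj y.1, y.2) = fderiv ℝ (liftPhase a) y (field e V y) :=
  congrFun (liftPhase_Xop e V a) y

lemma Test.differentiable {a : Om → ℂ} (ha : a ∈ Test) : Differentiable ℝ (liftPhase a) :=
  ha.1.differentiable (by simp)

lemma Xop_sub (e : Z2) (V : T2 → ℝ) {a b : Om → ℂ} (ha : a ∈ Test) (hb : b ∈ Test) :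
    Xop e V (a - b) = Xop e V a - Xop e V b := by
  funext z
  obtain ⟨y, rfl⟩ := exists_lift z
  rw [Pi.sub_apply, Xop_apply, Xop_apply, Xop_apply]
  have h1 : liftPhase (a - b) = liftPhase a - liftPhase b := rfl
  rw [h1, fderiv_sub (Test.differentiable ha y) (Test.differentiable hb y)]
  rfl

lemma Xop_sum (e : Z2) (V : T2 → ℝ) {ι : Type} (f : Finset ι) (a : ι → Om → ℂ)
    (ha : ∀ i, a i ∈ Test) : Xop e V (∑ i ∈ f, a i) = ∑ i ∈ f, Xop e V (a i) := by
  funext z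
  obtain ⟨y, rfl⟩ := exists_lift z
  rw [Finset.sum_apply]
  simp only [Xop_apply]
  have h1 : liftPhase (∑ i ∈ f, a i) = ∑ i ∈ f, liftPhase (a i) := by
    funext z
    simp [liftPhase, Finset.sum_apply]
  rw [h1, fderiv_sum fun i _ => Test.differentiable (ha i) y]
  simp

/-- The field grows linearly in η, but b vanishes beyond R. -/
lemma IsPLamField.norm_Xop_le {e : Z2} {V : T2 → ℝ} {K : NNReal} (hK : IsPLamField e V K)
    {b : Om → ℂ} {R : ℕ} (hR : ∀ z : Om, (R : ℝ) < ‖z.2‖ → b z = 0) {δ : ℝ}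
    (hδ : ∀ y, ‖fderiv ℝ (liftPhase b) y‖ ≤ δ) (z : Om) : ‖Xop e V b z‖ ≤ δ * (R + K) := by
  obtain ⟨y, rfl⟩ := exists_lift z
  rw [Xop_apply]
  have hδ0 : 0 ≤ δ := (norm_nonneg _).trans (hδ 0)
  rcases lt_or_ge (R : ℝ) ‖y.2‖ with h | h
  · have h2 : liftPhase b =ᶠ[𝓝 y] fun _ => 0 := by
      have : Continuous fun z : Cover => ‖z.2‖ := by fun_prop
      filter_upwards [this.continuousAt.eventually_const_lt h] with x hx
      exact hR _ hx
    rw [h2.fderiv_eq, fderiv_fun_const]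
    simp only [Pi.zero_apply, _root_.zero_apply, norm_zero]
    positivity
  · refine ((fderiv ℝ (liftPhase b) y).le_opNorm _).trans (mul_le_mul (hδ y) ?_ (norm_nonneg _) hδ0)
    have h1 : ‖y.2.2‖ ≤ R := (norm_snd_le y.2).trans h
    refine max_le ?_ (max_le ?_ ?_)
    · change ‖y.2.2 • unitDir e‖ ≤ _
      rw [norm_smul]
      have := mul_le_mul h1 (norm_unitDir_le e) (norm_nonneg _) (Nat.cast_nonneg R)
      have : (0 : ℝ) ≤ K := K.2
      linarith
    · change ‖(0 : Fin 2 → ℝ)‖ ≤ _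
      rw [norm_zero]
      positivity
    · change ‖-derivAvg e V y.1‖ ≤ _
      rw [norm_neg]
      have := hK.derivAvg_le y.1
      rw [Real.norm_eq_abs]
      have : (0 : ℝ) ≤ R := Nat.cast_nonneg R
      linarith

lemma integral_sum_bddCont {ι : Type} (s : Finset ι) {f : ι → Om → ℂ}
    (hf : ∀ i ∈ s, BddCont (f i)) (M : Measure Om) [IsFiniteMeasure M] :
    ∫ z, (∑ i ∈ s, f i) z ∂M = ∑ i ∈ s, ∫ z, f i z ∂M := by
  simp only [Finset.sum_apply]
  exact integral_finsetSum _ fun i hi => (hf i hi).integrable M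

section

variable {N : ℝ → Measure Om} [hN : ∀ t, IsFiniteMeasure (N t)] {C : ℝ}
  (hC : ∀ t, (N t).real Set.univ ≤ C)
include hN hC

lemma BddCont.intervalIntegrable {g : Om → ℂ} (hg : BddCont g)
    (hm : AEStronglyMeasurable (fun r => ∫ z, g z ∂(N r)) volume) (s t : ℝ) :
    IntervalIntegrable (fun r => ∫ z, g z ∂(N r)) volume s t := by
  obtain ⟨-, B, hB⟩ := hg
  have hB0 : 0 ≤ B := (norm_nonneg _).trans (hB default)
  have hC0 : 0 ≤ C := measureReal_nonneg.trans (hC 0)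
  refine (intervalIntegrable_const (c := B * C)).mono_fun hm.restrict (.of_forall fun r => ?_)
  refine (norm_integral_le_of_norm_le_const (.of_forall hB)).trans ?_
  rw [Real.norm_of_nonneg (by positivity)]
  exact mul_le_mul_of_nonneg_left (hC r) hB0

lemma Transports.sum {G : Set ℝ} {ι : Type} (q : Finset ι) {f g : ι → Om → ℂ}
    (hf : ∀ i ∈ q, BddCont (f i)) (hg : ∀ i ∈ q, BddCont (g i))
    (h : ∀ i ∈ q, Transports N G (f i) (g i)) :
    Transports N G (∑ i ∈ q, f i) (∑ i ∈ q, g i) := by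
  have e1 : (fun r => ∫ z, (∑ i ∈ q, g i) z ∂(N r)) = fun r => ∑ i ∈ q, ∫ z, g i z ∂(N r) :=
    funext fun r => integral_sum_bddCont q hg (N r)
  refine ⟨?_, fun s hs t ht => ?_⟩
  · rw [e1]
    exact Finset.aestronglyMeasurable_fun_sum _ fun i hi => (h i hi).1
  · rw [e1, integral_sum_bddCont q hf, integral_sum_bddCont q hf, ← Finset.sum_sub_distrib,
      intervalIntegral.integral_finsetSum fun i hi => (hg i hi).intervalIntegrable hC (h i hi).1 s t]
    exact Finset.sum_congr rfl fun i hi => (h i hi).2 s hs t ht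

/-- A family of measures that is transported by the field of `p_Λ` on modes is transported on all
test functions. -/
lemma Transports.of_modes {e : Z2} {V : T2 → ℝ} {K : NNReal} (hK : IsPLamField e V K) {G : Set ℝ}
    (h : ∀ p n, Transports N G (modeFn p (denseCoeff n)) (Xop e V (modeFn p (denseCoeff n))))
    {a : Om → ℂ} (ha : a ∈ Test) : Transports N G a (Xop e V a) := by
  obtain ⟨R, hR⟩ := exists_nat_support ha
  refine Transports.of_approx hC (.of_test ha) (.of_test (hK.Xop_mem_test ha)) fun δ hδ => ?_
  have hRK : (0 : ℝ) < R + K + 1 := by positivity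
  obtain ⟨f, hf1, hf2⟩ := exists_trigSum_approx ha hR (δ := δ / (R + K + 1)) (by positivity)
  have hT := trigSum_mem_test R f
  have hsmall : δ / (R + K + 1) ≤ δ := div_le_self hδ.le (by
    have : (0 : ℝ) ≤ R + K := by positivity
    linarith)
  have hmode : ∀ q : Z2 × ℕ, modeFn q.1 (denseCoeff (R, q.2)) ∈ Test := fun q =>
    modeFn_mem_test q.1 (contDiff_denseCoeff _) (hasCompactSupport_denseCoeff _)
  refine ⟨trigSum R f, Xop e V (trigSum R f), .of_test hT, .of_test (hK.Xop_mem_test hT), ?_,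
    fun z => ?_, fun z => ?_⟩
  · rw [trigSum, Xop_sum _ _ _ _ hmode]
    exact Transports.sum hC f (fun q _ => .of_test (hmode q))
      (fun q _ => .of_test (hK.Xop_mem_test (hmode q))) fun q _ => h _ _
  · exact (hf1.norm_le z).trans hsmall
  · have h1 := hK.norm_Xop_le (b := a - trigSum R f) (R := R) (fun z hz => by
      rw [Pi.sub_apply, hR z hz, trigSum_eq_zero hz, sub_zero]) hf2 z
    rw [Xop_sub e V ha hT] at h1
    refine h1.trans ?_
    rw [div_mul_eq_mul_div, div_le_iff₀ hRK]
    exact mul_le_mul_of_nonneg_left (by linarith) hδ.le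

end

/-- The family of modes is countable, so identities between their integrals can be established for
almost every time and then used simultaneously. -/
lemma measure_ext_of_modes {M N : Measure Om} [IsFiniteMeasure M] [IsFiniteMeasure N]
    (h : ∀ p n, ∫ z, modeFn p (denseCoeff n) z ∂M = ∫ z, modeFn p (denseCoeff n) z ∂N) :
    M = N := by
  refine measure_ext_of_test fun a ha => ?_
  obtain ⟨R, hR⟩ := exists_nat_support ha
  have hmode : ∀ q : Z2 × ℕ, modeFn q.1 (denseCoeff (R, q.2)) ∈ Test := fun q =>
    modeFn_mem_test q.1 (contDiff_denseCoeff _) (hasCompactSupport_denseCoeff _)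
  refine eq_of_forall_dist_le fun δ hδ => ?_
  set D := M.real Set.univ + N.real Set.univ + 1 with hD
  have hD0 : 0 < D := by positivity
  obtain ⟨f, hf, -⟩ := exists_trigSum_approx ha hR (δ := δ / D) (by positivity)
  have hT := trigSum_mem_test R f
  have hf' : ∀ z, ‖a z - trigSum R f z‖ ≤ δ / D := fun z => hf.norm_le z
  have e1 := norm_integral_sub_le (le_refl (M.real Set.univ)) (.of_test ha) (.of_test hT)
    (by positivity) hf'
  have e2 := norm_integral_sub_le (le_refl (N.real Set.univ)) (.of_test ha) (.of_test hT)
    (by positivity) hf'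
  have e3 : ∫ z, trigSum R f z ∂M = ∫ z, trigSum R f z ∂N := by
    rw [trigSum, integral_sum_bddCont f (fun q _ => .of_test (hmode q)),
      integral_sum_bddCont f (fun q _ => .of_test (hmode q))]
    exact Finset.sum_congr rfl fun q _ => h _ _
  rw [dist_eq_norm]
  calc ‖∫ z, a z ∂M - ∫ z, a z ∂N‖ = ‖(∫ z, a z ∂M - ∫ z, trigSum R f z ∂M) -
        (∫ z, a z ∂N - ∫ z, trigSum R f z ∂N)‖ := by rw [e3]; congr 1; ring
    _ ≤ M.real Set.univ * (δ / D) + N.real Set.univ * (δ / D) :=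
      (norm_sub_le _ _).trans (add_le_add e1 e2)
    _ = (M.real Set.univ + N.real Set.univ) / D * δ := by ring
    _ ≤ 1 * δ := by
      gcongr
      rw [div_le_one hD0, hD]
      linarith
    _ = δ := one_mul δ

/-- The Fourier coefficients of `M` vanish outside of the frequencies `p` orthogonal to `e^⊥`. -/
def PerpInvariant (e : Z2) (M : Measure Om) : Prop :=
  ∀ p, toR p ⬝ᵥ unitPerp e ≠ 0 → ∀ c : Cot → ℂ, ContDiff ℝ ∞ c → HasCompactSupport c →
    ∫ z, modeFn p c z ∂M = 0

/-- Multiplication by the derivative of I_Λ(V) adds only frequencies orthogonal to e^⊥, so it never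
leads from such a p to a coefficient that may be non-zero. -/
lemma PerpInvariant.integral_Xop {e : Z2} (he : e ≠ 0) {V : T2 → ℝ} (hV : SmoothOnTorus V)
    {M : Measure Om} [IsFiniteMeasure M] (hM : PerpInvariant e M) {p : Z2}
    (hp : toR p ⬝ᵥ unitPerp e ≠ 0) {c : Cot → ℂ} (hc : ContDiff ℝ ∞ c) (hs : HasCompactSupport c) :
    ∫ z, Xop e V (modeFn p c) z ∂M = 0 := by
  have h1 := hasSum_integral_Xop_modeFn he hV p hc hs M
  rw [hM p hp _ (contDiff_mulEta e p hc) (hasCompactSupport_mulEta e p hs), zero_sub] at h1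
  have h2 : ∀ j, dAvgCoeff e V j * ∫ z, modeFn (p + j) (dEta c) z ∂M = 0 := fun j => by
    rw [dAvgCoeff]
    split_ifs with hj
    · rw [hM (p + j) (by rwa [toR_add, add_dotProduct, hj, add_zero]) _ (contDiff_dEta hc)
        (hasCompactSupport_dEta hs), mul_zero]
    · rw [zero_mul]
  simp only [h2] at h1
  exact neg_eq_zero.mp (h1.unique hasSum_zero)

/-- On a measure which is invariant in the direction `e^⊥`, the full potential and its average have
the same action. -/
lemma PerpInvariant.integral_Xop_eq {e : Z2} (he : e ≠ 0) {V : T2 → ℝ} (hV : SmoothOnTorus V)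
    {M : Measure Om} [IsFiniteMeasure M] (hM : PerpInvariant e M) {p : Z2}
    (hp : toR p ⬝ᵥ unitPerp e = 0) {c : Cot → ℂ} (hc : ContDiff ℝ ∞ c) (hs : HasCompactSupport c) :
    ∫ z, Xop e V (modeFn p c) z ∂M = (∫ z, modeFn p (mulEta e p c) z ∂M) -
      ∑' j, vhat V j * (2 * Real.pi * Complex.I * ((toR j ⬝ᵥ unitDir e : ℝ) : ℂ)) *
        ∫ z, modeFn (p + j) (dEta c) z ∂M := by
  have h1 := (hasSum_integral_Xop_modeFn he hV p hc hs M).tsum_eq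
  have h2 : ∀ j, dAvgCoeff e V j * ∫ z, modeFn (p + j) (dEta c) z ∂M =
      vhat V j * (2 * Real.pi * Complex.I * ((toR j ⬝ᵥ unitDir e : ℝ) : ℂ)) *
        ∫ z, modeFn (p + j) (dEta c) z ∂M := fun j => by
    rw [dAvgCoeff]
    split_ifs with hj
    · rfl
    · rw [hM (p + j) (by rwa [toR_add, add_dotProduct, hp, zero_add]) _ (contDiff_dEta hc)
        (hasCompactSupport_dEta hs), mul_zero, mul_zero]
  simp only [h2] at h1
  rw [h1]
  ring

lemma integral_modeFn_avgMeasure {e : Z2} (he : e ≠ 0) (M : Measure Om) [IsFiniteMeasure M] (p : Z2)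
    {c : Cot → ℂ} (hc : ContDiff ℝ ∞ c) (hs : HasCompactSupport c) :
    ∫ z, modeFn p c z ∂(avgMeasure e M) =
      if toR p ⬝ᵥ unitPerp e = 0 then ∫ z, modeFn p c z ∂M else 0 := by
  obtain ⟨h1, B, hB⟩ := BddCont.of_test (modeFn_mem_test p hc hs)
  rw [integral_avgMeasure he M h1 hB]
  simp only [avg_modeFn he]
  split_ifs
  · rfl
  · exact integral_zero _ _

end

/-! ### Passage to the limit: positivity, concentration and fast invariance. -/

section

/-! ### Limits in the weak sense in time -/

/-- Lebesgue's differentiation theorem: almost every value is a limit of averages over intervals to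
its right. -/
lemma ae_mem_of_average_mem {m : ℝ → ℂ} (hm : LocallyIntegrable m volume) {S : Set ℂ}
    (hS : IsClosed S) (h : ∀ s t, s < t → (t - s)⁻¹ • ∫ r in s..t, m r ∈ S) : ∀ᵐ t, m t ∈ S := by
  filter_upwards [_root_.LocallyIntegrable.ae_hasDerivAt_integral hm] with x hx
  have h1 := (hasDerivAt_iff_tendsto_slope.mp (hx x)).mono_left
    (nhdsWithin_mono x (show Set.Ioi x ⊆ {x}ᶜ from fun y hy => ne_of_gt hy))
  refine hS.mem_of_tendsto h1 ?_
  filter_upwards [self_mem_nhdsWithin] with y hy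
  rw [slope_def_module, intervalIntegral.integral_same, sub_zero]
  exact h x y hy

lemma average_mem_of_continuous {f : ℝ → ℂ} (hf : Continuous f) {S : Set ℂ} (hS : IsClosed S)
    (hc : Convex ℝ S) (h : ∀ r, f r ∈ S) {s t : ℝ} (hst : s < t) :
    (t - s)⁻¹ • ∫ r in s..t, f r ∈ S := by
  rw [← interval_average_eq, Set.uIoc_of_le hst.le]
  refine hc.set_average_mem hS ?_ measure_Ioc_lt_top.ne (.of_forall h)
    (hf.integrableOn_Icc.mono_set Set.Ioc_subset_Icc_self)
  rw [Real.volume_Ioc]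
  exact (ENNReal.ofReal_pos.mpr (sub_pos.mpr hst)).ne'

/-- Convergence is weak in time, so no value of the limit is accessible directly, but averages over
intervals converge and a closed convex set contains the averages of its points. It is applied to the
half-line of nonnegative reals, to {0} and to small discs. -/
lemma ae_mem_of_tendsto {W : ℕ → ℝ → ℂ} (hW : ∀ n, Continuous (W n)) {m : ℝ → ℂ}
    (hm : LocallyIntegrable m volume)
    (hlim : ∀ s t, Tendsto (fun n => ∫ r in s..t, W n r) atTop (𝓝 (∫ r in s..t, m r)))
    {S : Set ℂ} (hS : IsClosed S) (hc : Convex ℝ S)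
    (h : ∀ κ > 0, ∀ᶠ n in atTop, ∀ r, W n r ∈ Metric.cthickening κ S) : ∀ᵐ t, m t ∈ S := by
  refine ae_mem_of_average_mem hm hS fun s t hst => ?_
  rw [← hS.closure_eq, Metric.closure_eq_iInter_cthickening]
  refine Set.mem_iInter₂.mpr fun κ hκ => ?_
  refine Metric.isClosed_cthickening.mem_of_tendsto ((hlim s t).const_smul (t - s)⁻¹) ?_
  filter_upwards [h κ hκ] with n hn
  exact average_mem_of_continuous (hW n) Metric.isClosed_cthickening (hc.cthickening κ) hn hst

section

variable {e : Z2} {ħ ε τ : ℕ → ℝ} {v : ℕ → ℝ → L2T} {μ : ℝ → Symbols →ₗ[ℂ] ℂ}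

lemma IsTimeLimit.exists_bound (hμ : IsTimeLimit e ħ ε τ v μ) {a : Om → ℂ} (ha : a ∈ Test) :
    ∃ B, ∀ᵐ t, ‖μ t (toSym ⟨a, ha⟩)‖ ≤ B := by
  obtain ⟨C, hC⟩ := hμ.bounded
  obtain ⟨K, -, hK⟩ := Test.exists_c3LE ha
  exact ⟨C * K, hC.mono fun t ht => ht _ _ ((B3LE.of_lift ha hK).bNormLE ha)⟩

lemma IsTimeLimit.locallyIntegrable (hμ : IsTimeLimit e ħ ε τ v μ) {a : Om → ℂ} (ha : a ∈ Test) :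
    LocallyIntegrable (fun t => μ t (toSym ⟨a, ha⟩)) volume := by
  obtain ⟨B, hB⟩ := hμ.exists_bound ha
  refine (locallyIntegrable_const (B : ℝ)).mono (hμ.measurable _) ?_
  filter_upwards [hB] with t ht
  exact ht.trans (Real.le_norm_self B)

lemma IsTimeLimit.tendsto_interval (hμ : IsTimeLimit e ħ ε τ v μ) (a : Symbols) (s t : ℝ) :
    Tendsto (fun n => ∫ r in s..t, wigner e (ħ n) (ε n) (v n (r * τ n)) a) atTop
      (𝓝 (∫ r in s..t, μ r a)) := by
  have key : ∀ s t : ℝ, Tendsto (fun n => ∫ r in Set.Ioc s t, wigner e (ħ n) (ε n) (v n (r * τ n)) a)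
      atTop (𝓝 (∫ r in Set.Ioc s t, μ r a)) := fun s t => by
    have h1 : ∀ f : ℝ → ℂ, ∫ r, (Set.Ioc s t).indicator (fun _ => (1 : ℂ)) r * f r =
        ∫ r in Set.Ioc s t, f r := fun f => by
      rw [← integral_indicator measurableSet_Ioc]
      refine integral_congr_ae (.of_forall fun r => ?_)
      by_cases hr : r ∈ Set.Ioc s t <;> simp [hr]
    have h2 := hμ.tendsto a ((Set.Ioc s t).indicator fun _ => (1 : ℂ))
      ((integrable_indicator_iff measurableSet_Ioc).mpr (integrableOn_const measure_Ioc_lt_top.ne))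
    simp only [h1] at h2
    exact h2
  exact (key s t).sub (key t s)

lemma IsTimeLimit.tendsto_interval_mode (hμ : IsTimeLimit e ħ ε τ v μ) (p : Z2) {c : Cot → ℂ}
    (hc : ContDiff ℝ ∞ c) (hs : HasCompactSupport c) (s t : ℝ) :
    Tendsto (fun n => ∫ r in s..t, corr (coef (v n (r * τ n))) p (sample e (ħ n) (ε n) c)) atTop
      (𝓝 (∫ r in s..t, μ r (modeSym p c hc hs))) := by
  have := hμ.tendsto_interval (modeSym p c hc hs) s t
  simp only [wigner_eq_corr e _ _ _ (modeSym p c hc hs) p c rfl] at this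
  exact this

lemma IsTimeLimit.ae_mem (hμ : IsTimeLimit e ħ ε τ v μ) (hħ : ∀ n, 0 < ħ n)
    (hv : ∀ n, Continuous (v n)) {ι : Type} (F : Finset ι) (p : ι → Z2) (c : ι → Cot → ℂ)
    (hc : ∀ i, ContDiff ℝ ∞ (c i)) (hs : ∀ i, HasCompactSupport (c i)) {S : Set ℂ}
    (hS : IsClosed S) (hconv : Convex ℝ S)
    (h : ∀ κ > 0, ∀ᶠ n in atTop, ∀ t,
      ∑ i ∈ F, corr (coef (v n t)) (p i) (sample e (ħ n) (ε n) (c i)) ∈ Metric.cthickening κ S) :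
    ∀ᵐ t, ∑ i ∈ F, μ t (modeSym (p i) (c i) (hc i) (hs i)) ∈ S := by
  have hcont : ∀ n i, Continuous fun t =>
      corr (coef (v n (t * τ n))) (p i) (sample e (ħ n) (ε n) (c i)) := fun n i =>
    continuous_corr_sample e (hħ n) ((hv n).comp (continuous_id.mul continuous_const)) (p i) (hs i)
  have hloc : ∀ i, LocallyIntegrable (fun t => μ t (modeSym (p i) (c i) (hc i) (hs i))) volume :=
    fun i => hμ.locallyIntegrable (modeFn_mem_test (p i) (hc i) (hs i))
  refine ae_mem_of_tendsto (W := fun n t =>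
    ∑ i ∈ F, corr (coef (v n (t * τ n))) (p i) (sample e (ħ n) (ε n) (c i)))
    (fun n => continuous_finsetSum _ fun i _ => hcont n i)
    (locallyIntegrable_finsetSum _ fun i _ => hloc i) (fun s t => ?_) hS hconv
    fun κ hκ => (h κ hκ).mono fun n hn t => hn _
  rw [intervalIntegral.integral_finsetSum fun i _ =>
    intervalIntegrable_iff.mpr ((hloc i).integrableOn_isCompact isCompact_uIcc |>.mono_set
      Set.uIoc_subset_uIcc)]
  simp only [intervalIntegral.integral_finsetSum fun i _ => (hcont _ i).intervalIntegrable s t]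
  exact tendsto_finsetSum _ fun i _ => hμ.tendsto_interval_mode (p i) (hc i) (hs i) s t

lemma IsInitialLimit.mem {u : ℕ → L2T} {μ₀ : Symbols →ₗ[ℂ] ℂ} (hμ : IsInitialLimit e ħ ε u μ₀)
    {ι : Type} (F : Finset ι) (p : ι → Z2) (c : ι → Cot → ℂ)
    (hc : ∀ i, ContDiff ℝ ∞ (c i)) (hs : ∀ i, HasCompactSupport (c i)) {S : Set ℂ}
    (hS : IsClosed S)
    (h : ∀ κ > 0, ∀ᶠ n in atTop,
      ∑ i ∈ F, corr (coef (u n)) (p i) (sample e (ħ n) (ε n) (c i)) ∈ Metric.cthickening κ S) :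
    ∑ i ∈ F, μ₀ (modeSym (p i) (c i) (hc i) (hs i)) ∈ S := by
  rw [← hS.closure_eq, Metric.closure_eq_iInter_cthickening]
  refine Set.mem_iInter₂.mpr fun κ hκ => ?_
  refine Metric.isClosed_cthickening.mem_of_tendsto
    (tendsto_finsetSum _ fun i _ => hμ.tendsto (modeSym (p i) (c i) (hc i) (hs i))) ?_
  filter_upwards [h κ hκ] with n hn
  simpa only [wigner_eq_corr e _ _ _ (modeSym _ _ _ _) _ _ rfl] using hn

end

/-! ### Properties of the correlations for small parameters -/

lemma corr_mem_cthickening_zero {e : Z2} {ħ ε κ : ℝ} {u : L2T} (hu : ‖u‖ = 1) (p : Z2) {c : Cot → ℂ}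
    (h : ∀ m, ‖sample e ħ ε c m‖ ≤ κ) :
    corr (coef u) p (sample e ħ ε c) ∈ Metric.cthickening κ ({0} : Set ℂ) := by
  refine Metric.mem_cthickening_of_dist_le _ 0 _ _ rfl ?_
  rw [dist_zero_right]
  have := norm_corr_le (summable_sq_coef u) p h
  rwa [tsum_sq_coef, hu, one_pow, mul_one] at this

lemma exists_lipschitz_coeff {c : Cot → ℂ} (hc : ContDiff ℝ ∞ c) (hs : HasCompactSupport c) :
    ∃ A, 0 ≤ A ∧ ∀ w w', ‖c w - c w'‖ ≤ A * ‖w - w'‖ := by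
  obtain ⟨A, hA0, hA⟩ := exists_bound_of_compactSupport
    (hc.continuous_fderiv (by simp)) (hs.fderiv (𝕜 := ℝ))
  exact ⟨A, hA0, fun w w' => Convex.norm_image_sub_le_of_norm_fderiv_le (𝕜 := ℝ) (s := Set.univ)
    (fun x _ => (hc.differentiable (by simp)).differentiableAt) (fun x _ => hA x) convex_univ
    trivial trivial⟩

/-- The coefficient of frequency `p` of a trigonometric sum. -/
def trigCoeff (R : ℕ) (f : Finset (Z2 × ℕ)) (p : Z2) (w : Cot) : ℂ :=
  ∑ q ∈ f with q.1 = p, denseCoeff (R, q.2) w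

lemma contDiff_trigCoeff (R : ℕ) (f : Finset (Z2 × ℕ)) (p : Z2) : ContDiff ℝ ∞ (trigCoeff R f p) :=
  ContDiff.sum fun _ _ => contDiff_denseCoeff _

lemma hasCompactSupport_trigCoeff (R : ℕ) (f : Finset (Z2 × ℕ)) (p : Z2) :
    HasCompactSupport (trigCoeff R f p) :=
  hasCompactSupport_cot_of_bound (R := R) fun _ hw =>
    Finset.sum_eq_zero fun _ _ => denseCoeff_eq_zero hw

lemma trigSum_eq (R : ℕ) (f : Finset (Z2 × ℕ)) :
    trigSum R f = ∑ p ∈ f.image Prod.fst, modeFn p (trigCoeff R f p) := by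
  rw [trigSum, ← Finset.sum_fiberwise_of_maps_to (g := Prod.fst) (t := f.image Prod.fst)
    fun q hq => Finset.mem_image_of_mem _ hq]
  refine Finset.sum_congr rfl fun p _ => ?_
  funext z
  rw [Finset.sum_apply, modeFn, trigCoeff, Finset.mul_sum]
  refine Finset.sum_congr rfl fun q hq => ?_
  rw [modeFn, (Finset.mem_filter.mp hq).2]

/-- The coefficients of the square of a trigonometric sum. -/
def sqCoeff (R : ℕ) (f : Finset (Z2 × ℕ)) (q : Z2 × Z2) (w : Cot) : ℂ :=
  trigCoeff R f q.1 w * conj (trigCoeff R f q.2 w)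

lemma contDiff_sqCoeff (R : ℕ) (f : Finset (Z2 × ℕ)) (q : Z2 × Z2) :
    ContDiff ℝ ∞ (sqCoeff R f q) :=
  (contDiff_trigCoeff R f q.1).mul
    (Complex.conjCLE.contDiff.comp (contDiff_trigCoeff R f q.2))

lemma hasCompactSupport_sqCoeff (R : ℕ) (f : Finset (Z2 × ℕ)) (q : Z2 × Z2) :
    HasCompactSupport (sqCoeff R f q) := (hasCompactSupport_trigCoeff R f q.1).mul_right

lemma map_trigSum_sq (L : Symbols →ₗ[ℂ] ℂ) (R : ℕ) (f : Finset (Z2 × ℕ)) :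
    L (toSym ⟨trigSum R f * fun z => conj (trigSum R f z),
      Test.mul (trigSum_mem_test R f) (Test.conj (trigSum_mem_test R f))⟩) =
    ∑ q ∈ f.image Prod.fst ×ˢ f.image Prod.fst, L (modeSym (q.1 - q.2) (sqCoeff R f q)
      (contDiff_sqCoeff R f q) (hasCompactSupport_sqCoeff R f q)) := by
  rw [← map_sum]
  simp only [modeSym]
  rw [← map_sum]
  congr 2
  apply Subtype.ext
  simp only [AddSubmonoidClass.coe_finsetSum]
  funext z
  rw [Pi.mul_apply, trigSum_eq, Finset.sum_apply, Finset.sum_apply, map_sum, Finset.sum_mul_sum,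
    Finset.sum_product]
  refine Finset.sum_congr rfl fun p _ => Finset.sum_congr rfl fun p' _ => ?_
  simp only [modeFn, sqCoeff, map_mul, sub_eq_add_neg, UnitAddTorus.mFourier_add,
    UnitAddTorus.mFourier_neg]
  ring

/-- Almost positivity of the Wigner distributions on squares. -/
lemma eventually_mem_cthickening_nonnegC (e : Z2) {ħ ε : ℕ → ℝ} (hħ : ∀ n, 0 < ħ n)
    (hε : ∀ n, 0 < ε n) (hε0 : Tendsto ε atTop (𝓝 0))
    (hħε : Tendsto (fun n => ħ n / ε n) atTop (𝓝 0)) (R : ℕ) (f : Finset (Z2 × ℕ)) {κ : ℝ}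
    (hκ : 0 < κ) : ∀ᶠ n in atTop, ∀ u : L2T, ‖u‖ = 1 →
      ∑ q ∈ f.image Prod.fst ×ˢ f.image Prod.fst,
        corr (coef u) (q.1 - q.2) (sample e (ħ n) (ε n) (sqCoeff R f q)) ∈
          Metric.cthickening κ nonnegC := by
  set F := f.image Prod.fst with hF
  choose B hB0 hB using fun p => exists_bound_coeff (contDiff_trigCoeff R f p)
    (hasCompactSupport_trigCoeff R f p)
  choose A hA0 hA using fun q => exists_lipschitz_coeff (contDiff_sqCoeff R f q)
    (hasCompactSupport_sqCoeff R f q)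
  -- `D` dominates, for all pairs, the Lipschitz constant of the weight times the length of its
  -- shift; the weights then vary by at most 2π(ħ/ε)D, which tends to 0.
  set D := ∑ q ∈ F ×ˢ F, A q * ‖toR (q.1 + q.2)‖ with hD
  have hDn : ∀ q ∈ F ×ˢ F, A q * ‖toR (q.1 + q.2)‖ ≤ D := fun q hq =>
    Finset.single_le_sum (f := fun q : Z2 × Z2 => A q * ‖toR (q.1 + q.2)‖)
      (fun q _ => mul_nonneg (hA0 q) (norm_nonneg _)) hq
  have hlim : Tendsto (fun n => (F.card : ℝ) ^ 2 * (2 * Real.pi * (ħ n / ε n) * D)) atTop (𝓝 0) := by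
    have := ((hħε.const_mul (2 * Real.pi)).mul_const D).const_mul ((F.card : ℝ) ^ 2)
    simpa using this
  filter_upwards [hlim.eventually_lt_const hκ, hε0.eventually_lt_const one_pos] with n hn hεn u hu
  obtain ⟨r, hr0, hr⟩ := exists_nonneg_corr_sum (summable_sq_coef u) F
    (fun p m => sample e (ħ n) (ε n) (trigCoeff R f p) m) (B := ∑ p ∈ F, B p)
    (κ := 2 * Real.pi * (ħ n / ε n) * D)
    (fun p hp m => (hB p _).trans (Finset.single_le_sum (fun p _ => hB0 p) hp))
    (fun p hp p' hp' m => by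
      have h1 := hA (p, p') (samplePt e (ħ n) (ε n) m) (samplePt e (ħ n) (ε n) (m + (p + p')))
      have h2 := norm_samplePt_le e (hħ n) (hε n) hεn.le (p + p')
      have h3 := hDn (p, p') (Finset.mk_mem_product hp hp')
      rw [samplePt_add, sub_add_cancel_left, norm_neg, ← samplePt_add] at h1
      refine h1.trans ((mul_le_mul_of_nonneg_left h2 (hA0 _)).trans ?_)
      have h4 : 0 ≤ 2 * Real.pi * (ħ n / ε n) := by
        have := hħ n
        have := hε n
        positivity
      calc A (p, p') * (2 * Real.pi * (ħ n / ε n) * ‖toR (p + p')‖)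
          = 2 * Real.pi * (ħ n / ε n) * (A (p, p') * ‖toR (p + p')‖) := by ring
        _ ≤ _ := mul_le_mul_of_nonneg_left h3 h4)
  rw [tsum_sq_coef, hu, one_pow, mul_one] at hr
  refine Metric.mem_cthickening_of_dist_le _ (r : ℂ) _ _ ⟨hr0, Complex.ofReal_im r⟩ ?_
  rw [dist_eq_norm, Finset.sum_product]
  exact hr.trans hn.le

lemma convex_nonnegC : Convex ℝ nonnegC := by
  intro x hx y hy a b ha hb _
  refine ⟨?_, ?_⟩
  · simp only [Complex.add_re, Complex.real_smul, Complex.re_ofReal_mul]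
    exact add_nonneg (mul_nonneg ha hx.1) (mul_nonneg hb hy.1)
  · simp only [Complex.add_im, Complex.real_smul, Complex.im_ofReal_mul, hx.2, hy.2]
    simp

end

section

/-! ### Concentration of the limit measures -/

lemma eq_add_unitDir_unitPerp {e : Z2} (he : e ≠ 0) (ξ : Fin 2 → ℝ) :
    ξ = (ξ ⬝ᵥ unitDir e) • unitDir e + (ξ ⬝ᵥ unitPerp e) • unitPerp e := by
  have hL := (len_pos he).ne'
  have h1 : len e * len e = (e 0 : ℝ) * e 0 + (e 1 : ℝ) * e 1 := by
    rw [len, Real.mul_self_sqrt (normSq_nonneg e), normSq, dotProduct, Fin.sum_univ_two]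
    rfl
  funext i
  fin_cases i
  · simp [unitDir, unitPerp, dotProduct, Fin.sum_univ_two, toR]
    field_simp
    linear_combination ξ 0 * h1
  · simp [unitDir, unitPerp, dotProduct, Fin.sum_univ_two, toR]
    field_simp
    linear_combination ξ 1 * h1

/-- `H_Λ(ξ)²`, cut off. -/
def hlamSq (e : Z2) (R : ℕ) (w : Cot) : ℂ := ((HLam e w.1 ^ 2 * cut R w : ℝ) : ℂ)

lemma contDiff_HLam (e : Z2) : ContDiff ℝ ∞ fun w : Cot => HLam e w.1 := by
  have : (fun w : Cot => HLam e w.1) = fun w => w.1 0 * unitDir e 0 + w.1 1 * unitDir e 1 :=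
    funext fun w => by rw [HLam, dotProduct, Fin.sum_univ_two]
  rw [this]
  have h0 : ∀ i : Fin 2, ContDiff ℝ ∞ fun w : Cot => w.1 i := fun i =>
    (contDiff_apply ℝ ℝ i).comp contDiff_fst
  exact ((h0 0).mul contDiff_const).add ((h0 1).mul contDiff_const)

lemma contDiff_hlamSq (e : Z2) (R : ℕ) : ContDiff ℝ ∞ (hlamSq e R) :=
  Complex.ofRealCLM.contDiff.comp (((contDiff_HLam e).pow 2).mul (contDiff_cut R))

lemma hasCompactSupport_hlamSq (e : Z2) (R : ℕ) : HasCompactSupport (hlamSq e R) :=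
  hasCompactSupport_cot_of_bound (R := R + 2) fun w hw => by
    rw [hlamSq, cut_eq_zero hw]; simp

/-- At a sampling point H_Λ(ξ) = εη, and |η| ≤ R + 2 on the support of the cut-off. -/
lemma norm_sample_hlamSq_le (e : Z2) (R : ℕ) (ħ : ℝ) {ε : ℝ} (hε : 0 < ε) (m : Z2) :
    ‖sample e ħ ε (hlamSq e R) m‖ ≤ ε ^ 2 * ((R : ℝ) + 2) ^ 2 := by
  rw [sample_eq]
  set w := samplePt e ħ ε m with hw
  have h1 : HLam e w.1 = ε * w.2 := by
    simp only [hw, samplePt]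
    field_simp
  rcases lt_or_ge ((R : ℝ) + 2) ‖w‖ with h | h
  · rw [hlamSq, cut_eq_zero h, mul_zero, Complex.ofReal_zero, norm_zero]
    positivity
  · have h2 : |w.2| ≤ R + 2 := (norm_snd_le w).trans h
    rw [hlamSq, Complex.norm_real, Real.norm_of_nonneg (mul_nonneg (sq_nonneg _) (cut R).nonneg),
      h1, mul_pow]
    refine (mul_le_of_le_one_right (by positivity) (cut R).le_one).trans ?_
    exact mul_le_mul_of_nonneg_left (sq_le_sq' (by linarith [neg_abs_le w.2])
      ((le_abs_self _).trans h2)) (sq_nonneg _)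

lemma modeFn_zero (c : Cot → ℂ) (z : Om) : modeFn 0 c z = c z.2 := by
  rw [modeFn, UnitAddTorus.mFourier_zero, ContinuousMap.one_apply, one_mul]

lemma ae_HLam_eq_zero {e : Z2} {M : Measure Om} [IsFiniteMeasure M]
    (h : ∀ R, ∫ z, modeFn 0 (hlamSq e R) z ∂M = 0) : ∀ᵐ z ∂M, HLam e z.2.1 = 0 := by
  have h1 : ∀ R, ∀ᵐ z ∂M, HLam e z.2.1 ^ 2 * cut R z.2 = 0 := fun R => by
    have h2 := h R
    simp only [modeFn_zero, hlamSq] at h2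
    rw [integral_complex_ofReal, Complex.ofReal_eq_zero, integral_eq_zero_iff_of_nonneg] at h2
    · exact h2
    · exact fun z => mul_nonneg (sq_nonneg _) (cut R).nonneg
    · have h3 := (BddCont.of_test (modeFn_mem_test 0 (contDiff_hlamSq e R)
        (hasCompactSupport_hlamSq e R))).integrable M
      have := h3.re
      simpa only [modeFn_zero, hlamSq, RCLike.re_to_complex, Complex.ofReal_re] using this
  filter_upwards [ae_all_iff.mpr h1] with z hz
  obtain ⟨R, hR⟩ := exists_nat_ge ‖z.2‖
  have := hz R
  rw [cut_eq_one (by linarith), mul_one] at this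
  exact pow_eq_zero_iff (two_ne_zero) |>.mp this

/-- A cut-off function that concentrates on `ξ = 0` for small `δ`. -/
def lowCoeff (R : ℕ) (δ : ℝ) (w : Cot) : ℂ :=
  (((δ / ((w.1 ⬝ᵥ w.1) / 2 + δ)) ^ 2 * cut R w : ℝ) : ℂ)

lemma dotProduct_self_nonneg' (x : Fin 2 → ℝ) : 0 ≤ x ⬝ᵥ x :=
  Finset.sum_nonneg fun i _ => mul_self_nonneg (x i)

lemma contDiff_lowCoeff (R : ℕ) {δ : ℝ} (hδ : 0 < δ) : ContDiff ℝ ∞ (lowCoeff R δ) := by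
  have h0 : ∀ i : Fin 2, ContDiff ℝ ∞ fun w : Cot => w.1 i := fun i =>
    (contDiff_apply ℝ ℝ i).comp contDiff_fst
  have h1 : ContDiff ℝ ∞ fun w : Cot => w.1 ⬝ᵥ w.1 := by
    simp only [dotProduct]
    exact ContDiff.sum fun i _ => (h0 i).mul (h0 i)
  refine Complex.ofRealCLM.contDiff.comp (((contDiff_const.div ((h1.div_const 2).add contDiff_const)
    fun w => ?_).pow 2).mul (contDiff_cut R))
  have := dotProduct_self_nonneg' w.1
  positivity

lemma hasCompactSupport_lowCoeff (R : ℕ) (δ : ℝ) : HasCompactSupport (lowCoeff R δ) :=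
  hasCompactSupport_cot_of_bound (R := R + 2) fun w hw => by
    rw [lowCoeff, cut_eq_zero hw]; simp

/-- For every δ the function `lowCoeff R δ` equals 1 at the points of the ball of radius R where ξ =
0, so its integral dominates the mass of that set. -/
lemma ae_xi_ne_zero {M : Measure Om} [IsFiniteMeasure M] {δ : ℕ → ℝ} (hδ : ∀ j, 0 < δ j)
    (h : ∀ R j, ‖∫ z, modeFn 0 (lowCoeff R (δ j)) z ∂M‖ ≤ (1 / ((j : ℝ) + 1)) ^ 2) :
    ∀ᵐ z ∂M, z.2.1 ≠ 0 := by
  have h1 : ∀ R : ℕ, ∀ᵐ z ∂M, ‖z.2‖ ≤ R → z.2.1 ≠ 0 := fun R => by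
    have h2 : ∀ j : ℕ, M.real {z : Om | ‖z.2‖ ≤ R ∧ z.2.1 = 0} ≤ (1 / ((j : ℝ) + 1)) ^ 2 := fun j => by
      refine le_trans ?_ (h R j)
      have h3 := (BddCont.of_test (modeFn_mem_test 0 (contDiff_lowCoeff R (hδ j))
        (hasCompactSupport_lowCoeff R (δ j)))).integrable M
      have h4 : Integrable (fun z : Om =>
          (δ j / ((z.2.1 ⬝ᵥ z.2.1) / 2 + δ j)) ^ 2 * cut R z.2) M := by
        have := h3.re
        simpa only [modeFn_zero, lowCoeff, RCLike.re_to_complex, Complex.ofReal_re] using this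
      have h5 := mul_meas_ge_le_integral_of_nonneg
        (.of_forall fun z => mul_nonneg (sq_nonneg _) (cut R).nonneg) h4 1
      simp only [modeFn_zero, lowCoeff]
      rw [integral_complex_ofReal, Complex.norm_real]
      refine le_trans ?_ (h5.trans (Real.le_norm_self _))
      rw [one_mul]
      refine measureReal_mono (fun z hz => ?_)
      have hz1 : ‖z.2‖ ≤ R := hz.1
      have hz2 : z.2.1 = 0 := hz.2
      change 1 ≤ (δ j / ((z.2.1 ⬝ᵥ z.2.1) / 2 + δ j)) ^ 2 * cut R z.2
      rw [cut_eq_one (by linarith), hz2, dotProduct_zero, zero_div, zero_add,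
        div_self (hδ j).ne']
      norm_num
    have h3 : Tendsto (fun j : ℕ => (1 / ((j : ℝ) + 1)) ^ 2) atTop (𝓝 0) := by
      simpa using (tendsto_one_div_add_atTop_nhds_zero_nat (𝕜 := ℝ)).pow 2
    have h4 : M.real {z : Om | ‖z.2‖ ≤ R ∧ z.2.1 = 0} = 0 :=
      le_antisymm (ge_of_tendsto' h3 h2) measureReal_nonneg
    rw [ae_iff]
    rw [measureReal_eq_zero_iff] at h4
    convert h4 using 2
    ext z
    simp
  filter_upwards [ae_all_iff.mpr h1] with z hz
  obtain ⟨R, hR⟩ := exists_nat_ge ‖z.2‖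
  exact hz R hR

/-- A regularisation of `c / (p·ξ)`, for `c` in the dense sequence. -/
def ratioCoeff (p : Z2) (n : ℕ × ℕ) (j : ℕ) (w : Cot) : ℂ :=
  (((toR p ⬝ᵥ w.1) / ((toR p ⬝ᵥ w.1) ^ 2 + 1 / ((j : ℝ) + 1)) : ℝ) : ℂ) * denseCoeff n w

lemma contDiff_ratioCoeff (p : Z2) (n : ℕ × ℕ) (j : ℕ) : ContDiff ℝ ∞ (ratioCoeff p n j) := by
  have h0 : ∀ i : Fin 2, ContDiff ℝ ∞ fun w : Cot => w.1 i := fun i =>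
    (contDiff_apply ℝ ℝ i).comp contDiff_fst
  have h1 : ContDiff ℝ ∞ fun w : Cot => toR p ⬝ᵥ w.1 := by
    simp only [dotProduct]
    exact ContDiff.sum fun i _ => contDiff_const.mul (h0 i)
  refine (Complex.ofRealCLM.contDiff.comp (h1.div ((h1.pow 2).add contDiff_const)
    fun w => ?_)).mul (contDiff_denseCoeff n)
  positivity

lemma hasCompactSupport_ratioCoeff (p : Z2) (n : ℕ × ℕ) (j : ℕ) :
    HasCompactSupport (ratioCoeff p n j) := (hasCompactSupport_denseCoeff n).mul_left

lemma integral_modeFn_eq_zero_of_dense {M : Measure Om} [IsFiniteMeasure M] {p : Z2}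
    (h : ∀ n, ∫ z, modeFn p (denseCoeff n) z ∂M = 0) {c : Cot → ℂ} (hc : ContDiff ℝ ∞ c)
    (hs : HasCompactSupport c) : ∫ z, modeFn p c z ∂M = 0 := by
  obtain ⟨r, hr⟩ := exists_support_bound_cot hs
  obtain ⟨R, hR⟩ := exists_nat_ge r
  refine norm_le_zero_iff.mp (le_of_forall_pos_le_add fun δ hδ => ?_)
  set D := M.real Set.univ + 1 with hD
  have hD0 : 0 < D := by positivity
  obtain ⟨i, hi⟩ := exists_countable_dense_coeff.choose_spec.2.2 R c hc
    (fun w hw => hr w (hR.trans_lt hw)) (δ / D) (by positivity)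
  have h1 := norm_integral_sub_le (le_refl (M.real Set.univ)) (f := modeFn p c)
    (g := modeFn p (denseCoeff (R, i))) (.of_test (modeFn_mem_test p hc hs))
    (.of_test (modeFn_mem_test p (contDiff_denseCoeff _) (hasCompactSupport_denseCoeff _)))
    (show 0 ≤ δ / D by positivity) fun z => by
      rw [modeFn, modeFn, ← mul_sub, norm_mul, norm_mFourier_apply, one_mul]
      exact (hi z.2).1
  rw [h, sub_zero] at h1
  rw [zero_add]
  refine h1.trans ?_
  rw [mul_div_assoc', div_le_iff₀ hD0, mul_comm]
  exact mul_le_mul_of_nonneg_left (by linarith) hδ.le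

/-- The relation satisfied on fast directions implies the invariance in the direction `e^⊥`. -/
lemma perpInvariant_of_ratio {e : Z2} (he : e ≠ 0) {M : Measure Om} [IsFiniteMeasure M]
    (h1 : ∀ᵐ z ∂M, HLam e z.2.1 = 0) (h2 : ∀ᵐ z ∂M, z.2.1 ≠ 0)
    (h : ∀ p, toR p ⬝ᵥ unitPerp e ≠ 0 → ∀ n j,
      ∫ z, modeFn p (mulXi p (ratioCoeff p n j)) z ∂M = 0) : PerpInvariant e M := by
  intro p hp c hc hs
  refine integral_modeFn_eq_zero_of_dense (fun n => ?_) hc hs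
  obtain ⟨B, hB0, hB⟩ := exists_bound_coeff (contDiff_denseCoeff n) (hasCompactSupport_denseCoeff n)
  have hval : ∀ j z, modeFn p (mulXi p (ratioCoeff p n j)) z =
      (((toR p ⬝ᵥ z.2.1) ^ 2 / ((toR p ⬝ᵥ z.2.1) ^ 2 + 1 / ((j : ℝ) + 1)) : ℝ) : ℂ) *
        (2 * Real.pi * Complex.I * modeFn p (denseCoeff n) z) := fun j z => by
    simp only [modeFn, mulXi, ratioCoeff]
    push_cast
    ring
  have hlim : Tendsto (fun j => ∫ z, modeFn p (mulXi p (ratioCoeff p n j)) z ∂M) atTop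
      (𝓝 (∫ z, 2 * Real.pi * Complex.I * modeFn p (denseCoeff n) z ∂M)) := by
    refine tendsto_integral_of_dominated_convergence (fun _ => 2 * Real.pi * B)
      (fun j => (Test.continuous (modeFn_mem_test p
        (contDiff_mulXi p (contDiff_ratioCoeff p n j))
        (hasCompactSupport_mulXi p (hasCompactSupport_ratioCoeff p n j)))).aestronglyMeasurable)
      (integrable_const _) (fun j => .of_forall fun z => ?_) ?_
    · rw [hval, norm_mul, Complex.norm_real, Real.norm_of_nonneg (by positivity)]
      have e1 : (toR p ⬝ᵥ z.2.1) ^ 2 / ((toR p ⬝ᵥ z.2.1) ^ 2 + 1 / ((j : ℝ) + 1)) ≤ 1 :=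
        div_le_one_of_le₀ (le_add_of_nonneg_right (by positivity)) (by positivity)
      refine (mul_le_of_le_one_left (norm_nonneg _) e1).trans ?_
      rw [norm_mul, norm_modeFn]
      have e2 : ‖(2 * Real.pi * Complex.I : ℂ)‖ = 2 * Real.pi := by
        simp [abs_of_pos Real.pi_pos]
      rw [e2]
      exact mul_le_mul_of_nonneg_left (hB _) (by positivity)
    · filter_upwards [h1, h2] with z hz1 hz2
      -- Almost everywhere ξ is a non-zero multiple of e^⊥, and p·e^⊥ ≠ 0. The regularised quotients
      -- therefore tend to 1.
      have hs0 : toR p ⬝ᵥ z.2.1 ≠ 0 := by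
        intro h0
        have e1 := eq_add_unitDir_unitPerp he z.2.1
        rw [show z.2.1 ⬝ᵥ unitDir e = 0 from hz1, zero_smul, zero_add] at e1
        have h0' : toR p ⬝ᵥ ((z.2.1 ⬝ᵥ unitPerp e) • unitPerp e) = 0 := by rw [← e1]; exact h0
        rw [dotProduct_smul, smul_eq_mul] at h0'
        have e2 := (mul_eq_zero.mp h0').resolve_right hp
        rw [e2, zero_smul] at e1
        exact hz2 e1
      simp only [hval]
      have e1 : Tendsto (fun j : ℕ => (toR p ⬝ᵥ z.2.1) ^ 2 /
          ((toR p ⬝ᵥ z.2.1) ^ 2 + 1 / ((j : ℝ) + 1))) atTop (𝓝 1) := by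
        have := (tendsto_const_nhds (x := (toR p ⬝ᵥ z.2.1) ^ 2)).div
          ((tendsto_one_div_add_atTop_nhds_zero_nat (𝕜 := ℝ)).const_add ((toR p ⬝ᵥ z.2.1) ^ 2))
          (by rw [add_zero]; exact pow_ne_zero 2 hs0)
        rwa [add_zero, div_self (pow_ne_zero 2 hs0)] at this
      have e2 := (Complex.continuous_ofReal.tendsto _).comp e1
      have e3 := e2.mul_const (2 * Real.pi * Complex.I * modeFn p (denseCoeff n) z)
      rwa [Complex.ofReal_one, one_mul] at e3
  simp only [h p hp n] at hlim
  have h3 := tendsto_nhds_unique hlim tendsto_const_nhds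
  rw [integral_const_mul] at h3
  exact (mul_eq_zero.mp h3).resolve_left Complex.two_pi_I_ne_zero

/-! ### Low frequencies -/

/-- For p = 0 the sampling point is ξ = 2πħk, where |ξ|²/2 is the eigenvalue of -ħ²Δ/2. The
correlation is the square of the regularised low mass, damped by the cut-off. -/
lemma norm_corr_lowCoeff_le (e : Z2) {ħ ε δ : ℝ} (hδ : 0 < δ) (u : L2T) (R : ℕ) :
    ‖corr (coef u) 0 (sample e ħ ε (lowCoeff R δ))‖ ≤ lowMass expBasis (freeEig ħ) δ u ^ 2 := by
  have hterm : ∀ k, (δ / (freeEig ħ k + δ)) ^ 2 * ‖expBasis.repr u k‖ ^ 2 ≤ ‖coef u k‖ ^ 2 :=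
    fun k => by
      rw [expBasis_repr]
      refine mul_le_of_le_one_left (sq_nonneg _) (pow_le_one₀ ?_ ?_)
      · have := freeEig_nonneg ħ k
        positivity
      · have := freeEig_nonneg ħ k
        rw [div_le_one (by positivity)]
        linarith
  have hsum : Summable fun k => (δ / (freeEig ħ k + δ)) ^ 2 * ‖expBasis.repr u k‖ ^ 2 :=
    .of_nonneg_of_le (fun k => by positivity) hterm (summable_sq_coef u)
  rw [lowMass, Real.sq_sqrt (tsum_nonneg fun k => by positivity), corr]
  refine tsum_of_norm_bounded hsum.hasSum fun k => ?_
  have hξ : ((samplePt e ħ ε (k + k + 0)).1 ⬝ᵥ (samplePt e ħ ε (k + k + 0)).1) / 2 =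
      freeEig ħ k := by
    simp only [samplePt, add_zero, toR_add, freeEig, normSq, smul_dotProduct, dotProduct_smul,
      add_dotProduct, dotProduct_add, smul_eq_mul]
    ring
  rw [sample_eq, lowCoeff, hξ, add_zero, norm_mul, norm_mul, RCLike.norm_conj, Complex.norm_real,
    Real.norm_of_nonneg (mul_nonneg (sq_nonneg _) (cut R).nonneg), expBasis_repr, add_zero]
  have h1 : (δ / (freeEig ħ k + δ)) ^ 2 * (cut R) (samplePt e ħ ε (k + k)) ≤
      (δ / (freeEig ħ k + δ)) ^ 2 := mul_le_of_le_one_right (sq_nonneg _) (cut R).le_one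
  calc ‖coef u k‖ * ‖coef u k‖ * ((δ / (freeEig ħ k + δ)) ^ 2 * (cut R) (samplePt e ħ ε (k + k)))
      ≤ ‖coef u k‖ * ‖coef u k‖ * (δ / (freeEig ħ k + δ)) ^ 2 := by gcongr
    _ = _ := by ring

lemma sq_spectralNorm (S : Set ℝ) (ħ : ℝ) (u : L2T) [DecidablePred (· ∈ S)] :
    spectralNorm S ħ u ^ 2 = ∑' k, if ħ ^ 2 * (4 * Real.pi ^ 2 * normSq k) ∈ S then
      ‖coef u k‖ ^ 2 else 0 := by
  rw [spectralNorm, Real.sq_sqrt (tsum_nonneg fun k => by split_ifs <;> positivity)]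
  refine tsum_congr fun k => ?_
  simp only [coef]
  congr

lemma summable_spectral (S : Set ℝ) (ħ : ℝ) (u : L2T) [DecidablePred (· ∈ S)] :
    Summable fun k => if ħ ^ 2 * (4 * Real.pi ^ 2 * normSq k) ∈ S then ‖coef u k‖ ^ 2 else 0 :=
  .of_nonneg_of_le (fun k => by split_ifs <;> positivity)
    (fun k => by split_ifs <;> [rfl; positivity]) (summable_sq_coef u)

lemma spectralNorm_le (S : Set ℝ) (ħ : ℝ) (u : L2T) : spectralNorm S ħ u ≤ ‖u‖ := by
  classical
  refine abs_le_of_sq_le_sq' ?_ (norm_nonneg u) |>.2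
  rw [sq_spectralNorm, ← tsum_sq_coef]
  exact (summable_spectral S ħ u).tsum_le_tsum (fun k => by split_ifs <;> [rfl; positivity])
    (summable_sq_coef u)

/-- The window concerns -ħ²Δ and the regularisation concerns half of it: outside the window the
eigenvalue of -ħ²Δ/2 exceeds δ'/2, whence the factor δ/(δ'/2). -/
lemma sq_lowMass_le {ħ δ δ' : ℝ} (hδ : 0 < δ) (hδ' : 0 < δ') (u : L2T) :
    lowMass expBasis (freeEig ħ) δ u ^ 2 ≤
      spectralNorm (Set.Icc 0 δ') ħ u ^ 2 + (δ / (δ' / 2)) ^ 2 * ‖u‖ ^ 2 := by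
  classical
  have h1 := summable_spectral (Set.Icc 0 δ') ħ u
  have h2 := (summable_sq_coef u).mul_left ((δ / (δ' / 2)) ^ 2)
  have hle : ∀ k, (δ / (freeEig ħ k + δ)) ^ 2 * ‖expBasis.repr u k‖ ^ 2 ≤
      (if ħ ^ 2 * (4 * Real.pi ^ 2 * normSq k) ∈ Set.Icc 0 δ' then ‖coef u k‖ ^ 2 else 0) +
        (δ / (δ' / 2)) ^ 2 * ‖coef u k‖ ^ 2 := fun k => by
    rw [expBasis_repr]
    have h0 := freeEig_nonneg ħ k
    have hk : ħ ^ 2 * (4 * Real.pi ^ 2 * normSq k) = 2 * freeEig ħ k := by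
      rw [freeEig]; ring
    rw [hk]
    split_ifs with h
    · refine le_add_of_le_of_nonneg (mul_le_of_le_one_left (sq_nonneg _)
        (pow_le_one₀ (by positivity) ?_)) (by positivity)
      rw [div_le_one (by positivity)]
      linarith
    · rw [zero_add]
      have h3 : δ' < 2 * freeEig ħ k := by
        by_contra hcon
        exact h ⟨by positivity, not_lt.mp hcon⟩
      gcongr
      linarith
  rw [lowMass, Real.sq_sqrt (tsum_nonneg fun k => by positivity), sq_spectralNorm, ← tsum_sq_coef,
    ← tsum_mul_left, ← h1.tsum_add h2]
  exact (Summable.of_nonneg_of_le (fun k => by positivity) hle (h1.add h2)).tsum_le_tsum hle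
    (h1.add h2)

lemma IsStrictlyOscillating.exists_lowMass_le {ħ : ℕ → ℝ} {u : ℕ → L2T} (hu : ∀ n, ‖u n‖ = 1)
    (h : IsStrictlyOscillating ħ u) {κ : ℝ} (hκ : 0 < κ) :
    ∃ δ > 0, ∀ᶠ n in atTop, lowMass expBasis (freeEig (ħ n)) δ (u n) ≤ κ := by
  have h1 := (h.eventually_lt_const (half_pos hκ)).and self_mem_nhdsWithin
  obtain ⟨δ', h2, h3⟩ := h1.exists
  have hδ' : 0 < δ' := h3
  -- With this δ the factor δ/(δ'/2) equals κ/2, so both terms are at most (κ/2)².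
  refine ⟨δ' * κ / 4, by positivity, ?_⟩
  have h4 := eventually_lt_of_limsup_lt h2
    (isBoundedUnder_of ⟨1, fun n => (spectralNorm_le _ _ _).trans (hu n).le⟩)
  filter_upwards [h4] with n hn
  refine abs_le_of_sq_le_sq' ((sq_lowMass_le (by positivity) hδ' (u n)).trans ?_) hκ.le |>.2
  have h5 : 0 ≤ spectralNorm (Set.Icc 0 δ') (ħ n) (u n) := Real.sqrt_nonneg _
  rw [hu n]
  have h6 : δ' * κ / 4 / (δ' / 2) = κ / 2 := by field_simp; ring
  rw [h6]
  nlinarith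

end

/-! ### The sequence of solutions and its limit family of measures. -/

section

/-! ### The semiclassical evolution -/

/-- A sequence of solutions of the Schrödinger equation, in the regime under study. -/
structure Evolution (e : Z2) (V : T2 → ℝ) (ħ ε τ : ℕ → ℝ) (u : ℕ → L2T) (v : ℕ → ℝ → L2T) :
    Prop where
  ne_zero : e ≠ 0
  smooth : SmoothOnTorus V
  ħ_pos : ∀ n, 0 < ħ n
  ħ_lim : Tendsto ħ atTop (𝓝 0)
  ε_pos : ∀ n, 0 < ε n
  ε_lim : Tendsto ε atTop (𝓝 0)
  ratio_lim : Tendsto (fun n => ħ n / ε n) atTop (𝓝 0)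
  τ_lim : Tendsto τ atTop atTop
  norm_u : ∀ n, ‖u n‖ = 1
  strict : IsStrictlyOscillating ħ u
  sol : ∀ n, IsSchrodingerSolution V (ħ n) (ε n) (u n) (v n)

variable {e : Z2} {V : T2 → ℝ} {ħ ε τ : ℕ → ℝ} {u : ℕ → L2T} {v : ℕ → ℝ → L2T}

section

variable (E : Evolution e V ħ ε τ u v)
include E

lemma Evolution.norm_v (n : ℕ) (t : ℝ) : ‖v n t‖ = 1 :=
  ((E.sol n).norm_eq E.smooth t).trans (E.norm_u n)

lemma Evolution.norm_corr_le (n : ℕ) (t : ℝ) (p : Z2) {f : Z2 → ℂ} {B : ℝ} (hB : ∀ m, ‖f m‖ ≤ B) :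
    ‖corr (coef (v n t)) p f‖ ≤ B := by
  have := TwoMicrolocal.norm_corr_le (summable_sq_coef (v n t)) p hB
  rwa [tsum_sq_coef, E.norm_v, one_pow, mul_one] at this

lemma Evolution.continuous_corr (n : ℕ) (p : Z2) {c : Cot → ℂ} (hs : HasCompactSupport c) :
    Continuous fun t => corr (coef (v n (t * τ n))) p (sample e (ħ n) (ε n) c) :=
  continuous_corr_sample e (E.ħ_pos n) ((E.sol n).1.comp (continuous_id.mul continuous_const)) p hs

lemma Evolution.continuous_corrField (n : ℕ) (p : Z2) {c : Cot → ℂ} (hc : ContDiff ℝ ∞ c)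
    (hs : HasCompactSupport c) :
    Continuous fun t => corrField e V (ħ n) (ε n) p c (coef (v n (t * τ n))) :=
  TwoMicrolocal.continuous_corrField e E.smooth (E.ħ_pos n)
    ((E.sol n).1.comp (continuous_id.mul continuous_const)) (fun _ => E.norm_v _ _) p hc hs

lemma Evolution.eventually_nonneg (R : ℕ) (f : Finset (Z2 × ℕ)) {κ : ℝ} (hκ : 0 < κ) :
    ∀ᶠ n in atTop, ∀ u : L2T, ‖u‖ = 1 →
      ∑ q ∈ f.image Prod.fst ×ˢ f.image Prod.fst,
        corr (coef u) (q.1 - q.2) (sample e (ħ n) (ε n) (sqCoeff R f q)) ∈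
          Metric.cthickening κ nonnegC :=
  eventually_mem_cthickening_nonnegC e E.ħ_pos E.ε_pos E.ε_lim E.ratio_lim R f hκ

lemma Evolution.eventually_hlamSq (R : ℕ) {κ : ℝ} (hκ : 0 < κ) :
    ∀ᶠ n in atTop, ∀ u : L2T, ‖u‖ = 1 →
      corr (coef u) 0 (sample e (ħ n) (ε n) (hlamSq e R)) ∈ Metric.cthickening κ ({0} : Set ℂ) := by
  have h1 : Tendsto (fun n => ε n ^ 2 * ((R : ℝ) + 2) ^ 2) atTop (𝓝 0) := by
    simpa using (E.ε_lim.pow 2).mul_const (((R : ℝ) + 2) ^ 2)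
  filter_upwards [h1.eventually_lt_const hκ] with n hn u hu
  exact corr_mem_cthickening_zero hu 0 fun m =>
    (norm_sample_hlamSq_le e R (ħ n) (E.ε_pos n) m).trans hn.le

/-- For fixed δ the defect in the conservation of the low mass is O(ε²/δ) whatever the time, so the
absence of concentration at ξ = 0 propagates uniformly over all times. -/
lemma Evolution.exists_lowCoeff {κ : ℝ} (hκ : 0 < κ) : ∃ δ > 0, ∀ᶠ n in atTop, ∀ R t,
    ‖corr (coef (v n t)) 0 (sample e (ħ n) (ε n) (lowCoeff R δ))‖ ≤ κ ^ 2 := by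
  obtain ⟨δ, hδ, h⟩ := E.strict.exists_lowMass_le E.norm_u (half_pos hκ)
  refine ⟨δ, hδ, ?_⟩
  set A := ‖mulOp (potC V E.smooth)‖ with hA
  have h1 : Tendsto (fun n => ε n ^ 2 * A) atTop (𝓝 0) := by
    simpa using (E.ε_lim.pow 2).mul_const A
  have h2 : Tendsto (fun n => 4 * (ε n ^ 2 * A) / δ * 1) atTop (𝓝 0) := by
    simpa using (h1.const_mul 4).div_const δ
  filter_upwards [h, h1.eventually_le_const (half_pos hδ), h2.eventually_le_const (half_pos hκ)]
    with n hn1 hn2 hn3 R t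
  refine (norm_corr_lowCoeff_le e hδ (v n t) R).trans ?_
  have h3 := (E.sol n).lowMass_le E.smooth hδ hn2 t
  rw [E.norm_u] at h3
  have h4 : 0 ≤ lowMass expBasis (freeEig (ħ n)) δ (v n t) := Real.sqrt_nonneg _
  exact pow_le_pow_left₀ h4 (h3.trans (by linarith)) 2

/-- The fast part of the field dominates. -/
lemma Evolution.exists_bound_fieldTail {c : Cot → ℂ} (hc : ContDiff ℝ ∞ c)
    (hs : HasCompactSupport c) (p : Z2) : ∃ D, 0 ≤ D ∧ ∀ n t,
      ‖corrField e V (ħ n) (ε n) p c (coef (v n t)) -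
        corr (coef (v n t)) p (sample e (ħ n) (ε n) (mulXi p c))‖ ≤ ε n * D := by
  obtain ⟨B, hB0, hB⟩ := exists_bound_coeff (contDiff_dEta hc) (hasCompactSupport_dEta hs)
  have hsum := E.smooth.smoothC.summable_weighted.mul_left (4 * Real.pi * B)
  refine ⟨∑' j, 4 * Real.pi * B * ((1 + ‖toR j‖) ^ 2 * ‖vhat V j‖),
    tsum_nonneg fun j => by have := Real.pi_pos; positivity, fun n t => ?_⟩
  rw [corrField, sub_sub_cancel_left, norm_neg, norm_mul, Complex.norm_real,
    Real.norm_of_nonneg (E.ε_pos n).le]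
  exact mul_le_mul_of_nonneg_left (tsum_of_norm_bounded hsum.hasSum fun j =>
    norm_vhat_mul_le e V j (E.norm_corr_le n t (p + j) fun m => hB _)) (E.ε_pos n).le

/-- Multiplied by τ, the time integral is a difference of two bounded correlations up to O(τ(ε +
ħ)), for large n; dividing by τ → ∞ leaves o(1). -/
lemma Evolution.tendsto_fast {c : Cot → ℂ} (hc : ContDiff ℝ ∞ c)
    (hs : HasCompactSupport c) (p : Z2) (s t : ℝ) :
    Tendsto (fun n => ∫ r in s..t, corr (coef (v n (r * τ n))) p
      (sample e (ħ n) (ε n) (mulXi p c))) atTop (𝓝 0) := by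
  obtain ⟨B, hB0, hB⟩ := exists_bound_coeff hc hs
  obtain ⟨D, hD0, hD⟩ := E.exists_bound_fieldTail hc hs p
  obtain ⟨C, hC0, hC⟩ := norm_corr_increment_le e E.smooth p hc hs
  have hlim : Tendsto (fun n => 2 * B * (τ n)⁻¹ + C * (ε n ^ 2 + ħ n) * |t - s| +
      ε n * D * |t - s|) atTop (𝓝 0) := by
    have h1 := (tendsto_inv_atTop_zero.comp E.τ_lim).const_mul (2 * B)
    have h2 := (((E.ε_lim.pow 2).add E.ħ_lim).const_mul C).mul_const |t - s|
    have h3 := (E.ε_lim.mul_const D).mul_const |t - s|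
    simpa using (h1.add h2).add h3
  refine squeeze_zero_norm' ?_ hlim
  filter_upwards [E.ε_lim.eventually_le_const one_pos, E.τ_lim.eventually_gt_atTop 0] with n hn1 hn2
  have h1 := hC (ħ n) (ε n) (E.ħ_pos n) (E.ε_pos n) hn1 (u n) (v n) (E.norm_u n) (E.sol n) (τ n) s t
  set I := ∫ r in s..t, corrField e V (ħ n) (ε n) p c (coef (v n (r * τ n))) with hI
  have h2 : ‖(τ n : ℂ) * I‖ ≤ 2 * B + C * (ε n ^ 2 + ħ n) * |τ n| * |t - s| := by
    have e1 := E.norm_corr_le n (t * τ n) p (f := sample e (ħ n) (ε n) c) fun m => hB _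
    have e2 := E.norm_corr_le n (s * τ n) p (f := sample e (ħ n) (ε n) c) fun m => hB _
    set x := corr (coef (v n (t * τ n))) p (sample e (ħ n) (ε n) c)
    set y := corr (coef (v n (s * τ n))) p (sample e (ħ n) (ε n) c)
    calc ‖(τ n : ℂ) * I‖ = ‖x - y - (x - y - (τ n : ℂ) * I)‖ := by congr 1; ring
      _ ≤ ‖x‖ + ‖y‖ + ‖x - y - (τ n : ℂ) * I‖ :=
        (norm_sub_le _ _).trans (by gcongr; exact norm_sub_le _ _)
      _ ≤ _ := by linarith
  rw [norm_mul, Complex.norm_real, Real.norm_of_nonneg hn2.le, abs_of_pos hn2] at h2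
  have h3 : ‖I‖ ≤ 2 * B * (τ n)⁻¹ + C * (ε n ^ 2 + ħ n) * |t - s| := by
    rw [← mul_le_mul_iff_right₀ hn2]
    refine h2.trans_eq ?_
    field_simp
  have h4 : ‖I - ∫ r in s..t, corr (coef (v n (r * τ n))) p
      (sample e (ħ n) (ε n) (mulXi p c))‖ ≤ ε n * D * |t - s| := by
    rw [hI, ← intervalIntegral.integral_sub
      ((E.continuous_corrField n p hc hs).intervalIntegrable _ _)
      ((E.continuous_corr n p (hasCompactSupport_mulXi p hs)).intervalIntegrable _ _)]
    exact intervalIntegral.norm_integral_le_of_norm_le_const fun r _ => hD n _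
  set J := ∫ r in s..t, corr (coef (v n (r * τ n))) p (sample e (ħ n) (ε n) (mulXi p c))
  calc ‖J‖ = ‖I - (I - J)‖ := by congr 1; ring
    _ ≤ ‖I‖ + ‖I - J‖ := norm_sub_le _ _
    _ ≤ _ := add_le_add h3 h4

end

/-! ### Slow directions -/

/-- The derivative of the correlations in the slow directions, divided by `ε`. -/
def slowField (e : Z2) (V : T2 → ℝ) (ħ ε : ℝ) (p : Z2) (c : Cot → ℂ) (x : Z2 → ℂ) : ℂ :=
  corr x p (sample e ħ ε (mulEta e p c)) -
    ∑' j, vhat V j * (2 * Real.pi * Complex.I * ((toR j ⬝ᵥ unitDir e : ℝ) : ℂ)) *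
      corr x (p + j) (sample e ħ ε (dEta c))

/-- Here p is parallel to e, so p·ξ = (p·e/L)H_Λ(ξ), and H_Λ(ξ) = εη at the sampling points: the
kinetic term drops to the size of the potential term. -/
lemma corrField_eq (he : e ≠ 0) {ħ ε : ℝ} (hε : 0 < ε) {p : Z2}
    (hp : toR p ⬝ᵥ unitPerp e = 0) (c : Cot → ℂ) (x : Z2 → ℂ) :
    corrField e V ħ ε p c x = ε * slowField e V ħ ε p c x := by
  rw [corrField, slowField, mul_sub, ← corr_const_mul]
  congr 2
  funext m
  rw [sample_eq, sample_eq, mulXi, mulEta]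
  have h1 : toR p ⬝ᵥ (samplePt e ħ ε m).1 =
      (toR p ⬝ᵥ unitDir e) * (ε * (samplePt e ħ ε m).2) := by
    have h2 : ε * (samplePt e ħ ε m).2 = (samplePt e ħ ε m).1 ⬝ᵥ unitDir e := by
      simp only [samplePt, HLam]
      field_simp
    conv_lhs => rw [eq_add_unitDir_unitPerp he (toR p), hp, zero_smul, add_zero, smul_dotProduct,
      dotProduct_comm (unitDir e), ← h2]
    rfl
  rw [h1]
  push_cast
  ring

/-- The limit family of measures. -/
structure LimitFamily (e : Z2) (ħ ε τ : ℕ → ℝ) (v : ℕ → ℝ → L2T) (N : ℝ → Measure Om) (C : ℝ) :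
    Prop where
  finite : ∀ t, IsFiniteMeasure (N t)
  mass : ∀ t, (N t).real Set.univ ≤ C
  measurable : ∀ a ∈ Test, AEStronglyMeasurable (fun t => ∫ z, a z ∂(N t)) volume
  tendsto : ∀ (p : Z2) (c : Cot → ℂ), ContDiff ℝ ∞ c → HasCompactSupport c → ∀ s t : ℝ,
    Tendsto (fun n => ∫ r in s..t, corr (coef (v n (r * τ n))) p (sample e (ħ n) (ε n) c)) atTop
      (𝓝 (∫ r in s..t, ∫ z, modeFn p c z ∂(N r)))

lemma PosOnSquares.of_forall {L : Symbols →ₗ[ℂ] ℂ} (h : ∀ (R : ℕ) (f : Finset (Z2 × ℕ)),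
    ∑ q ∈ f.image Prod.fst ×ˢ f.image Prod.fst, L (modeSym (q.1 - q.2) (sqCoeff R f q)
      (contDiff_sqCoeff R f q) (hasCompactSupport_sqCoeff R f q)) ∈ nonnegC) : PosOnSquares L :=
  fun R f => by
    rw [map_trigSum_sq]
    exact h R f

/-- Positivity and concentration on H_Λ = 0 hold at each single time. Invariance along e^⊥ is
produced by averaging in time, and the initial measure need not have it. -/
lemma Evolution.exists_initial_measure (E : Evolution e V ħ ε τ u v) {μ₀ : Symbols →ₗ[ℂ] ℂ}
    (hμ : IsInitialLimit e ħ ε u μ₀) : ∃ M : Measure Om, IsFiniteMeasure M ∧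
      (∀ a (ha : a ∈ Test), μ₀ (toSym ⟨a, ha⟩) = ∫ z, a z ∂M) ∧ ∀ᵐ z ∂M, HLam e z.2.1 = 0 := by
  obtain ⟨C, hC⟩ := hμ.bounded
  have hpos : PosOnSquares μ₀ := .of_forall fun R f =>
    hμ.mem (f.image Prod.fst ×ˢ f.image Prod.fst) (fun q : Z2 × Z2 => q.1 - q.2) (sqCoeff R f)
      (contDiff_sqCoeff R f) (hasCompactSupport_sqCoeff R f) isClosed_nonnegC fun κ hκ =>
        (E.eventually_nonneg R f hκ).mono fun n hn => hn _ (E.norm_u n)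
  obtain ⟨M, hM, -, hint⟩ := hpos.exists_measure hC
  refine ⟨M, hM, hint, ae_HLam_eq_zero fun R => ?_⟩
  have h1 := hμ.mem (Finset.univ : Finset Unit) (fun _ => 0) (fun _ => hlamSq e R)
    (fun _ => contDiff_hlamSq e R) (fun _ => hasCompactSupport_hlamSq e R) (S := {0})
    isClosed_singleton fun κ hκ => by
      simp only [Finset.univ_unique, Finset.sum_singleton]
      exact (E.eventually_hlamSq R hκ).mono fun n hn => hn _ (E.norm_u n)
  simp only [Finset.univ_unique, Finset.sum_singleton] at h1
  rw [← hint _ (modeFn_mem_test 0 (contDiff_hlamSq e R) (hasCompactSupport_hlamSq e R))]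
  exact h1

lemma IsTimeLimit.ae_mem_single {μ : ℝ → Symbols →ₗ[ℂ] ℂ} (hμ : IsTimeLimit e ħ ε τ v μ)
    (E : Evolution e V ħ ε τ u v) (p : Z2) {c : Cot → ℂ} (hc : ContDiff ℝ ∞ c)
    (hs : HasCompactSupport c) {S : Set ℂ} (hS : IsClosed S) (hconv : Convex ℝ S)
    (h : ∀ κ > 0, ∀ᶠ n in atTop, ∀ t,
      corr (coef (v n t)) p (sample e (ħ n) (ε n) c) ∈ Metric.cthickening κ S) :
    ∀ᵐ t, μ t (modeSym p c hc hs) ∈ S := by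
  have := hμ.ae_mem E.ħ_pos (fun n => (E.sol n).1) (Finset.univ : Finset Unit) (fun _ => p)
    (fun _ => c) (fun _ => hc) (fun _ => hs) hS hconv (by simpa using h)
  simpa using this

/-- Each property is a countable set of conditions on μ(t): squares with dense coefficients for
positivity, cut-off radii and precisions for the support, regularised quotients for the invariance.
Hence all of them hold together for almost every t. -/
lemma Evolution.exists_limitFamily (E : Evolution e V ħ ε τ u v) {μ : ℝ → Symbols →ₗ[ℂ] ℂ}
    (hμ : IsTimeLimit e ħ ε τ v μ) : ∃ (N : ℝ → Measure Om) (C : ℝ),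
      LimitFamily e ħ ε τ v N C ∧
      (∀ᵐ t, ∀ a (ha : a ∈ Test), μ t (toSym ⟨a, ha⟩) = ∫ z, a z ∂(N t)) ∧
      (∀ᵐ t, ∀ᵐ z ∂(N t), HLam e z.2.1 = 0) ∧ ∀ᵐ t, PerpInvariant e (N t) := by
  classical
  obtain ⟨C, hC⟩ := hμ.bounded
  have hpos : ∀ᵐ t, PosOnSquares (μ t) := by
    have h1 : ∀ q : ℕ × Finset (Z2 × ℕ), ∀ᵐ t, ∑ p ∈ q.2.image Prod.fst ×ˢ q.2.image Prod.fst,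
        μ t (modeSym (p.1 - p.2) (sqCoeff q.1 q.2 p) (contDiff_sqCoeff q.1 q.2 p)
          (hasCompactSupport_sqCoeff q.1 q.2 p)) ∈ nonnegC := fun q =>
      hμ.ae_mem E.ħ_pos (fun n => (E.sol n).1) _ (fun p : Z2 × Z2 => p.1 - p.2) _ _ _
        isClosed_nonnegC convex_nonnegC fun κ hκ =>
          (E.eventually_nonneg q.1 q.2 hκ).mono fun n hn t => hn _ (E.norm_v n t)
    filter_upwards [ae_all_iff.mpr h1] with t ht
    exact .of_forall fun R f => ht (R, f)
  -- At the exceptional times the zero measure is taken, so that finiteness and the mass bound hold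
  -- for every t.
  have hex : ∀ t, ∃ M : Measure Om, IsFiniteMeasure M ∧ M.real Set.univ ≤ |C| ∧
      (BDualBound (μ t) C → PosOnSquares (μ t) →
        ∀ a (ha : a ∈ Test), μ t (toSym ⟨a, ha⟩) = ∫ z, a z ∂M) := fun t => by
    by_cases h : BDualBound (μ t) C ∧ PosOnSquares (μ t)
    · obtain ⟨M, h1, h2, h3⟩ := h.2.exists_measure h.1
      exact ⟨M, h1, h2, fun _ _ => h3⟩
    · exact ⟨0, inferInstance, by simp, fun h1 h2 => absurd ⟨h1, h2⟩ h⟩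
  choose N hfin hmass hN using hex
  have hrep : ∀ᵐ t, ∀ a (ha : a ∈ Test), μ t (toSym ⟨a, ha⟩) = ∫ z, a z ∂(N t) := by
    filter_upwards [hC, hpos] with t h1 h2
    exact hN t h1 h2
  have hH : ∀ᵐ t, ∀ᵐ z ∂(N t), HLam e z.2.1 = 0 := by
    have h1 : ∀ R, ∀ᵐ t, μ t (modeSym 0 (hlamSq e R) (contDiff_hlamSq e R)
        (hasCompactSupport_hlamSq e R)) ∈ ({0} : Set ℂ) := fun R =>
      hμ.ae_mem_single E 0 _ _ isClosed_singleton (convex_singleton 0) fun κ hκ =>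
        (E.eventually_hlamSq R hκ).mono fun n hn t => hn _ (E.norm_v n t)
    filter_upwards [ae_all_iff.mpr h1, hrep] with t h2 h3
    refine ae_HLam_eq_zero fun R => ?_
    rw [← h3 _ (modeFn_mem_test 0 (contDiff_hlamSq e R) (hasCompactSupport_hlamSq e R))]
    exact h2 R
  have hξ : ∀ᵐ t, ∀ᵐ z ∂(N t), z.2.1 ≠ 0 := by
    choose δ hδ h1 using fun j : ℕ => E.exists_lowCoeff (κ := 1 / ((j : ℝ) + 1))
      Nat.one_div_pos_of_nat
    have h2 : ∀ R j : ℕ, ∀ᵐ t, μ t (modeSym 0 (lowCoeff R (δ j)) (contDiff_lowCoeff R (hδ j))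
        (hasCompactSupport_lowCoeff R (δ j))) ∈
          Metric.closedBall (0 : ℂ) ((1 / ((j : ℝ) + 1)) ^ 2) := fun R j =>
      hμ.ae_mem_single E 0 _ _ Metric.isClosed_closedBall (convex_closedBall _ _) fun κ hκ =>
        (h1 j).mono fun n hn t => Metric.self_subset_cthickening _
          (mem_closedBall_zero_iff.mpr (hn R t))
    filter_upwards [ae_all_iff.mpr fun R => ae_all_iff.mpr (h2 R), hrep] with t h3 h4
    refine ae_xi_ne_zero hδ fun R j => ?_
    rw [← h4 _ (modeFn_mem_test 0 (contDiff_lowCoeff R (hδ j)) (hasCompactSupport_lowCoeff R (δ j)))]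
    exact mem_closedBall_zero_iff.mp (h3 R j)
  refine ⟨N, |C|, ⟨hfin, hmass, fun a ha => ?_, fun p c hc hs s t => ?_⟩, hrep, hH, ?_⟩
  · exact (hμ.measurable (toSym ⟨a, ha⟩)).congr (hrep.mono fun t ht => ht a ha)
  · have h1 := hμ.tendsto_interval_mode p hc hs s t
    have h2 : ∫ r in s..t, μ r (modeSym p c hc hs) = ∫ r in s..t, ∫ z, modeFn p c z ∂(N r) :=
      intervalIntegral.integral_congr_ae (hrep.mono fun r hr _ => hr _ _)
    rwa [h2] at h1
  -- By `Evolution.tendsto_fast` the integral over every time interval is 0, hence so is almost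
  -- every value.
  · have h1 : ∀ (p : Z2) n j, ∀ᵐ t, μ t (modeSym p (mulXi p (ratioCoeff p n j))
        (contDiff_mulXi p (contDiff_ratioCoeff p n j))
        (hasCompactSupport_mulXi p (hasCompactSupport_ratioCoeff p n j))) = 0 := fun p n j => by
      refine ae_mem_of_average_mem (S := {0}) (hμ.locallyIntegrable _) isClosed_singleton
        fun s t _ => ?_
      have h2 := hμ.tendsto_interval_mode p (contDiff_mulXi p (contDiff_ratioCoeff p n j))
        (hasCompactSupport_mulXi p (hasCompactSupport_ratioCoeff p n j)) s t
      have h3 := tendsto_nhds_unique h2 (E.tendsto_fast (contDiff_ratioCoeff p n j)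
        (hasCompactSupport_ratioCoeff p n j) p s t)
      rw [modeSym] at h3
      rw [h3, smul_zero]
      rfl
    filter_upwards [hrep, hH, hξ,
      ae_all_iff.mpr fun p => ae_all_iff.mpr fun n => ae_all_iff.mpr (h1 p n)] with t h2 h3 h4 h5
    refine perpInvariant_of_ratio E.ne_zero h3 h4 fun p _ n j => ?_
    rw [← h5 p n j]
    exact (h2 _ _).symm

end

section

/-! ### The evolution of the limit measures -/

variable {e : Z2} {V : T2 → ℝ} {ħ ε τ : ℕ → ℝ} {u : ℕ → L2T} {v : ℕ → ℝ → L2T}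
  {N : ℝ → Measure Om} {C : ℝ}

lemma LimitFamily.norm_integral_le (hN : LimitFamily e ħ ε τ v N C) {f : Om → ℂ} {B : ℝ}
    (hB : ∀ z, ‖f z‖ ≤ B) (t : ℝ) : ‖∫ z, f z ∂(N t)‖ ≤ B * C := by
  have := hN.finite t
  refine (norm_integral_le_of_norm_le_const (.of_forall hB)).trans ?_
  exact mul_le_mul_of_nonneg_left (hN.mass t) ((norm_nonneg _).trans (hB default))

lemma LimitFamily.bddCont_intervalIntegrable (hN : LimitFamily e ħ ε τ v N C) {a : Om → ℂ}
    (ha : a ∈ Test) (s t : ℝ) :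
    IntervalIntegrable (fun r => ∫ z, a z ∂(N r)) volume s t := by
  have := hN.finite
  exact (BddCont.of_test ha).intervalIntegrable hN.mass (hN.measurable a ha) s t

/-- Before and after the limit the integrals are series over the frequencies j of V, dominated by a
multiple of (1 + ‖j‖)²|V̂(j)|, so the limit is taken termwise. In the limit the terms with j·e^⊥ ≠ 0
vanish by invariance, and what remains is the action of the averaged potential. -/
lemma LimitFamily.tendsto_slowField (hN : LimitFamily e ħ ε τ v N C)
    (E : Evolution e V ħ ε τ u v) (hperp : ∀ᵐ t, PerpInvariant e (N t)) {p : Z2}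
    (hp : toR p ⬝ᵥ unitPerp e = 0) {c : Cot → ℂ} (hc : ContDiff ℝ ∞ c) (hs : HasCompactSupport c)
    (s t : ℝ) :
    Tendsto (fun n => ∫ r in s..t, slowField e V (ħ n) (ε n) p c (coef (v n (r * τ n)))) atTop
      (𝓝 (∫ r in s..t, ∫ z, Xop e V (modeFn p c) z ∂(N r))) := by
  have hfin := hN.finite
  have hC0 : 0 ≤ C := measureReal_nonneg.trans (hN.mass 0)
  have hd := contDiff_dEta hc
  have hds := hasCompactSupport_dEta hs
  have hm := contDiff_mulEta e p hc
  have hms := hasCompactSupport_mulEta e p hs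
  obtain ⟨B, hB0, hB⟩ := exists_bound_coeff hd hds
  set γ : Z2 → ℂ := fun j => vhat V j * (2 * Real.pi * Complex.I * ((toR j ⬝ᵥ unitDir e : ℝ) : ℂ))
    with hγ
  have hsum : ∀ D : ℝ, Summable fun j => 4 * Real.pi * D * ((1 + ‖toR j‖) ^ 2 * ‖vhat V j‖) :=
    fun D => E.smooth.smoothC.summable_weighted.mul_left (4 * Real.pi * D)
  have hcorr : ∀ n r j, ‖corr (coef (v n (r * τ n))) (p + j) (sample e (ħ n) (ε n) (dEta c))‖ ≤ B :=
    fun n r j => E.norm_corr_le n _ (p + j) fun m => hB _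
  -- the integral of the field of index `n`, as a series
  have e1 : ∀ n, HasSum (fun j => γ j * ∫ r in s..t, corr (coef (v n (r * τ n))) (p + j)
      (sample e (ħ n) (ε n) (dEta c)))
      ((∫ r in s..t, corr (coef (v n (r * τ n))) p (sample e (ħ n) (ε n) (mulEta e p c))) -
        ∫ r in s..t, slowField e V (ħ n) (ε n) p c (coef (v n (r * τ n)))) := fun n => by
    have h1 : HasSum (fun j => ∫ r in s..t, γ j * corr (coef (v n (r * τ n))) (p + j)
        (sample e (ħ n) (ε n) (dEta c))) (∫ r in s..t, ∑' j, γ j * corr (coef (v n (r * τ n))) (p + j)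
        (sample e (ħ n) (ε n) (dEta c))) := by
      refine intervalIntegral.hasSum_integral_of_dominated_convergence
        (fun j _ => 4 * Real.pi * B * ((1 + ‖toR j‖) ^ 2 * ‖vhat V j‖))
        (fun j => ((continuous_const.mul (E.continuous_corr n (p + j) hds)).aestronglyMeasurable))
        (fun j => .of_forall fun r _ => norm_vhat_mul_le e V j (hcorr n r j))
        (.of_forall fun _ _ => hsum B) intervalIntegrable_const (.of_forall fun r _ => ?_)
      exact (Summable.of_norm_bounded (hsum B) fun j =>
        norm_vhat_mul_le e V j (hcorr n r j)).hasSum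
    simp only [intervalIntegral.integral_const_mul] at h1
    convert h1 using 1
    have hcont : Continuous fun r => ∑' j, γ j * corr (coef (v n (r * τ n))) (p + j)
        (sample e (ħ n) (ε n) (dEta c)) :=
      continuous_tsum (fun j => continuous_const.mul (E.continuous_corr n (p + j) hds)) (hsum B)
        fun j r => norm_vhat_mul_le e V j (hcorr n r j)
    simp only [slowField]
    rw [intervalIntegral.integral_sub ((E.continuous_corr n p hms).intervalIntegrable _ _)
      (hcont.intervalIntegrable _ _), sub_sub_cancel]
  -- the same for the limit
  have e2 : HasSum (fun j => γ j * ∫ r in s..t, ∫ z, modeFn (p + j) (dEta c) z ∂(N r))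
      ((∫ r in s..t, ∫ z, modeFn p (mulEta e p c) z ∂(N r)) -
        ∫ r in s..t, ∫ z, Xop e V (modeFn p c) z ∂(N r)) := by
    have hbd : ∀ j r, ‖∫ z, modeFn (p + j) (dEta c) z ∂(N r)‖ ≤ B * C := fun j r =>
      hN.norm_integral_le (fun z => by rw [norm_modeFn]; exact hB _) r
    have h1 : HasSum (fun j => ∫ r in s..t, γ j * ∫ z, modeFn (p + j) (dEta c) z ∂(N r))
        (∫ r in s..t, ∑' j, γ j * ∫ z, modeFn (p + j) (dEta c) z ∂(N r)) := by
      refine intervalIntegral.hasSum_integral_of_dominated_convergence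
        (fun j _ => 4 * Real.pi * (B * C) * ((1 + ‖toR j‖) ^ 2 * ‖vhat V j‖))
        (fun j => ((hN.measurable _ (modeFn_mem_test (p + j) hd hds)).const_mul (γ j)).restrict)
        (fun j => .of_forall fun r _ => norm_vhat_mul_le e V j (hbd j r))
        (.of_forall fun _ _ => hsum _) intervalIntegrable_const (.of_forall fun r _ => ?_)
      exact (Summable.of_norm_bounded (hsum (B * C)) fun j =>
        norm_vhat_mul_le e V j (hbd j r)).hasSum
    simp only [intervalIntegral.integral_const_mul] at h1
    convert h1 using 1
    obtain ⟨K, hK⟩ := exists_isPLamField E.ne_zero E.smooth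
    rw [← intervalIntegral.integral_sub
      (hN.bddCont_intervalIntegrable (modeFn_mem_test p hm hms) s t)
      (hN.bddCont_intervalIntegrable (hK.Xop_mem_test (modeFn_mem_test p hc hs)) s t)]
    refine intervalIntegral.integral_congr_ae (hperp.mono fun r hr _ => ?_)
    rw [hr.integral_Xop_eq E.ne_zero E.smooth hp hc hs, sub_sub_cancel]
  have e3 : Tendsto (fun n => ∑' j, γ j * ∫ r in s..t, corr (coef (v n (r * τ n))) (p + j)
      (sample e (ħ n) (ε n) (dEta c))) atTop
      (𝓝 (∑' j, γ j * ∫ r in s..t, ∫ z, modeFn (p + j) (dEta c) z ∂(N r))) := by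
    refine tendsto_tsum_of_dominated_convergence (hsum (B * |t - s|))
      (fun j => (hN.tendsto (p + j) _ hd hds s t).const_mul (γ j)) (.of_forall fun n j => ?_)
    exact norm_vhat_mul_le e V j
      (intervalIntegral.norm_integral_le_of_norm_le_const fun r _ => hcorr n r j)
  have e4 := (hN.tendsto p _ hm hms s t).sub e3
  rw [e2.tsum_eq, sub_sub_cancel] at e4
  refine e4.congr fun n => ?_
  rw [(e1 n).tsum_eq, sub_sub_cancel]

/-- The increments of the correlations in the slow directions. -/
lemma Evolution.norm_increment_le (E : Evolution e V ħ ε τ u v) {p : Z2}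
    (hp : toR p ⬝ᵥ unitPerp e = 0) {c : Cot → ℂ} (hc : ContDiff ℝ ∞ c) (hs : HasCompactSupport c) :
    ∃ D, 0 ≤ D ∧ ∀ᶠ n in atTop, ∀ s t : ℝ,
      ‖corr (coef (v n (t * τ n))) p (sample e (ħ n) (ε n) c) -
        corr (coef (v n (s * τ n))) p (sample e (ħ n) (ε n) c) -
        ((τ n * ε n : ℝ) : ℂ) *
          ∫ r in s..t, slowField e V (ħ n) (ε n) p c (coef (v n (r * τ n)))‖ ≤
        D * (ε n + ħ n / ε n) * (τ n * ε n) * |t - s| := by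
  obtain ⟨D, hD0, hD⟩ := norm_corr_increment_le e E.smooth p hc hs
  refine ⟨D, hD0, ?_⟩
  filter_upwards [E.ε_lim.eventually_le_const one_pos, E.τ_lim.eventually_gt_atTop 0]
    with n hn1 hn2 s t
  have h1 := hD (ħ n) (ε n) (E.ħ_pos n) (E.ε_pos n) hn1 (u n) (v n) (E.norm_u n) (E.sol n) (τ n) s t
  simp only [corrField_eq E.ne_zero (E.ε_pos n) hp, intervalIntegral.integral_const_mul] at h1
  rw [← mul_assoc, ← Complex.ofReal_mul, abs_of_pos hn2] at h1
  refine h1.trans_eq ?_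
  have := (E.ε_pos n).ne'
  field_simp

/-- For large times, the limit measures are annihilated by the field of `p_Λ`. -/
lemma LimitFamily.integral_Xop_eq_zero (hN : LimitFamily e ħ ε τ v N C)
    (E : Evolution e V ħ ε τ u v) (hperp : ∀ᵐ t, PerpInvariant e (N t))
    (hτε : Tendsto (fun n => τ n * ε n) atTop atTop) :
    ∀ᵐ t, ∀ p n, ∫ z, Xop e V (modeFn p (denseCoeff n)) z ∂(N t) = 0 := by
  have hfin := hN.finite
  obtain ⟨K, hK⟩ := exists_isPLamField E.ne_zero E.smooth
  refine ae_all_iff.mpr fun p => ae_all_iff.mpr fun k => ?_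
  have hc := contDiff_denseCoeff k
  have hs := hasCompactSupport_denseCoeff k
  by_cases hp : toR p ⬝ᵥ unitPerp e = 0
  swap
  · filter_upwards [hperp] with t ht
    exact ht.integral_Xop E.ne_zero E.smooth hp hc hs
  have hX := hK.Xop_mem_test (modeFn_mem_test p hc hs)
  have hloc : LocallyIntegrable (fun t => ∫ z, Xop e V (modeFn p (denseCoeff k)) z ∂(N t))
      volume := by
    obtain ⟨A, hA0, hA, -⟩ := Test.exists_lipschitz hX
    refine (locallyIntegrable_const (A * C : ℝ)).mono (hN.measurable _ hX) (.of_forall fun t => ?_)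
    exact (hN.norm_integral_le hA t).trans (Real.le_norm_self _)
  refine ae_mem_of_average_mem (S := {0}) hloc isClosed_singleton fun s t _ => ?_
  have h1 := hN.tendsto_slowField E hperp hp hc hs s t
  obtain ⟨B, hB0, hB⟩ := exists_bound_coeff hc hs
  obtain ⟨D, hD0, hD⟩ := E.norm_increment_le hp hc hs
  have h2 : Tendsto (fun n => ∫ r in s..t, slowField e V (ħ n) (ε n) p (denseCoeff k)
      (coef (v n (r * τ n)))) atTop (𝓝 0) := by
    -- The increment of a correlation is at most 2B; after division by τε it tends to 0, and the
    -- remainder is O(ε + ħ/ε).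
    have hlim : Tendsto (fun n => 2 * B * (τ n * ε n)⁻¹ + D * (ε n + ħ n / ε n) * |t - s|) atTop
        (𝓝 0) := by
      have h1 := (tendsto_inv_atTop_zero.comp hτε).const_mul (2 * B)
      have h2 := ((E.ε_lim.add E.ratio_lim).const_mul D).mul_const |t - s|
      simpa using h1.add h2
    refine squeeze_zero_norm' ?_ hlim
    filter_upwards [hD, hτε.eventually_gt_atTop 0] with n hn1 hn2
    have h3 := hn1 s t
    set I := ∫ r in s..t, slowField e V (ħ n) (ε n) p (denseCoeff k) (coef (v n (r * τ n)))
    have h4 : ‖((τ n * ε n : ℝ) : ℂ) * I‖ ≤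
        2 * B + D * (ε n + ħ n / ε n) * (τ n * ε n) * |t - s| := by
      have e1 := E.norm_corr_le n (t * τ n) p (f := sample e (ħ n) (ε n) (denseCoeff k))
        fun m => hB _
      have e2 := E.norm_corr_le n (s * τ n) p (f := sample e (ħ n) (ε n) (denseCoeff k))
        fun m => hB _
      set x := corr (coef (v n (t * τ n))) p (sample e (ħ n) (ε n) (denseCoeff k))
      set y := corr (coef (v n (s * τ n))) p (sample e (ħ n) (ε n) (denseCoeff k))
      calc ‖((τ n * ε n : ℝ) : ℂ) * I‖ = ‖x - y - (x - y - ((τ n * ε n : ℝ) : ℂ) * I)‖ := by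
            congr 1; ring
        _ ≤ ‖x‖ + ‖y‖ + ‖x - y - ((τ n * ε n : ℝ) : ℂ) * I‖ :=
          (norm_sub_le _ _).trans (by gcongr; exact norm_sub_le _ _)
        _ ≤ _ := by linarith
    rw [norm_mul, Complex.norm_real, Real.norm_of_nonneg hn2.le] at h4
    rw [← mul_le_mul_iff_right₀ hn2]
    refine h4.trans_eq ?_
    linear_combination (-2 * B) * mul_inv_cancel₀ hn2.ne'
  rw [tendsto_nhds_unique h1 h2, smul_zero]
  rfl

/-- At the critical time scale, and below, the limit measures solve a transport equation. -/
lemma LimitFamily.integral_modeFn_eq (hN : LimitFamily e ħ ε τ v N C)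
    (E : Evolution e V ħ ε τ u v) (hperp : ∀ᵐ t, PerpInvariant e (N t)) {σ : ℝ}
    (hτε : Tendsto (fun n => τ n * ε n) atTop (𝓝 σ)) {M : Measure Om}
    (hM : ∀ (p : Z2) (c : Cot → ℂ), ContDiff ℝ ∞ c → HasCompactSupport c →
      Tendsto (fun n => corr (coef (u n)) p (sample e (ħ n) (ε n) c)) atTop
        (𝓝 (∫ z, modeFn p c z ∂M))) {p : Z2} (hp : toR p ⬝ᵥ unitPerp e = 0) {c : Cot → ℂ}
    (hc : ContDiff ℝ ∞ c) (hs : HasCompactSupport c) :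
    ∀ᵐ t, ∫ z, modeFn p c z ∂(N t) = ∫ z, modeFn p c z ∂M +
      σ * ∫ r in (0 : ℝ)..t, ∫ z, Xop e V (modeFn p c) z ∂(N r) := by
  have hfin := hN.finite
  obtain ⟨K, hK⟩ := exists_isPLamField E.ne_zero E.smooth
  have hmode := modeFn_mem_test p hc hs
  have hX := hK.Xop_mem_test hmode
  obtain ⟨B, hB0, hB⟩ := exists_bound_coeff hc hs
  obtain ⟨D, hD0, hD⟩ := E.norm_increment_le hp hc hs
  set W : ℕ → ℝ → ℂ := fun n t => corr (coef (v n (t * τ n))) p (sample e (ħ n) (ε n) c) with hW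
  set g : ℝ → ℂ := fun t => ∫ z, modeFn p c z ∂M +
      σ * ∫ r in (0 : ℝ)..t, ∫ z, Xop e V (modeFn p c) z ∂(N r) with hg
  have hXint : ∀ s t, IntervalIntegrable (fun r => ∫ z, Xop e V (modeFn p c) z ∂(N r)) volume s t :=
    fun s t => hN.bddCont_intervalIntegrable hX s t
  have hgc : Continuous g := continuous_const.add
    (continuous_const.mul (intervalIntegral.continuous_primitive hXint 0))
  -- In the slow directions the correlations converge at every time, since their initial values and
  -- the integrals of their derivatives do. The pointwise limit is continuous and agrees almost
  -- everywhere with the weak one.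
  have hpt : ∀ t, Tendsto (fun n => W n t) atTop (𝓝 (g t)) := fun t => by
    have h0 : ∀ n, W n 0 = corr (coef (u n)) p (sample e (ħ n) (ε n) c) := fun n => by
      simp only [hW, zero_mul, (E.sol n).2.1]
    have h1 : Tendsto (fun n => W n 0 + ((τ n * ε n : ℝ) : ℂ) *
        ∫ r in (0 : ℝ)..t, slowField e V (ħ n) (ε n) p c (coef (v n (r * τ n)))) atTop (𝓝 (g t)) := by
      simp only [h0]
      exact (hM p c hc hs).add (((Complex.continuous_ofReal.tendsto _).comp hτε).mul
        (hN.tendsto_slowField E hperp hp hc hs 0 t))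
    have h2 : Tendsto (fun n => W n t - W n 0 - ((τ n * ε n : ℝ) : ℂ) *
        ∫ r in (0 : ℝ)..t, slowField e V (ħ n) (ε n) p c (coef (v n (r * τ n)))) atTop (𝓝 0) := by
      have hlim : Tendsto (fun n => D * (ε n + ħ n / ε n) * (τ n * ε n) * |t - 0|) atTop (𝓝 0) := by
        simpa using (((E.ε_lim.add E.ratio_lim).const_mul D).mul hτε).mul_const |t - 0|
      exact squeeze_zero_norm' (hD.mono fun n hn => hn 0 t) hlim
    have h3 := h1.add h2
    rw [add_zero] at h3
    exact h3.congr fun n => by ring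
  have hint : ∀ s t, ∫ r in s..t, ∫ z, modeFn p c z ∂(N r) = ∫ r in s..t, g r := fun s t => by
    refine tendsto_nhds_unique (hN.tendsto p c hc hs s t) ?_
    exact intervalIntegral.tendsto_integral_filter_of_dominated_convergence (fun _ => B)
      (.of_forall fun n => (E.continuous_corr n p hs).aestronglyMeasurable)
      (.of_forall fun n => .of_forall fun r _ => E.norm_corr_le n _ p fun m => hB _)
      intervalIntegrable_const (.of_forall fun r _ => hpt r)
  have hloc : LocallyIntegrable (fun t => ∫ z, modeFn p c z ∂(N t)) volume := by
    refine (locallyIntegrable_const (B * C : ℝ)).mono (hN.measurable _ hmode) (.of_forall fun t => ?_)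
    exact (hN.norm_integral_le (fun z => by rw [norm_modeFn]; exact hB _) t).trans
      (Real.le_norm_self _)
  have h4 := ae_mem_of_average_mem (S := {0}) (hloc.sub hgc.locallyIntegrable) isClosed_singleton
    fun s t _ => by
      simp only [Pi.sub_apply]
      rw [intervalIntegral.integral_sub (hN.bddCont_intervalIntegrable hmode s t)
        (hgc.intervalIntegrable s t), hint, sub_self, smul_zero]
      rfl
  exact h4.mono fun t ht => sub_eq_zero.mp ht

/-- Below the critical time scale, the limit measures are the average of the initial one. -/
lemma LimitFamily.eq_avgMeasure (hN : LimitFamily e ħ ε τ v N C)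
    (E : Evolution e V ħ ε τ u v) (hperp : ∀ᵐ t, PerpInvariant e (N t))
    (hτε : Tendsto (fun n => τ n * ε n) atTop (𝓝 0)) {M : Measure Om} [IsFiniteMeasure M]
    (hM : ∀ (p : Z2) (c : Cot → ℂ), ContDiff ℝ ∞ c → HasCompactSupport c →
      Tendsto (fun n => corr (coef (u n)) p (sample e (ħ n) (ε n) c)) atTop
        (𝓝 (∫ z, modeFn p c z ∂M))) : ∀ᵐ t, N t = avgMeasure e M := by
  have h1 : ∀ p k, ∀ᵐ t, ∫ z, modeFn p (denseCoeff k) z ∂(N t) =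
      ∫ z, modeFn p (denseCoeff k) z ∂(avgMeasure e M) := fun p k => by
    have hc := contDiff_denseCoeff k
    have hs := hasCompactSupport_denseCoeff k
    rw [integral_modeFn_avgMeasure E.ne_zero M p hc hs]
    split_ifs with hp
    · filter_upwards [hN.integral_modeFn_eq E hperp hτε hM hp hc hs] with t ht
      rw [ht, Complex.ofReal_zero, zero_mul, add_zero]
    · filter_upwards [hperp] with t ht
      exact ht p hp _ hc hs
  filter_upwards [ae_all_iff.mpr fun p => ae_all_iff.mpr (h1 p)] with t ht
  have := hN.finite t
  exact measure_ext_of_modes ht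

/-- At the critical time scale, the limit measures are transported by the flow of `p_Λ`. -/
lemma LimitFamily.integral_eq_flow (hN : LimitFamily e ħ ε τ v N C)
    (E : Evolution e V ħ ε τ u v) (hperp : ∀ᵐ t, PerpInvariant e (N t))
    (hτε : Tendsto (fun n => τ n * ε n) atTop (𝓝 1)) {M : Measure Om} [IsFiniteMeasure M]
    (hM : ∀ (p : Z2) (c : Cot → ℂ), ContDiff ℝ ∞ c → HasCompactSupport c →
      Tendsto (fun n => corr (coef (u n)) p (sample e (ħ n) (ε n) c)) atTop
        (𝓝 (∫ z, modeFn p c z ∂M))) :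
    ∀ᵐ t, ∀ a ∈ Test, ∫ z, a z ∂(N t) = ∫ z, a (flowOm e V t z) ∂(avgMeasure e M) := by
  classical
  have hfin := hN.finite
  obtain ⟨K, hK⟩ := exists_isPLamField E.ne_zero E.smooth
  set P := avgMeasure e M with hP
  -- The family is defined only up to a null set of times. Prescribing its value at 0 puts 0 among
  -- the times of `G`, and the transport can start from the averaged initial measure.
  set N' : ℝ → Measure Om := fun t => if t = 0 then P else N t with hN'
  have hfin' : ∀ t, IsFiniteMeasure (N' t) := fun t => by
    simp only [hN']
    split_ifs <;> infer_instance
  have hmass' : ∀ t, (N' t).real Set.univ ≤ max C (P.real Set.univ) := fun t => by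
    simp only [hN']
    split_ifs
    · exact le_max_right _ _
    · exact (hN.mass t).trans (le_max_left _ _)
  have hae : ∀ᵐ t : ℝ, t ≠ 0 := by simp [ae_iff, measure_singleton]
  have hN'N : ∀ᵐ t, N' t = N t := hae.mono fun t ht => if_neg ht
  have hN'0 : N' 0 = P := if_pos rfl
  set G : Set ℝ := {t | ∀ p k, ∫ z, modeFn p (denseCoeff k) z ∂(N' t) =
    ∫ z, modeFn p (denseCoeff k) z ∂P +
      ∫ r in (0 : ℝ)..t, ∫ z, Xop e V (modeFn p (denseCoeff k)) z ∂(N' r)} with hGdef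
  have hXeq : ∀ (f : Om → ℂ) (s t : ℝ), ∫ r in s..t, ∫ z, f z ∂(N' r) =
      ∫ r in s..t, ∫ z, f z ∂(N r) := fun f s t =>
    intervalIntegral.integral_congr_ae (hN'N.mono fun r hr _ => by rw [hr])
  have hG : ∀ᵐ t, t ∈ G := by
    have h1 : ∀ p k, ∀ᵐ t, ∫ z, modeFn p (denseCoeff k) z ∂(N t) =
        ∫ z, modeFn p (denseCoeff k) z ∂P +
          ∫ r in (0 : ℝ)..t, ∫ z, Xop e V (modeFn p (denseCoeff k)) z ∂(N r) := fun p k => by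
      have hc := contDiff_denseCoeff k
      have hs := hasCompactSupport_denseCoeff k
      rw [hP, integral_modeFn_avgMeasure E.ne_zero M p hc hs]
      split_ifs with hp
      · filter_upwards [hN.integral_modeFn_eq E hperp hτε hM hp hc hs] with t ht
        rw [ht, Complex.ofReal_one, one_mul]
      · filter_upwards [hperp] with t ht
        rw [ht p hp _ hc hs, intervalIntegral.integral_congr_ae (g := fun _ => 0)
          (hperp.mono fun r hr _ => hr.integral_Xop E.ne_zero E.smooth hp hc hs)]
        simp
    filter_upwards [ae_all_iff.mpr fun p => ae_all_iff.mpr (h1 p), hN'N] with t ht ht' p k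
    rw [ht', hXeq]
    exact ht p k
  have h0G : (0 : ℝ) ∈ G := fun p k => by
    rw [hN'0, intervalIntegral.integral_same, add_zero]
  have hT : ∀ a ∈ Test, Transports N' G a (Xop e V a) := fun a ha =>
    Transports.of_modes hmass' hK (fun p k => by
      have hc := contDiff_denseCoeff k
      have hs := hasCompactSupport_denseCoeff k
      have hX := hK.Xop_mem_test (modeFn_mem_test p hc hs)
      have hm : AEStronglyMeasurable
          (fun r => ∫ z, Xop e V (modeFn p (denseCoeff k)) z ∂(N' r)) volume :=
        (hN.measurable _ hX).congr (hN'N.mono fun t ht => by beta_reduce; rw [ht])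
      refine ⟨hm, fun s hs t ht => ?_⟩
      have hi := fun s t => (BddCont.of_test hX).intervalIntegrable hmass' hm s t
      rw [ht p k, hs p k, add_sub_add_left_eq_sub,
        intervalIntegral.integral_interval_sub_left (hi 0 t) (hi 0 s)]) ha
  filter_upwards [hG, hN'N] with t ht ht' a ha
  have h1 := Transports.integral_eq hmass' hK hG hT ha h0G ht t
  simp only [sub_self, sub_zero, hN'0, ht'] at h1
  rw [← h1]
  simp only [hK.flowOm_zero]

/-- Above the critical time scale, the limit measures are invariant by the flow of `p_Λ`. -/
lemma LimitFamily.integral_comp_flow (hN : LimitFamily e ħ ε τ v N C)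
    (E : Evolution e V ħ ε τ u v) (hperp : ∀ᵐ t, PerpInvariant e (N t))
    (hτε : Tendsto (fun n => τ n * ε n) atTop atTop) :
    ∀ᵐ t, ∀ s, ∀ a ∈ Test, ∫ z, a z ∂(N t) = ∫ z, a (flowOm e V s z) ∂(N t) := by
  obtain ⟨K, hK⟩ := exists_isPLamField E.ne_zero E.smooth
  filter_upwards [hN.integral_Xop_eq_zero E hperp hτε] with t ht s a ha
  have hfin := hN.finite t
  -- For fixed t the family constantly equal to `N t` solves the transport equation, because X
  -- annihilates it; its transport by the flow is invariance.
  have hT : ∀ a ∈ Test, Transports (fun _ => N t) Set.univ a (Xop e V a) := fun a ha =>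
    Transports.of_modes (fun _ => le_refl ((N t).real Set.univ)) hK (fun p k => by
      simp only [Transports, ht]
      exact ⟨aestronglyMeasurable_const, fun s _ t _ => by simp⟩) ha
  have h1 := Transports.integral_eq (N := fun _ => N t) (fun _ => le_refl ((N t).real Set.univ)) hK
    (.of_forall fun _ => Set.mem_univ _) hT ha (Set.mem_univ 0) (Set.mem_univ s) s
  simp only [sub_self, sub_zero, hK.flowOm_zero] at h1
  exact h1

end

/-! ### Return to 𝕋² × Λ^⊥ × ℝ and the three time scales. -/

section

/-! ### Measures on `𝕋² × Λ^⊥ × ℝ` -/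

/-- The inclusion of `𝕋² × Λ^⊥ × ℝ` in the phase space. -/
def incl (e : Z2) (z : CompactPhase e) : Om := (z.1, z.2.1.1, z.2.2)

lemma continuous_incl (e : Z2) : Continuous (incl e) :=
  continuous_fst.prodMk ((continuous_subtype_val.comp (continuous_fst.comp continuous_snd)).prodMk
    (continuous_snd.comp continuous_snd))

lemma isClosedEmbedding_incl (e : Z2) : IsClosedEmbedding (incl e) := by
  have hcl : IsClosed {ξ : Fin 2 → ℝ | ξ ⬝ᵥ toR e = 0} :=
    isClosed_eq (by fun_prop) continuous_const
  exact IsClosedEmbedding.id.prodMap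
    ((hcl.isClosedEmbedding_subtypeVal).prodMap IsClosedEmbedding.id)

lemma measurableEmbedding_incl (e : Z2) : MeasurableEmbedding (incl e) :=
  (isClosedEmbedding_incl e).measurableEmbedding

lemma HLam_eq_zero_iff {e : Z2} (he : e ≠ 0) (ξ : Fin 2 → ℝ) : HLam e ξ = 0 ↔ ξ ⬝ᵥ toR e = 0 := by
  rw [HLam, unitDir, dotProduct_smul, smul_eq_mul, mul_eq_zero,
    or_iff_right (inv_ne_zero (len_pos he).ne')]

/-- The restriction of a measure to `𝕋² × Λ^⊥ × ℝ`. -/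
def compactPart (e : Z2) (M : Measure Om) : Measure (CompactPhase e) := M.comap (incl e)

instance (e : Z2) (M : Measure Om) [IsFiniteMeasure M] : IsFiniteMeasure (compactPart e M) :=
  ⟨by
    rw [compactPart, (measurableEmbedding_incl e).comap_apply]
    exact measure_lt_top M _⟩

lemma map_compactPart {e : Z2} (he : e ≠ 0) {M : Measure Om} (hM : ∀ᵐ z ∂M, HLam e z.2.1 = 0) :
    (compactPart e M).map (incl e) = M := by
  rw [compactPart, (measurableEmbedding_incl e).map_comap]
  refine Measure.restrict_eq_self_of_ae_mem (hM.mono fun z hz => ?_)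
  exact ⟨(z.1, ⟨z.2.1, (HLam_eq_zero_iff he _).mp hz⟩, z.2.2), rfl⟩

lemma integral_compactPart {e : Z2} (he : e ≠ 0) {M : Measure Om}
    (hM : ∀ᵐ z ∂M, HLam e z.2.1 = 0) (f : Om → ℂ) :
    ∫ z, f (incl e z) ∂(compactPart e M) = ∫ z, f z ∂M := by
  rw [← (measurableEmbedding_incl e).integral_map, map_compactPart he hM]

lemma integral_avgMeasure_compactPart {e : Z2} (he : e ≠ 0) {M : Measure Om} [IsFiniteMeasure M]
    (hM : ∀ᵐ z ∂M, HLam e z.2.1 = 0) {f : Om → ℂ} (hf : BddCont f) :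
    ∫ z, f (incl e z) ∂(avgMeasure e (compactPart e M) : Measure (CompactPhase e)) =
      ∫ z, f z ∂(avgMeasure e M) := by
  obtain ⟨hc, B, hB⟩ := hf
  rw [integral_avgMeasure he M hc hB, ← integral_compactPart he hM]
  exact integral_avgMeasure he (compactPart e M) (f := fun z : CompactPhase e => f (incl e z))
    (hc.comp (continuous_incl e)) fun z => hB _

lemma isCompactPart_of_integral {e : Z2} {L : Symbols →ₗ[ℂ] ℂ} {m : FiniteMeasure (CompactPhase e)}
    (h : ∀ a (ha : a ∈ Test),
      L (toSym ⟨a, ha⟩) = ∫ z, a (incl e z) ∂(m : Measure (CompactPhase e))) :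
    IsCompactPart e L m := fun a ha => h a.1 (symbols_mem_test a.2 ha)

/-! ### The flow on `𝕋² × Λ^⊥ × ℝ` -/

/-- The flow of `p_Λ` on `𝕋² × Λ^⊥ × ℝ`. -/
def flowPhase (e : Z2) (V : T2 → ℝ) (t : ℝ) (z : CompactPhase e) : CompactPhase e :=
  ((flowOm e V t (incl e z)).1, z.2.1, (flowOm e V t (incl e z)).2.2)

section

variable {e : Z2} {V : T2 → ℝ} {K : NNReal} (hK : IsPLamField e V K)
include hK

lemma IsPLamField.incl_flowPhase (t : ℝ) (z : CompactPhase e) :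
    incl e (flowPhase e V t z) = flowOm e V t (incl e z) := by
  obtain ⟨y, hy⟩ := exists_lift (incl e z)
  have h2 : (flowOm e V t (incl e z)).2.1 = z.2.1.1 := by
    rw [← hy, hK.flowOm_proj, hK.flowCover_xi]
    exact congrArg (fun z : Om => z.2.1) hy
  refine Prod.ext rfl (Prod.ext ?_ rfl)
  rw [h2]
  rfl

lemma IsPLamField.isFlowOfPLam : IsFlowOfPLam e V (flowPhase e V) := by
  intro x ξ η
  refine ⟨fun t => (flowCover e V t (x, ξ.1, η)).1, fun t => (flowCover e V t (x, ξ.1, η)).2.2,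
    congrArg Prod.fst (hK.flowCover_zero _),
    congrArg (fun z : Cover => z.2.2) (hK.flowCover_zero _), fun t => hK.hasDerivAt_fst t _,
    fun t => hK.hasDerivAt_eta t _, fun t => ?_⟩
  have h1 := hK.flowOm_proj t (x, ξ.1, η)
  change ((flowOm e V t (proj x, ξ.1, η)).1, ξ, (flowOm e V t (proj x, ξ.1, η)).2.2) = _
  rw [show flowOm e V t (proj x, ξ.1, η) = _ from h1]

lemma IsPLamField.continuous_flowPhase (t : ℝ) : Continuous (flowPhase e V t) := by
  have h1 := (hK.continuous_flowOm t).comp (continuous_incl e)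
  exact (continuous_fst.comp h1).prodMk ((continuous_fst.comp continuous_snd).prodMk
    (continuous_snd.comp (continuous_snd.comp h1)))

lemma IsPLamField.continuous_orbit (z : CompactPhase e) :
    Continuous fun t => flowPhase e V t z := by
  obtain ⟨y, hy⟩ := exists_lift (incl e z)
  have h1 : Continuous fun t => flowCover e V t y :=
    continuous_iff_continuousAt.mpr fun t => (hK.hasDerivAt_flowCover y t).continuousAt
  have h2 : Continuous fun t => flowOm e V t (incl e z) := by
    rw [← hy]
    simp only [hK.flowOm_proj]
    exact (continuous_proj.comp (continuous_fst.comp h1)).prodMk (continuous_snd.comp h1)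
  exact (continuous_fst.comp h2).prodMk (continuous_const.prodMk
    (continuous_snd.comp (continuous_snd.comp h2)))

/-- The averaged potential is constant along e^⊥, so the flow commutes with translations in this
direction, and therefore with I_Λ. -/
lemma IsPLamField.flowPhase_shift (he : e ≠ 0) (t s : ℝ) (z : CompactPhase e) :
    flowPhase e V t (z.1 + proj (s • unitPerp e), z.2) =
      ((flowPhase e V t z).1 + proj (s • unitPerp e), (flowPhase e V t z).2) := by
  obtain ⟨y, hy⟩ := exists_lift (incl e z)
  have h1 : incl e (z.1 + proj (s • unitPerp e), z.2) =
      (proj (y + (s • unitPerp e, 0)).1, (y + (s • unitPerp e, 0)).2) := by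
    refine Prod.ext ?_ ?_
    · rw [Prod.fst_add, proj_add]
      change z.1 + _ = _
      rw [← show proj y.1 = z.1 from congrArg Prod.fst hy]
    · rw [Prod.snd_add, add_zero]
      exact (congrArg Prod.snd hy).symm
  have h2 : flowOm e V t (incl e (z.1 + proj (s • unitPerp e), z.2)) =
      ((flowOm e V t (incl e z)).1 + proj (s • unitPerp e), (flowOm e V t (incl e z)).2) := by
    rw [h1, hK.flowOm_proj, hK.flowCover_translate fun y => derivAvg_add_perp he V y s, ← hy,
      hK.flowOm_proj, Prod.fst_add, Prod.snd_add, proj_add, add_zero]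
  rw [flowPhase, h2]
  rfl

lemma IsPLamField.avg_comp_flowPhase (he : e ≠ 0) (a : CompactPhase e → ℂ) (t : ℝ)
    (z : CompactPhase e) :
    avg e (fun x => a (flowPhase e V t (x, z.2))) z.1 = avgPhase e a (flowPhase e V t z) := by
  simp only [avgPhase, avg, hK.flowPhase_shift he t _ z]

/-- Invariance is stated as an equality of measures: it passes from test functions to every
continuous compactly supported function with no further approximation. -/
lemma IsPLamField.map_flowPhase_compactPart (he : e ≠ 0) {M : Measure Om} [IsFiniteMeasure M]
    (hM : ∀ᵐ z ∂M, HLam e z.2.1 = 0) (s : ℝ)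
    (h : ∀ a ∈ Test, ∫ z, a z ∂M = ∫ z, a (flowOm e V s z) ∂M) :
    (compactPart e M).map (flowPhase e V s) = compactPart e M := by
  have hφ := (hK.continuous_flowOm s).measurable
  have h1 : M.map (flowOm e V s) = M := by
    refine (measure_ext_of_test fun a ha => ?_).symm
    rw [integral_map hφ.aemeasurable (Test.continuous ha).aestronglyMeasurable]
    exact h a ha
  have hι := measurableEmbedding_incl e
  have h2 : ((compactPart e M).map (flowPhase e V s)).map (incl e) =
      (compactPart e M).map (incl e) := by
    rw [Measure.map_map hι.measurable (hK.continuous_flowPhase s).measurable]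
    have h3 : incl e ∘ flowPhase e V s = flowOm e V s ∘ incl e := funext (hK.incl_flowPhase s)
    rw [h3, ← Measure.map_map hφ hι.measurable, map_compactPart he hM, h1]
  rw [← hι.comap_map ((compactPart e M).map (flowPhase e V s)), h2, hι.comap_map]

end

/-! ### The three time scales -/

lemma exists_bound_of_hasCompactSupport {X : Type} [TopologicalSpace X] {a : X → ℂ}
    (hc : Continuous a) (hs : HasCompactSupport a) : ∃ B, ∀ z, ‖a z‖ ≤ B := by
  obtain ⟨B, -, h⟩ := exists_bound_of_compactSupport hc hs
  exact ⟨B, h⟩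

lemma IsInitialLimit.tendsto_corr {e : Z2} {ħ ε : ℕ → ℝ} {u : ℕ → L2T} {μ₀ : Symbols →ₗ[ℂ] ℂ}
    (hμ : IsInitialLimit e ħ ε u μ₀) {M : Measure Om}
    (hM : ∀ a (ha : a ∈ Test), μ₀ (toSym ⟨a, ha⟩) = ∫ z, a z ∂M) (p : Z2) (c : Cot → ℂ)
    (hc : ContDiff ℝ ∞ c) (hs : HasCompactSupport c) :
    Tendsto (fun n => corr (coef (u n)) p (sample e (ħ n) (ε n) c)) atTop
      (𝓝 (∫ z, modeFn p c z ∂M)) := by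
  have h1 := hμ.tendsto (modeSym p c hc hs)
  simp only [wigner_eq_corr e _ _ _ (modeSym p c hc hs) p c rfl] at h1
  rwa [modeSym, hM] at h1

lemma IsInitialLimit.unique {e : Z2} {ħ ε : ℕ → ℝ} {u : ℕ → L2T} {μ₀ μ₁ : Symbols →ₗ[ℂ] ℂ}
    (h₀ : IsInitialLimit e ħ ε u μ₀) (h₁ : IsInitialLimit e ħ ε u μ₁) : μ₀ = μ₁ :=
  LinearMap.ext fun a => tendsto_nhds_unique (h₀.tendsto a) (h₁.tendsto a)

lemma IsPrimitiveRankOne.ne_zero {Λ : AddSubgroup (Fin 2 → ℤ)} (hΛ : IsPrimitiveRankOne Λ) {e : Z2}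
    (he : AddSubgroup.zmultiples e = Λ) : e ≠ 0 := by
  rintro rfl
  rw [AddSubgroup.zmultiples_zero_eq_bot] at he
  have h1 := hΛ.1
  rw [← he] at h1
  have h2 : toR '' ((⊥ : AddSubgroup (Fin 2 → ℤ)) : Set (Fin 2 → ℤ)) = {0} := by
    rw [AddSubgroup.coe_bot, Set.image_singleton]
    congr 1
    funext i
    simp [toR]
  rw [h2, Submodule.span_zero_singleton, finrank_bot] at h1
  exact zero_ne_one h1

variable {e : Z2} {V : T2 → ℝ} {ħ ε τ : ℕ → ℝ} {u : ℕ → L2T} {v : ℕ → ℝ → L2T}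
  {μ : ℝ → Symbols →ₗ[ℂ] ℂ}

/-- The family of measures below the critical time scale. -/
lemma Evolution.exists_subcritical (E : Evolution e V ħ ε τ u v) (hμ : IsTimeLimit e ħ ε τ v μ)
    {μ₀ : Symbols →ₗ[ℂ] ℂ} (hμ₀ : IsInitialLimit e ħ ε u μ₀)
    (hτε : Tendsto (fun n => τ n * ε n) atTop (𝓝 0)) :
    ∃ (m : ℝ → FiniteMeasure (CompactPhase e)) (m₀ : FiniteMeasure (CompactPhase e)),
      (∀ᵐ t, IsCompactPart e (μ t) (m t)) ∧ IsCompactPart e μ₀ m₀ ∧ Continuous m ∧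
      ∀ (t : ℝ) (a : CompactPhase e → ℂ), Continuous a → HasCompactSupport a →
        ∫ z, a z ∂(m t : Measure (CompactPhase e)) =
          ∫ z, avgPhase e a z ∂(m₀ : Measure (CompactPhase e)) := by
  have he := E.ne_zero
  obtain ⟨N, C, hN, hrep, hH, hperp⟩ := E.exists_limitFamily hμ
  obtain ⟨M, hMfin, hM, hMH⟩ := E.exists_initial_measure hμ₀
  have hcorr := hμ₀.tendsto_corr hM
  -- The representative that is constant in time is chosen; it gives the compact part of μ(t) for
  -- almost every t.
  refine ⟨fun _ => ⟨avgMeasure e (compactPart e M), inferInstance⟩, ⟨compactPart e M, inferInstance⟩,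
    ?_, ?_, continuous_const, fun t a hc hs => ?_⟩
  · filter_upwards [hrep, hN.eq_avgMeasure E hperp hτε hcorr] with t h1 h2
    refine isCompactPart_of_integral fun a ha => ?_
    rw [h1 a ha, h2]
    exact (integral_avgMeasure_compactPart he hMH (.of_test ha)).symm
  · exact isCompactPart_of_integral fun a ha =>
      (hM a ha).trans (integral_compactPart he hMH a).symm
  · obtain ⟨B, hB⟩ := exists_bound_of_hasCompactSupport hc hs
    exact integral_avgMeasure he (compactPart e M) hc hB

/-- The family of measures at the critical time scale. -/
lemma Evolution.exists_critical (E : Evolution e V ħ ε τ u v) (hμ : IsTimeLimit e ħ ε τ v μ)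
    {μ₀ : Symbols →ₗ[ℂ] ℂ} (hμ₀ : IsInitialLimit e ħ ε u μ₀)
    (hτε : Tendsto (fun n => τ n * ε n) atTop (𝓝 1)) :
    ∃ (m : ℝ → FiniteMeasure (CompactPhase e)) (m₀ : FiniteMeasure (CompactPhase e)),
      (∀ᵐ t, IsCompactPart e (μ t) (m t)) ∧ IsCompactPart e μ₀ m₀ ∧ Continuous m ∧
      ∀ (t : ℝ) (a : CompactPhase e → ℂ), Continuous a → HasCompactSupport a →
        ∫ z, a z ∂(m t : Measure (CompactPhase e)) =
          ∫ z, avgPhase e a (flowPhase e V t z) ∂(m₀ : Measure (CompactPhase e)) := by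
  have he := E.ne_zero
  obtain ⟨K, hK⟩ := exists_isPLamField he E.smooth
  obtain ⟨N, C, hN, hrep, hH, hperp⟩ := E.exists_limitFamily hμ
  obtain ⟨M, hMfin, hM, hMH⟩ := E.exists_initial_measure hμ₀
  have hcorr := hμ₀.tendsto_corr hM
  set P : Measure (CompactPhase e) := avgMeasure e (compactPart e M) with hP
  have hPfin : IsFiniteMeasure P := by rw [hP]; infer_instance
  have hmeas : ∀ t, AEMeasurable (flowPhase e V t) P := fun t =>
    (hK.continuous_flowPhase t).measurable.aemeasurable
  have hint : ∀ (t : ℝ) (a : CompactPhase e → ℂ), Continuous a →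
      ∫ z, a z ∂(P.map (flowPhase e V t)) = ∫ z, a (flowPhase e V t z) ∂P := fun t a hc =>
    integral_map (hmeas t) hc.aestronglyMeasurable
  -- The push-forward is defined at every t and weakly continuous; it represents the compact part of
  -- μ(t) only for almost every t, which is the modification on a null set.
  refine ⟨fun t => ⟨P.map (flowPhase e V t), inferInstance⟩, ⟨compactPart e M, inferInstance⟩,
    ?_, ?_, ?_, fun t a hc hs => ?_⟩
  · filter_upwards [hrep, hN.integral_eq_flow E hperp hτε hcorr] with t h1 h2
    refine isCompactPart_of_integral fun a ha => ?_
    rw [h1 a ha, h2 a ha]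
    refine Eq.trans ?_ (hint t _ ((Test.continuous ha).comp (continuous_incl e))).symm
    simp only [Function.comp_apply, hK.incl_flowPhase]
    exact (integral_avgMeasure_compactPart he hMH (hK.bddCont_comp ha t)).symm
  · exact isCompactPart_of_integral fun a ha =>
      (hM a ha).trans (integral_compactPart he hMH a).symm
  · refine continuous_iff_continuousAt.mpr fun t => ?_
    refine FiniteMeasure.tendsto_iff_forall_integral_tendsto.mpr fun f => ?_
    have h1 : ∀ s, ∫ z, f z ∂(P.map (flowPhase e V s)) = ∫ z, f (flowPhase e V s z) ∂P := fun s =>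
      integral_map (hmeas s) f.continuous.aestronglyMeasurable
    change Tendsto (fun s => ∫ z, f z ∂(P.map (flowPhase e V s))) (𝓝 t)
      (𝓝 (∫ z, f z ∂(P.map (flowPhase e V t))))
    simp only [h1]
    exact tendsto_integral_filter_of_dominated_convergence (fun _ => ‖f‖)
      (.of_forall fun s => (f.continuous.comp (hK.continuous_flowPhase s)).aestronglyMeasurable)
      (.of_forall fun s => .of_forall fun z => f.norm_coe_le_norm _) (integrable_const _)
      (.of_forall fun z => (f.continuous.comp (hK.continuous_orbit z)).tendsto t)
  · obtain ⟨B, hB⟩ := exists_bound_of_hasCompactSupport hc hs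
    refine (hint t a hc).trans ?_
    refine (integral_avgMeasure he (compactPart e M)
      (f := fun z : CompactPhase e => a (flowPhase e V t z))
      (hc.comp (hK.continuous_flowPhase t)) fun z => hB _).trans ?_
    simp only [hK.avg_comp_flowPhase he a t]
    rfl

/-- The family of measures for an arbitrary time scale. -/
lemma Evolution.exists_general (E : Evolution e V ħ ε τ u v) (hμ : IsTimeLimit e ħ ε τ v μ) :
    ∃ m : ℝ → FiniteMeasure (CompactPhase e), (∀ᵐ t, IsCompactPart e (μ t) (m t)) ∧
      (Tendsto (fun n => τ n * ε n) atTop atTop →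
        ∀ᵐ t : ℝ, ∀ a : CompactPhase e → ℂ, Continuous a → HasCompactSupport a → ∀ s : ℝ,
          ∫ z, a z ∂(m t : Measure (CompactPhase e)) =
            ∫ z, a (flowPhase e V s z) ∂(m t : Measure (CompactPhase e))) := by
  have he := E.ne_zero
  obtain ⟨K, hK⟩ := exists_isPLamField he E.smooth
  obtain ⟨N, C, hN, hrep, hH, hperp⟩ := E.exists_limitFamily hμ
  have hfin := hN.finite
  refine ⟨fun t => ⟨compactPart e (N t), inferInstance⟩, ?_, fun hτε => ?_⟩
  · filter_upwards [hrep, hH] with t h1 h2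
    exact isCompactPart_of_integral fun a ha =>
      (h1 a ha).trans (integral_compactPart he h2 a).symm
  · filter_upwards [hH, hN.integral_comp_flow E hperp hτε] with t h1 h2 a hc _ s
    have h3 := hK.map_flowPhase_compactPart he h1 s (h2 s)
    have h4 := integral_map (μ := compactPart e (N t))
      (hK.continuous_flowPhase s).measurable.aemeasurable (hc.aestronglyMeasurable (μ := _))
    rw [h3] at h4
    exact h4

end

end TwoMicrolocal

end

theorem theorem2p2
    (V : TwoMicrolocal.T2 → ℝ) (hV : TwoMicrolocal.SmoothOnTorus V)
    (Λ : AddSubgroup (Fin 2 → ℤ)) (hΛ : TwoMicrolocal.IsPrimitiveRankOne Λ)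
    (e : Fin 2 → ℤ) (he : AddSubgroup.zmultiples e = Λ)
    (ħ ε τ : ℕ → ℝ)
    (hħ_pos : ∀ n, 0 < ħ n) (hħ : Tendsto ħ atTop (𝓝 0))
    (hε_pos : ∀ n, 0 < ε n) (hε : Tendsto ε atTop (𝓝 0))
    (hħε : Tendsto (fun n => ħ n / ε n) atTop (𝓝 0))
    (hτ : Tendsto τ atTop atTop)
    (u : ℕ → TwoMicrolocal.L2T) (hu : ∀ n, ‖u n‖ = 1)
    (hosc : TwoMicrolocal.IsOscillating ħ u)
    (hsosc : TwoMicrolocal.IsStrictlyOscillating ħ u)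
    (v : ℕ → ℝ → TwoMicrolocal.L2T)
    (hv : ∀ n, TwoMicrolocal.IsSchrodingerSolution V (ħ n) (ε n) (u n) (v n))
    (μ : ℝ → TwoMicrolocal.Symbols →ₗ[ℂ] ℂ)
    (hμ : TwoMicrolocal.IsTimeLimit e ħ ε τ v μ) :
    ∃ φ : ℝ → TwoMicrolocal.CompactPhase e → TwoMicrolocal.CompactPhase e,
      TwoMicrolocal.IsFlowOfPLam e V φ ∧
      ∃ m : ℝ → FiniteMeasure (TwoMicrolocal.CompactPhase e),
        (∀ᵐ t : ℝ, TwoMicrolocal.IsCompactPart e (μ t) (m t)) ∧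
        (∀ μ₀ : TwoMicrolocal.Symbols →ₗ[ℂ] ℂ, TwoMicrolocal.IsInitialLimit e ħ ε u μ₀ →
          ∃ m₀ : FiniteMeasure (TwoMicrolocal.CompactPhase e),
            TwoMicrolocal.IsCompactPart e μ₀ m₀ ∧
            (Tendsto (fun n => τ n * ε n) atTop (𝓝 0) →
              Continuous m ∧
              ∀ (t : ℝ) (a : TwoMicrolocal.CompactPhase e → ℂ), Continuous a →
                HasCompactSupport a →
                ∫ z, a z ∂(m t : Measure (TwoMicrolocal.CompactPhase e)) =
                  ∫ z, TwoMicrolocal.avgPhase e a z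
                    ∂(m₀ : Measure (TwoMicrolocal.CompactPhase e))) ∧
            ((∀ᶠ n in atTop, τ n * ε n = 1) →
              Continuous m ∧
              ∀ (t : ℝ) (a : TwoMicrolocal.CompactPhase e → ℂ), Continuous a →
                HasCompactSupport a →
                ∫ z, a z ∂(m t : Measure (TwoMicrolocal.CompactPhase e)) =
                  ∫ z, TwoMicrolocal.avgPhase e a (φ t z)
                    ∂(m₀ : Measure (TwoMicrolocal.CompactPhase e)))) ∧
        (Tendsto (fun n => τ n * ε n) atTop atTop →
          ∀ᵐ t : ℝ, ∀ a : TwoMicrolocal.CompactPhase e → ℂ, Continuous a →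
            HasCompactSupport a → ∀ s : ℝ,
              ∫ z, a z ∂(m t : Measure (TwoMicrolocal.CompactPhase e)) =
                ∫ z, a (φ s z) ∂(m t : Measure (TwoMicrolocal.CompactPhase e))) := by
  classical
  have E : TwoMicrolocal.Evolution e V ħ ε τ u v :=
    ⟨hΛ.ne_zero he, hV, hħ_pos, hħ, hε_pos, hε, hħε, hτ, hu, hsosc, hv⟩
  obtain ⟨K, hK⟩ := TwoMicrolocal.exists_isPLamField E.ne_zero hV
  refine ⟨TwoMicrolocal.flowPhase e V, hK.isFlowOfPLam, ?_⟩
  -- The family `m` has to be fixed before μ₀. The initial limit is unique when it exists and the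
  -- regimes exclude one another, so `m` can be chosen case by case.
  by_cases hex : ∃ μ₀, TwoMicrolocal.IsInitialLimit e ħ ε u μ₀
  swap
  · obtain ⟨m, h1, h2⟩ := E.exists_general hμ
    exact ⟨m, h1, fun μ₀ hμ₀ => absurd ⟨μ₀, hμ₀⟩ hex, h2⟩
  obtain ⟨ν, hν⟩ := hex
  by_cases h0 : Tendsto (fun n => τ n * ε n) atTop (𝓝 0)
  · obtain ⟨m, m₀, h1, h2, h3, h4⟩ := E.exists_subcritical hμ hν h0
    refine ⟨m, h1, fun μ₀ hμ₀ => ⟨m₀, hν.unique hμ₀ ▸ h2, fun _ => ⟨h3, h4⟩, fun h => ?_⟩,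
      fun h => absurd h0 (not_tendsto_nhds_of_tendsto_atTop h 0)⟩
    exact absurd (tendsto_nhds_unique h0 (tendsto_const_nhds.congr' (h.mono fun n hn => hn.symm)))
      zero_ne_one
  by_cases h1 : ∀ᶠ n in atTop, τ n * ε n = 1
  · have hlim : Tendsto (fun n => τ n * ε n) atTop (𝓝 1) :=
      tendsto_const_nhds.congr' (h1.mono fun n hn => hn.symm)
    obtain ⟨m, m₀, h2, h3, h4, h5⟩ := E.exists_critical hμ hν hlim
    exact ⟨m, h2, fun μ₀ hμ₀ => ⟨m₀, hν.unique hμ₀ ▸ h3, fun h => absurd h h0, fun _ => ⟨h4, h5⟩⟩,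
      fun h => absurd hlim (not_tendsto_nhds_of_tendsto_atTop h 1)⟩
  -- In the remaining regimes only the invariance for τε → ∞ has content; the clauses on μ₀ reduce
  -- to the existence of its compact part.
  obtain ⟨m, h2, h3⟩ := E.exists_general hμ
  refine ⟨m, h2, fun μ₀ hμ₀ => ?_, h3⟩
  obtain ⟨M, hMfin, hM, hMH⟩ := E.exists_initial_measure hμ₀
  exact ⟨⟨TwoMicrolocal.compactPart e M, inferInstance⟩,
    TwoMicrolocal.isCompactPart_of_integral fun a ha =>
      (hM a ha).trans (TwoMicrolocal.integral_compactPart E.ne_zero hMH a).symm,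
    fun h => absurd h h0, fun h => absurd h h1⟩
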